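/- \textbf{Setting.} Let $K$ be a field of characteristic $0$; all gradings are by $\mathbb Z$ or by $\mathbb Z/2$ (more generally by $\mathbb Z/2N$), differentials have degree $-1$, and the Koszul sign rule is used. Write $A_\infty(n)=C_*(K(n))$ ($n\ge 2$) for the $A_\infty$ operad: $A_\infty(n)$ is spanned by oriented planar rooted trees $(T,\sigma)$ with $n$ leaves and all vertices with at least two inputs, $\sigma$ an orientation of the span of the $t$ internal edges, $|T|=n-2-t$, with $$(U,\sigma)\circ_i(V,\tau)=(-1)^{i(n+1)+m|V|}(U\circ_iV,\ \sigma\wedge\tau\wedge e),\quad \partial(U,\sigma)=\sum_{V/e=U}(V,e\wedge\sigma),\quad r(T,\sigma)=(-1)^n(rT,\sigma)$$ (in the first formula $U,V$ have $m,n$ leaves and $e$ is the new edge; $r$ generates the action of $\mathbb Z/(n+1)$ by rotation of trees). A \emph{cyclic diagonal} is a morphism of dg operads $\Delta:A_\infty\to A_\infty\otimes A_\infty$ which commutes with the cyclic actions and satisfies $\Delta(c_2)=c_2\otimes c_2$ for the corolla $c_2\in A_\infty(2)$. A \emph{cyclic $A_\infty$-algebra of parity $\epsilon\in\{0,1\}$}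 is a complex $A$ with a non-degenerate graded symmetric inner product $\langle-,-\rangle$ of parity $\epsilon$ compatible with the differential, and a morphism of dg operads $\rho:A_\infty\to\mathrm{End}_A$ compatible with the cyclic structures. For two finite-dimensional cyclic $A_\infty$-algebras $A,B$ of parities $\epsilon_A,\epsilon_B$, the tensor product $A\otimes B$ defined by $\Delta$ has inner product $\langle a_1\otimes b_1,a_2\otimes b_2\rangle=(-1)^{|b_1||a_2|}\langle a_1,a_2\rangle\langle b_1,b_2\rangle$ and structure map $i\circ(\rho_A\otimes\rho_B)\circ\Delta$, where $i:\mathrm{End}_A\otimes\mathrm{End}_B\to\mathrm{End}_{A\otimes B}$ is the canonical map; it is cyclic of parity $\epsilon_A+\epsilon_B \bmod 2$. \textbf{Graph complexes.} A ribbon graph is a finite connected graph with all valencies $\ge 3$ and a cyclic ordering of the half-edges at each vertex. $\mathcal G_*=\mathcal G_*^{(0)}$ is spanned by isomorphism classes of ribbon graphs with an orientation of the vector space spanned by vertices and half-edges; the complex $\mathcal G_*(\det)=\mathcal G_*^{(1)}$, twisted by the local system $\det$, by ribbon graphs with an orientation of the vector space spanned by the edges; in both $(\Gamma,-\sigma)=-(\Gamma,\sigma)$.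 Given $\Gamma$, order its vertices $v_1,\dots,v_k$, name the half-edges at $v_i$ in cyclic order $e_{i,0},\dots,e_{i,n_i}$, and choose an ordering and directions $h_j=(h_j^+,h_j^-)$ of its edges $h_1,\dots,h_E$. For trees $T_i$ with $n_i$ leaves and oriented internal edges $f_{i,1}\wedge\dots\wedge f_{i,t_i}$ let $\Gamma(T_1,\dots,T_k)$ be the graph obtained by replacing $v_i$ by $T_i$ (root at $e_{i,0}$, leaves at $e_{i,1},\dots,e_{i,n_i}$). Put $$\Phi^{(\epsilon)}_\Gamma(T_1,\dots,T_k)=(-1)^{\sum_i(n_i-2)+\sum_{i<j}n_it_j}\ \Gamma(T_1,\dots,T_k)\in\mathcal G_*^{(\epsilon)} .$$ For $\epsilon=0$ the orientation of $\Gamma(T_1,\dots,T_k)$ is the one which becomes $\langle v_1e_{1,0}\dots e_{1,n_1}\dots v_ke_{k,0}\dots e_{k,n_k}\rangle$ when $f_{1,1},f_{1,2},\dots,f_{k,t_k}$ are collapsed in this order, where collapsing $e$ with half-edges $e^\pm$ at $v^\pm$ takes $\langle v^-v^+e^-e^+\dots\rangle$ to $\langle v\dots\rangle$. For $\epsilon=1$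 it is $f_{1,1}\wedge\dots\wedge f_{k,t_k}\wedge h_1\wedge\dots\wedge h_E$. (So $\Phi^{(0)}_\Gamma=\phi_\Gamma$ and $\Phi^{(1)}_\Gamma=\psi_\Gamma$, for the trivialization of $\det E(\Gamma)$ given by $h_1\wedge\dots\wedge h_E$.) \textbf{Kontsevich cocycles.} For a finite-dimensional cyclic $A_\infty$-algebra $A$ of parity $\epsilon$, $c_A:\mathcal G_*^{(\epsilon)}\to K$ is the linear form such that for all $\Gamma$ and all choices as above $c_A\circ\Phi_\Gamma^{(\epsilon)}$ is the composition $$\bigotimes_iA_\infty(n_i)\xrightarrow{\rho^{\otimes k}}\bigotimes_i\mathrm{Hom}(A^{\otimes n_i},A)\cong\bigotimes_i(A^\vee)^{\otimes(n_i+1)}\xrightarrow{\ \eta\ }\bigl((A^\vee)^{\otimes2}\bigr)^{\otimes E}\xrightarrow{(\langle-,-\rangle^{-1})^{\otimes E}}K .$$ Here the isomorphism is $f\mapsto\langle f(-),-\rangle$, $\eta$ is the permutation $(e_{1,1},\dots,e_{1,n_1},e_{1,0},e_{2,1},\dots,e_{k,0})\to(h_1^+,h_1^-,\dots,h_E^+,h_E^-)$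 of the factors with its Koszul sign; for $\epsilon=1$ the composition is multiplied by the sign of the permutation relating the words $v_1e_{1,0}\dots e_{1,n_1}\dots v_ke_{k,0}\dots e_{k,n_k}$ and $v_1\dots v_kh_1^+h_1^-\dots h_E^+h_E^-$. The inverse pairing is $\langle-,-\rangle^{-1}(b_s^\vee,b_t^\vee)=(-1)^{\epsilon|b_t|}(g^{-1})_{st}$ for a homogeneous basis $(b_s)$ with Gram matrix $g_{st}=\langle b_s,b_t\rangle$. \textbf{The diagonal.} $\delta:\mathcal G_*^{(\epsilon_A+\epsilon_B)}\to\mathcal G_*^{(\epsilon_A)}\otimes\mathcal G_*^{(\epsilon_B)}$ (superscripts mod $2$) is the linear map such that for all $\Gamma$ and all choices as above $$\delta\circ\Phi_\Gamma^{(\epsilon_A+\epsilon_B)}=(-1)^{\epsilon_A\epsilon_B\,b(b-1)/2}\,\bigl(\Phi_\Gamma^{(\epsilon_A)}\otimes\Phi_\Gamma^{(\epsilon_B)}\bigr)\circ\tau\circ\Delta^{\otimes k},$$ where $\tau$ is the permutation $x_1\otimes y_1\otimes\dots\otimes x_k\otimes y_k\mapsto\pm\,x_1\otimes\dots\otimes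 x_k\otimes y_1\otimes\dots\otimes y_k$ with its Koszul sign and $b=E-k+1$ is the first Betti number of $\Gamma$. \textbf{Theorem.} Let $A$ and $B$ be finite-dimensional cyclic $A_\infty$-algebras of parities $\epsilon_A,\epsilon_B\in\{0,1\}$ (so the inner products may be even or odd), and let $\Delta$ be a cyclic diagonal. Then $A\otimes B$ is a cyclic $A_\infty$-algebra of parity $\epsilon_A+\epsilon_B$, the linear maps $c_A$, $c_B$, $c_{A\otimes B}$ and $\delta$ exist and are uniquely determined by the above (in particular do not depend on the choices made), and $$c_{A\otimes B}=(c_A\otimes c_B)\circ\delta ,$$ where $(c_A\otimes c_B)(x\otimes y)=c_A(x)\,c_B(y)$. -/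

import Mathlib

open scoped TensorProduct DirectSum

noncomputable section

namespace CyclicTensor

universe u

/-! ### Signs -/

/-- The sign `(-1) ^ x` of a parity `x`, as a scalar. -/
def msign (K : Type u) [Field K] (x : ZMod 2) : K := if x = 0 then 1 else -1

/-- The Koszul exponent of the rearrangement of a word: the sum of the products `w x * w y` over
all pairs of letters `x`, `y` of the word such that `x` stands before `y` and `pos y < pos x`.
If `w` gives the parities of the letters, `(-1) ^ inversions w pos l` is the Koszul sign of sorting
the word `l` by the position `pos`; for `w = 1` it is the sign of the sorting permutation. -/
def inversions {α β : Type*} [LinearOrder β] (w : α → ZMod 2) (pos : α → β) : List α → ZMod 2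
  | [] => 0
  | x :: l => ((l.filter fun y => pos y < pos x).map fun y => w x * w y).sum + inversions w pos l

/-! ### The operad `A∞`

A planar rooted tree with `n` leaves, all of whose vertices have at least two inputs, is recorded by
its set of internal edges; an internal edge is recorded by the interval `(a, b)` of the leaves
`a, a + 1, …, b` which lie above it (`1 ≤ a < b ≤ n`, leaves numbered from the left). The intervals
that occur are proper, and any two of them are nested or disjoint. The cell of the associahedron
`K(n)` corresponding to a tree with `t` internal edges has dimension `n - 2 - t`. -/

/-- Intervals of leaves, with the lexicographic order. -/
abbrev Interval := ℕ ×ₗ ℕ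

/-- The interval with end points `a` and `b`. -/
def Interval.mk (a b : ℕ) : Interval := toLex (a, b)

/-- The left end point. -/
def Interval.lo (e : Interval) : ℕ := (ofLex e).1

/-- The right end point. -/
def Interval.hi (e : Interval) : ℕ := (ofLex e).2

/-- The interval `e` can be the set of leaves above an internal edge of a tree with `n` leaves. -/
def Interval.Proper (n : ℕ) (e : Interval) : Prop :=
  1 ≤ e.lo ∧ e.lo < e.hi ∧ e.hi ≤ n ∧ ¬(e.lo = 1 ∧ e.hi = n)

/-- Two intervals are nested or disjoint. -/
def Interval.Compatible (e f : Interval) : Prop :=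
  (e.lo ≤ f.lo ∧ f.hi ≤ e.hi) ∨ (f.lo ≤ e.lo ∧ e.hi ≤ f.hi) ∨ e.hi < f.lo ∨ f.hi < e.lo

/-- Planar rooted trees with `n` leaves, given by their internal edges. -/
@[ext]
structure PlanarTree (n : ℕ) where
  edges : Finset Interval
  proper : ∀ e ∈ edges, e.Proper n
  compatible : ∀ e ∈ edges, ∀ f ∈ edges, e.Compatible f

namespace PlanarTree

/-- The corolla: the tree with one vertex. -/
def corolla (n : ℕ) : PlanarTree n where
  edges := ∅
  proper := by simp
  compatible := by simp

/-- The internal edges of a tree, listed in their standard order. -/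
def edgeList {n : ℕ} (T : PlanarTree n) : List {e : Interval // e ∈ T.edges} :=
  (Finset.univ : Finset {e : Interval // e ∈ T.edges}).sort

/-- The standard orientation of a tree, as a list of internal edges. -/
def stdOrientation {n : ℕ} (T : PlanarTree n) : List Interval := T.edgeList.map Subtype.val

/-- The degree `n - 2 - t` of a tree with `n` leaves and `t` internal edges, in any
group `ZMod q`. -/
def degree (q : ℕ) {n : ℕ} (T : PlanarTree n) : ZMod q := (((n : ℤ) - 2 - T.edges.card : ℤ) : ZMod q)

end PlanarTree

/-- The graded vector space `A∞(n) = C_*(K(n))`. The basis vector of a tree `T` is the oriented tree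
`(T, e₁ ∧ … ∧ e_t)` with `e₁ < … < e_t` the internal edges of `T`. -/
abbrev TreeChain (K : Type u) [Field K] (n : ℕ) := PlanarTree n →₀ K

/-- The oriented tree `(T, e₁ ∧ … ∧ e_t)` as an element of `A∞(n)`, for any list `e₁, …, e_t` of the
internal edges of `T`. -/
def oriented (K : Type u) [Field K] {n : ℕ} (T : PlanarTree n) (l : List Interval) :
    TreeChain K n :=
  Finsupp.single T (msign K (inversions (fun _ => 1) id l))

/-- The arities and positions for which the partial composition `∘ᵢ` of an `m`-ary with an `n`-ary
operation is an `N`-ary operation. -/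
def Composable (m n i N : ℕ) : Prop := 2 ≤ m ∧ 2 ≤ n ∧ 1 ≤ i ∧ i ≤ m ∧ N + 1 = m + n

/-- Where an internal edge of the lower tree goes when a tree with `n` leaves is grafted to the
leaf `i`. -/
def shiftLower (n i : ℕ) (e : Interval) : Interval :=
  Interval.mk (if e.lo ≤ i then e.lo else e.lo + n - 1) (if e.hi < i then e.hi else e.hi + n - 1)

/-- Where an internal edge of the upper tree goes when that tree is grafted to the leaf `i`. -/
def shiftUpper (i : ℕ) (e : Interval) : Interval := Interval.mk (e.lo + i - 1) (e.hi + i - 1)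

/-- The tree `U ∘ᵢ V`: the root of `V` is grafted to the `i`-th leaf of `U`. -/
def graft {m n i N : ℕ} (h : Composable m n i N) (U : PlanarTree m) (V : PlanarTree n) :
    PlanarTree N where
  edges := insert (Interval.mk i (i + n - 1))
    (U.edges.image (shiftLower n i) ∪ V.edges.image (shiftUpper i))
  proper := by
    obtain ⟨hm, hn, hi, hi', hN⟩ := h
    intro e he
    simp only [Finset.mem_insert, Finset.mem_union, Finset.mem_image] at he
    rcases he with rfl | ⟨f, hf, rfl⟩ | ⟨f, hf, rfl⟩
    · simp only [Interval.Proper, Interval.mk, Interval.lo, Interval.hi, ofLex_toLex]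
      omega
    · have := U.proper f hf
      simp only [Interval.Proper, shiftLower, Interval.mk, Interval.lo, Interval.hi, ofLex_toLex]
        at this ⊢
      grind
    · have := V.proper f hf
      simp only [Interval.Proper, shiftUpper, Interval.mk, Interval.lo, Interval.hi, ofLex_toLex]
        at this ⊢
      grind
  compatible := by
    obtain ⟨hm, hn, hi, hi', hN⟩ := h
    intro e he f hf
    simp only [Finset.mem_insert, Finset.mem_union, Finset.mem_image] at he hf
    rcases he with rfl | ⟨e, he, rfl⟩ | ⟨e, he, rfl⟩ <;>
      rcases hf with rfl | ⟨f, hf, rfl⟩ | ⟨f, hf, rfl⟩ <;>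
      [skip; have h₁ := U.proper f hf; have h₁ := V.proper f hf;
        have h₁ := U.proper e he;
        (have h₁ := U.proper e he; have h₂ := U.proper f hf; have h₃ := U.compatible e he f hf);
        (have h₁ := U.proper e he; have h₂ := V.proper f hf);
        have h₁ := V.proper e he;
        (have h₁ := V.proper e he; have h₂ := U.proper f hf);
        (have h₁ := V.proper e he; have h₂ := V.proper f hf; have h₃ := V.compatible e he f hf)] <;>
      simp only [Interval.Proper, Interval.Compatible, shiftLower, shiftUpper, Interval.mk,
        Interval.lo, Interval.hi, ofLex_toLex] at * <;>
      grind

/-- The partial composition `(U, σ) ∘ᵢ (V, τ) = (-1) ^ (i (n + 1) + m |V|) (U ∘ᵢ V, σ ∧ τ ∧ e)`, with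
`e` the new internal edge, on basis vectors. -/
def treeComp (K : Type u) [Field K] {m n i N : ℕ} (h : Composable m n i N) (U : PlanarTree m)
    (V : PlanarTree n) : TreeChain K N :=
  msign K ((i : ZMod 2) * ((n : ZMod 2) + 1) + (m : ZMod 2) * V.degree 2) •
    oriented K (graft h U V)
      (U.stdOrientation.map (shiftLower n i) ++ V.stdOrientation.map (shiftUpper i) ++
        [Interval.mk i (i + n - 1)])

/-- The interval `e` is a new internal edge of a tree which becomes `T` when `e` is collapsed. -/
def PlanarTree.CanAdd {n : ℕ} (T : PlanarTree n) (e : Interval) : Prop :=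
  e ∉ T.edges ∧ e.Proper n ∧ ∀ f ∈ T.edges, e.Compatible f

/-- The tree with an additional internal edge `e`. -/
def PlanarTree.addEdge {n : ℕ} (T : PlanarTree n) (e : Interval) (h : T.CanAdd e) :
    PlanarTree n where
  edges := insert e T.edges
  proper := by
    intro f hf
    rcases Finset.mem_insert.1 hf with rfl | hf
    · exact h.2.1
    · exact T.proper f hf
  compatible := by
    intro f hf f' hf'
    have hsymm : ∀ x y : Interval, x.Compatible y → y.Compatible x := by
      intro x y
      unfold Interval.Compatible
      tauto
    rcases Finset.mem_insert.1 hf with h₁ | h₁ <;> rcases Finset.mem_insert.1 hf' with h₂ | h₂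
    · subst h₁ h₂
      exact Or.inl ⟨le_rfl, le_rfl⟩
    · subst h₁
      exact h.2.2 f' h₂
    · subst h₂
      exact hsymm _ _ (h.2.2 f h₁)
    · exact T.compatible f h₁ f' h₂

open Classical in
/-- The differential `∂ (U, σ) = ∑ (V, e ∧ σ)`, the sum over the trees `V` with an internal edge `e`
such that `V / e = U`. -/
def treeBoundary (K : Type u) [Field K] (n : ℕ) : TreeChain K n →ₗ[K] TreeChain K n :=
  Finsupp.linearCombination K fun U =>
    ∑ p ∈ Finset.Icc 1 n ×ˢ Finset.Icc 1 n,
      if h : U.CanAdd (Interval.mk p.1 p.2) then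
        oriented K (U.addEdge _ h) (Interval.mk p.1 p.2 :: U.stdOrientation)
      else 0

/-- What becomes of an internal edge when a tree with `n` leaves is rotated: leaf `i` becomes leaf
`i + 1`, the last leaf becomes the root and the root becomes the first leaf. -/
def rotateEdge (n : ℕ) (e : Interval) : Interval :=
  if e.hi = n then Interval.mk 1 e.lo else Interval.mk (e.lo + 1) (e.hi + 1)

/-- The rotated tree. -/
def PlanarTree.rotate {n : ℕ} (T : PlanarTree n) : PlanarTree n where
  edges := T.edges.image (rotateEdge n)
  proper := by
    intro e he
    obtain ⟨e', he', rfl⟩ := Finset.mem_image.1 he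
    have h₁ := T.proper e' he'
    simp only [rotateEdge]
    split_ifs <;> simp only [Interval.Proper, Interval.mk, Interval.lo, Interval.hi, ofLex_toLex] at * <;>
      omega
  compatible := by
    intro e he f hf
    obtain ⟨e', he', rfl⟩ := Finset.mem_image.1 he
    obtain ⟨f', hf', rfl⟩ := Finset.mem_image.1 hf
    have h₁ := T.proper e' he'
    have h₂ := T.proper f' hf'
    have h₃ := T.compatible e' he' f' hf'
    clear he hf he' hf'
    simp only [rotateEdge]
    split_ifs <;> simp only [Interval.Proper, Interval.Compatible, Interval.mk, Interval.lo,
      Interval.hi, ofLex_toLex] at * <;> omega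

/-- The generator of the action of `ℤ / (n + 1)` on `A∞(n)`: `r (T, σ) = (-1) ^ n (r T, σ)`. -/
def treeRotation (K : Type u) [Field K] (n : ℕ) : TreeChain K n →ₗ[K] TreeChain K n :=
  Finsupp.linearCombination K fun T =>
    msign K (n : ZMod 2) • oriented K T.rotate (T.stdOrientation.map (rotateEdge n))

/-! ### Cyclic diagonals -/

/-- The space `(A∞ ⊗ A∞)(n) = A∞(n) ⊗ A∞(n)`; the basis vector of `(T, T')` is `T ⊗ T'`. -/
abbrev TreeChain₂ (K : Type u) [Field K] (n : ℕ) := PlanarTree n × PlanarTree n →₀ K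

/-- The element `x ⊗ y` of `A∞(n) ⊗ A∞(n)`. -/
def treeTmul {K : Type u} [Field K] {n : ℕ} (x y : TreeChain K n) : TreeChain₂ K n :=
  x.sum fun T s => y.sum fun T' s' => Finsupp.single (T, T') (s * s')

/-- The partial composition of `A∞ ⊗ A∞`:
`(U₁ ⊗ U₂) ∘ᵢ (V₁ ⊗ V₂) = (-1) ^ (|U₂| |V₁|) (U₁ ∘ᵢ V₁) ⊗ (U₂ ∘ᵢ V₂)`. -/
def treeComp₂ {K : Type u} [Field K] {m n i N : ℕ} (h : Composable m n i N) (x : TreeChain₂ K m)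
    (y : TreeChain₂ K n) : TreeChain₂ K N :=
  x.sum fun U s => y.sum fun V s' =>
    (s * s' * msign K (U.2.degree 2 * V.1.degree 2)) •
      treeTmul (treeComp K h U.1 V.1) (treeComp K h U.2 V.2)

/-- The differential of `A∞ ⊗ A∞`: `∂ (U₁ ⊗ U₂) = ∂ U₁ ⊗ U₂ + (-1) ^ |U₁| U₁ ⊗ ∂ U₂`. -/
def treeBoundary₂ (K : Type u) [Field K] (n : ℕ) : TreeChain₂ K n →ₗ[K] TreeChain₂ K n :=
  Finsupp.linearCombination K fun U =>
    treeTmul (treeBoundary K n (Finsupp.single U.1 1)) (Finsupp.single U.2 1) +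
      msign K (U.1.degree 2) •
        treeTmul (Finsupp.single U.1 1) (treeBoundary K n (Finsupp.single U.2 1))

/-- The cyclic action `r ⊗ r` on `A∞ ⊗ A∞`. -/
def treeRotation₂ (K : Type u) [Field K] (n : ℕ) : TreeChain₂ K n →ₗ[K] TreeChain₂ K n :=
  Finsupp.linearCombination K fun U =>
    treeTmul (treeRotation K n (Finsupp.single U.1 1)) (treeRotation K n (Finsupp.single U.2 1))

/-- Cyclic diagonals `Δ : A∞ → A∞ ⊗ A∞`: morphisms of dg operads (degree zero, compatible with the
partial compositions and the differentials) which commute with the cyclic action and induce on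
homology the canonical diagonal of the associative operad. As `H_*(A∞)` is the associative operad,
generated by the class of the corolla `c₂`, and `A∞(2)` is spanned by `c₂`, the last condition says
`Δ c₂ = c₂ ⊗ c₂`. -/
structure IsCyclicDiagonal {K : Type u} [Field K]
    (Δ : ∀ n, TreeChain K n →ₗ[K] TreeChain₂ K n) : Prop where
  degree_zero : ∀ n, 2 ≤ n → ∀ T : PlanarTree n, ∀ P ∈ (Δ n (Finsupp.single T 1)).support,
    P.1.degree 0 + P.2.degree 0 = T.degree 0
  comp : ∀ m n i N (h : Composable m n i N) (U : PlanarTree m) (V : PlanarTree n),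
    Δ N (treeComp K h U V) =
      treeComp₂ h (Δ m (Finsupp.single U 1)) (Δ n (Finsupp.single V 1))
  boundary : ∀ n, 2 ≤ n → ∀ x, Δ n (treeBoundary K n x) = treeBoundary₂ K n (Δ n x)
  rotation : ∀ n, 2 ≤ n → ∀ x, Δ n (treeRotation K n x) = treeRotation₂ K n (Δ n x)
  diagonal : Δ 2 (Finsupp.single (PlanarTree.corolla 2) 1) =
    Finsupp.single (PlanarTree.corolla 2, PlanarTree.corolla 2) 1

/-! ### Cyclic `A∞`-algebras

Gradings are by `ZMod (2 * N)`; this is a `ℤ`-grading for `N = 0` and a `ℤ / 2`-grading for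
`N = 1`. -/

/-- The parity of a degree. -/
def parity {N : ℕ} (i : ZMod (2 * N)) : ZMod 2 := ZMod.castHom (Dvd.intro N rfl) (ZMod 2) i

/-- `Hom(A^{⊗ n}, A)`. -/
abbrev Op (K : Type u) [Field K] (A : Type*) [AddCommGroup A] [Module K A] (n : ℕ) :=
  MultilinearMap K (fun _ : Fin n => A) A

/-- The data of a cyclic `A∞`-algebra: a differential, an inner product, and for each `n` a map
`A∞(n) → Hom(A^{⊗ n}, A)`. -/
structure CyclicData (K : Type u) [Field K] (A : Type*) [AddCommGroup A] [Module K A] where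
  d : A →ₗ[K] A
  pairing : A →ₗ[K] A →ₗ[K] K
  ρ : ∀ n, TreeChain K n →ₗ[K] Op K A n

/-- The value `f (a₁, …, g (aᵢ, …, a_{i+n-1}), …, a_N)`, without sign. -/
def insertOp {K : Type u} [Field K] {A : Type*} [AddCommGroup A] [Module K A] {m n i N : ℕ}
    (h : Composable m n i N) (f : Op K A m) (g : Op K A n) (a : Fin N → A) : A :=
  f fun p =>
    if h₁ : p.1 + 1 < i then a ⟨p.1, by obtain ⟨_, _, _, _, _⟩ := h; omega⟩
    else if h₂ : p.1 + 1 = i then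
      g fun q => a ⟨p.1 + q.1, by obtain ⟨_, _, _, _, _⟩ := h; have := q.2; omega⟩
    else a ⟨p.1 + n - 1, by obtain ⟨_, _, _, _, _⟩ := h; have := p.2; omega⟩

/-- `X` is a cyclic `A∞`-algebra structure on the graded vector space `A = ⨁ 𝒜 i` whose inner
product is symmetric and of parity `ε`. -/
structure IsCyclicAInfinity {K : Type u} [Field K] {A : Type*} [AddCommGroup A] [Module K A] {N : ℕ}
    (𝒜 : ZMod (2 * N) → Submodule K A) (ε : ZMod 2) (X : CyclicData K A) : Prop where
  /-- The differential has degree `-1`. -/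
  d_mem : ∀ i, ∀ a ∈ 𝒜 i, X.d a ∈ 𝒜 (i - 1)
  d_d : ∀ a, X.d (X.d a) = 0
  /-- The inner product is graded symmetric, of parity `ε`, non-degenerate and a chain map. -/
  pairing_symm : ∀ i j, ∀ a ∈ 𝒜 i, ∀ b ∈ 𝒜 j,
    X.pairing a b = msign K (parity i * parity j) * X.pairing b a
  pairing_parity : ∀ i j, ∀ a ∈ 𝒜 i, ∀ b ∈ 𝒜 j, X.pairing a b ≠ 0 → parity i = parity j + ε
  pairing_nondegenerate : X.pairing.Nondegenerate
  pairing_d : ∀ i, ∀ a ∈ 𝒜 i, ∀ b,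
    X.pairing (X.d a) b = msign K (parity i + 1) * X.pairing a (X.d b)
  /-- `ρ` is a morphism of dg operads `A∞ → End_A`. -/
  ρ_mem : ∀ n, 2 ≤ n → ∀ (T : PlanarTree n) (i : Fin n → ZMod (2 * N)) (a : Fin n → A),
    (∀ l, a l ∈ 𝒜 (i l)) → X.ρ n (Finsupp.single T 1) a ∈ 𝒜 (T.degree (2 * N) + ∑ l, i l)
  ρ_comp : ∀ m n p M (h : Composable m n p M) (U : PlanarTree m) (V : PlanarTree n)
    (i : Fin M → ZMod (2 * N)) (a : Fin M → A), (∀ l, a l ∈ 𝒜 (i l)) →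
    X.ρ M (treeComp K h U V) a =
      msign K (V.degree 2 * ∑ l : Fin M with l.1 + 1 < p, parity (i l)) •
        insertOp h (X.ρ m (Finsupp.single U 1)) (X.ρ n (Finsupp.single V 1)) a
  ρ_boundary : ∀ n, 2 ≤ n → ∀ (T : PlanarTree n) (i : Fin n → ZMod (2 * N)) (a : Fin n → A),
    (∀ l, a l ∈ 𝒜 (i l)) →
    X.ρ n (treeBoundary K n (Finsupp.single T 1)) a =
      X.d (X.ρ n (Finsupp.single T 1) a) -
        ∑ l, msign K (T.degree 2 + ∑ l' with l' < l, parity (i l')) •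
          X.ρ n (Finsupp.single T 1) (Function.update a l (X.d (a l)))
  /-- `ρ` is compatible with the cyclic structures. -/
  cyclic : ∀ n, 2 ≤ n → ∀ (T : PlanarTree n) (i : Fin (n + 1) → ZMod (2 * N)) (a : Fin (n + 1) → A),
    (∀ l, a l ∈ 𝒜 (i l)) →
    X.pairing (X.ρ n (treeRotation K n (Finsupp.single T 1)) fun l => a l.castSucc) (a (Fin.last n)) =
      msign K (parity (i 0) * ∑ l : Fin n, parity (i l.succ)) *
        X.pairing (X.ρ n (Finsupp.single T 1) fun l => a l.succ) (a 0)

/-! ### Tensor products -/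

section Tensor

variable {K : Type u} [Field K] {A : Type*} [AddCommGroup A] [Module K A]
  {B : Type*} [AddCommGroup B] [Module K B] {N : ℕ}

/-- The grading of `A ⊗ B`. -/
def tensorGrading (𝒜 : ZMod (2 * N) → Submodule K A) (ℬ : ZMod (2 * N) → Submodule K B) :
    ZMod (2 * N) → Submodule K (A ⊗[K] B) :=
  fun i => ⨆ j, Submodule.map₂ (TensorProduct.mk K A B) (𝒜 j) (ℬ (i - j))

/-- The projection of a graded vector space to its part of parity `p`. -/
def parityProj (𝒜 : ZMod (2 * N) → Submodule K A) [DirectSum.Decomposition 𝒜] (p : ZMod 2) :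
    A →ₗ[K] A :=
  (DirectSum.toModule K (ZMod (2 * N)) A
    fun i => if parity i = p then (𝒜 i).subtype else 0) ∘ₗ
      (DirectSum.decomposeLinearEquiv 𝒜).toLinearMap

/-- The multilinear map `(a₁ ⊗ b₁, …, a_n ⊗ b_n) ↦ f (a₁, …, a_n) ⊗ g (b₁, …, b_n)`. -/
def plainTensorOp [FiniteDimensional K A] [FiniteDimensional K B] {n : ℕ} (f : Op K A n)
    (g : Op K B n) : Op K (A ⊗[K] B) n :=
  let bA := Module.finBasis K A
  let bB := Module.finBasis K B
  ∑ α : Fin n → Fin (Module.finrank K A), ∑ β : Fin n → Fin (Module.finrank K B),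
    ((MultilinearMap.mkPiAlgebra K (Fin n) K).compLinearMap
      fun l => (bA.tensorProduct bB).coord (α l, β l)).smulRight
        ((f fun l => bA (α l)) ⊗ₜ[K] (g fun l => bB (β l)))

/-- The map `i : End_A ⊗ End_B → End_{A ⊗ B}`,
`i (f ⊗ g) (a₁ ⊗ b₁, …, a_n ⊗ b_n) = (-1) ^ s f (a₁, …, a_n) ⊗ g (b₁, …, b_n)` with
`s = ∑_{l < l'} |b_l| |a_l'| + ∑_l |a_l| |g|`; here `q = |g|`. -/
def tensorOp (𝒜 : ZMod (2 * N) → Submodule K A) [DirectSum.Decomposition 𝒜]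
    (ℬ : ZMod (2 * N) → Submodule K B) [DirectSum.Decomposition ℬ]
    [FiniteDimensional K A] [FiniteDimensional K B] {n : ℕ} (f : Op K A n) (g : Op K B n)
    (q : ZMod 2) : Op K (A ⊗[K] B) n :=
  ∑ s : Fin n → ZMod 2, ∑ t : Fin n → ZMod 2,
    msign K (∑ l, ∑ l' with l < l', t l * s l' + ∑ l, s l * q) •
      plainTensorOp (f.compLinearMap fun l => parityProj 𝒜 (s l))
        (g.compLinearMap fun l => parityProj ℬ (t l))

/-- The tensor product of two cyclic `A∞`-algebras defined by a diagonal `Δ`. The differential is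
`d_A ⊗ id + id ⊗ d_B`, the inner product is
`⟨a₁ ⊗ b₁, a₂ ⊗ b₂⟩ = (-1) ^ (|b₁| |a₂|) ⟨a₁, a₂⟩ ⟨b₁, b₂⟩`, and the structure map is
`i ∘ (ρ_A ⊗ ρ_B) ∘ Δ`. -/
def CyclicData.tensor (𝒜 : ZMod (2 * N) → Submodule K A) [DirectSum.Decomposition 𝒜]
    (ℬ : ZMod (2 * N) → Submodule K B) [DirectSum.Decomposition ℬ]
    [FiniteDimensional K A] [FiniteDimensional K B] (X : CyclicData K A) (Y : CyclicData K B)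
    (Δ : ∀ n, TreeChain K n →ₗ[K] TreeChain₂ K n) : CyclicData K (A ⊗[K] B) where
  d := TensorProduct.map X.d LinearMap.id +
    ∑ s : ZMod 2, msign K s • TensorProduct.map (parityProj 𝒜 s) Y.d
  pairing := ∑ s : ZMod 2, ∑ t : ZMod 2, msign K (t * s) •
    LinearMap.BilinForm.tmul (X.pairing.compl₁₂ LinearMap.id (parityProj 𝒜 s))
        (Y.pairing.compl₁₂ (parityProj ℬ t) LinearMap.id)
  ρ n := (Finsupp.linearCombination K fun P : PlanarTree n × PlanarTree n =>
    tensorOp 𝒜 ℬ (X.ρ n (Finsupp.single P.1 1)) (Y.ρ n (Finsupp.single P.2 1))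
      (P.2.degree 2)) ∘ₗ Δ n

end Tensor

/-! ### Ribbon graphs and graph complexes -/

/-- A finite set `H` of half-edges with two self-maps: the vertices are the classes of half-edges
under `rot`, the edges are the classes under `inv`. -/
structure RibbonData where
  H : Type
  [fintype : Fintype H]
  rot : H → H
  inv : H → H

attribute [instance] RibbonData.fintype

namespace RibbonData

/-- Vertices. -/
def Vertex (R : RibbonData) : Type := Quot fun x y : R.H => R.rot x = y

/-- Edges. -/
def Edge (R : RibbonData) : Type := Quot fun x y : R.H => R.inv x = y

/-- The vertex of a half-edge. -/
def vertexOf (R : RibbonData) (h : R.H) : R.Vertex := Quot.mk _ h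

/-- The edge of a half-edge. -/
def edgeOf (R : RibbonData) (h : R.H) : R.Edge := Quot.mk _ h

/-- `R` is a ribbon graph: `rot` is the cyclic ordering of the half-edges at each vertex, `inv`
exchanges the two half-edges of each edge, every vertex has valency at least three, and the graph is
connected (and not empty). -/
structure IsRibbonGraph (R : RibbonData) : Prop where
  nonempty : Nonempty R.H
  rot_bijective : Function.Bijective R.rot
  inv_inv : ∀ h, R.inv (R.inv h) = h
  inv_ne : ∀ h, R.inv h ≠ h
  valency : ∀ h, R.rot h ≠ h ∧ R.rot (R.rot h) ≠ h
  connected : ∀ h h', Relation.ReflTransGen (fun x y => R.rot x = y ∨ R.inv x = y) h h'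

/-- Isomorphisms of ribbon graphs. -/
structure Iso (R S : RibbonData) where
  toEquiv : R.H ≃ S.H
  map_rot : ∀ h, toEquiv (R.rot h) = S.rot (toEquiv h)
  map_inv : ∀ h, toEquiv (R.inv h) = S.inv (toEquiv h)

/-- The vertices, half-edges and edges of a graph. -/
inductive Cell (R : RibbonData) : Type
  | vertex (v : R.Vertex)
  | half (h : R.H)
  | edge (e : R.Edge)

/-- The map on vertices, half-edges and edges given by an isomorphism. -/
def Iso.mapCell {R S : RibbonData} (φ : R.Iso S) : R.Cell → S.Cell
  | .vertex v => .vertex (Quot.map φ.toEquiv (fun a b h => by rw [← h, φ.map_rot]) v)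
  | .half h => .half (φ.toEquiv h)
  | .edge e => .edge (Quot.map φ.toEquiv (fun a b h => by rw [← h, φ.map_inv]) e)

/-- The cells which enter an orientation: the vertices and half-edges for an ordinary orientation
(`ε = 0`), the edges for an orientation twisted by `det` (`ε = 1`). -/
def Cell.InOrientation {R : RibbonData} (ε : ZMod 2) : R.Cell → Prop
  | .vertex _ => ε = 0
  | .half _ => ε = 0
  | .edge _ => ε = 1

/-- The list `l` is an ordering of the cells which enter an orientation. It stands for the
orientation `⟨l⟩` of the vector space spanned by these cells. -/
def IsOrientation (R : RibbonData) (ε : ZMod 2) (l : List R.Cell) : Prop :=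
  l.Nodup ∧ ∀ c, c ∈ l ↔ c.InOrientation ε

end RibbonData

/-- Ribbon graphs with an orientation (ordinary for `ε = 0`, twisted for `ε = 1`). -/
structure OrientedGraph (ε : ZMod 2) where
  graph : RibbonData
  orientation : List graph.Cell
  isRibbonGraph : graph.IsRibbonGraph
  isOrientation : graph.IsOrientation ε orientation

/-- The relations of the graph complex: exchanging two neighbours in an ordering reverses the
orientation, and isomorphic oriented graphs are identified. -/
inductive GraphRelation (K : Type u) [Field K] (ε : ZMod 2) : (OrientedGraph ε →₀ K) → Prop
  | swap (R : RibbonData) (hR : R.IsRibbonGraph) (l₁ l₂ : List R.Cell) (a b : R.Cell)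
      (h : R.IsOrientation ε (l₁ ++ a :: b :: l₂)) (h' : R.IsOrientation ε (l₁ ++ b :: a :: l₂)) :
      GraphRelation K ε (Finsupp.single ⟨R, l₁ ++ a :: b :: l₂, hR, h⟩ 1 +
        Finsupp.single ⟨R, l₁ ++ b :: a :: l₂, hR, h'⟩ 1)
  | iso (G G' : OrientedGraph ε) (φ : G.graph.Iso G'.graph)
      (h : G'.orientation = G.orientation.map φ.mapCell) :
      GraphRelation K ε (Finsupp.single G 1 - Finsupp.single G' 1)

/-- The underlying vector space of the ribbon graph complex: `𝒢_*` for `ε = 0`, and the complex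
`𝒢_*(det)` twisted by the local system `det` for `ε = 1`. -/
abbrev GraphComplex (K : Type u) [Field K] (ε : ZMod 2) :=
  (OrientedGraph ε →₀ K) ⧸ Submodule.span K {x | GraphRelation K ε x}

open Classical in
/-- The class of the graph `R` with the orientation `⟨l⟩` (zero if `R` is not a ribbon graph or `l`
is not an orientation; this case never occurs below). -/
def graphClass (K : Type u) [Field K] (ε : ZMod 2) (R : RibbonData) (l : List R.Cell) :
    GraphComplex K ε :=
  if h : R.IsRibbonGraph ∧ R.IsOrientation ε l then
    Submodule.Quotient.mk (Finsupp.single ⟨R, l, h.1, h.2⟩ 1)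
  else 0

/-- A labelling of a graph: an ordering `v₁, …, v_k` of the vertices and names
`e_{i,0}, …, e_{i,n_i}` of the half-edges at each vertex `v_i`, following their cyclic ordering. -/
structure Labelling (R : RibbonData) where
  k : ℕ
  n : Fin k → ℕ
  e : (Σ i, Fin (n i + 1)) ≃ R.H
  rot_e : ∀ i j, R.rot (e ⟨i, j⟩) = e ⟨i, j + 1⟩

/-- The list `o = (h₁, …, h_E)` of half-edges gives an ordering of the edges together with a
direction of each edge: the `j`-th edge consists of `h_j⁺ = h_j` and `h_j⁻ = inv h_j`. -/
def IsEdgeOrder (R : RibbonData) (o : List R.H) : Prop :=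
  (o.map R.edgeOf).Nodup ∧ ∀ c, c ∈ o.map R.edgeOf

/-! ### Replacing vertices by trees -/

/-- The half-edges of a tree with `n` leaves: the legs (`0` is the root, `1, …, n` are the leaves)
and two half-edges `(f, true)`, `(f, false)` for each internal edge `f`, at the end of `f` which is
nearer to the root and at the other end. -/
abbrev TreeHalf {n : ℕ} (T : PlanarTree n) : Type :=
  Fin (n + 1) ⊕ {e : Interval // e ∈ T.edges} × Bool

namespace TreeHalf

variable {n : ℕ} {T : PlanarTree n}

/-- Seen from its vertex, a half-edge leads to a set of legs which is a segment of the cyclically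
ordered set `0, 1, …, n` of all legs. This is the first leg of the segment. -/
def start : TreeHalf T → ℕ
  | .inl j => j
  | .inr (f, true) => f.1.lo
  | .inr (f, false) => (f.1.hi + 1) % (n + 1)

/-- The number of legs to which a half-edge leads, seen from its vertex. -/
def length : TreeHalf T → ℕ
  | .inl _ => 1
  | .inr (f, true) => f.1.hi + 1 - f.1.lo
  | .inr (f, false) => n + f.1.lo - f.1.hi

/-- The segment of `y` begins where the segment of `x` ends, and does not meet it, and `y` is not
the other half of the edge of `x`. -/
def Follows (x y : TreeHalf T) : Prop :=
  y.start = (x.start + x.length) % (n + 1) ∧ x.length + y.length < n + 1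

open Classical in
/-- The successor of a half-edge in the cyclic ordering at its vertex: among the half-edges which
follow `x` it is the one with the longest segment. -/
def next (x : TreeHalf T) : TreeHalf T :=
  if h : ∃ y : TreeHalf T, x.Follows y ∧ ∀ z : TreeHalf T, x.Follows z → z.length ≤ y.length then
    h.choose
  else x

end TreeHalf

namespace Labelling

variable {R : RibbonData} (L : Labelling R) (T : ∀ i, PlanarTree (L.n i))

/-- The half-edges of `Γ(T₁, …, T_k)`: those of `Γ` and two for each internal edge of each tree. -/
abbrev ExpandedHalf : Type := R.H ⊕ Σ i, {e : Interval // e ∈ (T i).edges} × Bool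

/-- The half-edges of the tree `T_i` as half-edges of `Γ(T₁, …, T_k)`: the root is glued to
`e_{i,0}` and the leaves are glued to `e_{i,1}, …, e_{i,n_i}`. -/
def glue (i : Fin L.k) : TreeHalf (T i) → L.ExpandedHalf T
  | .inl j => .inl (L.e ⟨i, j⟩)
  | .inr p => .inr ⟨i, p⟩

/-- The graph `Γ(T₁, …, T_k)`: the vertex `v_i` of `Γ` is replaced by the tree `T_i`. -/
def expand : RibbonData where
  H := L.ExpandedHalf T
  rot
    | .inl h => L.glue T (L.e.symm h).1 (TreeHalf.next (.inl (L.e.symm h).2))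
    | .inr p => L.glue T p.1 (TreeHalf.next (.inr p.2))
  inv
    | .inl h => .inl (R.inv h)
    | .inr p => .inr ⟨p.1, p.2.1, !p.2.2⟩

/-- A half-edge of `Γ(T₁, …, T_k)`. -/
def old (h : R.H) : (L.expand T).H := Sum.inl h

/-- The half-edge `f⁺` (`s = true`, nearer to the root) or `f⁻` (`s = false`) of the internal edge
`f` of `T_i`. -/
def new (i : Fin L.k) (f : {e : Interval // e ∈ (T i).edges}) (s : Bool) : (L.expand T).H :=
  Sum.inr ⟨i, f, s⟩

/-- The word `v₁ e_{1,0} e_{1,1} … e_{1,n₁} v₂ e_{2,0} … e_{k,n_k}`. -/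
def cellWord : List R.Cell :=
  (List.finRange L.k).flatMap fun i =>
    .vertex (R.vertexOf (L.e ⟨i, 0⟩)) :: (List.finRange (L.n i + 1)).map fun j => .half (L.e ⟨i, j⟩)

/-- The word `e_{1,1} … e_{1,n₁} e_{1,0} e_{2,1} … e_{k,n_k} e_{k,0}`. -/
def halfWord : List R.H :=
  (List.finRange L.k).flatMap fun i =>
    (List.finRange (L.n i)).map (fun j => L.e ⟨i, j.succ⟩) ++ [L.e ⟨i, 0⟩]

/-- The orientation of `Γ(T₁, …, T_k)` determined by an orientation of `Γ` and the standard
orientations `f_{i,1} ∧ … ∧ f_{i,t_i}` of the trees.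

For `ε = 0` the orientation of `Γ` is `⟨v₁ e_{1,0} … e_{1,n₁} … v_k e_{k,0} … e_{k,n_k}⟩` and the
orientation of `Γ(T₁, …, T_k)` is the one which gives it back when the edges `f_{1,1}, …, f_{k,t_k}`
are collapsed in this order; collapsing `f` takes `⟨v⁻ v⁺ f⁻ f⁺ …⟩` to `⟨v …⟩`, where `f⁻`, `f⁺` are
half-edges at `v⁻`, `v⁺`. With `v⁺` at the end of `f` nearer to the root, and keeping the name `v⁺`
for `v`, this removes `v⁻ f⁻ f⁺` in `⟨v⁻ f⁻ f⁺ … v⁺ …⟩`.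

For `ε = 1` the orientation of `Γ` is `⟨o₁ … o_E⟩` and that of `Γ(T₁, …, T_k)` is
`⟨f_{1,1} … f_{k,t_k} o₁ … o_E⟩`. -/
def expandedOrientation (ε : ZMod 2) (o : List R.H) : List (L.expand T).Cell :=
  if ε = 0 then
    ((List.finRange L.k).flatMap fun i => (T i).edgeList.flatMap fun f =>
      [.vertex ((L.expand T).vertexOf (L.new T i f false)), .half (L.new T i f false),
        .half (L.new T i f true)]) ++
    (List.finRange L.k).flatMap fun i =>
      .vertex ((L.expand T).vertexOf (L.old T (L.e ⟨i, 0⟩))) ::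
        (List.finRange (L.n i + 1)).map fun j => .half (L.old T (L.e ⟨i, j⟩))
  else
    ((List.finRange L.k).flatMap fun i => (T i).edgeList.map fun f =>
      .edge ((L.expand T).edgeOf (L.new T i f true))) ++
    o.map fun h => .edge ((L.expand T).edgeOf (L.old T h))

end Labelling

/-- The element `(-1) ^ |Γ| (-1) ^ (∑_{i < j} n_i t_j) Γ(T₁, …, T_k)` of the graph complex, where
`t_j` is the number of internal edges of `T_j` and `|Γ| = ∑ (n_i - 2)`. For `ε = 0` this is
`φ_Γ (T₁, …, T_k)`; for `ε = 1` it is `ψ_Γ (T₁, …, T_k)`, with the trivialization of the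
orientations of `Γ` given by the ordering `o` of the edges. -/
def treesToGraph (K : Type u) [Field K] (ε : ZMod 2) {R : RibbonData} (L : Labelling R)
    (o : List R.H) (T : ∀ i, PlanarTree (L.n i)) : GraphComplex K ε :=
  msign K (∑ i, ((L.n i : ZMod 2) - 2) +
      ∑ i, ∑ j with i < j, (L.n i : ZMod 2) * ((T j).edges.card : ZMod 2)) •
    graphClass K ε (L.expand T) (L.expandedOrientation T ε o)

/-! ### Kontsevich classes -/

section Kontsevich

variable {K : Type u} [Field K] {A : Type*} [AddCommGroup A] [Module K A]

/-- The inverse `⟨-, -⟩⁻¹` of an inner product of parity `ε`, as a map `A^∨ ⊗ A^∨ → K`, on the basis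
dual to a homogeneous basis `b`. It is characterized by the identity
`a = ∑_{s, t} ⟨a, b_s⟩ · ⟨-, -⟩⁻¹ (b_s^∨, b_t^∨) · (-1) ^ (ε |b_t|) b_t`. -/
def inversePairing (pairing : A →ₗ[K] A →ₗ[K] K) (ε : ZMod 2) {m : ℕ}
    (b : Module.Basis (Fin m) K A) (deg : Fin m → ZMod 2) (s t : Fin m) : K :=
  (Matrix.of fun s t => pairing (b s) (b t))⁻¹ s t * msign K (ε * deg t)

open Classical in
/-- The contraction of operations `f_i ∈ Hom(A^{⊗ n_i}, A)` of parities `p_i` along a graph: the image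
of `f₁ ⊗ … ⊗ f_k` under
`⨂ Hom(A^{⊗ n_i}, A) ≅ ⨂ (A^∨)^{⊗ (n_i + 1)} → (A^∨ ⊗ A^∨)^{⊗ E} → K`.
The isomorphism is `f_i ↦ ⟨f_i (-), -⟩`, the second map is the permutation
`(e_{1,1}, …, e_{1,n₁}, e_{1,0}, …, e_{k,1}, …, e_{k,n_k}, e_{k,0}) → (h₁⁺, h₁⁻, …, h_E⁺, h_E⁻)` of
the factors, the last map is `(⟨-, -⟩⁻¹)^{⊗ E}`. The result is written out in a homogeneous basis `b`
of `A`, `deg` being the parities of its members. A coloring `α` assigns a member of the basis to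
each half-edge. The signs are the Koszul signs:
* from applying the isomorphisms, of degree `ε`, to the tensor product `f₁ ⊗ … ⊗ f_k`;
* from evaluating the tensor product of the functionals `⟨f_i (-), -⟩`, of degree `p_i + ε`;
* from evaluating the tensor product of the `E` maps `⟨-, -⟩⁻¹`, of degree `ε`;
* from the permutation of the elements `b_{α(h)}`.

For odd inner products there is in addition the sign by which the cell words
`v₁ e_{1,0} … e_{1,n₁} … v_k e_{k,0} … e_{k,n_k}` and `v₁ … v_k h₁⁺ h₁⁻ … h_E⁺ h_E⁻` differ. -/
def contraction (pairing : A →ₗ[K] A →ₗ[K] K) (ε : ZMod 2) {m : ℕ} (b : Module.Basis (Fin m) K A)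
    (deg : Fin m → ZMod 2) {R : RibbonData} (L : Labelling R) (o : List R.H)
    (f : ∀ i, Op K A (L.n i)) (p : Fin L.k → ZMod 2) : K :=
  let edgeWord : List R.H := o.flatMap fun h => [h, R.inv h]
  let cellWord' : List R.Cell :=
    (List.finRange L.k).map (fun i => .vertex (R.vertexOf (L.e ⟨i, 0⟩))) ++ edgeWord.map .half
  msign K (ε * ∑ i : Fin L.k, ((L.k : ZMod 2) - 1 - (i.1 : ZMod 2)) * p i +
      ∑ i, ∑ j with i < j, (p i + ε) * (p j + ε) +
      ε * (o.length.choose 2 : ℕ) +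
      ε * inversions (fun _ => 1) (fun c => cellWord'.idxOf c) L.cellWord) *
    ∑ α : R.H → Fin m,
      msign K (inversions (fun h => deg (α h)) (fun h => L.halfWord.idxOf h) edgeWord) *
        (∏ i, pairing (f i fun j => b (α (L.e ⟨i, j.succ⟩))) (b (α (L.e ⟨i, 0⟩)))) *
        (o.map fun h => inversePairing pairing ε b deg (α h) (α (R.inv h))).prod

/-- The linear form `c` on `𝒢_*` (`ε = 0`) or `𝒢_*(det)` (`ε = 1`) is the Kontsevich cocycle of the
cyclic `A∞`-algebra `X`: for every ribbon graph `Γ`, with any choice of labellings, bases etc., it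
restricts on the subspace of all graphs `Γ(T₁, …, T_k)` to the composition of
`φ_Γ⁻¹` (or `ψ_Γ⁻¹`), `ρ ⊗ … ⊗ ρ` and the contraction along `Γ`. -/
def IsKontsevichCocycle {N : ℕ} (𝒜 : ZMod (2 * N) → Submodule K A) (ε : ZMod 2)
    (X : CyclicData K A) (c : GraphComplex K ε →ₗ[K] K) : Prop :=
  ∀ (R : RibbonData), R.IsRibbonGraph → ∀ (L : Labelling R) (o : List R.H), IsEdgeOrder R o →
  ∀ (T : ∀ i, PlanarTree (L.n i)) (m : ℕ) (b : Module.Basis (Fin m) K A)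
    (deg : Fin m → ZMod (2 * N)), (∀ s, b s ∈ 𝒜 (deg s)) →
  c (treesToGraph K ε L o T) =
    contraction X.pairing ε b (fun s => parity (deg s)) L o
      (fun i => X.ρ _ (Finsupp.single (T i) 1)) (fun i => (T i).degree 2)

end Kontsevich

/-! ### The diagonal of the graph complex -/

/-- `δ` is the diagonal of the graph complexes defined by `Δ`: for every ribbon graph `Γ`, and any
choice of a labelling, it restricts on the subspace of all graphs `Γ(T₁, …, T_k)` to the composition
of the inverse of `φ_Γ` (or `ψ_Γ`), `Δ ⊗ … ⊗ Δ`, the permutation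
`(T₁ ⊗ T₁') ⊗ … ⊗ (T_k ⊗ T_k') ↦ ± (T₁ ⊗ … ⊗ T_k) ⊗ (T₁' ⊗ … ⊗ T_k')`, and `φ_Γ` (or `ψ_Γ`) on both
factors. In the untwisted complex, `φ_Γ` is used, in the twisted one `ψ_Γ`. If both target factors
are twisted, the two maps `ψ_Γ` are formed with opposite orderings `s₁, …, s_b` and `s_b, …, s₁` of a
basis of the first homology of `Γ`, which accounts for the sign `(-1) ^ (b (b - 1) / 2)`. -/
def IsGraphDiagonal {K : Type u} [Field K] (Δ : ∀ n, TreeChain K n →ₗ[K] TreeChain₂ K n)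
    (εA εB : ZMod 2)
    (δ : GraphComplex K (εA + εB) →ₗ[K] GraphComplex K εA ⊗[K] GraphComplex K εB) : Prop :=
  ∀ (R : RibbonData), R.IsRibbonGraph → ∀ (L : Labelling R) (o : List R.H), IsEdgeOrder R o →
  ∀ T : ∀ i, PlanarTree (L.n i),
  δ (treesToGraph K (εA + εB) L o T) =
    ∑ P ∈ Fintype.piFinset fun i => (Δ (L.n i) (Finsupp.single (T i) 1)).support,
      ((∏ i, Δ (L.n i) (Finsupp.single (T i) 1) (P i)) *
        msign K (∑ i, ∑ j with i < j, (P i).2.degree 2 * (P j).1.degree 2 +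
          εA * εB * ((Fintype.card R.H / 2 + 1 - L.k).choose 2 : ℕ))) •
      (treesToGraph K εA L o (fun i => (P i).1) ⊗ₜ[K] treesToGraph K εB L o (fun i => (P i).2))

end CyclicTensor

end

noncomputable section

namespace CyclicTensor

open List (append_assoc cons_append ext_getElem finRange finRange_succ flatMap_append
  flatMap_congr flatMap_cons flatMap_map getElem_append getElem_finRange getElem_map
  length_append length_cons length_finRange length_map length_singleton map_append
  map_congr_left map_cons map_const' map_flatMap map_map map_nil map_singleton mem_cons
  mem_cons_of_mem mem_cons_self mem_finRange mem_map nil_append nodup_finRange not_mem_nil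
  perm_ext_iff_of_nodup prod_append prod_cons sum_append sum_cons sum_nil sum_replicate
  sum_singleton)
open Finset (mem_univ mul_sum prod_congr prod_eq_zero prod_mul_distrib smul_sum sum_add_distrib
  sum_comm sum_congr sum_eq_single sum_mul)
open Finsupp (linearCombination linearCombination_apply linearCombination_single single
  smul_single sum_fintype)
open RibbonData (Cell)

/-- The internal edges of a tree. -/
abbrev PlanarTree.Edge {n : ℕ} (T : PlanarTree n) := {e : Interval // e ∈ T.edges}

/-! ### Scalars `(-1) ^ x` -/

section Signs

theorem zmod2_cases (x : ZMod 2) : x = 0 ∨ x = 1 := by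
  revert x; decide

theorem zmod2_mul_self (x : ZMod 2) : x * x = x := by
  revert x; decide

theorem zmod2_add_self (x : ZMod 2) : x + x = 0 := by
  revert x; decide

theorem zmod2_neg (x : ZMod 2) : -x = x := by
  revert x; decide

variable (K : Type u) [Field K]

@[simp] theorem msign_zero : msign K 0 = 1 := by simp [msign]

@[simp] theorem msign_one : msign K 1 = -1 := by simp [msign]

theorem msign_add (x y : ZMod 2) : msign K (x + y) = msign K x * msign K y := by
  rcases zmod2_cases x with rfl | rfl <;> rcases zmod2_cases y with rfl | rfl <;>
    simp [show (1 : ZMod 2) + 1 = 0 from rfl]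

theorem msign_mul_self (x : ZMod 2) : msign K x * msign K x = 1 := by
  rw [← msign_add, zmod2_add_self, msign_zero]

theorem msign_ne_zero (x : ZMod 2) : msign K x ≠ 0 := by
  intro h; simpa [h] using msign_mul_self K x

theorem msign_sum {ι : Type*} (s : Finset ι) (f : ι → ZMod 2) :
    msign K (∑ i ∈ s, f i) = ∏ i ∈ s, msign K (f i) := by
  classical
  induction s using Finset.induction_on with
  | empty => simp
  | insert a s ha ih => rw [Finset.sum_insert ha, Finset.prod_insert ha, msign_add, ih]

theorem msign_list_sum {ι : Type*} (l : List ι) (f : ι → ZMod 2) :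
    msign K (l.map f).sum = (l.map fun i => msign K (f i)).prod := by
  induction l with
  | nil => simp
  | cons a l ih => simp [msign_add, ih]

theorem msign_smul_smul {M : Type*} [AddCommGroup M] [Module K M] (x : ZMod 2) (m : M) :
    msign K x • msign K x • m = m := by
  rw [smul_smul, msign_mul_self, one_smul]

theorem msign_smul_eq_iff {M : Type*} [AddCommGroup M] [Module K M] {x : ZMod 2} {m m' : M} :
    msign K x • m = m' ↔ m = msign K x • m' := by
  constructor <;> rintro rfl <;> rw [msign_smul_smul]

end Signs

/-! ### Sums over the pairs of a list -/

section PairSum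

variable {α β : Type*}

/-- The sum of `s x y` over all pairs of entries such that `x` stands before `y`. -/
def pairSum (s : α → α → ZMod 2) : List α → ZMod 2
  | [] => 0
  | x :: l => (l.map (s x)).sum + pairSum s l

theorem pairSum_append (s : α → α → ZMod 2) (l l' : List α) :
    pairSum s (l ++ l') =
      pairSum s l + pairSum s l' + (l.map fun x => (l'.map (s x)).sum).sum := by
  induction l with
  | nil => simp [pairSum]
  | cons a l ih =>
    simp only [cons_append, pairSum, map_append, sum_append, ih, map_cons, sum_cons]
    ring

theorem pairSum_map (s : α → α → ZMod 2) (f : β → α) (l : List β) :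
    pairSum s (l.map f) = pairSum (fun x y => s (f x) (f y)) l := by
  induction l with
  | nil => rfl
  | cons a l ih => simp [pairSum, ih, Function.comp_def]

theorem pairSum_swap (s : α → α → ZMod 2) (l₁ l₂ : List α) (x y : α) :
    pairSum s (l₁ ++ x :: y :: l₂) = pairSum s (l₁ ++ y :: x :: l₂) + (s x y + s y x) := by
  simp only [pairSum_append, pairSum, map_cons, sum_cons]
  have : (l₁.map fun z => s z x + (s z y + (l₂.map (s z)).sum)).sum =
      (l₁.map fun z => s z y + (s z x + (l₂.map (s z)).sum)).sum := by
    congr 1; apply map_congr_left; intro z _; ring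
  rw [this]
  linear_combination (-1 : ZMod 2) * zmod2_add_self (s y x)

theorem list_sum_map_add {M : Type*} [AddCommMonoid M] (l : List α) (f g : α → M) :
    (l.map fun x => f x + g x).sum = (l.map f).sum + (l.map g).sum := by
  induction l with
  | nil => simp
  | cons a l ih => simp only [map_cons, sum_cons, ih]; abel

theorem list_sum_map_mul_left (l : List α) (c : ZMod 2) (f : α → ZMod 2) :
    (l.map fun x => c * f x).sum = c * (l.map f).sum := by
  induction l with
  | nil => simp
  | cons a l ih => simp [ih, mul_add]

theorem pairSum_add (s s' : α → α → ZMod 2) (l : List α) :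
    pairSum (fun x y => s x y + s' x y) l = pairSum s l + pairSum s' l := by
  induction l with
  | nil => simp [pairSum]
  | cons a l ih => simp only [pairSum, ih, list_sum_map_add]; ring

theorem pairSum_mul_left (c : ZMod 2) (s : α → α → ZMod 2) (l : List α) :
    pairSum (fun x y => c * s x y) l = c * pairSum s l := by
  induction l with
  | nil => simp [pairSum]
  | cons a l ih => simp only [pairSum, ih, list_sum_map_mul_left]; ring

theorem pairSum_congr {s s' : α → α → ZMod 2} {l : List α}
    (h : ∀ x ∈ l, ∀ y ∈ l, s x y = s' x y) : pairSum s l = pairSum s' l := by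
  induction l with
  | nil => rfl
  | cons a l ih =>
    simp only [pairSum]
    rw [ih fun x hx y hy => h x (mem_cons_of_mem _ hx) y (mem_cons_of_mem _ hy),
      map_congr_left fun y hy => h a mem_cons_self y (mem_cons_of_mem _ hy)]

theorem sum_sum_eq_pairSum_of_pairwise [LinearOrder α] (s : α → α → ZMod 2) (l : List α)
    (hl : l.Pairwise (· < ·)) :
    ∑ i ∈ l.toFinset, ∑ j ∈ l.toFinset with i < j, s i j = pairSum s l := by
  induction l with
  | nil => simp [pairSum]
  | cons a l ih =>
    have hl' := List.pairwise_cons.1 hl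
    have ha : a ∉ l.toFinset := fun h => lt_irrefl a (hl'.1 a (List.mem_toFinset.1 h))
    rw [List.toFinset_cons, Finset.sum_insert ha, pairSum]
    congr 1
    · rw [Finset.filter_insert, if_neg (lt_irrefl a), Finset.filter_true_of_mem fun x hx =>
        hl'.1 x (List.mem_toFinset.1 hx), List.sum_toFinset]
      exact hl'.2.imp ne_of_lt
    · rw [← ih hl'.2]
      refine sum_congr rfl fun i hi => ?_
      rw [Finset.filter_insert, if_neg (not_lt_of_gt (hl'.1 i (List.mem_toFinset.1 hi)))]

theorem sum_sum_eq_pairSum {k : ℕ} (s : Fin k → Fin k → ZMod 2) :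
    ∑ i, ∑ j with i < j, s i j = pairSum s (finRange k) := by
  rw [← sum_sum_eq_pairSum_of_pairwise s _ (List.pairwise_lt_finRange k)]
  simp

theorem list_sum_eq_fintype_sum {M : Type*} [AddCommMonoid M] [Fintype α] {l : List α}
    (hn : l.Nodup) (hl : ∀ x, x ∈ l) (f : α → M) : (l.map f).sum = ∑ i, f i := by
  classical
  rw [← List.sum_toFinset f hn]
  congr 1
  ext x; simp [hl]

theorem list_prod_eq_fintype_prod {M : Type*} [CommMonoid M] [Fintype α] {l : List α}
    (hn : l.Nodup) (hl : ∀ x, x ∈ l) (f : α → M) : (l.map f).prod = ∏ i, f i := by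
  classical
  rw [← List.prod_toFinset f hn]
  congr 1
  ext x; simp [hl]

end PairSum

/-! ### Signs of rearrangements of words -/

section Words

variable {α β : Type*}

/-- A function of words which does not change when two neighbours are exchanged is constant on the
rearrangements of a word. -/
theorem eq_of_perm_of_swap {X : Sort*} (D : List α → X) {l l' : List α}
    (h : ∀ l₁ x y l₂, l.Perm (l₁ ++ x :: y :: l₂) →
      D (l₁ ++ x :: y :: l₂) = D (l₁ ++ y :: x :: l₂))
    (hl : l.Perm l') : D l = D l' := by
  suffices H : ∀ m m' : List α, m.Perm m' → ∀ a : List α, l.Perm (a ++ m) →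
      D (a ++ m) = D (a ++ m') from H l l' hl [] (List.Perm.refl _)
  intro m m' hm
  induction hm with
  | nil => intro _ _; rfl
  | cons x _ ih => intro a ha; simpa using ih (a ++ [x]) (by simpa using ha)
  | swap x y l => intro a ha; exact h a y x l ha
  | trans h1 _ ih₁ ih₂ =>
    intro a ha
    exact (ih₁ a ha).trans (ih₂ a (ha.trans (h1.append_left a)))

theorem ne_of_nodup_perm {l l₁ l₂ : List α} {x y : α} (hn : l.Nodup)
    (h : l.Perm (l₁ ++ x :: y :: l₂)) : x ≠ y := by
  rintro rfl
  have := List.Nodup.of_append_right (h.nodup_iff.1 hn)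
  simp at this

section
variable [LinearOrder β] (w : α → ZMod 2) (pos : α → β)

theorem inversions_swap (l₁ l₂ : List α) {x y : α} (h : pos x ≠ pos y) :
    inversions w pos (l₁ ++ x :: y :: l₂) = inversions w pos (l₁ ++ y :: x :: l₂) + w x * w y := by
  induction l₁ with
  | nil =>
    simp only [nil_append, inversions, List.filter_cons]
    rcases lt_or_gt_of_ne h with h | h
    · simp only [h, not_lt_of_gt h, decide_true, decide_false, if_true, if_false,
        Bool.false_eq_true, map_cons, sum_cons]
      linear_combination (-1 : ZMod 2) * zmod2_add_self (w x * w y)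
    · simp only [h, not_lt_of_gt h, decide_true, decide_false, if_true, if_false,
        Bool.false_eq_true, map_cons, sum_cons]
      ring
  | cons a l ih =>
    simp only [cons_append, inversions, ih, ← add_assoc]
    congr 2
    apply List.Perm.sum_eq
    apply List.Perm.map
    apply List.Perm.filter
    exact (List.Perm.swap y x l₂).append_left l

theorem inversions_swap_word (a b u v : List α)
    (h : ∀ x ∈ u, ∀ y ∈ v, pos x ≠ pos y) :
    inversions w pos (a ++ u ++ v ++ b) = inversions w pos (a ++ v ++ u ++ b) +
      (u.map w).sum * (v.map w).sum := by
  have key : ∀ (x : α) (v a b : List α), (∀ y ∈ v, pos x ≠ pos y) →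
      inversions w pos (a ++ x :: (v ++ b)) = inversions w pos (a ++ v ++ x :: b) +
        w x * (v.map w).sum := by
    intro x v
    induction v with
    | nil => intro a b _; simp
    | cons y v ih =>
      intro a b h
      have := ih (a ++ [y]) b fun z hz => h z (mem_cons_of_mem _ hz)
      simp only [append_assoc, cons_append, nil_append] at this
      simp only [cons_append, append_assoc]
      rw [inversions_swap w pos a _ (h y mem_cons_self), this]
      simp; ring
  induction u generalizing a with
  | nil => simp
  | cons x u ih =>
    have h1 := ih (a ++ [x]) fun z hz => h z (mem_cons_of_mem _ hz)
    simp only [append_assoc, cons_append, nil_append] at h1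
    have h2 := key x v a (u ++ b) fun y hy => h x mem_cons_self y hy
    simp only [append_assoc, cons_append] at h1 h2 ⊢
    rw [h1, h2]
    simp; ring

end

/-- The Koszul exponent of sorting a word with respect to a chosen linear order. -/
def wordSign (w : α → ZMod 2) (l : List α) : ZMod 2 :=
  @inversions α α (@IsWellOrder.linearOrder α WellOrderingRel _) w id l

theorem wordSign_swap (w : α → ZMod 2) (l₁ l₂ : List α) {x y : α} (h : x ≠ y) :
    wordSign w (l₁ ++ x :: y :: l₂) = wordSign w (l₁ ++ y :: x :: l₂) + w x * w y :=
  letI := @IsWellOrder.linearOrder α WellOrderingRel _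
  inversions_swap w id l₁ l₂ h

theorem wordSign_swap_word (w : α → ZMod 2) (a b : List α) {u v : List α} (h : u.Disjoint v) :
    wordSign w (a ++ u ++ v ++ b) = wordSign w (a ++ v ++ u ++ b) +
      (u.map w).sum * (v.map w).sum :=
  letI := @IsWellOrder.linearOrder α WellOrderingRel _
  inversions_swap_word w id a b u v fun x hx y hy e => h hx (by change x = y at e; exact e ▸ hy)

theorem inversions_eq_zero_of_sorted [LinearOrder β] (w : α → ZMod 2) (pos : α → β) (l : List α)
    (h : l.Pairwise fun x y => pos x < pos y) : inversions w pos l = 0 := by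
  induction l with
  | nil => rfl
  | cons a l ih =>
    have h' := List.pairwise_cons.1 h
    rw [inversions, ih h'.2, List.filter_eq_nil_iff.2]
    · simp
    · intro b hb; simpa using (h'.1 b hb).le

theorem inversions_add_wordSign_eq {γ : Type*} [LinearOrder γ] (w : α → ZMod 2) (pos : α → γ)
    {l l' : List α} (hn : l.Nodup) (h : l.Perm l') (hpos : Set.InjOn pos {x | x ∈ l}) :
    inversions w pos l + wordSign w l = inversions w pos l' + wordSign w l' := by
  refine eq_of_perm_of_swap (fun m => inversions w pos m + wordSign w m) ?_ h
  intro l₁ x y l₂ hp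
  have hxy := ne_of_nodup_perm hn hp
  have : pos x ≠ pos y := fun e => hxy (hpos (hp.mem_iff.2 (by simp)) (hp.mem_iff.2 (by simp)) e)
  simp only [inversions_swap w pos l₁ l₂ this, wordSign_swap w l₁ l₂ hxy]
  linear_combination zmod2_add_self (w x * w y)

theorem inversions_idxOf [DecidableEq α] (w : α → ZMod 2) {l l' : List α} (hn : l.Nodup)
    (h : l.Perm l') :
    inversions w (fun x => l'.idxOf x) l = wordSign w l + wordSign w l' := by
  have h1 := inversions_add_wordSign_eq w (fun x => l'.idxOf x) hn h fun x hx y _ e =>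
    (List.idxOf_inj (h.mem_iff.1 hx)).1 e
  rw [inversions_eq_zero_of_sorted w _ l'] at h1
  · linear_combination h1 - zmod2_add_self (wordSign w l)
  · rw [List.pairwise_iff_getElem]
    intro i j hi hj hij
    rw [(h.nodup_iff.1 hn).idxOf_getElem, (h.nodup_iff.1 hn).idxOf_getElem]
    exact hij

theorem wordSign_append (w : α → ZMod 2) (a b : List α) {l l' : List α} (hn : l.Nodup)
    (h : l.Perm l') :
    wordSign w (a ++ l ++ b) + wordSign w l = wordSign w (a ++ l' ++ b) + wordSign w l' := by
  refine eq_of_perm_of_swap (fun l => wordSign w (a ++ l ++ b) + wordSign w l) ?_ h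
  intro l₁ x y l₂ hp
  have hxy := ne_of_nodup_perm hn hp
  have := wordSign_swap w (a ++ l₁) (l₂ ++ b) hxy
  simp only [append_assoc, cons_append] at this ⊢
  rw [this, wordSign_swap w l₁ l₂ hxy]
  linear_combination zmod2_add_self (w x * w y)

theorem wordSign_map (w : β → ZMod 2) {f : α → β} (hf : Function.Injective f) {l l' : List α}
    (hn : l.Nodup) (h : l.Perm l') :
    wordSign w (l.map f) + wordSign (fun x => w (f x)) l =
      wordSign w (l'.map f) + wordSign (fun x => w (f x)) l' := by
  refine eq_of_perm_of_swap
    (fun l => wordSign w (l.map f) + wordSign (fun x => w (f x)) l) ?_ h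
  intro l₁ x y l₂ hp
  have hxy := ne_of_nodup_perm hn hp
  simp only [map_append, map_cons]
  rw [wordSign_swap w _ _ (hf.ne hxy), wordSign_swap _ l₁ l₂ hxy]
  linear_combination zmod2_add_self (w (f x) * w (f y))

/-- A function of words which is multiplied by the Koszul sign when two neighbours are exchanged. -/
theorem eq_msign_smul_of_perm {K : Type u} [Field K] {M : Type*} [AddCommGroup M] [Module K M]
    (w : α → ZMod 2) (G : List α → M) {l l' : List α} (hn : l.Nodup)
    (h : ∀ l₁ x y l₂, l.Perm (l₁ ++ x :: y :: l₂) →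
      G (l₁ ++ x :: y :: l₂) = msign K (w x * w y) • G (l₁ ++ y :: x :: l₂)) (hl : l.Perm l') :
    G l = msign K (wordSign w l + wordSign w l') • G l' := by
  have := eq_of_perm_of_swap (fun m => msign K (wordSign w m) • G m) ?_ hl
  · rw [msign_add, mul_smul, ← this, msign_smul_smul]
  · intro l₁ x y l₂ hp
    rw [h _ _ _ _ hp, wordSign_swap w l₁ l₂ (ne_of_nodup_perm hn hp), msign_add, mul_smul,
      msign_smul_smul]

end Words

/-! ### Markings of ribbon graphs -/

/-- Names for the half-edges of a graph, following the cyclic orderings at the vertices, the vertices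
being indexed by an arbitrary type. -/
@[ext]
structure Marking (R : RibbonData) (ι : Type) where
  n : ι → ℕ
  e : (Σ i, Fin (n i + 1)) ≃ R.H
  rot_e : ∀ i j, R.rot (e ⟨i, j⟩) = e ⟨i, j + 1⟩

/-- The marking given by a labelling. -/
def Labelling.marking {R : RibbonData} (L : Labelling R) : Marking R (Fin L.k) :=
  ⟨L.n, L.e, L.rot_e⟩

/-- A dependent function on `Option ι` from its value at `none` and its values at `some i`. -/
def optCons {ι : Type} {β : Option ι → Type*} (t : β none) (T : ∀ i, β (some i)) : ∀ i, β i
  | none => t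
  | some i => T i

/-- A family of trees, one for each vertex. -/
local notation:max "optTrees" M:max => optCons (β := fun i => PlanarTree (Marking.n M i))

@[simp] theorem optCons_none {ι : Type} {β : Option ι → Type*} (t : β none)
    (T : ∀ i, β (some i)) : optCons t T none = t := rfl

@[simp] theorem optCons_some {ι : Type} {β : Option ι → Type*} (t : β none)
    (T : ∀ i, β (some i)) (i : ι) : optCons t T (some i) = T i := rfl

theorem optCons_eta {ι : Type} {β : Option ι → Type*} (T : ∀ i, β i) :
    optCons (T none) (fun i => T (some i)) = T := by
  funext i; cases i <;> rfl

/-- The orderings `ℓ` of the vertices and `o` of the (directed) edges which enter the definition of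
the orientations of a ribbon graph `R`. -/
structure IsFrame (R : RibbonData) {ι : Type} (ℓ : List ι) (o : List R.H) : Prop where
  isRibbonGraph : R.IsRibbonGraph
  nodup : ℓ.Nodup
  mem : ∀ i, i ∈ ℓ
  isEdgeOrder : IsEdgeOrder R o

namespace Marking

variable {R S : RibbonData} {ι ι' ι₀ : Type}

/-- The word `v e₀ … e_n` of the vertex `i`. -/
def cellBlock (M : Marking R ι) (i : ι) : List R.Cell :=
  .vertex (R.vertexOf (M.e ⟨i, 0⟩)) :: (finRange (M.n i + 1)).map fun j => .half (M.e ⟨i, j⟩)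

/-- The word `e₁ … e_n e₀` of the vertex `i`. -/
def halfBlock (M : Marking R ι) (i : ι) : List R.H :=
  (finRange (M.n i)).map (fun j => M.e ⟨i, j.succ⟩) ++ [M.e ⟨i, 0⟩]

/-- Renaming the vertices. -/
def reindex (M : Marking R ι) (σ : ι' ≃ ι) : Marking R ι' where
  n i := M.n (σ i)
  e := (Equiv.sigmaCongrLeft (β := fun i => Fin (M.n i + 1)) σ).trans M.e
  rot_e i j := M.rot_e (σ i) j

/-- Transport along an isomorphism of graphs. -/
def transport (M : Marking R ι) (φ : R.Iso S) : Marking S ι where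
  n := M.n
  e := M.e.trans φ.toEquiv
  rot_e i j := by
    simp only [Equiv.trans_apply]
    rw [← φ.map_rot, M.rot_e]

/-- Rotating the names of the half-edges: `e_{j - c}` becomes the half-edge with number `j`. -/
def rotate (M : Marking R ι) (c : ∀ i, Fin (M.n i + 1)) : Marking R ι where
  n := M.n
  e := (Equiv.sigmaCongrRight fun i => Equiv.subRight (c i)).trans M.e
  rot_e i j := by
    simp only [Equiv.trans_apply, Equiv.sigmaCongrRight_apply, Equiv.subRight_apply]
    rw [M.rot_e, sub_add_eq_add_sub]

theorem transport_e (M : Marking R ι) (φ : R.Iso S) (i j) :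
    (M.transport φ).e ⟨i, j⟩ = φ.toEquiv (M.e ⟨i, j⟩) := rfl

theorem rotate_e (M : Marking R ι) (c : ∀ i, Fin (M.n i + 1)) (i) (j : Fin (M.n i + 1)) :
    (M.rotate c).e ⟨i, j⟩ = M.e ⟨i, j - c i⟩ := rfl

theorem vertexOf_e (M : Marking R ι) (i : ι) (j : Fin (M.n i + 1)) :
    R.vertexOf (M.e ⟨i, j⟩) = R.vertexOf (M.e ⟨i, 0⟩) := by
  induction j using Fin.induction with
  | zero => rfl
  | succ j ih =>
    rw [← ih]
    refine (Quot.sound ?_).symm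
    rw [M.rot_e]
    congr 2
    exact Fin.coeSucc_eq_succ

/-- The vertices are named by the index type of a marking. -/
def vertexEquiv (M : Marking R ι) : R.Vertex ≃ ι where
  toFun := Quot.lift (fun h => (M.e.symm h).1) fun x y h => by
    obtain ⟨⟨i, j⟩, rfl⟩ := M.e.surjective x
    rw [← h, M.rot_e]; simp
  invFun i := R.vertexOf (M.e ⟨i, 0⟩)
  left_inv v := by
    induction v using Quot.ind with
    | _ h =>
      refine (M.vertexOf_e _ (M.e.symm h).2).symm.trans ?_
      rw [Sigma.eta, Equiv.apply_symm_apply]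
      rfl
  right_inv i := by simp [RibbonData.vertexOf]

theorem vertexEquiv_e (M : Marking R ι) (i j) : M.vertexEquiv (R.vertexOf (M.e ⟨i, j⟩)) = i :=
  congrArg Sigma.fst (M.e.symm_apply_apply ⟨i, j⟩)

theorem two_le (M : Marking R ι) (hR : R.IsRibbonGraph) (i : ι) : 2 ≤ M.n i := by
  have h := hR.valency (M.e ⟨i, 0⟩)
  rw [M.rot_e, M.rot_e] at h
  simp only [ne_eq, EmbeddingLike.apply_eq_iff_eq, Sigma.mk.injEq, heq_eq_eq, true_and] at h
  by_contra hlt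
  obtain h0 | h1 : M.n i = 0 ∨ M.n i = 1 := by omega
  · exact h.1 (by ext; have := (0 + 1 : Fin (M.n i + 1)).2; simp; omega)
  · refine h.2 ?_
    generalize M.n i = a at h1
    subst h1; rfl

section Split

variable (M : Marking R (Option ι₀)) {m n p : ℕ}

/-- The valencies after a vertex has been split. -/
def splitN (m n : ℕ) : Option (Option ι₀) → ℕ
  | none => n
  | some none => m
  | some (some i) => M.n (some i)

/-- The half-edges at the vertices after a vertex `none` of valency `m + n` has been split into two
vertices `some none` and `none`, joined by an edge. -/
def splitEquiv (h : Composable m n p (M.n none)) :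
    (Σ i, Fin (M.splitN m n i + 1)) ≃ (Σ i, Fin (M.n i + 1)) ⊕ Bool where
  toFun
    | ⟨none, j⟩ => if h0 : j.1 = 0 then .inr false else
        .inl ⟨none, ⟨j.1 + p - 1, by
          obtain ⟨_, _, _, _, _⟩ := h; have : j.1 < n + 1 := j.2; omega⟩⟩
    | ⟨some none, j⟩ =>
      if h0 : j.1 = p then .inr true
      else if h1 : j.1 < p then .inl ⟨none, ⟨j.1, by obtain ⟨_, _, _, _, _⟩ := h; omega⟩⟩
      else .inl ⟨none, ⟨j.1 + n - 1, by
        obtain ⟨_, _, _, _, _⟩ := h; have : j.1 < m + 1 := j.2; omega⟩⟩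
    | ⟨some (some i), j⟩ => .inl ⟨some i, j⟩
  invFun
    | .inr false => ⟨none, 0⟩
    | .inr true => ⟨some none, ⟨p, by obtain ⟨_, _, _, _, _⟩ := h; show p < m + 1; omega⟩⟩
    | .inl ⟨some i, j⟩ => ⟨some (some i), j⟩
    | .inl ⟨none, j⟩ =>
      if h1 : j.1 < p then ⟨some none, ⟨j.1, by
        obtain ⟨_, _, _, _, _⟩ := h; show _ < m + 1; omega⟩⟩
      else if h2 : j.1 < p + n then ⟨none, ⟨j.1 - p + 1, by show _ < n + 1; omega⟩⟩
      else ⟨some none, ⟨j.1 - n + 1, by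
        obtain ⟨_, _, _, _, _⟩ := h; have := j.2; show _ < m + 1; omega⟩⟩
  left_inv := by
    obtain ⟨h1, h2, h3, h4, h5⟩ := h
    rintro ⟨_ | _ | i, j, hj⟩
    · change j < n + 1 at hj
      by_cases h0 : j = 0
      · subst h0; rfl
      · simp only [h0, dite_false]
        rw [dif_neg (by omega), dif_pos (by omega)]
        congr 2; omega
    · change j < m + 1 at hj
      by_cases h0 : j = p
      · subst h0; simp
      · by_cases h6 : j < p
        · simp [h0, h6]
        · simp only [h0, h6, dite_false]
          rw [dif_neg (by omega), dif_neg (by omega)]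
          congr 2; omega
    · rfl
  right_inv := by
    obtain ⟨h1, h2, h3, h4, h5⟩ := h
    rintro (⟨_ | i, j, hj⟩ | _ | _)
    · dsimp only
      by_cases h6 : j < p
      · simp [h6, h6.ne]
      · by_cases h7 : j < p + n
        · simp only [h6, h7, dite_false, dite_true]
          rw [dif_neg (by omega)]
          congr 3; omega
        · simp only [h6, h7, dite_false]
          rw [dif_neg (by omega), dif_neg (by omega)]
          congr 3; omega
    · rfl
    · simp
    · simp

/-- The names of the half-edges of a graph one vertex of which has been split. -/
def splitE (h : Composable m n p (M.n none)) :
    (Σ i, Fin (M.splitN m n i + 1)) ≃ R.H ⊕ Bool :=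
  (M.splitEquiv h).trans (Equiv.sumCongr M.e (Equiv.refl _))

/-- The graph in which the vertex `none` has been split into two vertices, joined by an edge whose
half-edges are `true` at the lower and `false` at the upper vertex. -/
abbrev splitGraph (h : Composable m n p (M.n none)) : RibbonData where
  H := R.H ⊕ Bool
  rot x := M.splitE h ⟨((M.splitE h).symm x).1, ((M.splitE h).symm x).2 + 1⟩
  inv := Sum.map R.inv not

/-- The marking of the graph in which the vertex `none` has been split. -/
def split (h : Composable m n p (M.n none)) :
    Marking (M.splitGraph h) (Option (Option ι₀)) where
  n := M.splitN m n
  e := M.splitE h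
  rot_e i j := by
    change M.splitE h ⟨((M.splitE h).symm (M.splitE h ⟨i, j⟩)).1, _ + 1⟩ = _
    rw [Equiv.symm_apply_apply]

theorem fin_val_nsmul_one {a : ℕ} (x : Fin (a + 1)) : x.1 • (1 : Fin (a + 1)) = x := by
  have : ∀ c : ℕ, (c • (1 : Fin (a + 1))).1 = c % (a + 1) := by
    intro c
    induction c with
    | zero => rw [zero_nsmul]; simp
    | succ c ih => rw [succ_nsmul, Fin.val_add, ih, Fin.val_one']; simp
  exact Fin.ext ((this x.1).trans (Nat.mod_eq_of_lt x.2))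

theorem reach_e {S : RibbonData} {ι : Type} (M : Marking S ι) (i : ι) (j j' : Fin (M.n i + 1)) :
    Relation.ReflTransGen (fun x y => S.rot x = y ∨ S.inv x = y) (M.e ⟨i, j⟩) (M.e ⟨i, j'⟩) := by
  have : ∀ c : ℕ, Relation.ReflTransGen (fun x y => S.rot x = y ∨ S.inv x = y) (M.e ⟨i, j⟩)
      (M.e ⟨i, j + c • 1⟩) := by
    intro c
    induction c with
    | zero => simpa using Relation.ReflTransGen.refl
    | succ c ih =>
      refine ih.tail (Or.inl ?_)
      rw [M.rot_e]; congr 2; rw [succ_nsmul, add_assoc]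
  have h := this (j' - j).1
  rw [fin_val_nsmul_one] at h
  simpa using h

theorem fin_add_one_ne {a : ℕ} (ha : 2 ≤ a) (j : Fin (a + 1)) : j + 1 ≠ j ∧ j + 1 + 1 ≠ j := by
  obtain ⟨b, rfl⟩ := Nat.exists_eq_add_of_le ha
  have h1 : (1 : Fin (2 + b + 1)) ≠ 0 := by simp
  have h2 : (1 + 1 : Fin (2 + b + 1)) ≠ 0 := by
    rw [Ne, Fin.ext_iff, Fin.val_add]
    simp [Nat.mod_eq_of_lt (show 1 < 2 + b + 1 by omega),
      Nat.mod_eq_of_lt (show 2 < 2 + b + 1 by omega)]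
  exact ⟨fun e => h1 (add_eq_left.1 e), fun e => h2 (add_eq_left.1 ((add_assoc _ _ _).symm.trans e))⟩

theorem splitGraph_isRibbonGraph (h : Composable m n p (M.n none)) (hR : R.IsRibbonGraph) :
    (M.splitGraph h).IsRibbonGraph := by
  have hn : ∀ i, 2 ≤ M.splitN m n i := by
    rintro (_ | _ | i)
    · exact h.2.1
    · exact h.1
    · exact M.two_le hR _
  have hrot : ∀ i j, (M.splitGraph h).rot (M.splitE h ⟨i, j⟩) = M.splitE h ⟨i, j + 1⟩ :=
    (M.split h).rot_e
  refine ⟨⟨.inr true⟩, ?_, ?_, ?_, ?_, ?_⟩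
  · refine Finite.injective_iff_bijective.1 ?_
    intro x y hxy
    obtain ⟨⟨i, j⟩, rfl⟩ := (M.splitE h).surjective x
    obtain ⟨⟨i', j'⟩, rfl⟩ := (M.splitE h).surjective y
    rw [hrot, hrot] at hxy
    have := (M.splitE h).injective hxy
    obtain ⟨rfl, h2⟩ := Sigma.mk.inj this
    rw [add_right_cancel (eq_of_heq h2)]
  · rintro (x | b)
    · exact congrArg Sum.inl (hR.inv_inv x)
    · exact congrArg Sum.inr (Bool.not_not b)
  · rintro (x | b) hx
    · exact hR.inv_ne x (Sum.inl.inj hx)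
    · exact Bool.not_ne_self b (Sum.inr.inj hx)
  · intro x
    obtain ⟨⟨i, j⟩, rfl⟩ := (M.splitE h).surjective x
    rw [hrot, hrot]
    have h2 := fin_add_one_ne (hn i) j
    constructor
    · exact fun e => h2.1 (eq_of_heq (Sigma.mk.inj ((M.splitE h).injective e)).2)
    · exact fun e => h2.2 (eq_of_heq (Sigma.mk.inj ((M.splitE h).injective e)).2)
  · let r : R.H ⊕ Bool → R.H ⊕ Bool → Prop := Relation.ReflTransGen
      fun x y => (M.splitGraph h).rot x = y ∨ (M.splitGraph h).inv x = y
    have htrans : ∀ {x y z}, r x y → r y z → r x z := fun h1 h₂ => h1.trans h₂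
    have hv : ∀ i j j', r (M.splitE h ⟨i, j⟩) (M.splitE h ⟨i, j'⟩) := (M.split h).reach_e
    have hb : ∀ b, r (.inr b) (.inr !b) := fun b => Relation.ReflTransGen.single (Or.inr rfl)
    have hV : M.splitE h ⟨none, 0⟩ = .inr false := rfl
    have hU : M.splitE h ⟨some none, ⟨p, by
        obtain ⟨_, _, _, _, _⟩ := h; show p < m + 1; omega⟩⟩ = .inr true := by
      simp [splitE, splitEquiv]
    have hnone : ∀ j, r (.inl (M.e ⟨none, j⟩)) (.inr true) ∧
        r (.inr true) (.inl (M.e ⟨none, j⟩)) := by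
      intro j
      obtain ⟨⟨i, k⟩, hk⟩ := (M.splitE h).surjective (.inl (M.e ⟨none, j⟩))
      rw [← hk]
      rcases i with _ | _ | i
      · have h1 := hv none k 0
        have h₂ := hv none 0 k
        rw [hV] at h1 h₂
        exact ⟨htrans h1 (hb false), htrans (hb true) h₂⟩
      · rw [← hU]
        exact ⟨hv _ _ _, hv _ _ _⟩
      · cases M.e.injective (Sum.inl.inj (show Sum.inl (M.e ⟨some i, k⟩) = _ from hk))
    have hold : ∀ i j j', r (.inl (M.e ⟨i, j⟩)) (.inl (M.e ⟨i, j'⟩)) := by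
      rintro (_ | i) j j'
      · exact htrans (hnone j).1 (hnone j').2
      · exact hv (some (some i)) j j'
    have hR' : ∀ x y, r (.inl x) (.inl y) := by
      intro x y
      induction hR.connected x y with
      | refl => exact Relation.ReflTransGen.refl
      | @tail y z _ hyz ih =>
        refine htrans ih ?_
        rcases hyz with rfl | rfl
        · obtain ⟨⟨i, j⟩, rfl⟩ := M.e.surjective y
          rw [M.rot_e]
          exact hold _ _ _
        · exact Relation.ReflTransGen.single (Or.inr rfl)
    have hto : ∀ x, r x (.inr true) ∧ r (.inr true) x := by
      rintro (x | _ | _)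
      · exact ⟨htrans (hR' _ _) (hnone 0).1, htrans (hnone 0).2 (hR' _ _)⟩
      · exact ⟨hb false, hb true⟩
      · exact ⟨Relation.ReflTransGen.refl, Relation.ReflTransGen.refl⟩
    exact fun x y => htrans (hto x).1 (hto y).2

end Split
end Marking

/-! ### Signs of rotations and compositions of trees -/

/-- The exponent of the sign in `r T = ± r T`. -/
def PlanarTree.rotationSign {n : ℕ} (T : PlanarTree n) : ZMod 2 :=
  (n : ZMod 2) + inversions (fun _ => 1) id (T.stdOrientation.map (rotateEdge n))

/-- The exponent of the sign in `U ∘ᵢ V = ± graft U V`. -/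
def graftSign {m n i : ℕ} (U : PlanarTree m) (V : PlanarTree n) : ZMod 2 :=
  ((i : ZMod 2) * ((n : ZMod 2) + 1) + (m : ZMod 2) * V.degree 2) +
    inversions (fun _ => 1) id
      (U.stdOrientation.map (shiftLower n i) ++ V.stdOrientation.map (shiftUpper i) ++
        [Interval.mk i (i + n - 1)])

theorem treeRotation_single (K : Type u) [Field K] {n : ℕ} (T : PlanarTree n) :
    treeRotation K n (single T 1) = single T.rotate (msign K T.rotationSign) := by
  simp [treeRotation, oriented, PlanarTree.rotationSign, msign_add]

theorem treeComp_eq (K : Type u) [Field K] {m n i N : ℕ} (h : Composable m n i N)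
    (U : PlanarTree m) (V : PlanarTree n) :
    treeComp K h U V = single (graft h U V) (msign K (graftSign (i := i) U V)) := by
  simp [treeComp, oriented, graftSign, msign_add]

theorem Interval.ext' {e f : Interval} (h1 : e.lo = f.lo) (h2 : e.hi = f.hi) : e = f :=
  ofLex.injective (Prod.ext h1 h2)

@[simp] theorem Interval.mk_lo (a b : ℕ) : (Interval.mk a b).lo = a := rfl

@[simp] theorem Interval.mk_hi (a b : ℕ) : (Interval.mk a b).hi = b := rfl

/-- A tree which is not a corolla is obtained by grafting. -/
theorem PlanarTree.exists_eq_graft {N : ℕ} (T : PlanarTree N) (hT : T.edges.Nonempty) :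
    ∃ m n p, ∃ (h : Composable m n p N) (U : PlanarTree m) (V : PlanarTree n),
      T = graft h U V ∧ U.edges.card + V.edges.card < T.edges.card := by
  obtain ⟨f, hf, hmin⟩ := T.edges.exists_min_image (fun e => e.hi - e.lo) hT
  have hfp := T.proper f hf
  have key : ∀ e ∈ T.edges.erase f, e.Proper N ∧
      (e.hi < f.lo ∨ f.hi < e.lo ∨ e.lo ≤ f.lo ∧ f.hi ≤ e.hi ∧ (e.lo < f.lo ∨ f.hi < e.hi)) := by
    intro e he
    obtain ⟨hne, he⟩ := Finset.mem_erase.1 he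
    have h1 := T.proper e he
    have h2 := T.compatible e he f hf
    have h3 := hmin e he
    refine ⟨h1, ?_⟩
    have h4 : ¬(e.lo = f.lo ∧ e.hi = f.hi) := fun h => hne (Interval.ext' h.1 h.2)
    simp only [Interval.Proper, Interval.Compatible] at *
    omega
  let un : Interval → Interval := fun e => Interval.mk
    (if e.lo ≤ f.lo then e.lo else e.lo - (f.hi - f.lo))
    (if e.hi < f.lo then e.hi else e.hi - (f.hi - f.lo))
  have hlo : ∀ e, (un e).lo = if e.lo ≤ f.lo then e.lo else e.lo - (f.hi - f.lo) := fun _ => rfl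
  have hhi : ∀ e, (un e).hi = if e.hi < f.lo then e.hi else e.hi - (f.hi - f.lo) := fun _ => rfl
  have hcomp : Composable (N - (f.hi - f.lo)) (f.hi - f.lo + 1) f.lo N := by
    simp only [Interval.Proper] at hfp
    refine ⟨?_, ?_, ?_, ?_, ?_⟩ <;> omega
  refine ⟨N - (f.hi - f.lo), f.hi - f.lo + 1, f.lo, hcomp,
    ⟨(T.edges.erase f).image un, ?_, ?_⟩, PlanarTree.corolla _, ?_, ?_⟩
  · intro e' he'
    obtain ⟨e, he, rfl⟩ := Finset.mem_image.1 he'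
    have h1 := key e he
    simp only [Interval.Proper, hlo, hhi] at *
    split_ifs <;> omega
  · intro e' he' g' hg'
    obtain ⟨e, he, rfl⟩ := Finset.mem_image.1 he'
    obtain ⟨g, hg, rfl⟩ := Finset.mem_image.1 hg'
    have h1 := key e he
    have h2 := key g hg
    have h3 := T.compatible e (Finset.mem_of_mem_erase he) g (Finset.mem_of_mem_erase hg)
    clear he hg he' hg' hmin key
    simp only [Interval.Proper, Interval.Compatible, hlo, hhi] at *
    split_ifs <;> omega
  · ext1
    change T.edges = insert (Interval.mk f.lo (f.lo + (f.hi - f.lo + 1) - 1))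
      (((T.edges.erase f).image un).image (shiftLower (f.hi - f.lo + 1) f.lo) ∪ Finset.image _ ∅)
    have e₁ : Interval.mk f.lo (f.lo + (f.hi - f.lo + 1) - 1) = f := by
      simp only [Interval.Proper] at hfp
      refine Interval.ext' rfl ?_
      simp only [Interval.mk_hi]; omega
    have e₂ : ((T.edges.erase f).image un).image (shiftLower (f.hi - f.lo + 1) f.lo) =
        T.edges.erase f := by
      rw [Finset.image_image]
      conv_rhs => rw [← Finset.image_id (s := T.edges.erase f)]
      refine Finset.image_congr fun e he => ?_
      have h1 := key e he
      refine Interval.ext' ?_ ?_ <;>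
        simp only [Function.comp, shiftLower, Interval.mk_lo, Interval.mk_hi, hlo, hhi, id,
          Interval.Proper] at *
      · clear he hmin key
        split_ifs <;> omega
      · clear he hmin key
        split_ifs <;> omega
    rw [e₁, e₂, Finset.image_empty, Finset.union_empty, Finset.insert_erase hf]
  · have h1 : ((T.edges.erase f).image un).card ≤ (T.edges.erase f).card := Finset.card_image_le
    have h2 := Finset.card_erase_lt_of_mem hf
    simp only [PlanarTree.corolla, Finset.card_empty]
    omega

theorem PlanarTree.eq_corolla {n : ℕ} {T : PlanarTree n} (h : T.edges.card = 0) :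
    T = PlanarTree.corolla n :=
  PlanarTree.ext (Finset.card_eq_zero.1 h)

/-! ### Functionals of trees on marked ribbon graphs -/

/-- The trees which replace the vertices of a graph one vertex of which has been split. -/
def Marking.splitTrees {R : RibbonData} {ι₀ : Type} (M : Marking R (Option ι₀)) {m n p : ℕ}
    (h : Composable m n p (M.n none)) (U : PlanarTree m) (V : PlanarTree n)
    (T : ∀ i, PlanarTree (M.n (some i))) (i : Option (Option ι₀)) :
    PlanarTree ((M.split h).n i) :=
  match i with
  | none => V
  | some none => U
  | some (some i) => T i

/-- Functions of the data `(Γ, T₁, …, T_k)` which depend on the choices in the way in which the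
elements `Φ_Γ (T₁, …, T_k)` of the graph complex of parity `ε` do, and for which the composition of
trees corresponds to the splitting of vertices. -/
structure GraphFunctional (K : Type u) [Field K] (ε : ZMod 2) (W : Type*) [AddCommGroup W]
    [Module K W] where
  val : ∀ {R : RibbonData} {ι : Type} [Fintype ι] (M : Marking R ι) (_ : List ι) (_ : List R.H)
    (_ : ∀ i, PlanarTree (M.n i)), W
  val_reindex : ∀ {R : RibbonData} {ι ι' : Type} [Fintype ι] [Fintype ι'] (M : Marking R ι)
    (σ : ι' ≃ ι) (ℓ : List ι') (o : List R.H) (T : ∀ i, PlanarTree (M.n i)), IsFrame R ℓ o →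
    val (M.reindex σ) ℓ o (fun i => T (σ i)) = val M (ℓ.map σ) o T
  val_transport : ∀ {R S : RibbonData} {ι : Type} [Fintype ι] (M : Marking R ι) (φ : R.Iso S)
    (ℓ : List ι) (o : List R.H) (T : ∀ i, PlanarTree (M.n i)), IsFrame R ℓ o →
    val (M.transport φ) ℓ (o.map φ.toEquiv) T = val M ℓ o T
  val_swap_vertices : ∀ {R : RibbonData} {ι : Type} [Fintype ι] (M : Marking R ι) (l₁ l₂ : List ι)
    (x y : ι) (o : List R.H) (T : ∀ i, PlanarTree (M.n i)), IsFrame R (l₁ ++ x :: y :: l₂) o →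
    val M (l₁ ++ x :: y :: l₂) o T =
      msign K ((T x).degree 2 * (T y).degree 2 + ε * ((M.n x : ZMod 2) * (M.n y : ZMod 2))) •
        val M (l₁ ++ y :: x :: l₂) o T
  val_swap_edges : ∀ {R : RibbonData} {ι : Type} [Fintype ι] (M : Marking R ι) (ℓ : List ι)
    (o₁ o₂ : List R.H) (x y : R.H) (T : ∀ i, PlanarTree (M.n i)),
    IsFrame R ℓ (o₁ ++ x :: y :: o₂) →
    val M ℓ (o₁ ++ x :: y :: o₂) T = msign K ε • val M ℓ (o₁ ++ y :: x :: o₂) T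
  val_flip_edge : ∀ {R : RibbonData} {ι : Type} [Fintype ι] (M : Marking R ι) (ℓ : List ι)
    (o₁ o₂ : List R.H) (x : R.H) (T : ∀ i, PlanarTree (M.n i)), IsFrame R ℓ (o₁ ++ x :: o₂) →
    val M ℓ (o₁ ++ x :: o₂) T = val M ℓ (o₁ ++ R.inv x :: o₂) T
  val_rotate : ∀ {R : RibbonData} {ι₀ : Type} [Fintype ι₀] (M : Marking R (Option ι₀))
    (ℓ₀ : List ι₀) (o : List R.H) (t : PlanarTree (M.n none)) (T : ∀ i, PlanarTree (M.n (some i))),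
    IsFrame R (none :: ℓ₀.map some) o →
    val (M.rotate (optCons 1 fun _ => 0)) (none :: ℓ₀.map some) o
        (optTrees M t.rotate T) =
      msign K (t.rotationSign + ε * (M.n none : ZMod 2)) •
        val M (none :: ℓ₀.map some) o (optTrees M t T)
  val_graft : ∀ {R : RibbonData} {ι₀ : Type} [Fintype ι₀] (M : Marking R (Option ι₀))
    (ℓ₀ : List ι₀) (o : List R.H) {m n p : ℕ} (h : Composable m n p (M.n none)) (U : PlanarTree m)
    (V : PlanarTree n) (T : ∀ i, PlanarTree (M.n (some i))), IsFrame R (none :: ℓ₀.map some) o →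
    val M (none :: ℓ₀.map some) o (optTrees M (graft h U V) T) =
      msign K (graftSign (i := p) U V +
          ε * ((p : ZMod 2) * n + p + (m : ZMod 2) * n + 1)) •
        val (M.split h) (some none :: none :: ℓ₀.map fun i => some (some i))
          (.inr false :: o.map .inl) (M.splitTrees h U V T)

namespace IsFrame

variable {R : RibbonData} {ι ι' : Type} {ℓ : List ι} {o : List R.H}

theorem perm (h : IsFrame R ℓ o) {ℓ' : List ι} (h' : ℓ.Perm ℓ') : IsFrame R ℓ' o :=
  ⟨h.1, h'.nodup_iff.1 h.2, fun i => h'.mem_iff.1 (h.3 i), h.4⟩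

theorem map (h : IsFrame R ℓ o) (σ : ι ≃ ι') : IsFrame R (ℓ.map σ) o :=
  ⟨h.1, h.2.map σ.injective, fun i => List.mem_map.2 ⟨σ.symm i, h.3 _, σ.apply_symm_apply i⟩, h.4⟩

theorem isEdgeOrder_perm {o o' : List R.H} (h : IsEdgeOrder R o) (h' : o.Perm o') :
    IsEdgeOrder R o' :=
  ⟨(h'.map R.edgeOf).nodup_iff.1 h.1, fun c => (h'.map R.edgeOf).mem_iff.1 (h.2 c)⟩

theorem permEdges (h : IsFrame R ℓ o) {o' : List R.H} (h' : o.Perm o') : IsFrame R ℓ o' :=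
  ⟨h.1, h.2, h.3, isEdgeOrder_perm h.4 h'⟩

theorem edgeOf_eq_iff (hR : R.IsRibbonGraph) {x y : R.H} :
    R.edgeOf x = R.edgeOf y ↔ x = y ∨ R.inv x = y := by
  constructor
  · intro h
    have := Quot.eqvGen_exact h
    clear h
    induction this with
    | rel x y h => exact Or.inr h
    | refl x => exact Or.inl rfl
    | symm x y _ ih =>
      rcases ih with rfl | rfl
      · exact Or.inl rfl
      · exact Or.inr (hR.inv_inv x)
    | trans x y z _ _ ih₁ ih₂ =>
      rcases ih₁ with rfl | rfl
      · exact ih₂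
      · rcases ih₂ with rfl | rfl
        · exact Or.inr rfl
        · exact Or.inl (hR.inv_inv x).symm
  · rintro (rfl | rfl)
    · rfl
    · exact Quot.sound rfl

theorem split {ι₀ : Type} {M : Marking R (Option ι₀)} {m n p : ℕ}
    (h : Composable m n p (M.n none)) {ℓ₀ : List ι₀} (hf : IsFrame R (none :: ℓ₀.map some) o) :
    IsFrame (M.splitGraph h) (some none :: none :: ℓ₀.map fun i => some (some i))
      (.inr false :: o.map .inl) := by
  have hr := M.splitGraph_isRibbonGraph h hf.1
  have hn : ℓ₀.Nodup := List.Nodup.of_map _ (List.nodup_cons.1 hf.2).2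
  have hm : ∀ i, i ∈ ℓ₀ := fun i => by simpa using hf.3 (some i)
  refine ⟨hr, ?_, ?_, ?_, ?_⟩
  · simp only [List.nodup_cons, mem_cons, mem_map]
    refine ⟨by simp, by simp, hn.map fun i j h => by simpa using h⟩
  · rintro (_ | _ | i) <;> simp [hm]
  · rw [map_cons, map_map, List.nodup_cons]
    constructor
    · rw [mem_map]
      rintro ⟨x, _, hx⟩
      rcases (edgeOf_eq_iff hr).1 hx with h | h <;> cases h
    · have h1 := hf.4.1
      rw [List.nodup_iff_injective_get] at h1
      refine List.Nodup.map_on ?_ (List.Nodup.of_map _ hf.4.1)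
      intro x hx y hy hxy
      have : R.edgeOf x = R.edgeOf y := by
        rw [edgeOf_eq_iff hf.1]
        rcases (edgeOf_eq_iff hr).1 hxy with h | h
        · exact Or.inl (Sum.inl.inj h)
        · exact Or.inr (Sum.inl.inj h)
      exact List.inj_on_of_nodup_map hf.4.1 hx hy this
  · intro c
    induction c using Quot.ind with
    | _ x =>
      rcases x with x | _ | _
      · obtain ⟨y, hy, hyx⟩ := List.mem_map.1 (hf.4.2 (R.edgeOf x))
        refine List.mem_map.2 ⟨.inl y, by simp [hy], ?_⟩
        refine (edgeOf_eq_iff hr).2 ?_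
        rcases (edgeOf_eq_iff hf.1).1 hyx with rfl | rfl
        · exact Or.inl rfl
        · exact Or.inr rfl
      · exact List.mem_map.2 ⟨.inr false, by simp, rfl⟩
      · exact List.mem_map.2 ⟨.inr false, by simp, (edgeOf_eq_iff hr).2 (Or.inr rfl)⟩

end IsFrame

namespace GraphFunctional

variable {K : Type u} [Field K] {ε : ZMod 2} {W : Type*} [AddCommGroup W] [Module K W]
  {W' : Type*} [AddCommGroup W'] [Module K W']

/-- The composition of a functional with a linear map. -/
def map (F : GraphFunctional K ε W) (g : W →ₗ[K] W') : GraphFunctional K ε W' where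
  val M ℓ o T := g (F.val M ℓ o T)
  val_reindex M σ ℓ o T h := by rw [F.val_reindex M σ ℓ o T h]
  val_transport M φ ℓ o T h := by rw [F.val_transport M φ ℓ o T h]
  val_swap_vertices M l₁ l₂ x y o T h := by rw [F.val_swap_vertices M l₁ l₂ x y o T h, map_smul]
  val_swap_edges M ℓ o₁ o₂ x y T h := by rw [F.val_swap_edges M ℓ o₁ o₂ x y T h, map_smul]
  val_flip_edge M ℓ o₁ o₂ x T h := by rw [F.val_flip_edge M ℓ o₁ o₂ x T h]
  val_rotate M ℓ₀ o t T h := by rw [F.val_rotate M ℓ₀ o t T h, map_smul]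
  val_graft M ℓ₀ o _ _ _ h U V T hf := by rw [F.val_graft M ℓ₀ o h U V T hf, map_smul]

theorem exists_list_of_perm_cons {ι : Type} {ℓ : List ι} {x : ι} (hn : ℓ.Nodup)
    (hx : x ∈ ℓ) : ∃ ℓ', ℓ.Perm (x :: ℓ') := by
  obtain ⟨a, b, rfl⟩ := List.append_of_mem hx
  exact ⟨a ++ b, List.perm_middle⟩

theorem exists_eq_map_some {ι : Type} {ℓ : List (Option ι)} (h : none ∉ ℓ) :
    ∃ ℓ₀ : List ι, ℓ = ℓ₀.map some := by
  induction ℓ with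
  | nil => exact ⟨[], rfl⟩
  | cons a l ih =>
    obtain ⟨l', rfl⟩ := ih fun hi => h (mem_cons_of_mem _ hi)
    obtain ⟨b, rfl⟩ := Option.ne_none_iff_exists'.1 fun e => h (e ▸ mem_cons_self)
    exact ⟨b :: l', rfl⟩

/-- Two functionals which agree on corollas are equal. -/
theorem val_eq_of_corolla {F F' : GraphFunctional K ε W}
    (hc : ∀ {R : RibbonData} {ι : Type} [Fintype ι] (M : Marking R ι) (ℓ : List ι) (o : List R.H),
      IsFrame R ℓ o → F.val M ℓ o (fun i => PlanarTree.corolla (M.n i)) =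
        F'.val M ℓ o (fun i => PlanarTree.corolla (M.n i)))
    {R : RibbonData} {ι : Type} [Fintype ι] (M : Marking R ι) (ℓ : List ι) (o : List R.H)
    (T : ∀ i, PlanarTree (M.n i)) (hf : IsFrame R ℓ o) : F.val M ℓ o T = F'.val M ℓ o T := by
  induction hk : ∑ i, (T i).edges.card using Nat.strong_induction_on generalizing R ι with
  | _ k ih =>
  subst hk
  by_cases h0 : ∃ x, (T x).edges.Nonempty
  · obtain ⟨x, hx⟩ := h0
    classical
    let σ := Equiv.optionSubtypeNe x
    have hσ : σ none = x := Equiv.optionSubtypeNe_none x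
    let ℓ₁ : List (Option {i // i ≠ x}) := ℓ.map σ.symm
    have hℓ₁ : IsFrame R ℓ₁ o := hf.map σ.symm
    obtain ⟨ℓ₂, hℓ₂⟩ := exists_list_of_perm_cons hℓ₁.2 (hℓ₁.3 none)
    have hf₂ := hℓ₁.perm hℓ₂
    obtain ⟨ℓ₀, rfl⟩ := exists_eq_map_some (List.nodup_cons.1 hf₂.2).1
    let M' := M.reindex σ
    let T' : ∀ i, PlanarTree (M'.n i) := fun i => T (σ i)
    have hsum : ∑ i, (T' i).edges.card = ∑ i, (T i).edges.card :=
      σ.sum_comp fun i => (T i).edges.card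
    have hx' : (T' none).edges.Nonempty := by
      change (T (σ none)).edges.Nonempty
      rw [hσ]; exact hx
    have hmap : ℓ = ℓ₁.map σ := by simp [ℓ₁]
    rw [hmap, ← F.val_reindex M σ ℓ₁ o T hℓ₁, ← F'.val_reindex M σ ℓ₁ o T hℓ₁]
    refine (eq_of_perm_of_swap (fun l => F.val M' l o T' = F'.val M' l o T') ?_ hℓ₂).mpr ?_
    · intro l₁ a b l₂ hp
      rw [F.val_swap_vertices M' l₁ l₂ a b o T' (hℓ₁.perm hp),
        F'.val_swap_vertices M' l₁ l₂ a b o T' (hℓ₁.perm hp)]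
      exact propext (smul_right_injective _ (msign_ne_zero K _)).eq_iff
    · obtain ⟨m, n, p, h, U, V, hT, hlt⟩ := (T' none).exists_eq_graft hx'
      have e : T' = optCons (β := fun i => PlanarTree (M'.n i)) (graft h U V)
          (fun i => T' (some i)) := by
        rw [← hT]; exact (optCons_eta T').symm
      rw [e, F.val_graft M' ℓ₀ o h U V _ hf₂, F'.val_graft M' ℓ₀ o h U V _ hf₂]
      congr 1
      refine ih _ ?_ _ _ _ _ (hf₂.split h) rfl
      rw [← hsum, Fintype.sum_option, Fintype.sum_option, Fintype.sum_option]
      change V.edges.card + (U.edges.card + ∑ i, (T' (some i)).edges.card) <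
        (T' none).edges.card + ∑ i, (T' (some i)).edges.card
      omega
  · have : T = fun i => PlanarTree.corolla (M.n i) := by
      funext i
      exact PlanarTree.eq_corolla (Finset.card_eq_zero.2
        (Finset.not_nonempty_iff_eq_empty.1 fun h => h0 ⟨i, h⟩))
    rw [this]
    exact hc M ℓ o hf

end GraphFunctional

/-! ### Isomorphisms and orientations -/

namespace RibbonData

variable {R S : RibbonData}

theorem Iso.map_vertexOf (φ : R.Iso S) (h : R.H) :
    φ.mapCell (.vertex (R.vertexOf h)) = .vertex (S.vertexOf (φ.toEquiv h)) := rfl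

theorem Iso.map_half (φ : R.Iso S) (h : R.H) : φ.mapCell (.half h) = .half (φ.toEquiv h) := rfl

theorem Iso.map_edgeOf (φ : R.Iso S) (h : R.H) :
    φ.mapCell (.edge (R.edgeOf h)) = .edge (S.edgeOf (φ.toEquiv h)) := rfl

/-- The inverse isomorphism. -/
def Iso.symm (φ : R.Iso S) : S.Iso R where
  toEquiv := φ.toEquiv.symm
  map_rot h := by rw [Equiv.symm_apply_eq, φ.map_rot, Equiv.apply_symm_apply]
  map_inv h := by rw [Equiv.symm_apply_eq, φ.map_inv, Equiv.apply_symm_apply]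

theorem Iso.mapCell_symm (φ : R.Iso S) (c : R.Cell) : φ.symm.mapCell (φ.mapCell c) = c := by
  rcases c with v | h | e
  · induction v using Quot.ind with
    | _ h =>
      exact congrArg (fun h => Cell.vertex (R.vertexOf h)) (φ.toEquiv.symm_apply_apply h)
  · exact congrArg Cell.half (φ.toEquiv.symm_apply_apply h)
  · induction e using Quot.ind with
    | _ h =>
      exact congrArg (fun h => Cell.edge (R.edgeOf h)) (φ.toEquiv.symm_apply_apply h)

theorem Iso.mapCell_symm' (φ : R.Iso S) (c : S.Cell) : φ.mapCell (φ.symm.mapCell c) = c :=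
  φ.symm.mapCell_symm c

theorem Iso.mapCell_injective (φ : R.Iso S) : Function.Injective φ.mapCell :=
  Function.LeftInverse.injective φ.mapCell_symm

theorem Iso.isRibbonGraph (φ : R.Iso S) (h : R.IsRibbonGraph) : S.IsRibbonGraph where
  nonempty := h.nonempty.map φ.toEquiv
  rot_bijective := by
    have : S.rot = φ.toEquiv ∘ R.rot ∘ φ.toEquiv.symm := by
      funext x; simp [φ.map_rot]
    rw [this]
    exact φ.toEquiv.bijective.comp (h.rot_bijective.comp φ.toEquiv.symm.bijective)
  inv_inv x := by
    obtain ⟨x, rfl⟩ := φ.toEquiv.surjective x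
    rw [← φ.map_inv, ← φ.map_inv, h.inv_inv]
  inv_ne x := by
    obtain ⟨x, rfl⟩ := φ.toEquiv.surjective x
    rw [← φ.map_inv]
    exact fun e => h.inv_ne x (φ.toEquiv.injective e)
  valency x := by
    obtain ⟨x, rfl⟩ := φ.toEquiv.surjective x
    rw [← φ.map_rot, ← φ.map_rot]
    exact ⟨fun e => (h.valency x).1 (φ.toEquiv.injective e),
      fun e => (h.valency x).2 (φ.toEquiv.injective e)⟩
  connected x y := by
    obtain ⟨x, rfl⟩ := φ.toEquiv.surjective x
    obtain ⟨y, rfl⟩ := φ.toEquiv.surjective y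
    refine Relation.ReflTransGen.lift φ.toEquiv ?_ x y (h.connected x y)
    rintro a b (rfl | rfl)
    · exact Or.inl (φ.map_rot a).symm
    · exact Or.inr (φ.map_inv a).symm

theorem Iso.inOrientation (φ : R.Iso S) (ε : ZMod 2) (c : R.Cell) :
    (φ.mapCell c).InOrientation ε ↔ c.InOrientation ε := by
  rcases c with v | h | e <;> rfl

theorem Iso.isOrientation (φ : R.Iso S) {ε : ZMod 2} {l : List R.Cell} (h : R.IsOrientation ε l) :
    S.IsOrientation ε (l.map φ.mapCell) := by
  refine ⟨h.1.map φ.mapCell_injective, fun c => ?_⟩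
  rw [mem_map]
  constructor
  · rintro ⟨a, ha, rfl⟩
    exact (φ.inOrientation ε a).2 ((h.2 a).1 ha)
  · intro hc
    refine ⟨φ.symm.mapCell c, (h.2 _).2 ((φ.symm.inOrientation ε c).2 hc), φ.mapCell_symm' c⟩

theorem IsOrientation.perm {ε : ZMod 2} {l l' : List R.Cell} (h : R.IsOrientation ε l)
    (h' : l.Perm l') : R.IsOrientation ε l' :=
  ⟨h'.nodup_iff.1 h.1, fun c => h'.mem_iff.symm.trans (h.2 c)⟩

end RibbonData

section GraphClass

variable (K : Type u) [Field K] (ε : ZMod 2) {R S : RibbonData}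

theorem graphClass_iso (φ : R.Iso S) (l : List R.Cell) :
    graphClass K ε R l = graphClass K ε S (l.map φ.mapCell) := by
  have hiff : (R.IsRibbonGraph ∧ R.IsOrientation ε l) ↔
      (S.IsRibbonGraph ∧ S.IsOrientation ε (l.map φ.mapCell)) := by
    constructor
    · exact fun h => ⟨φ.isRibbonGraph h.1, φ.isOrientation h.2⟩
    · intro h
      refine ⟨φ.symm.isRibbonGraph h.1, ?_⟩
      have := φ.symm.isOrientation h.2
      simpa [map_map, Function.comp_def, φ.mapCell_symm] using this
  unfold graphClass
  by_cases h : R.IsRibbonGraph ∧ R.IsOrientation ε l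
  · rw [dif_pos h, dif_pos (hiff.1 h)]
    refine (Submodule.Quotient.eq _).2 (Submodule.subset_span ?_)
    exact GraphRelation.iso _ _ φ rfl
  · rw [dif_neg h, dif_neg fun h' => h (hiff.2 h')]

theorem graphClass_swap (l₁ l₂ : List R.Cell) (a b : R.Cell) :
    graphClass K ε R (l₁ ++ a :: b :: l₂) = - graphClass K ε R (l₁ ++ b :: a :: l₂) := by
  have hp : (l₁ ++ a :: b :: l₂).Perm (l₁ ++ b :: a :: l₂) :=
    (List.Perm.swap b a l₂).append_left l₁
  unfold graphClass
  by_cases h : R.IsRibbonGraph ∧ R.IsOrientation ε (l₁ ++ a :: b :: l₂)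
  · have h' := h.2.perm hp
    rw [dif_pos h, dif_pos ⟨h.1, h'⟩, eq_neg_iff_add_eq_zero]
    refine (Submodule.Quotient.mk_eq_zero _).2 (Submodule.subset_span ?_)
    exact GraphRelation.swap R h.1 l₁ l₂ a b h.2 h'
  · rw [dif_neg h, dif_neg fun h' => h ⟨h'.1, h'.2.perm hp.symm⟩, neg_zero]

theorem graphClass_eq_zero {l : List R.Cell} (h : ¬l.Nodup) : graphClass K ε R l = 0 :=
  dif_neg fun h' => h h'.2.1

theorem graphClass_perm {l l' : List R.Cell} (h : l.Perm l') :
    graphClass K ε R l =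
      msign K (wordSign (fun _ => 1) l + wordSign (fun _ => 1) l') • graphClass K ε R l' := by
  by_cases hn : l.Nodup
  · refine eq_msign_smul_of_perm (fun _ => 1) _ hn (fun l₁ x y l₂ _ => ?_) h
    rw [graphClass_swap]; simp
  · rw [graphClass_eq_zero K ε hn, graphClass_eq_zero K ε fun h' => hn (h.nodup_iff.2 h'),
      smul_zero]

theorem graphClass_swap_word (a b u v : List R.Cell) :
    graphClass K ε R (a ++ u ++ v ++ b) =
      msign K ((u.length : ZMod 2) * (v.length : ZMod 2)) •
        graphClass K ε R (a ++ v ++ u ++ b) := by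
  have hp : (a ++ u ++ v ++ b).Perm (a ++ v ++ u ++ b) := by
    simp only [append_assoc]
    refine List.Perm.append_left a ?_
    simp only [← append_assoc]
    exact List.Perm.append_right b List.perm_append_comm
  by_cases hn : (a ++ u ++ v ++ b).Nodup
  · have hd : u.Disjoint v := by
      have h1 := (List.nodup_append.1 hn).1
      rw [append_assoc] at h1
      exact List.disjoint_of_nodup_append (List.nodup_append.1 h1).2.1
    rw [graphClass_perm K ε hp, wordSign_swap_word _ a b hd]
    congr 2
    simp only [map_const', sum_replicate, nsmul_eq_mul, mul_one]
    linear_combination zmod2_add_self (wordSign (fun _ => 1) (a ++ v ++ u ++ b))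
  · rw [graphClass_eq_zero K ε hn, graphClass_eq_zero K ε fun h' => hn (hp.nodup_iff.2 h'),
      smul_zero]

theorem graphClass_transpose (a m b : List R.Cell) (x y : R.Cell) :
    graphClass K ε R (a ++ x :: (m ++ y :: b)) = - graphClass K ε R (a ++ y :: (m ++ x :: b)) := by
  have h1 := graphClass_swap_word K ε a b [x] (m ++ [y])
  have h2 := graphClass_swap_word K ε a (x :: b) m [y]
  simp only [append_assoc, cons_append, nil_append, length_append, length_singleton] at h1 h2
  rw [h1, h2, smul_smul, ← msign_add]
  have : (((1 : ℕ) : ZMod 2) * ((m.length + 1 : ℕ) : ZMod 2) + (m.length : ZMod 2) * ((1 : ℕ) : ZMod 2))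
      = 1 := by
    push_cast
    linear_combination zmod2_add_self (m.length : ZMod 2)
  rw [this, msign_one, neg_one_smul]

/-- Rearranging blocks of odd length. -/
theorem graphClass_flatMap_perm {α : Type*} (blk : α → List R.Cell)
    (hblk : ∀ x, ((blk x).length : ZMod 2) = 1) (a b : List R.Cell) {l l' : List α}
    (hn : l.Nodup) (h : l.Perm l') :
    graphClass K ε R (a ++ l.flatMap blk ++ b) =
      msign K (wordSign (fun _ => 1) l + wordSign (fun _ => 1) l') •
        graphClass K ε R (a ++ l'.flatMap blk ++ b) := by
  refine eq_msign_smul_of_perm (fun _ => 1) (fun l => graphClass K ε R (a ++ l.flatMap blk ++ b))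
    hn (fun l₁ x y l₂ _ => ?_) h
  have := graphClass_swap_word K ε (a ++ l₁.flatMap blk) (l₂.flatMap blk ++ b) (blk x) (blk y)
  rw [hblk, hblk] at this
  simpa [append_assoc] using this

end GraphClass

/-! ### Half-edges of trees -/

namespace TreeHalf

variable {n : ℕ} {T : PlanarTree n}

theorem start_inl (j : Fin (n + 1)) : start (T := T) (.inl j) = j := rfl

theorem start_true (f : T.Edge) :
    start (T := T) (.inr (f, true)) = f.1.lo := rfl

theorem start_false (f : T.Edge) :
    start (T := T) (.inr (f, false)) = if f.1.hi = n then 0 else f.1.hi + 1 := by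
  have h := T.proper f.1 f.2
  simp only [Interval.Proper] at h
  change (f.1.hi + 1) % (n + 1) = _
  split_ifs with h'
  · rw [h', Nat.mod_self]
  · rw [Nat.mod_eq_of_lt]; omega

theorem length_inl (j : Fin (n + 1)) : length (T := T) (.inl j) = 1 := rfl

theorem length_true (f : T.Edge) :
    length (T := T) (.inr (f, true)) = f.1.hi + 1 - f.1.lo := rfl

theorem length_false (f : T.Edge) :
    length (T := T) (.inr (f, false)) = n + f.1.lo - f.1.hi := rfl

theorem start_le (x : TreeHalf T) : x.start ≤ n := by
  rcases x with j | ⟨f, _ | _⟩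
  · exact Nat.lt_succ_iff.1 j.2
  · exact Nat.lt_succ_iff.1 (Nat.mod_lt _ (Nat.succ_pos n))
  · have h := T.proper f.1 f.2
    simp only [Interval.Proper] at h
    rw [start_true]; omega

theorem length_pos (x : TreeHalf T) : 1 ≤ x.length := by
  rcases x with j | ⟨f, _ | _⟩
  · exact le_rfl
  all_goals
    have h := T.proper f.1 f.2
    simp only [Interval.Proper] at h
  · rw [length_false]; omega
  · rw [length_true]; omega

theorem length_lt (hn : 2 ≤ n) (x : TreeHalf T) : x.length < n := by
  rcases x with j | ⟨f, _ | _⟩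
  · rw [length_inl]; omega
  all_goals
    have h := T.proper f.1 f.2
    simp only [Interval.Proper] at h
  · rw [length_false]; omega
  · rw [length_true]; omega

theorem ext_of_start_length {x y : TreeHalf T} (h1 : x.start = y.start)
    (h2 : x.length = y.length) : x = y := by
  rcases x with j | ⟨f, _ | _⟩ <;> rcases y with k | ⟨g, _ | _⟩
  · exact congrArg Sum.inl (Fin.ext h1)
  · have hg := T.proper g.1 g.2
    simp only [Interval.Proper, length_inl, length_false] at *
    omega
  · have hg := T.proper g.1 g.2
    simp only [Interval.Proper, length_inl, length_true] at *
    omega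
  · have hf := T.proper f.1 f.2
    simp only [Interval.Proper, length_inl, length_false] at *
    omega
  · have hf := T.proper f.1 f.2
    have hg := T.proper g.1 g.2
    simp only [Interval.Proper, start_false, length_false] at *
    have : f = g := by
      refine Subtype.ext (Interval.ext' ?_ ?_)
      · split_ifs at h1 <;> omega
      · split_ifs at h1 <;> omega
    rw [this]
  · have hf := T.proper f.1 f.2
    have hg := T.proper g.1 g.2
    simp only [Interval.Proper, start_false, start_true, length_false, length_true] at *
    split_ifs at h1 <;> omega
  · have hf := T.proper f.1 f.2
    simp only [Interval.Proper, length_inl, length_true] at *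
    omega
  · have hf := T.proper f.1 f.2
    have hg := T.proper g.1 g.2
    simp only [Interval.Proper, start_false, start_true, length_false, length_true] at *
    split_ifs at h1 <;> omega
  · have hf := T.proper f.1 f.2
    have hg := T.proper g.1 g.2
    simp only [Interval.Proper, start_true, length_true] at *
    have : f = g := Subtype.ext (Interval.ext' (by omega) (by omega))
    rw [this]

theorem follows_iff (hn : 2 ≤ n) (x y : TreeHalf T) : x.Follows y ↔
    (y.start = x.start + x.length ∨ y.start + (n + 1) = x.start + x.length) ∧
      x.length + y.length < n + 1 := by
  have h1 := x.start_le
  have h2 := x.length_lt hn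
  have h3 := y.start_le
  unfold Follows
  refine and_congr_left fun _ => ?_
  by_cases h : x.start + x.length < n + 1
  · rw [Nat.mod_eq_of_lt h]; omega
  · rw [Nat.mod_eq_sub_mod (by omega), Nat.mod_eq_of_lt (by omega)]; omega

theorem next_eq {x y : TreeHalf T} (h1 : x.Follows y)
    (h2 : ∀ z : TreeHalf T, x.Follows z → z.length ≤ y.length) : x.next = y := by
  have h : ∃ y : TreeHalf T, x.Follows y ∧ ∀ z : TreeHalf T, x.Follows z → z.length ≤ y.length :=
    ⟨y, h1, h2⟩
  unfold next
  rw [dif_pos h]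
  obtain ⟨h3, h4⟩ := h.choose_spec
  exact ext_of_start_length (h3.1.trans h1.1.symm) (le_antisymm (h2 _ h3) (h4 _ h1))

theorem next_spec (hn : 2 ≤ n) (x : TreeHalf T) :
    x.Follows x.next ∧ ∀ z : TreeHalf T, x.Follows z → z.length ≤ x.next.length := by
  classical
  have hx : x.Follows (.inl ⟨(x.start + x.length) % (n + 1), Nat.mod_lt _ (Nat.succ_pos n)⟩) := by
    refine ⟨rfl, ?_⟩
    have := x.length_lt hn
    rw [length_inl]; omega
  obtain ⟨y, hy, hy'⟩ := Finset.exists_max_image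
    (Finset.univ.filter fun y : TreeHalf T => x.Follows y) length
    ⟨_, Finset.mem_filter.2 ⟨mem_univ _, hx⟩⟩
  have h1 : x.Follows y := (Finset.mem_filter.1 hy).2
  have h2 : ∀ z : TreeHalf T, x.Follows z → z.length ≤ y.length := fun z hz =>
    hy' z (Finset.mem_filter.2 ⟨mem_univ _, hz⟩)
  rw [next_eq h1 h2]
  exact ⟨h1, h2⟩

end TreeHalf

namespace Marking

variable {R S : RibbonData} {ι ι' ι₀ : Type}

/-! ### Replacing the vertices of a marked graph by trees -/

section Expand

variable [Fintype ι] [Fintype ι'] [Fintype ι₀] (M : Marking R ι) (T : ∀ i, PlanarTree (M.n i))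

/-- A half-edge of a tree as a half-edge of the graph in which the vertices are replaced by trees. -/
def glue (i : ι) : TreeHalf (T i) → R.H ⊕ Σ i, (T i).Edge × Bool
  | .inl j => .inl (M.e ⟨i, j⟩)
  | .inr p => .inr ⟨i, p⟩

/-- The graph in which the vertices are replaced by trees. -/
abbrev expand : RibbonData where
  H := R.H ⊕ Σ i, (T i).Edge × Bool
  rot
    | .inl h => M.glue T (M.e.symm h).1 (TreeHalf.next (.inl (M.e.symm h).2))
    | .inr p => M.glue T p.1 (TreeHalf.next (.inr p.2))
  inv
    | .inl h => .inl (R.inv h)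
    | .inr p => .inr ⟨p.1, p.2.1, !p.2.2⟩

theorem expand_rot_glue (i : ι) (x : TreeHalf (T i)) :
    (M.expand T).rot (M.glue T i x) = M.glue T i x.next := by
  rcases x with j | p
  · change (fun y : Σ i, Fin (M.n i + 1) => M.glue T y.1 (TreeHalf.next (.inl y.2)))
      (M.e.symm (M.e ⟨i, j⟩)) = _
    rw [Equiv.symm_apply_apply]
  · rfl

theorem exists_glue (h : (M.expand T).H) : ∃ i x, h = M.glue T i x := by
  rcases h with h | ⟨i, p⟩
  · obtain ⟨⟨i, j⟩, rfl⟩ := M.e.surjective h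
    exact ⟨i, .inl j, rfl⟩
  · exact ⟨i, .inr p, rfl⟩

variable {M T}

/-- An isomorphism from a graph with trees for vertices, given by a map of half-edges. -/
def expandIso {S : RibbonData} (θ : (M.expand T).H ≃ S.H)
    (hrot : ∀ i x, θ (M.glue T i x.next) = S.rot (θ (M.glue T i x)))
    (hinv : ∀ h, θ ((M.expand T).inv h) = S.inv (θ h)) : (M.expand T).Iso S where
  toEquiv := θ
  map_rot h := by
    obtain ⟨i, x, rfl⟩ := M.exists_glue T h
    rw [expand_rot_glue, hrot]
  map_inv := hinv

variable (M T)

theorem vertexOf_glue_next (i : ι) (x : TreeHalf (T i)) :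
    (M.expand T).vertexOf (M.glue T i x.next) = (M.expand T).vertexOf (M.glue T i x) := by
  refine (Quot.sound ?_).symm
  exact M.expand_rot_glue T i x

/-- The word `v⁻ f⁻ f⁺` of an internal edge of a tree. -/
def edgeTriple (i : ι) (f : (T i).Edge) : List (M.expand T).Cell :=
  [.vertex ((M.expand T).vertexOf (.inr ⟨i, f, false⟩)), .half (.inr ⟨i, f, false⟩),
    .half (.inr ⟨i, f, true⟩)]

/-- The part of the orientation which belongs to the internal edges of a tree. -/
def treeBlock (ε : ZMod 2) (i : ι) : List (M.expand T).Cell :=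
  if ε = 0 then (T i).edgeList.flatMap (M.edgeTriple T i)
  else (T i).edgeList.map fun f => .edge ((M.expand T).edgeOf (.inr ⟨i, f, true⟩))

/-- The word `v e₀ … e_n` of a vertex, in the graph with trees for vertices. -/
def rootBlock (i : ι) : List (M.expand T).Cell :=
  .vertex ((M.expand T).vertexOf (.inl (M.e ⟨i, 0⟩))) ::
    (finRange (M.n i + 1)).map fun j => .half (.inl (M.e ⟨i, j⟩))

/-- The part of the orientation which belongs to the original graph. -/
def baseBlock (ε : ZMod 2) (ℓ : List ι) (o : List R.H) : List (M.expand T).Cell :=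
  if ε = 0 then ℓ.flatMap (M.rootBlock T) else o.map fun h => .edge ((M.expand T).edgeOf (.inl h))

/-- The element of the graph complex given by trees at the vertices of a marked graph. -/
def graphElement (K : Type u) [Field K] (ε : ZMod 2) (ℓ : List ι) (o : List R.H) :
    GraphComplex K ε :=
  msign K (∑ i, (M.n i : ZMod 2) +
      pairSum (fun i j => (M.n i : ZMod 2) * ((T j).edges.card : ZMod 2)) ℓ) •
    graphClass K ε (M.expand T) (ℓ.flatMap (M.treeBlock T ε) ++ M.baseBlock T ε ℓ o)

theorem length_edgeList (i : ι) : (T i).edgeList.length = (T i).edges.card := by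
  simp [PlanarTree.edgeList]

theorem length_treeBlock (ε : ZMod 2) (i : ι) :
    ((M.treeBlock T ε i).length : ZMod 2) = ((T i).edges.card : ZMod 2) := by
  unfold treeBlock
  split_ifs
  · rw [List.length_flatMap]
    simp [edgeTriple, length_edgeList, show (3 : ZMod 2) = 1 from rfl]
  · rw [length_map, length_edgeList]

theorem length_rootBlock (i : ι) : ((M.rootBlock T i).length : ZMod 2) = (M.n i : ZMod 2) := by
  simp only [rootBlock, length_cons, length_map, length_finRange]
  push_cast
  linear_combination zmod2_add_self 1

theorem natCast_sub_two_sub {a b : ℕ} : (((a : ℤ) - 2 - b : ℤ) : ZMod 2) = (a : ZMod 2) + b := by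
  push_cast
  linear_combination zmod2_neg (b : ZMod 2) - zmod2_add_self (1 : ZMod 2)

end Expand

end Marking

theorem PlanarTree.degree_two {n : ℕ} (T : PlanarTree n) :
    T.degree 2 = (n : ZMod 2) + T.edges.card := Marking.natCast_sub_two_sub

namespace Marking

variable {R S : RibbonData} {ι ι' ι₀ : Type} [Fintype ι] [Fintype ι'] [Fintype ι₀]
  (K : Type u) [Field K] (ε : ZMod 2)

theorem graphElement_reindex (M : Marking R ι) (σ : ι' ≃ ι) (ℓ : List ι') (o : List R.H)
    (T : ∀ i, PlanarTree (M.n i)) :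
    (M.reindex σ).graphElement (fun i => T (σ i)) K ε ℓ o = M.graphElement T K ε (ℓ.map σ) o := by
  let φ : ((M.reindex σ).expand fun i => T (σ i)).Iso (M.expand T) := expandIso
    (Equiv.sumCongr (Equiv.refl R.H)
      (Equiv.sigmaCongrLeft (β := fun i => (T i).Edge × Bool) σ))
    (by
      have key : ∀ i x, Equiv.sumCongr (Equiv.refl R.H)
          (Equiv.sigmaCongrLeft (β := fun i => (T i).Edge × Bool) σ)
          ((M.reindex σ).glue (fun i => T (σ i)) i x) = M.glue T (σ i) x := by
        rintro i (j | p) <;> rfl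
      intro i x
      exact (key i _).trans ((M.expand_rot_glue T (σ i) x).symm.trans
        (congrArg (M.expand T).rot (key i x).symm)))
    (by rintro (h | ⟨i, f, s⟩) <;> rfl)
  unfold graphElement
  rw [graphClass_iso K ε φ]
  congr 2
  · congr 1
    · exact σ.sum_comp fun i => (M.n i : ZMod 2)
    · rw [pairSum_map]; rfl
  · rw [map_append, map_flatMap, flatMap_map]
    congr 1
    · congr 1
      funext i
      unfold treeBlock
      split_ifs
      · rw [map_flatMap]; rfl
      · rw [map_map]; rfl
    · unfold baseBlock
      split_ifs
      · rw [map_flatMap, flatMap_map]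
        congr 1
        funext i
        unfold rootBlock
        rw [map_cons, map_map]
        rfl
      · rw [map_map]; rfl

theorem graphElement_transport (M : Marking R ι) (φ : R.Iso S) (ℓ : List ι) (o : List R.H)
    (T : ∀ i, PlanarTree (M.n i)) :
    (M.transport φ).graphElement T K ε ℓ (o.map φ.toEquiv) = M.graphElement T K ε ℓ o := by
  let ψ : (M.expand T).Iso ((M.transport φ).expand T) := expandIso
    (Equiv.sumCongr φ.toEquiv (Equiv.refl _))
    (by
      have key : ∀ i x, Equiv.sumCongr φ.toEquiv
          (Equiv.refl (Σ i, (T i).Edge × Bool)) (M.glue T i x) =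
            (M.transport φ).glue T i x := by
        rintro i (j | p) <;> rfl
      intro i x
      exact (key i _).trans (((M.transport φ).expand_rot_glue T i x).symm.trans
        (congrArg ((M.transport φ).expand T).rot (key i x).symm)))
    (by
      rintro (h | ⟨i, f, s⟩)
      · exact congrArg Sum.inl (φ.map_inv h)
      · rfl)
  unfold graphElement
  rw [graphClass_iso K ε ψ]
  congr 2
  rw [map_append, map_flatMap]
  congr 1
  · congr 1
    funext i
    unfold treeBlock
    split_ifs
    · rw [map_flatMap]; rfl
    · rw [map_map]; rfl
  · unfold baseBlock
    split_ifs
    · rw [map_flatMap]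
      congr 1
      funext i
      unfold rootBlock
      rw [map_cons, map_map]
      rfl
    · rw [map_map, map_map]; rfl

theorem graphElement_swap_vertices (M : Marking R ι) (l₁ l₂ : List ι) (x y : ι) (o : List R.H)
    (T : ∀ i, PlanarTree (M.n i)) :
    M.graphElement T K ε (l₁ ++ x :: y :: l₂) o =
      msign K ((T x).degree 2 * (T y).degree 2 + ε * ((M.n x : ZMod 2) * (M.n y : ZMod 2))) •
        M.graphElement T K ε (l₁ ++ y :: x :: l₂) o := by
  unfold graphElement
  rw [pairSum_swap, PlanarTree.degree_two, PlanarTree.degree_two]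
  have h1 := graphClass_swap_word K ε (l₁.flatMap (M.treeBlock T ε))
    (l₂.flatMap (M.treeBlock T ε) ++ M.baseBlock T ε (l₁ ++ x :: y :: l₂) o)
    (M.treeBlock T ε x) (M.treeBlock T ε y)
  rw [length_treeBlock, length_treeBlock] at h1
  simp only [flatMap_append, flatMap_cons, append_assoc] at h1 ⊢
  rw [h1]
  rcases zmod2_cases ε with rfl | rfl
  · have h2 := graphClass_swap_word K 0 (l₁.flatMap (M.treeBlock T 0) ++ (M.treeBlock T 0 y ++
        (M.treeBlock T 0 x ++ l₂.flatMap (M.treeBlock T 0))) ++ l₁.flatMap (M.rootBlock T))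
      (l₂.flatMap (M.rootBlock T)) (M.rootBlock T x) (M.rootBlock T y)
    rw [length_rootBlock, length_rootBlock] at h2
    simp only [baseBlock, if_true, flatMap_append, flatMap_cons, append_assoc]
      at h2 ⊢
    rw [h2, smul_smul, smul_smul, smul_smul, ← msign_add, ← msign_add, ← msign_add]
    congr 2
    ring
  · simp only [baseBlock, one_ne_zero, if_false]
    rw [smul_smul, smul_smul, ← msign_add, ← msign_add]
    congr 2
    linear_combination (-1 : ZMod 2) * zmod2_add_self ((M.n x : ZMod 2) * (M.n y : ZMod 2))

theorem graphElement_swap_edges (M : Marking R ι) (ℓ : List ι) (o₁ o₂ : List R.H) (x y : R.H)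
    (T : ∀ i, PlanarTree (M.n i)) :
    M.graphElement T K ε ℓ (o₁ ++ x :: y :: o₂) =
      msign K ε • M.graphElement T K ε ℓ (o₁ ++ y :: x :: o₂) := by
  unfold graphElement
  rcases zmod2_cases ε with rfl | rfl
  · simp [baseBlock]
  · simp only [baseBlock, one_ne_zero, if_false, map_append, map_cons]
    rw [← append_assoc, graphClass_swap, smul_comm]
    simp [append_assoc]

theorem graphElement_flip_edge (M : Marking R ι) (ℓ : List ι) (o₁ o₂ : List R.H) (x : R.H)
    (T : ∀ i, PlanarTree (M.n i)) :
    M.graphElement T K ε ℓ (o₁ ++ x :: o₂) = M.graphElement T K ε ℓ (o₁ ++ R.inv x :: o₂) := by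
  have : (M.expand T).edgeOf (.inl x) = (M.expand T).edgeOf (.inl (R.inv x)) := Quot.sound rfl
  unfold graphElement baseBlock
  simp only [map_append, map_cons, this]

theorem edgeList_nodup {n : ℕ} (T : PlanarTree n) : T.edgeList.Nodup := Finset.sort_nodup _ _

theorem mem_edgeList {n : ℕ} (T : PlanarTree n) (f : T.Edge) :
    f ∈ T.edgeList := (Finset.mem_sort _).2 (mem_univ f)

theorem inversions_map {α β γ : Type*} [LinearOrder γ] (w : β → ZMod 2) (pos : β → γ) (f : α → β)
    (l : List α) :
    inversions w pos (l.map f) = inversions (fun x => w (f x)) (fun x => pos (f x)) l := by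
  induction l with
  | nil => rfl
  | cons a l ih =>
    simp only [map_cons, inversions, ih, List.filter_map, map_map]
    rfl

/-- The sign by which an ordering of the internal edges of a tree differs from the standard one. -/
theorem inversions_edges {n : ℕ} (T : PlanarTree n) (l : List T.Edge)
    (hn : l.Nodup) (hl : ∀ f, f ∈ l) :
    inversions (fun _ => 1) id (l.map Subtype.val) =
      wordSign (fun _ => 1) l + wordSign (fun _ => 1) T.edgeList := by
  have hp : l.Perm T.edgeList := (perm_ext_iff_of_nodup hn (edgeList_nodup T)).2 fun f =>
    ⟨fun _ => mem_edgeList T f, fun _ => hl f⟩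
  have h := inversions_add_wordSign_eq (fun _ => 1) (fun f : T.Edge => f.1)
    hn hp fun _ _ _ _ h => Subtype.ext h
  have h0 : inversions (fun _ => 1) (fun f : T.Edge => f.1)
      T.edgeList = 0 := by
    refine inversions_eq_zero_of_sorted _ _ _ ?_
    exact (Finset.sortedLT_sort _).pairwise
  rw [inversions_map]
  change inversions (fun _ => 1) (fun f : T.Edge => f.1) l = _
  rw [h0] at h
  linear_combination h - zmod2_add_self (wordSign (fun _ => 1) l)

end Marking

/-! ### Rotation of trees -/

section RotateHalf

variable {n : ℕ} (t : PlanarTree n)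

theorem rotateEdge_injOn : Set.InjOn (rotateEdge n) {e | e.Proper n} := by
  intro e he f hf h
  simp only [Set.mem_ofPred_eq, Interval.Proper] at he hf
  have h1 := congrArg Interval.lo h
  have h2 := congrArg Interval.hi h
  simp only [rotateEdge] at h1 h2
  refine Interval.ext' ?_ ?_ <;> split_ifs at h1 h2 <;>
    simp only [Interval.mk_lo, Interval.mk_hi] at h1 h2 <;> omega

/-- The internal edges of the rotated tree. -/
def rotateEdgeSub (f : t.Edge) : t.rotate.Edge :=
  ⟨rotateEdge n f.1, Finset.mem_image_of_mem _ f.2⟩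

theorem rotateEdgeSub_injective : Function.Injective (rotateEdgeSub t) := by
  intro f g h
  exact Subtype.ext (rotateEdge_injOn (t.proper _ f.2) (t.proper _ g.2) (congrArg Subtype.val h))

theorem rotateEdgeSub_surjective : Function.Surjective (rotateEdgeSub t) := by
  rintro ⟨e, he⟩
  obtain ⟨f, hf, rfl⟩ := Finset.mem_image.1 he
  exact ⟨⟨f, hf⟩, rfl⟩

theorem card_rotate : t.rotate.edges.card = t.edges.card :=
  Finset.card_image_of_injOn fun _ he _ hf h => rotateEdge_injOn (t.proper _ he) (t.proper _ hf) h

/-- The half-edges of the internal edges of the rotated tree. -/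
def rotatePair (p : t.Edge × Bool) :
    t.rotate.Edge × Bool :=
  (rotateEdgeSub t p.1, if p.1.1.hi = n then !p.2 else p.2)

theorem rotatePair_bijective : Function.Bijective (rotatePair t) := by
  constructor
  · rintro ⟨f, s⟩ ⟨g, s'⟩ h
    have h1 := rotateEdgeSub_injective t (congrArg Prod.fst h)
    dsimp only at h1
    subst h1
    have h2 := congrArg Prod.snd h
    simp only [rotatePair] at h2
    split_ifs at h2 <;> simp_all
  · rintro ⟨f, s⟩
    obtain ⟨g, rfl⟩ := rotateEdgeSub_surjective t f
    refine ⟨(g, if g.1.hi = n then !s else s), ?_⟩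
    simp only [rotatePair]
    split_ifs <;> simp

/-- The half-edges of the rotated tree. -/
def rotateHalf : TreeHalf t → TreeHalf t.rotate
  | .inl j => .inl (j + 1)
  | .inr p => .inr (rotatePair t p)

theorem rotateHalf_surjective : Function.Surjective (rotateHalf t) := by
  rintro (j | p)
  · exact ⟨.inl (j - 1), congrArg Sum.inl (sub_add_cancel j 1)⟩
  · obtain ⟨q, rfl⟩ := (rotatePair_bijective t).2 p
    exact ⟨.inr q, rfl⟩

theorem rotateHalf_start_length (hn : 2 ≤ n) (x : TreeHalf t) :
    (rotateHalf t x).start = (if x.start = n then 0 else x.start + 1) ∧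
      (rotateHalf t x).length = x.length := by
  rcases x with j | ⟨f, s⟩
  · refine ⟨?_, rfl⟩
    change (j + 1 : Fin (n + 1)).1 = if j.1 = n then 0 else j.1 + 1
    rw [Fin.val_add_one]
    simp only [Fin.ext_iff, Fin.val_last]
  · have hf := t.proper f.1 f.2
    simp only [Interval.Proper] at hf
    have hlo : (rotateEdgeSub t f).1.lo = if f.1.hi = n then 1 else f.1.lo + 1 := by
      change (rotateEdge n f.1).lo = _
      unfold rotateEdge; split_ifs <;> rfl
    have hhi : (rotateEdgeSub t f).1.hi = if f.1.hi = n then f.1.lo else f.1.hi + 1 := by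
      change (rotateEdge n f.1).hi = _
      unfold rotateEdge; split_ifs <;> rfl
    simp only [rotateHalf, rotatePair]
    cases s <;> by_cases h : f.1.hi = n <;>
      simp only [h, if_true, if_false, Bool.not_true, Bool.not_false, TreeHalf.start_true,
        TreeHalf.start_false, TreeHalf.length_true, TreeHalf.length_false, hlo, hhi] <;>
      grind

theorem rotateHalf_next (hn : 2 ≤ n) (x : TreeHalf t) :
    rotateHalf t x.next = (rotateHalf t x).next := by
  have hfol : ∀ y z : TreeHalf t, (rotateHalf t y).Follows (rotateHalf t z) ↔ y.Follows z := by
    intro y z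
    have h1 := y.start_le
    have h2 := z.start_le
    have h3 := y.length_lt hn
    rw [TreeHalf.follows_iff hn, TreeHalf.follows_iff hn, (rotateHalf_start_length t hn y).1,
      (rotateHalf_start_length t hn y).2, (rotateHalf_start_length t hn z).1,
      (rotateHalf_start_length t hn z).2]
    split_ifs <;> omega
  obtain ⟨h1, h2⟩ := TreeHalf.next_spec hn x
  refine (TreeHalf.next_eq ((hfol _ _).2 h1) fun z hz => ?_).symm
  obtain ⟨z, rfl⟩ := rotateHalf_surjective t z
  rw [(rotateHalf_start_length t hn _).2, (rotateHalf_start_length t hn _).2]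
  exact h2 z ((hfol _ _).1 hz)

end RotateHalf

namespace Marking

variable {R S : RibbonData} {ι ι₀ : Type} [Fintype ι] [Fintype ι₀]

section Chain

variable (M : Marking R ι) (T : ∀ i, PlanarTree (M.n i)) (i : ι)

/-- The edges of the list `c` lead from the vertex `v` to the vertex `u`. -/
def Linked : (M.expand T).Vertex → List (T i).Edge →
    (M.expand T).Vertex → Prop
  | v, [], u => v = u
  | v, f :: c, u => v = (M.expand T).vertexOf (.inr ⟨i, f, true⟩) ∧
      Linked ((M.expand T).vertexOf (.inr ⟨i, f, false⟩)) c u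

/-- The word `v⁺ f⁺ f⁻` of an internal edge of a tree. -/
def edgeTripleFlip (f : (T i).Edge) : List (M.expand T).Cell :=
  [.vertex ((M.expand T).vertexOf (.inr ⟨i, f, true⟩)), .half (.inr ⟨i, f, true⟩),
    .half (.inr ⟨i, f, false⟩)]

theorem graphClass_linked (K : Type u) [Field K] (ε : ZMod 2) (mid b : List (M.expand T).Cell)
    (u : (M.expand T).Vertex) (c : List (T i).Edge) :
    ∀ (v : (M.expand T).Vertex) (a : List (M.expand T).Cell), M.Linked T i v c u →
      graphClass K ε (M.expand T) (a ++ c.flatMap (M.edgeTriple T i) ++ mid ++ .vertex v :: b) =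
        graphClass K ε (M.expand T)
          (a ++ c.flatMap (M.edgeTripleFlip T i) ++ mid ++ .vertex u :: b) := by
  induction c with
  | nil =>
    rintro v a rfl
    rfl
  | cons f c ih =>
    rintro v a ⟨rfl, h⟩
    have h1 := ih _ (a ++ M.edgeTripleFlip T i f) h
    simp only [flatMap_cons, edgeTriple, edgeTripleFlip, append_assoc, cons_append,
      nil_append] at h1 ⊢
    rw [← h1]
    clear h1 ih
    have h2 := graphClass_transpose K ε (R := M.expand T) a
      (.half (.inr ⟨i, f, false⟩) :: .half (.inr ⟨i, f, true⟩) ::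
        (c.flatMap (M.edgeTriple T i) ++ mid)) b
      (.vertex ((M.expand T).vertexOf (.inr ⟨i, f, false⟩)))
      (.vertex ((M.expand T).vertexOf (.inr ⟨i, f, true⟩)))
    have h3 := graphClass_swap K ε (R := M.expand T)
      (a ++ [.vertex ((M.expand T).vertexOf (.inr ⟨i, f, true⟩))])
      (c.flatMap (M.edgeTriple T i) ++
        (mid ++ .vertex ((M.expand T).vertexOf (.inr ⟨i, f, false⟩)) :: b))
      (.half (.inr ⟨i, f, false⟩)) (.half (.inr ⟨i, f, true⟩))
    simp only [append_assoc, cons_append, nil_append] at h2 h3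
    rw [h2, h3, neg_neg]

theorem linked_of_sorted (hn : 2 ≤ M.n i) (c : List (T i).Edge) :
    ∀ z : TreeHalf (T i), z.start = 0 → c.Pairwise (fun f g => f.1.lo < g.1.lo) →
      (∀ f ∈ c, f.1.hi = M.n i) →
      (∀ g : (T i).Edge, g.1.hi = M.n i → (g ∈ c ↔ z.length < g.1.lo)) →
      M.Linked T i ((M.expand T).vertexOf (M.glue T i z)) c
        ((M.expand T).vertexOf (.inl (M.e ⟨i, Fin.last _⟩))) := by
  have hzero : ∀ y : TreeHalf (T i), y.start = 0 → y.length = 1 ∨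
      ∃ g : (T i).Edge, g.1.hi = M.n i ∧ y.length = g.1.lo := by
    rintro (j | ⟨f, _ | _⟩) hy
    · exact Or.inl rfl
    · rw [TreeHalf.start_false] at hy
      split_ifs at hy with h
      exact Or.inr ⟨f, h, by rw [TreeHalf.length_false]; omega⟩
    · have hf := (T i).proper f.1 f.2
      simp only [Interval.Proper, TreeHalf.start_true] at hf hy
      omega
  induction c with
  | nil =>
    intro z hz _ _ h
    have h' : TreeHalf.next (T := T i) (.inl (Fin.last _)) = z := by
      refine TreeHalf.next_eq ((TreeHalf.follows_iff hn _ _).2 ?_) fun y hy => ?_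
      · rw [TreeHalf.start_inl, TreeHalf.length_inl, hz, Fin.val_last]
        have := z.length_lt hn
        omega
      · rw [TreeHalf.follows_iff hn, TreeHalf.start_inl, TreeHalf.length_inl, Fin.val_last] at hy
        have := z.length_pos
        have h2 := y.start_le
        rcases hzero y (by omega) with h1 | ⟨g, hg, h1⟩
        · omega
        · have := h g hg
          simp only [not_mem_nil, false_iff] at this
          omega
    change _ = _
    rw [← h']
    exact M.vertexOf_glue_next T i (.inl (Fin.last _))
  | cons g c ih =>
    intro z hz hc hhi h
    have hgp := (T i).proper g.1 g.2
    have hg := hhi g mem_cons_self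
    have hzg := (h g hg).1 mem_cons_self
    have hc' := List.pairwise_cons.1 hc
    simp only [Interval.Proper] at hgp
    refine ⟨?_, ?_⟩
    · have h' : TreeHalf.next (T := T i) (.inr (g, true)) = z := by
        refine TreeHalf.next_eq ((TreeHalf.follows_iff hn _ _).2 ?_) fun y hy => ?_
        · rw [TreeHalf.start_true, TreeHalf.length_true, hz]
          omega
        · rw [TreeHalf.follows_iff hn, TreeHalf.start_true, TreeHalf.length_true] at hy
          have := z.length_pos
          have h2 := y.start_le
          rcases hzero y (by omega) with h1 | ⟨f, hf, h1⟩
          · omega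
          · by_contra hlt
            have hfc := (h f hf).2 (by omega)
            rcases List.mem_cons.1 hfc with rfl | hfc
            · omega
            · have := hc'.1 f hfc
              omega
      rw [← h']
      exact M.vertexOf_glue_next T i (.inr (g, true))
    · refine ih (.inr (g, false)) ?_ hc'.2 (fun f hf => hhi f (mem_cons_of_mem _ hf)) ?_
      · rw [TreeHalf.start_false, if_pos hg]
      · intro f hf
        rw [TreeHalf.length_false, show M.n i + g.1.lo - g.1.hi = g.1.lo by omega]
        constructor
        · exact fun hfc => hc'.1 f hfc
        · intro hlt
          rcases List.mem_cons.1 ((h f hf).2 (by omega)) with rfl | hfc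
          · omega
          · exact hfc

/-- Passing from the first leg to the last one as the root does not change the orientation. -/
theorem graphClass_reroot (K : Type u) [Field K] (ε : ZMod 2) (hn : 2 ≤ M.n i)
    (mid b : List (M.expand T).Cell) :
    graphClass K ε (M.expand T) ((T i).edgeList.flatMap (M.edgeTriple T i) ++ mid ++
        .vertex ((M.expand T).vertexOf (.inl (M.e ⟨i, 0⟩))) :: b) =
      graphClass K ε (M.expand T) ((T i).edgeList.flatMap (fun f =>
          if f.1.hi = M.n i then M.edgeTripleFlip T i f else M.edgeTriple T i f) ++ mid ++
        .vertex ((M.expand T).vertexOf (.inl (M.e ⟨i, Fin.last _⟩))) :: b) := by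
  classical
  let p : (T i).Edge → Bool := fun f => decide (f.1.hi = M.n i)
  have hperm : (T i).edgeList.Perm
      ((T i).edgeList.filter p ++ (T i).edgeList.filter fun f => !p f) :=
    (List.filter_append_perm p _).symm
  have hc : M.Linked T i ((M.expand T).vertexOf (M.glue T i (.inl 0))) ((T i).edgeList.filter p)
      ((M.expand T).vertexOf (.inl (M.e ⟨i, Fin.last _⟩))) := by
    refine M.linked_of_sorted T i hn _ (.inl 0) rfl ?_ ?_ ?_
    · have hs : (T i).edgeList.Pairwise (· < ·) := (Finset.sortedLT_sort _).pairwise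
      refine List.Pairwise.imp_of_mem ?_ (hs.filter p)
      intro f g hf hg hfg
      have h1 : f.1.hi = M.n i := by simpa [p] using (List.mem_filter.1 hf).2
      have h2 : g.1.hi = M.n i := by simpa [p] using (List.mem_filter.1 hg).2
      rcases (Prod.Lex.lt_iff (x := (f.1 : Interval)) (y := (g.1 : Interval))).1 hfg with h | ⟨_, h⟩
      · exact h
      · change f.1.hi < g.1.hi at h
        omega
    · intro f hf
      simpa [p] using (List.mem_filter.1 hf).2
    · intro g hg
      have := (T i).proper g.1 g.2
      simp only [Interval.Proper] at this
      rw [List.mem_filter, TreeHalf.length_inl]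
      simp only [mem_edgeList, p, hg, decide_true, true_and, true_iff]
      omega
  have h1 := graphClass_flatMap_perm K ε (M.edgeTriple T i) (fun _ => show ((3 : ℕ) : ZMod 2) = 1 from rfl) []
    (mid ++ .vertex ((M.expand T).vertexOf (.inl (M.e ⟨i, 0⟩))) :: b) (edgeList_nodup (T i)) hperm
  have h2 := graphClass_flatMap_perm K ε
    (fun f => if f.1.hi = M.n i then M.edgeTripleFlip T i f else M.edgeTriple T i f)
    (fun f => by split_ifs <;> exact show ((3 : ℕ) : ZMod 2) = 1 from rfl) []
    (mid ++ .vertex ((M.expand T).vertexOf (.inl (M.e ⟨i, Fin.last _⟩))) :: b)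
    (edgeList_nodup (T i)) hperm
  have h3 := M.graphClass_linked T i K ε
    (((T i).edgeList.filter fun f => !p f).flatMap (M.edgeTriple T i) ++ mid) b _ _ _ [] hc
  have e₁ : ((T i).edgeList.filter p).flatMap (fun f =>
      if f.1.hi = M.n i then M.edgeTripleFlip T i f else M.edgeTriple T i f) =
      ((T i).edgeList.filter p).flatMap (M.edgeTripleFlip T i) := by
    refine flatMap_congr fun f hf => ?_
    rw [if_pos (by simpa [p] using (List.mem_filter.1 hf).2)]
  have e₂ : ((T i).edgeList.filter fun f => !p f).flatMap (fun f =>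
      if f.1.hi = M.n i then M.edgeTripleFlip T i f else M.edgeTriple T i f) =
      ((T i).edgeList.filter fun f => !p f).flatMap (M.edgeTriple T i) := by
    refine flatMap_congr fun f hf => ?_
    rw [if_neg (by simpa [p] using (List.mem_filter.1 hf).2)]
  simp only [nil_append, flatMap_append, e₁, e₂, append_assoc] at h1 h2 h3 ⊢
  rw [h1, h2]
  congr 1

end Chain

/-! ### Rotation in the graph complex -/

theorem map_finRange_sub_one {α : Type*} {n : ℕ} (f : Fin (n + 1) → α) :
    (finRange (n + 1)).map (fun j => f (j - 1)) =
      f (Fin.last n) :: (finRange n).map fun j => f j.castSucc := by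
  rw [finRange_succ, map_cons, map_map]
  congr 1
  · rw [sub_eq_iff_eq_add.2 (Fin.last_add_one n).symm]
  · refine map_congr_left fun j _ => ?_
    simp only [Function.comp]
    congr 1
    rw [← Fin.coeSucc_eq_succ, add_sub_cancel_right]

theorem map_finRange_castSucc {α : Type*} {n : ℕ} (f : Fin (n + 1) → α) :
    (finRange (n + 1)).map f = (finRange n).map (fun j => f j.castSucc) ++ [f (Fin.last n)] := by
  rw [List.finRange_succ_last, map_append, map_map]
  rfl

theorem treeBlock_eq_flatMap (M : Marking R ι) (T : ∀ i, PlanarTree (M.n i)) (ε : ZMod 2) (i : ι) :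
    M.treeBlock T ε i = (T i).edgeList.flatMap fun f =>
      if ε = 0 then M.edgeTriple T i f else [.edge ((M.expand T).edgeOf (.inr ⟨i, f, true⟩))] := by
  unfold treeBlock
  split_ifs
  · rfl
  · induction (T i).edgeList with
    | nil => rfl
    | cons a l ih => simp [ih]

theorem graphElement_rotate (K : Type u) [Field K] (ε : ZMod 2) (M : Marking R (Option ι₀))
    (hn : 2 ≤ M.n none) (ℓ₀ : List ι₀) (o : List R.H) (t : PlanarTree (M.n none))
    (T : ∀ i, PlanarTree (M.n (some i))) :
    (M.rotate (optCons 1 fun _ => 0)).graphElement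
        (optTrees M t.rotate T) K ε (none :: ℓ₀.map some) o =
      msign K (t.rotationSign + ε * (M.n none : ZMod 2)) •
        M.graphElement (optTrees M t T) K ε
          (none :: ℓ₀.map some) o := by
  set M' := M.rotate (optCons 1 fun _ => 0) with hM'
  set A : ∀ i, PlanarTree (M.n i) := optTrees M t T with hA
  set A' : ∀ i, PlanarTree (M'.n i) := optTrees M t.rotate T
    with hA'
  have e_none : ∀ j : Fin (M.n none + 1), M'.e ⟨none, j⟩ = M.e ⟨none, j - 1⟩ := fun _ => rfl
  have e_some : ∀ i (j : Fin (M.n (some i) + 1)), M'.e ⟨some i, j⟩ = M.e ⟨some i, j⟩ := fun i j =>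
    congrArg (fun j => M.e ⟨some i, j⟩) (sub_zero j)
  let θ : (M.expand A).H ≃ (M'.expand A').H := Equiv.sumCongr (Equiv.refl R.H)
    (Equiv.sigmaCongrRight fun i => match i with
      | none => Equiv.ofBijective (rotatePair t) (rotatePair_bijective t)
      | some _ => Equiv.refl _)
  have key_none : ∀ x : TreeHalf t,
      θ (M.glue A none x) = M'.glue A' none (rotateHalf t x) := by
    rintro (j | p)
    · refine congrArg Sum.inl ?_
      rw [e_none, add_sub_cancel_right]
      rfl
    · rfl
  have key_some : ∀ i (x : TreeHalf (T i)),
      θ (M.glue A (some i) x) = M'.glue A' (some i) x := by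
    rintro i (j | p)
    · refine congrArg Sum.inl ?_
      rw [e_some]
      rfl
    · rfl
  let φ : (M.expand A).Iso (M'.expand A') := expandIso θ
    (by
      rintro (_ | i) x
      · rw [key_none x]
        refine (key_none x.next).trans
          ((congrArg (M'.glue A' none) (rotateHalf_next t hn x)).trans ?_)
        exact (M'.expand_rot_glue A' none _).symm
      · rw [key_some i x]
        refine (key_some i x.next).trans ?_
        exact (M'.expand_rot_glue A' (some i) _).symm)
    (by
      rintro (h | ⟨_ | i, f, s⟩)
      · rfl
      · have h : rotatePair t (f, !s) = ((rotatePair t (f, s)).1, !(rotatePair t (f, s)).2) := by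
          simp only [rotatePair]
          split_ifs <;> rfl
        exact congrArg (fun q => (Sum.inr ⟨none, q⟩ : (M'.expand A').H)) h
      · rfl)
  have hlist : (t.edgeList.map (rotateEdgeSub t)).Perm t.rotate.edgeList := by
    refine (perm_ext_iff_of_nodup ((edgeList_nodup t).map (rotateEdgeSub_injective t))
      (edgeList_nodup _)).2 fun f => ⟨fun _ => mem_edgeList _ f, fun _ => ?_⟩
    obtain ⟨g, rfl⟩ := rotateEdgeSub_surjective t f
    exact List.mem_map_of_mem (mem_edgeList t g)
  have hrs : t.rotationSign = (M.n none : ZMod 2) + (wordSign (fun _ => 1)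
      (t.edgeList.map (rotateEdgeSub t)) + wordSign (fun _ => 1) t.rotate.edgeList) := by
    rw [← inversions_edges t.rotate _ ((edgeList_nodup t).map (rotateEdgeSub_injective t))
      fun f => hlist.mem_iff.2 (mem_edgeList _ f)]
    unfold PlanarTree.rotationSign PlanarTree.stdOrientation
    rw [map_map, map_map]
    rfl
  have hblk : ∀ f : t.rotate.Edge, (((if ε = 0 then M'.edgeTriple A' none f
      else [.edge ((M'.expand A').edgeOf (.inr ⟨none, f, true⟩))] :
        List (M'.expand A').Cell).length : ℕ) : ZMod 2) = 1 := by
    intro f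
    split_ifs
    · exact show ((3 : ℕ) : ZMod 2) = 1 from rfl
    · exact show ((1 : ℕ) : ZMod 2) = 1 from rfl
  have hsort := graphClass_flatMap_perm K ε (R := M'.expand A')
    (fun f : t.rotate.Edge => if ε = 0 then M'.edgeTriple A' none f
      else [.edge ((M'.expand A').edgeOf (.inr ⟨none, f, true⟩))]) hblk []
    ((ℓ₀.map some).flatMap (M'.treeBlock A' ε) ++ M'.baseBlock A' ε (none :: ℓ₀.map some) o)
    (edgeList_nodup _) hlist.symm
  have hmid : (ℓ₀.map some).flatMap (M'.treeBlock A' ε) =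
      ((ℓ₀.map some).flatMap (M.treeBlock A ε)).map φ.mapCell := by
    rw [map_flatMap, flatMap_map, flatMap_map]
    congr 1
    funext i
    unfold treeBlock
    split_ifs
    · rw [map_flatMap]; rfl
    · rw [map_map]; rfl
  unfold graphElement
  rw [flatMap_cons, flatMap_cons, treeBlock_eq_flatMap, append_assoc, append_assoc]
  simp only [nil_append] at hsort
  refine (congrArg _ hsort).trans ?_
  have hpre : (∑ i, (M'.n i : ZMod 2) +
      pairSum (fun i j => (M'.n i : ZMod 2) * ((A' j).edges.card : ZMod 2)) (none :: ℓ₀.map some)) =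
      ∑ i, (M.n i : ZMod 2) +
        pairSum (fun i j => (M.n i : ZMod 2) * ((A j).edges.card : ZMod 2))
          (none :: ℓ₀.map some) := by
    congr 1
    refine pairSum_congr fun x _ y _ => ?_
    rcases y with _ | y
    · change (M.n x : ZMod 2) * (t.rotate.edges.card : ZMod 2) = _ * (t.edges.card : ZMod 2)
      rw [card_rotate]
    · rfl
  rw [hpre, smul_comm (msign K (t.rotationSign + _)), hrs]
  congr 1
  have htrue : ∀ f : t.Edge, (M'.expand A').edgeOf
      (.inr ⟨none, rotateEdgeSub t f, true⟩) =
        (M'.expand A').edgeOf (φ.toEquiv (.inr ⟨none, f, true⟩)) := by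
    intro f
    change _ = (M'.expand A').edgeOf (.inr ⟨none, rotateEdgeSub t f, if f.1.hi = _ then !true else true⟩)
    split_ifs
    · have h : (M'.expand A').edgeOf (.inr ⟨none, rotateEdgeSub t f, true⟩) =
          (M'.expand A').edgeOf (.inr ⟨none, rotateEdgeSub t f, !true⟩) := Quot.sound rfl
      exact h
    · rfl
  rcases zmod2_cases ε with rfl | rfl
  · have hW : (t.edgeList.map (rotateEdgeSub t)).flatMap (fun f : t.rotate.Edge => if (0 : ZMod 2) = 0 then
          M'.edgeTriple A' none f else [.edge ((M'.expand A').edgeOf (.inr ⟨none, f, true⟩))]) ++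
        ((ℓ₀.map some).flatMap (M'.treeBlock A' 0) ++ M'.baseBlock A' 0 (none :: ℓ₀.map some) o) =
        (t.edgeList.flatMap (fun f : t.Edge =>
          if f.1.hi = M.n none then M.edgeTripleFlip A none f else M.edgeTriple A none f) ++
          (ℓ₀.map some).flatMap (M.treeBlock A 0) ++
          Cell.vertex ((M.expand A).vertexOf (.inl (M.e ⟨none, Fin.last _⟩))) ::
            ((finRange (M.n none + 1)).map (fun j => (Cell.half (.inl (M.e ⟨none, j - 1⟩)) : (M.expand A).Cell)) ++
              (ℓ₀.map some).flatMap (M.rootBlock A))).map φ.mapCell := by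
      rw [map_append, map_append, hmid, append_assoc]
      congr 1
      · rw [flatMap_map, map_flatMap]
        congr 1
        funext f
        rw [if_pos rfl]
        have hθ : ∀ s, φ.toEquiv (.inr ⟨none, f, s⟩) =
          .inr ⟨none, rotateEdgeSub t f, if f.1.hi = M.n none then !s else s⟩ := fun s => rfl
        split_ifs with h
        · have h1 := hθ true
          have h2 := hθ false
          rw [if_pos h] at h1 h2
          simp only [edgeTripleFlip, map_cons, map_nil, RibbonData.Iso.map_half,
            RibbonData.Iso.map_vertexOf, h1, h2]
          rfl
        · have h1 := hθ true
          have h2 := hθ false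
          rw [if_neg h] at h1 h2
          simp only [edgeTriple, map_cons, map_nil, RibbonData.Iso.map_half,
            RibbonData.Iso.map_vertexOf, h1, h2]
      · congr 1
        unfold baseBlock
        rw [if_pos rfl, flatMap_cons, map_cons, map_append]
        unfold rootBlock
        rw [cons_append]
        congr 1
        · change Cell.vertex ((M'.expand A').vertexOf (.inl (M.e ⟨none, 0 - 1⟩))) =
            .vertex ((M'.expand A').vertexOf (.inl (M.e ⟨none, Fin.last _⟩)))
          rw [sub_eq_iff_eq_add.2 (Fin.last_add_one (M.n none)).symm]
        · congr 1
          · rw [map_map]; rfl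
          · rw [map_flatMap, flatMap_map, flatMap_map]
            congr 1
            funext i
            rw [map_cons, map_map]
            congr 1
            · exact congrArg (fun h => Cell.vertex ((M'.expand A').vertexOf (.inl h)))
                (e_some i 0)
            · exact map_congr_left fun j _ =>
                congrArg (fun h => (Cell.half (.inl h) : (M'.expand A').Cell)) (e_some i j)
    have hroot := M.graphClass_reroot A none K 0 hn ((ℓ₀.map some).flatMap (M.treeBlock A 0))
      ((finRange (M.n none + 1)).map (fun j => (Cell.half (.inl (M.e ⟨none, j - 1⟩)) : (M.expand A).Cell)) ++
              (ℓ₀.map some).flatMap (M.rootBlock A))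
    have hlegs := graphClass_swap_word K 0 (R := M.expand A)
      (t.edgeList.flatMap (M.edgeTriple A none) ++ (ℓ₀.map some).flatMap (M.treeBlock A 0) ++
        [.vertex ((M.expand A).vertexOf (.inl (M.e ⟨none, 0⟩)))])
      ((ℓ₀.map some).flatMap (M.rootBlock A))
      [Cell.half (.inl (M.e ⟨none, Fin.last _⟩))]
      ((finRange (M.n none)).map fun j =>
        Cell.half (.inl (M.e ⟨none, j.castSucc⟩)))
    rw [hW, ← graphClass_iso]
    refine (congrArg _ hroot.symm).trans ?_
    rw [map_finRange_sub_one
      (fun j => (Cell.half (.inl (M.e ⟨none, j⟩)) : (M.expand A).Cell))]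
    have hleg' : M.baseBlock A 0 (none :: ℓ₀.map some) o =
        .vertex ((M.expand A).vertexOf (.inl (M.e ⟨none, 0⟩))) ::
          ((finRange (M.n none)).map (fun j => .half (.inl (M.e ⟨none, j.castSucc⟩))) ++
            [.half (.inl (M.e ⟨none, Fin.last _⟩))] ++ (ℓ₀.map some).flatMap (M.rootBlock A)) := by
      unfold baseBlock
      rw [if_pos rfl, flatMap_cons, ← map_finRange_castSucc
        (fun j => (Cell.half (.inl (M.e ⟨none, j⟩)) : (M.expand A).Cell))]
      rfl
    rw [hleg']
    simp only [append_assoc, cons_append, nil_append, length_singleton, length_map, length_finRange,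
      Nat.cast_one, one_mul] at hlegs ⊢
    refine (congrArg _ hlegs).trans ?_
    rw [smul_smul, ← msign_add]
    congr 2
    ring
  · have hW : (t.edgeList.map (rotateEdgeSub t)).flatMap (fun f : t.rotate.Edge => if (1 : ZMod 2) = 0 then
          M'.edgeTriple A' none f else [.edge ((M'.expand A').edgeOf (.inr ⟨none, f, true⟩))]) ++
        ((ℓ₀.map some).flatMap (M'.treeBlock A' 1) ++ M'.baseBlock A' 1 (none :: ℓ₀.map some) o) =
        (t.edgeList.flatMap (fun f : t.Edge =>
          if (1 : ZMod 2) = 0 then M.edgeTriple A none f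
            else [.edge ((M.expand A).edgeOf (.inr ⟨none, f, true⟩))]) ++
          ((ℓ₀.map some).flatMap (M.treeBlock A 1) ++
          M.baseBlock A 1 (none :: ℓ₀.map some) o)).map φ.mapCell := by
      rw [map_append, map_append, hmid]
      congr 1
      · rw [flatMap_map, map_flatMap]
        congr 1
        funext f
        rw [if_neg one_ne_zero, if_neg one_ne_zero, htrue]
        rfl
      · congr 1
        unfold baseBlock
        rw [if_neg one_ne_zero, if_neg one_ne_zero, map_map]
        rfl
    rw [hW, ← graphClass_iso, treeBlock_eq_flatMap]
    congr 2
    linear_combination (-1 : ZMod 2) * zmod2_add_self (M.n none : ZMod 2)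

end Marking

/-! ### Half-edges of a composition of trees -/

section GraftHalf

variable {m n p N : ℕ} (h : Composable m n p N) (U : PlanarTree m) (V : PlanarTree n)

/-- An internal edge of the lower tree as an internal edge of the composition. -/
def lowerEdge (f : U.Edge) : (graft h U V).Edge :=
  ⟨shiftLower n p f.1, Finset.mem_insert_of_mem
    (Finset.mem_union_left _ (Finset.mem_image_of_mem _ f.2))⟩

/-- An internal edge of the upper tree as an internal edge of the composition. -/
def upperEdge (f : V.Edge) : (graft h U V).Edge :=
  ⟨shiftUpper p f.1, Finset.mem_insert_of_mem
    (Finset.mem_union_right _ (Finset.mem_image_of_mem _ f.2))⟩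

/-- The new internal edge of a composition. -/
def newEdge : (graft h U V).Edge :=
  ⟨Interval.mk p (p + n - 1), Finset.mem_insert_self _ _⟩

theorem exists_graft_edge (f : (graft h U V).Edge) :
    (∃ g, f = lowerEdge h U V g) ∨ (∃ g, f = upperEdge h U V g) ∨ f = newEdge h U V := by
  obtain ⟨e, he⟩ := f
  rcases Finset.mem_insert.1 he with rfl | he'
  · exact Or.inr (Or.inr rfl)
  rcases Finset.mem_union.1 he' with h' | h'
  · obtain ⟨g, hg, rfl⟩ := Finset.mem_image.1 h'
    exact Or.inl ⟨⟨g, hg⟩, rfl⟩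
  · obtain ⟨g, hg, rfl⟩ := Finset.mem_image.1 h'
    exact Or.inr (Or.inl ⟨⟨g, hg⟩, rfl⟩)

theorem lowerEdge_lo (f : U.Edge) : (lowerEdge h U V f).1.lo =
    if f.1.lo ≤ p then f.1.lo else f.1.lo + n - 1 := rfl

theorem lowerEdge_hi (f : U.Edge) : (lowerEdge h U V f).1.hi =
    if f.1.hi < p then f.1.hi else f.1.hi + n - 1 := rfl

theorem upperEdge_lo (f : V.Edge) :
    (upperEdge h U V f).1.lo = f.1.lo + p - 1 := rfl

theorem upperEdge_hi (f : V.Edge) :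
    (upperEdge h U V f).1.hi = f.1.hi + p - 1 := rfl

theorem newEdge_lo : (newEdge h U V).1.lo = p := rfl

theorem newEdge_hi : (newEdge h U V).1.hi = p + n - 1 := rfl

/-- The internal edges of a composition. -/
def graftEdge : U.Edge ⊕ V.Edge ⊕ Unit →
    (graft h U V).Edge
  | .inl f => lowerEdge h U V f
  | .inr (.inl f) => upperEdge h U V f
  | .inr (.inr _) => newEdge h U V

theorem graftEdge_bijective : Function.Bijective (graftEdge h U V) := by
  constructor
  · intro x y hxy
    have h1 := congrArg (fun f => f.1.lo) hxy
    have h2 := congrArg (fun f => f.1.hi) hxy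
    clear hxy
    have h' := h
    obtain ⟨hm, hn, hp, hp', hN⟩ := h'
    rcases x with x | x | x <;> rcases y with y | y | y <;>
      simp only [graftEdge, lowerEdge_lo, lowerEdge_hi, upperEdge_lo, upperEdge_hi, newEdge_lo,
        newEdge_hi] at h1 h2 <;>
      [have hx := U.proper _ x.2; have hx := U.proper _ x.2; have hx := U.proper _ x.2;
        have hx := V.proper _ x.2; have hx := V.proper _ x.2; have hx := V.proper _ x.2;
        skip; skip; skip] <;>
      [have hy := U.proper _ y.2; have hy := V.proper _ y.2; skip;
        have hy := U.proper _ y.2; have hy := V.proper _ y.2; skip;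
        have hy := U.proper _ y.2; have hy := V.proper _ y.2; skip] <;>
      (try simp only [Interval.Proper] at hx) <;> (try simp only [Interval.Proper] at hy)
    · refine congrArg Sum.inl (Subtype.ext (Interval.ext' ?_ ?_)) <;> grind
    · grind
    · grind
    · grind
    · refine congrArg (fun x => Sum.inr (Sum.inl x)) (Subtype.ext (Interval.ext' ?_ ?_)) <;> omega
    · omega
    · grind
    · omega
    · rfl
  · intro f
    rcases exists_graft_edge h U V f with ⟨g, rfl⟩ | ⟨g, rfl⟩ | rfl
    · exact ⟨.inl g, rfl⟩
    · exact ⟨.inr (.inl g), rfl⟩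
    · exact ⟨.inr (.inr ()), rfl⟩

theorem card_graft : (graft h U V).edges.card = U.edges.card + V.edges.card + 1 := by
  have := Fintype.card_of_bijective (graftEdge_bijective h U V)
  simp only [Fintype.card_sum, Fintype.card_coe, Fintype.card_unit] at this
  omega

/-- A half-edge of the lower tree as a half-edge of the composition. -/
def lowerHalf : TreeHalf U → TreeHalf (graft h U V)
  | .inl j =>
    if j.1 = p then .inr (newEdge h U V, true)
    else .inl ⟨if j.1 < p then j.1 else j.1 + n - 1, by
      obtain ⟨_, _, _, _, _⟩ := h; have := j.2; split_ifs <;> omega⟩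
  | .inr (f, s) => .inr (lowerEdge h U V f, s)

/-- A half-edge of the upper tree as a half-edge of the composition. -/
def upperHalf : TreeHalf V → TreeHalf (graft h U V)
  | .inl j =>
    if j.1 = 0 then .inr (newEdge h U V, false)
    else .inl ⟨j.1 + p - 1, by obtain ⟨_, _, _, _, _⟩ := h; have := j.2; omega⟩
  | .inr (f, s) => .inr (upperEdge h U V f, s)

theorem lowerHalf_start_length (x : TreeHalf U) :
    (lowerHalf h U V x).start = (if x.start ≤ p then x.start else x.start + n - 1) ∧
      (lowerHalf h U V x).length =
        (if x.start ≤ p ∧ p < x.start + x.length ∨ m + 1 + p < x.start + x.length then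
          x.length + n - 1 else x.length) := by
  have h' := h
  obtain ⟨hm, hn, hp, hp', hN⟩ := h'
  rcases x with j | ⟨f, s⟩
  · have := j.2
    simp only [lowerHalf]
    by_cases h1 : j.1 = p
    · rw [if_pos h1]
      simp only [TreeHalf.start_true, TreeHalf.length_true, newEdge_lo, newEdge_hi,
        TreeHalf.start_inl, TreeHalf.length_inl]
      grind
    · rw [if_neg h1]
      simp only [TreeHalf.start_inl, TreeHalf.length_inl]
      grind
  · have hf := U.proper f.1 f.2
    simp only [Interval.Proper] at hf
    cases s <;> simp only [lowerHalf, TreeHalf.start_true, TreeHalf.length_true,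
      TreeHalf.start_false, TreeHalf.length_false, lowerEdge_lo, lowerEdge_hi] <;> grind

theorem upperHalf_start_length (x : TreeHalf V) :
    (upperHalf h U V x).start =
        (if x.start = 0 then (if p = m then 0 else p + n) else x.start + p - 1) ∧
      (upperHalf h U V x).length =
        (if x.start = 0 ∨ n + 1 < x.start + x.length then x.length + m - 1 else x.length) := by
  have h' := h
  obtain ⟨hm, hn, hp, hp', hN⟩ := h'
  rcases x with j | ⟨f, s⟩
  · have := j.2
    simp only [upperHalf]
    by_cases h1 : j.1 = 0
    · rw [if_pos h1]
      simp only [TreeHalf.start_false, TreeHalf.length_false, newEdge_lo, newEdge_hi,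
        TreeHalf.start_inl, TreeHalf.length_inl]
      grind
    · rw [if_neg h1]
      simp only [TreeHalf.start_inl, TreeHalf.length_inl]
      grind
  · have hf := V.proper f.1 f.2
    simp only [Interval.Proper] at hf
    cases s <;> simp only [upperHalf, TreeHalf.start_true, TreeHalf.length_true,
      TreeHalf.start_false, TreeHalf.length_false, upperEdge_lo, upperEdge_hi] <;> grind

theorem exists_graft_half (z : TreeHalf (graft h U V)) :
    (∃ x, z = lowerHalf h U V x) ∨ ∃ y, z = upperHalf h U V y := by
  have h' := h
  obtain ⟨hm, hn, hp, hp', hN⟩ := h'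
  rcases z with ⟨j, hj⟩ | ⟨f, s⟩
  · by_cases h1 : j < p
    · refine Or.inl ⟨.inl ⟨j, by omega⟩, ?_⟩
      simp [lowerHalf, h1, h1.ne]
    · by_cases h2 : j < p + n
      · refine Or.inr ⟨.inl ⟨j + 1 - p, by omega⟩, ?_⟩
        simp only [upperHalf]
        rw [if_neg (by omega)]
        refine congrArg Sum.inl (Fin.ext ?_)
        simp only
        omega
      · refine Or.inl ⟨.inl ⟨j + 1 - n, by omega⟩, ?_⟩
        simp only [lowerHalf]
        rw [if_neg (by omega)]
        refine congrArg Sum.inl (Fin.ext ?_)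
        simp only
        rw [if_neg (by omega)]
        omega
  · rcases exists_graft_edge h U V f with ⟨g, rfl⟩ | ⟨g, rfl⟩ | rfl
    · exact Or.inl ⟨.inr (g, s), rfl⟩
    · exact Or.inr ⟨.inr (g, s), rfl⟩
    · cases s
      · exact Or.inr ⟨.inl 0, by simp [upperHalf]⟩
      · exact Or.inl ⟨.inl ⟨p, by omega⟩, by simp [lowerHalf]⟩

theorem lowerHalf_next (x : TreeHalf U) :
    lowerHalf h U V x.next = (lowerHalf h U V x).next := by
  have h' := h
  obtain ⟨hm, hn, hp, hp', hN⟩ := h'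
  have hN' : 2 ≤ N := by omega
  obtain ⟨h1, h2⟩ := TreeHalf.next_spec hm x
  rw [TreeHalf.follows_iff hm] at h1
  have a₁ := x.start_le
  have a₂ := x.length_lt hm
  have a₃ := x.length_pos
  have b₁ := x.next.start_le
  have b₂ := x.next.length_lt hm
  have b₃ := x.next.length_pos
  obtain ⟨c₁, c₂⟩ := lowerHalf_start_length h U V x
  obtain ⟨d₁, d₂⟩ := lowerHalf_start_length h U V x.next
  refine (TreeHalf.next_eq ((TreeHalf.follows_iff hN' _ _).2 ?_) fun z hz => ?_).symm
  · rw [c₁, c₂, d₁, d₂]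
    clear h2 c₁ c₂ d₁ d₂
    grind
  · rw [TreeHalf.follows_iff hN'] at hz
    rcases exists_graft_half h U V z with ⟨y, rfl⟩ | ⟨y, rfl⟩
    · obtain ⟨e₁, e₂⟩ := lowerHalf_start_length h U V y
      have f₁ := y.start_le
      have f₂ := y.length_lt hm
      have f₃ := y.length_pos
      have g := h2 y
      rw [TreeHalf.follows_iff hm] at g
      rw [c₁, c₂, e₁, e₂] at hz
      rw [d₂, e₂]
      clear h2 c₁ c₂ d₁ d₂ e₁ e₂
      grind
    · obtain ⟨e₁, e₂⟩ := upperHalf_start_length h U V y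
      have f₁ := y.start_le
      have f₂ := y.length_lt hn
      have f₃ := y.length_pos
      have g := h2 (.inl ⟨p, by omega⟩)
      rw [TreeHalf.follows_iff hm, TreeHalf.start_inl, TreeHalf.length_inl] at g
      rw [c₁, c₂, e₁, e₂] at hz
      rw [d₂, e₂]
      clear h2 c₁ c₂ d₁ d₂ e₁ e₂
      grind

theorem upperHalf_next (x : TreeHalf V) :
    upperHalf h U V x.next = (upperHalf h U V x).next := by
  have h' := h
  obtain ⟨hm, hn, hp, hp', hN⟩ := h'
  have hN' : 2 ≤ N := by omega
  obtain ⟨h1, h2⟩ := TreeHalf.next_spec hn x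
  rw [TreeHalf.follows_iff hn] at h1
  have a₁ := x.start_le
  have a₂ := x.length_lt hn
  have a₃ := x.length_pos
  have b₁ := x.next.start_le
  have b₂ := x.next.length_lt hn
  have b₃ := x.next.length_pos
  obtain ⟨c₁, c₂⟩ := upperHalf_start_length h U V x
  obtain ⟨d₁, d₂⟩ := upperHalf_start_length h U V x.next
  refine (TreeHalf.next_eq ((TreeHalf.follows_iff hN' _ _).2 ?_) fun z hz => ?_).symm
  · rw [c₁, c₂, d₁, d₂]
    clear h2 c₁ c₂ d₁ d₂
    grind
  · rw [TreeHalf.follows_iff hN'] at hz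
    rcases exists_graft_half h U V z with ⟨y, rfl⟩ | ⟨y, rfl⟩
    · obtain ⟨e₁, e₂⟩ := lowerHalf_start_length h U V y
      have f₁ := y.start_le
      have f₂ := y.length_lt hm
      have f₃ := y.length_pos
      have g := h2 (.inl 0)
      rw [TreeHalf.follows_iff hn, TreeHalf.start_inl, TreeHalf.length_inl, Fin.val_zero] at g
      rw [c₁, c₂, e₁, e₂] at hz
      rw [d₂, e₂]
      clear h2 c₁ c₂ d₁ d₂ e₁ e₂
      grind
    · obtain ⟨e₁, e₂⟩ := upperHalf_start_length h U V y
      have f₁ := y.start_le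
      have f₂ := y.length_lt hn
      have f₃ := y.length_pos
      have g := h2 y
      rw [TreeHalf.follows_iff hn] at g
      rw [c₁, c₂, e₁, e₂] at hz
      rw [d₂, e₂]
      clear h2 c₁ c₂ d₁ d₂ e₁ e₂
      grind

end GraftHalf

namespace Marking

variable {R : RibbonData} {ι₀ : Type}

/-- The half-edges at the two vertices into which a vertex is split. -/
theorem split_legs (M : Marking R (Option ι₀)) {m n p : ℕ} (h : Composable m n p (M.n none)) :
    ∃ A B C : List R.H,
      (finRange (M.n none)).map (fun j => M.e ⟨none, j.succ⟩) = A ++ B ++ C ∧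
      (finRange m).map (fun j => M.splitE h ⟨some none, (Fin.succ j : Fin (m + 1))⟩) =
        A.map .inl ++ .inr true :: C.map .inl ∧
      (finRange n).map (fun j => M.splitE h ⟨none, (Fin.succ j : Fin (n + 1))⟩) =
        B.map .inl ∧
      A.length = p - 1 ∧ B.length = n ∧ C.length = m - p := by
  have h' := h
  obtain ⟨hm, hn, hp, hp', hN⟩ := h'
  let g : ℕ → R.H := fun k => if hk : k < M.n none + 1 then M.e ⟨none, ⟨k, hk⟩⟩ else M.e ⟨none, 0⟩
  have hg : ∀ k (hk : k < M.n none + 1), g k = M.e ⟨none, ⟨k, hk⟩⟩ := fun k hk => dif_pos hk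
  refine ⟨(List.range (p - 1)).map fun k => g (k + 1), (List.range n).map fun k => g (k + p),
    (List.range (m - p)).map fun k => g (k + p + n), ?_, ?_, ?_, by simp, by simp, by simp⟩
  · refine ext_getElem (by simp; omega) fun i h1 h2 => ?_
    simp only [length_map, length_finRange] at h1
    simp only [getElem_map, getElem_finRange, getElem_append, length_map, List.length_range,
      length_append, List.getElem_range]
    split_ifs <;> rw [hg _ (by omega)] <;> refine congrArg (fun j => M.e ⟨none, j⟩) (Fin.ext ?_) <;>
      simp <;> omega
  · refine ext_getElem (by simp; omega) fun i h1 h2 => ?_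
    simp only [length_map, length_finRange] at h1
    simp only [getElem_map, getElem_finRange, getElem_append, length_map, List.length_range,
      List.getElem_cons, List.getElem_range]
    simp only [splitE, splitEquiv, Equiv.trans_apply, Equiv.coe_fn_mk, Fin.val_succ, Fin.cast_mk]
    split_ifs <;> first | omega | skip
    · rfl
    · simp only [Equiv.sumCongr_apply, Sum.map_inl]
      rw [hg _ (by omega)]
    · simp only [Equiv.sumCongr_apply, Sum.map_inl]
      rw [hg _ (by omega)]
      refine congrArg (fun j => Sum.inl (M.e ⟨none, j⟩)) (Fin.ext ?_)
      simp only; omega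
  · refine ext_getElem (by simp) fun i h1 h2 => ?_
    simp only [length_map, length_finRange] at h1
    simp only [getElem_map, getElem_finRange, List.getElem_range]
    simp only [splitE, splitEquiv, Equiv.trans_apply, Equiv.coe_fn_mk, Fin.val_succ, Fin.cast_mk]
    rw [dif_neg (by omega)]
    simp only [Equiv.sumCongr_apply, Sum.map_inl]
    rw [hg _ (by omega)]
    refine congrArg (fun j => Sum.inl (M.e ⟨none, j⟩)) (Fin.ext ?_)
    simp only; omega

theorem splitE_upper_zero (M : Marking R (Option ι₀)) {m n p : ℕ}
    (h : Composable m n p (M.n none)) :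
    M.splitE h ⟨none, (0 : Fin (n + 1))⟩ = .inr false := rfl

theorem splitE_lower (M : Marking R (Option ι₀)) {m n p : ℕ} (h : Composable m n p (M.n none))
    (j : Fin (m + 1)) : M.splitE h ⟨some none, j⟩ = if h0 : j.1 = p then .inr true else
      .inl (M.e ⟨none, ⟨if j.1 < p then j.1 else j.1 + n - 1, by
        obtain ⟨_, _, _, _, _⟩ := h; have := j.2; split_ifs <;> omega⟩⟩) := by
  have h' := h
  obtain ⟨hm, hn, hp, hp', hN⟩ := h'
  simp only [splitE, splitEquiv, Equiv.trans_apply, Equiv.coe_fn_mk]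
  split_ifs <;> rfl

theorem splitE_upper (M : Marking R (Option ι₀)) {m n p : ℕ} (h : Composable m n p (M.n none))
    (j : Fin (n + 1)) : M.splitE h ⟨none, j⟩ = if h0 : j.1 = 0 then .inr false else
      .inl (M.e ⟨none, ⟨j.1 + p - 1, by
        obtain ⟨_, _, _, _, _⟩ := h; have := j.2; omega⟩⟩) := by
  simp only [splitE, splitEquiv, Equiv.trans_apply, Equiv.coe_fn_mk]
  split_ifs <;> rfl

theorem splitE_lower_zero (M : Marking R (Option ι₀)) {m n p : ℕ}
    (h : Composable m n p (M.n none)) :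
    M.splitE h ⟨some none, (0 : Fin (m + 1))⟩ = .inl (M.e ⟨none, 0⟩) := by
  have hp : 0 < p := h.2.2.1
  refine (M.splitE_lower h 0).trans ((dif_neg hp.ne).trans ?_)
  exact congrArg (fun j => Sum.inl (M.e ⟨none, j⟩)) (Fin.ext (if_pos hp))

/-! ### Grafting in the graph complex -/

section

variable [Fintype ι₀] (M : Marking R (Option ι₀)) {m n p : ℕ} (h : Composable m n p (M.n none))
  (U : PlanarTree m) (V : PlanarTree n) (T : ∀ i, PlanarTree (M.n (some i)))

/-- The map from the half-edges of a split graph with trees for vertices to those of the graph with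
composed trees for vertices. -/
def graftMap : ((M.split h).expand (M.splitTrees h U V T)).H →
    (M.expand (optTrees M (graft h U V) T)).H
  | .inl (.inl x) => .inl x
  | .inl (.inr s) => .inr ⟨none, newEdge h U V, s⟩
  | .inr ⟨none, f, s⟩ => .inr ⟨none, upperEdge h U V f, s⟩
  | .inr ⟨some none, f, s⟩ => .inr ⟨none, lowerEdge h U V f, s⟩
  | .inr ⟨some (some i), q⟩ => .inr ⟨some i, q⟩

theorem graftMap_bijective : Function.Bijective (M.graftMap h U V T) := by
  have hb := graftEdge_bijective h U V
  have hk : ∀ (x y : U.Edge ⊕ V.Edge ⊕ Unit)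
      (s s' : Bool), (Sum.inr ⟨none, graftEdge h U V x, s⟩ :
        (M.expand (optTrees M (graft h U V) T)).H) =
        Sum.inr ⟨none, graftEdge h U V y, s'⟩ → x = y ∧ s = s' := by
    intro x y s s' hxy
    have := eq_of_heq (Sigma.mk.inj (Sum.inr.inj hxy)).2
    exact ⟨hb.1 (congrArg Prod.fst this), congrArg Prod.snd this⟩
  constructor
  · rintro ((x | s) | ⟨_ | _ | i, f, s⟩) ((y | s') | ⟨_ | _ | i', g, s'⟩) hxy
    · cases hxy; rfl
    · cases hxy
    · cases hxy
    · cases hxy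
    · cases hxy
    · cases hxy
    · obtain ⟨h1, rfl⟩ := hk (.inr (.inr ())) (.inr (.inr ())) s s' hxy
      rfl
    · obtain ⟨h1, rfl⟩ := hk (.inr (.inr ())) (.inr (.inl g)) s s' hxy
      cases h1
    · obtain ⟨h1, rfl⟩ := hk (.inr (.inr ())) (.inl g) s s' hxy
      cases h1
    · cases hxy
    · cases hxy
    · obtain ⟨h1, rfl⟩ := hk (.inr (.inl f)) (.inr (.inr ())) s s' hxy
      cases h1
    · obtain ⟨h1, rfl⟩ := hk (.inr (.inl f)) (.inr (.inl g)) s s' hxy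
      cases h1; rfl
    · obtain ⟨h1, rfl⟩ := hk (.inr (.inl f)) (.inl g) s s' hxy
      cases h1
    · cases hxy
    · cases hxy
    · obtain ⟨h1, rfl⟩ := hk (.inl f) (.inr (.inr ())) s s' hxy
      cases h1
    · obtain ⟨h1, rfl⟩ := hk (.inl f) (.inr (.inl g)) s s' hxy
      cases h1
    · obtain ⟨h1, rfl⟩ := hk (.inl f) (.inl g) s s' hxy
      cases h1; rfl
    · cases hxy
    · cases hxy
    · cases hxy
    · cases hxy
    · cases hxy
    · cases hxy; rfl
  · rintro (x | ⟨_ | i, f, s⟩)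
    · exact ⟨.inl (.inl x), rfl⟩
    · rcases exists_graft_edge h U V f with ⟨g, rfl⟩ | ⟨g, rfl⟩ | rfl
      · exact ⟨.inr ⟨some none, g, s⟩, rfl⟩
      · exact ⟨.inr ⟨none, g, s⟩, rfl⟩
      · exact ⟨.inl (.inr s), rfl⟩
    · exact ⟨.inr ⟨some (some i), f, s⟩, rfl⟩

/-- Splitting a vertex and replacing both parts by trees is the same as replacing the vertex by the
composition of the trees. -/
def graftIso : ((M.split h).expand (M.splitTrees h U V T)).Iso
    (M.expand (optTrees M (graft h U V) T)) :=
  expandIso (Equiv.ofBijective _ (M.graftMap_bijective h U V T))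
    (by
      have key₁ : ∀ x : TreeHalf U, M.graftMap h U V T
          ((M.split h).glue (M.splitTrees h U V T) (some none) x) =
            M.glue (optTrees M (graft h U V) T) none
              (lowerHalf h U V x) := by
        rintro (j | q)
        · change M.graftMap h U V T (.inl (M.splitE h ⟨some none, j⟩)) = _
          rw [splitE_lower]
          simp only [lowerHalf]
          split_ifs <;> rfl
        · rfl
      have key₂ : ∀ x : TreeHalf V, M.graftMap h U V T
          ((M.split h).glue (M.splitTrees h U V T) none x) =
            M.glue (optTrees M (graft h U V) T) none
              (upperHalf h U V x) := by
        rintro (j | q)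
        · change M.graftMap h U V T (.inl (M.splitE h ⟨none, j⟩)) = _
          rw [splitE_upper]
          simp only [upperHalf]
          split_ifs <;> rfl
        · rfl
      have key₃ : ∀ i (x : TreeHalf (T i)), M.graftMap h U V T
          ((M.split h).glue (M.splitTrees h U V T) (some (some i)) x) =
            M.glue (optTrees M (graft h U V) T) (some i) x := by
        rintro i (j | q) <;> rfl
      rintro (_ | _ | i) x
      · refine (key₂ x.next).trans ((congrArg _ (upperHalf_next h U V x)).trans ?_)
        refine (M.expand_rot_glue _ none _).symm.trans (congrArg _ (key₂ x).symm)
      · refine (key₁ x.next).trans ((congrArg _ (lowerHalf_next h U V x)).trans ?_)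
        refine (M.expand_rot_glue _ none _).symm.trans (congrArg _ (key₁ x).symm)
      · refine (key₃ i x.next).trans ?_
        refine (M.expand_rot_glue _ (some i) _).symm.trans (congrArg _ (key₃ i x).symm))
    (by rintro ((x | s) | ⟨_ | _ | i, f, s⟩) <;> rfl)

end

end Marking

namespace Marking

variable {R : RibbonData} {ι₀ : Type} [Fintype ι₀]

section

variable (M : Marking R (Option ι₀)) {m n p : ℕ} (h : Composable m n p (M.n none))
  (U : PlanarTree m) (V : PlanarTree n) (T : ∀ i, PlanarTree (M.n (some i)))

theorem map_finRange_succ {α : Type*} {n : ℕ} (f : Fin (n + 1) → α) :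
    (finRange (n + 1)).map f = f 0 :: (finRange n).map fun j => f j.succ := by
  rw [finRange_succ, map_cons, map_map]
  rfl

theorem graft_edgeList_perm : (U.edgeList.map (lowerEdge h U V) ++
    V.edgeList.map (upperEdge h U V) ++ [newEdge h U V]).Perm (graft h U V).edgeList := by
  have e : U.edgeList.map (lowerEdge h U V) ++ V.edgeList.map (upperEdge h U V) ++
      [newEdge h U V] = (U.edgeList.map Sum.inl ++ (V.edgeList.map Sum.inl ++ [Sum.inr ()]).map
        Sum.inr).map (graftEdge h U V) := by
    simp only [map_append, map_map, append_assoc]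
    rfl
  refine (perm_ext_iff_of_nodup ?_ (edgeList_nodup _)).2 fun f =>
    ⟨fun _ => mem_edgeList _ f, fun _ => ?_⟩
  · rw [e]
    refine List.Nodup.map (graftEdge_bijective h U V).1 ?_
    refine List.Nodup.append ((edgeList_nodup U).map Sum.inl_injective)
      (List.Nodup.map Sum.inr_injective (List.Nodup.append
        ((edgeList_nodup V).map Sum.inl_injective) (List.nodup_singleton _) ?_)) ?_
    · intro x hx hx'
      obtain ⟨y, _, rfl⟩ := List.mem_map.1 hx
      cases List.mem_singleton.1 hx'
    · intro x hx hx'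
      obtain ⟨y, _, rfl⟩ := List.mem_map.1 hx
      obtain ⟨z, _, hz⟩ := List.mem_map.1 hx'
      cases hz
  · simp only [List.mem_append, mem_map, List.mem_singleton]
    rcases exists_graft_edge h U V f with ⟨g, rfl⟩ | ⟨g, rfl⟩ | rfl
    · exact Or.inl (Or.inl ⟨g, mem_edgeList _ g, rfl⟩)
    · exact Or.inl (Or.inr ⟨g, mem_edgeList _ g, rfl⟩)
    · exact Or.inr rfl

theorem graftSign_eq : graftSign (i := p) U V = ((p : ZMod 2) * ((n : ZMod 2) + 1) +
    (m : ZMod 2) * ((n : ZMod 2) + V.edges.card)) +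
      (wordSign (fun _ => 1) (graft h U V).edgeList + wordSign (fun _ => 1)
        (U.edgeList.map (lowerEdge h U V) ++ V.edgeList.map (upperEdge h U V) ++
          [newEdge h U V])) := by
  have hp := graft_edgeList_perm M h U V
  have := inversions_edges (graft h U V) _ (hp.nodup_iff.2 (edgeList_nodup _))
    fun f => hp.mem_iff.2 (mem_edgeList _ f)
  rw [add_comm] at this
  unfold graftSign PlanarTree.stdOrientation
  rw [← this, PlanarTree.degree_two]
  simp only [map_append, map_map]
  rfl

theorem graphClass_graft_legs (K : Type u) [Field K] (ε : ZMod 2) {S : RibbonData}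
    (P Q A B C Z : List S.Cell) (v x y : S.Cell) :
    graphClass K ε S (P ++ Q ++ A ++ x :: C ++ v :: y :: B ++ Z) =
      msign K (((C.length : ZMod 2) * B.length) + (Q.length + A.length)) •
        graphClass K ε S (P ++ [v, y, x] ++ Q ++ A ++ B ++ C ++ Z) := by
  have h1 := graphClass_swap_word K ε (P ++ Q ++ A ++ [x]) Z C ([v, y] ++ B)
  have h2 := graphClass_swap_word K ε P (B ++ C ++ Z) (Q ++ A) [x, v, y]
  have h3 := graphClass_swap_word K ε P (Q ++ A ++ B ++ C ++ Z) [x] [v, y]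
  simp only [append_assoc, cons_append, nil_append, length_append, length_cons,
    List.length_nil] at h1 h2 h3 ⊢
  rw [h1, h2, h3, smul_smul, smul_smul, ← msign_add, ← msign_add]
  congr 2
  push_cast
  linear_combination ((C.length : ZMod 2) + Q.length + A.length + 1) * zmod2_add_self 1

theorem pairSum_option (s t : Option ι₀ → ZMod 2) (ℓ₀ : List ι₀) :
    pairSum (fun i j => s i * t j) (none :: ℓ₀.map some) =
      s none * (ℓ₀.map fun i => t (some i)).sum +
        pairSum (fun i j => s (some i) * t (some j)) ℓ₀ := by
  rw [pairSum, pairSum_map, map_map, ← list_sum_map_mul_left]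
  rfl

theorem graphElement_graft (K : Type u) [Field K] (ε : ZMod 2) (ℓ₀ : List ι₀) (o : List R.H) :
    M.graphElement (optTrees M (graft h U V) T) K ε
        (none :: ℓ₀.map some) o =
      msign K (graftSign (i := p) U V + ε * ((p : ZMod 2) * n + p + (m : ZMod 2) * n + 1)) •
        (M.split h).graphElement (M.splitTrees h U V T) K ε
          (some none :: none :: ℓ₀.map fun i => some (some i)) (.inr false :: o.map .inl) := by
  set A : ∀ i, PlanarTree (M.n i) := optTrees M (graft h U V) T
    with hA
  let φ : ((M.split h).expand (M.splitTrees h U V T)).Iso (M.expand A) := M.graftIso h U V T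
  let τ : ZMod 2 := (ℓ₀.map fun i => ((T i).edges.card : ZMod 2)).sum
  let blk : (graft h U V).Edge → List (M.expand A).Cell := fun f =>
    if ε = 0 then M.edgeTriple A none f
      else [.edge ((M.expand A).edgeOf (.inr ⟨none, f, true⟩))]
  have hblk : ∀ f, ((blk f).length : ZMod 2) = 1 := by
    intro f
    simp only [blk]
    split_ifs
    · exact show ((3 : ℕ) : ZMod 2) = 1 from rfl
    · exact show ((1 : ℕ) : ZMod 2) = 1 from rfl
  let X : List (M.expand A).Cell := (ℓ₀.map some).flatMap (M.treeBlock A ε)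
  have hX : (X.length : ZMod 2) = τ := by
    have : ∀ l : List ι₀, ((((l.map some).flatMap (M.treeBlock A ε)).length : ℕ) : ZMod 2) =
        (l.map fun i => ((T i).edges.card : ZMod 2)).sum := by
      intro l
      induction l with
      | nil => rfl
      | cons i l ih =>
        rw [map_cons, flatMap_cons, length_append, Nat.cast_add, length_treeBlock, ih]
        rfl
    exact this ℓ₀
  have hsort := graphClass_flatMap_perm K ε (R := M.expand A) blk hblk []
    (X ++ M.baseBlock A ε (none :: ℓ₀.map some) o) (edgeList_nodup _)
    (graft_edgeList_perm M h U V).symm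
  simp only [nil_append] at hsort
  have hmapV : ((M.split h).treeBlock (M.splitTrees h U V T) ε none).map φ.mapCell =
      (V.edgeList.map (upperEdge h U V)).flatMap blk := by
    rw [treeBlock_eq_flatMap, map_flatMap, flatMap_map]
    refine flatMap_congr (l := V.edgeList) fun f _ => ?_
    simp only [blk]
    split_ifs <;> rfl
  have hmapU : ((M.split h).treeBlock (M.splitTrees h U V T) ε (some none)).map φ.mapCell =
      (U.edgeList.map (lowerEdge h U V)).flatMap blk := by
    rw [treeBlock_eq_flatMap, map_flatMap, flatMap_map]
    refine flatMap_congr (l := U.edgeList) fun f _ => ?_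
    simp only [blk]
    split_ifs <;> rfl
  have hmapT : ∀ i, ((M.split h).treeBlock (M.splitTrees h U V T) ε (some (some i))).map
      φ.mapCell = M.treeBlock A ε (some i) := by
    intro i
    rw [treeBlock_eq_flatMap, map_flatMap]
    refine Eq.trans (flatMap_congr (l := (T i).edgeList) fun f _ => ?_)
      (treeBlock_eq_flatMap M A ε (some i)).symm
    split_ifs <;> rfl
  have hleft : M.treeBlock A ε none = (graft h U V).edgeList.flatMap blk :=
    treeBlock_eq_flatMap M A ε none
  have hX' : ((ℓ₀.map fun i => some (some i)).flatMap ((M.split h).treeBlock (M.splitTrees h U V T) ε)).map φ.mapCell = X := by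
    rw [map_flatMap, flatMap_map]
    refine Eq.trans (flatMap_congr fun i _ => hmapT i) ?_
    simp only [X, flatMap_map]
  have hN : (M.n none : ZMod 2) = m + n + 1 := by
    have := h.2.2.2.2
    have h' : ((M.n none + 1 : ℕ) : ZMod 2) = ((m + n : ℕ) : ZMod 2) := by rw [this]
    push_cast at h'
    linear_combination h' - zmod2_add_self 1
  have hpre₁ : ∑ i, (M.n i : ZMod 2) +
      pairSum (fun i j => (M.n i : ZMod 2) * ((A j).edges.card : ZMod 2)) (none :: ℓ₀.map some) =
      (m + n + 1) + ∑ i, (M.n (some i) : ZMod 2) + (m + n + 1) * τ +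
        pairSum (fun i j => (M.n (some i) : ZMod 2) * ((T j).edges.card : ZMod 2)) ℓ₀ := by
    rw [pairSum_option (fun i => (M.n i : ZMod 2))
      (fun j => ((A j).edges.card : ZMod 2)), Fintype.sum_option, hN]
    simp only [hA, optCons_some, τ]
    ring
  have hpre₂ : ∑ i, ((M.split h).n i : ZMod 2) +
      pairSum (fun i j => ((M.split h).n i : ZMod 2) * ((M.splitTrees h U V T j).edges.card : ZMod 2))
        (some none :: none :: ℓ₀.map fun i => some (some i)) =
      (m + n) + ∑ i, (M.n (some i) : ZMod 2) + m * (V.edges.card : ZMod 2) + (m + n) * τ +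
        pairSum (fun i j => (M.n (some i) : ZMod 2) * ((T j).edges.card : ZMod 2)) ℓ₀ := by
    rw [pairSum, pairSum, pairSum_map, Fintype.sum_option, Fintype.sum_option, map_cons, sum_cons,
      map_map, map_map]
    have e₁ : (ℓ₀.map ((fun j => ((M.split h).n (some none) : ZMod 2) * ((M.splitTrees h U V T j).edges.card : ZMod 2)) ∘
        fun i => some (some i))).sum = m * τ := (list_sum_map_mul_left _ _ _)
    have e₂ : (ℓ₀.map ((fun j => ((M.split h).n none : ZMod 2) * ((M.splitTrees h U V T j).edges.card : ZMod 2)) ∘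
        fun i => some (some i))).sum = n * τ := (list_sum_map_mul_left _ _ _)
    rw [e₁, e₂]
    change ((n : ZMod 2) + (m + ∑ i, (M.n (some i) : ZMod 2))) + (m * (V.edges.card : ZMod 2) +
      m * τ + (n * τ + pairSum (fun i j => (M.n (some i) : ZMod 2) *
        ((T j).edges.card : ZMod 2)) ℓ₀)) = _
    ring
  unfold graphElement
  rw [hpre₁, hpre₂, flatMap_cons, hleft, append_assoc]
  refine (congrArg _ hsort).trans ?_
  rw [graphClass_iso K ε φ, map_append, flatMap_cons, flatMap_cons, map_append, map_append, hX',
    hmapU, hmapV, graftSign_eq M h U V, smul_smul, smul_smul, ← msign_add, ← msign_add]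
  simp only [flatMap_append, flatMap_cons, List.flatMap_nil, List.append_nil]
  rcases zmod2_cases ε with rfl | rfl
  · have hnew : blk (newEdge h U V) = [.vertex ((M.expand A).vertexOf
        (.inr ⟨none, newEdge h U V, false⟩)), .half (.inr ⟨none, newEdge h U V, false⟩),
          .half (.inr ⟨none, newEdge h U V, true⟩)] := if_pos rfl
    obtain ⟨A₁, B₁, C₁, hW, hU, hV, hA₁, hB₁, hC₁⟩ := M.split_legs h
    let c : R.H → (M.expand A).Cell := fun x => .half (.inl x)
    have hroot : M.rootBlock A none = .vertex ((M.expand A).vertexOf (.inl (M.e ⟨none, 0⟩))) ::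
        c (M.e ⟨none, 0⟩) :: (A₁.map c ++ B₁.map c ++ C₁.map c) := by
      unfold rootBlock
      rw [finRange_succ, map_cons, map_map, ← map_append, ← map_append, ← hW, map_map]
      rfl
    have hrootU : ((M.split h).rootBlock (M.splitTrees h U V T) (some none)).map φ.mapCell =
        .vertex ((M.expand A).vertexOf (.inl (M.e ⟨none, 0⟩))) :: c (M.e ⟨none, 0⟩) ::
          (A₁.map c ++ .half (.inr ⟨none, newEdge h U V, true⟩) :: C₁.map c) := by
      have h1 := congrArg (List.map fun x => (Cell.half (M.graftMap h U V T (.inl x)) :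
        (M.expand A).Cell)) hU
      rw [map_append, map_cons, map_map, map_map, map_map] at h1
      unfold rootBlock
      rw [map_cons, map_map]
      refine congr (congrArg List.cons ?_) ((map_finRange_succ (n := m) _).trans
        (congr (congrArg List.cons ?_) h1))
      · exact congrArg (fun x => Cell.vertex ((M.expand A).vertexOf
          (M.graftMap h U V T (.inl x)))) (M.splitE_lower_zero h)
      · exact congrArg (fun x => (Cell.half (M.graftMap h U V T (.inl x)) :
          (M.expand A).Cell)) (M.splitE_lower_zero h)
    have hrootV : ((M.split h).rootBlock (M.splitTrees h U V T) none).map φ.mapCell =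
        .vertex ((M.expand A).vertexOf (.inr ⟨none, newEdge h U V, false⟩)) ::
          .half (.inr ⟨none, newEdge h U V, false⟩) :: B₁.map c := by
      have h1 := congrArg (List.map fun x => (Cell.half (M.graftMap h U V T (.inl x)) :
        (M.expand A).Cell)) hV
      rw [map_map, map_map] at h1
      unfold rootBlock
      rw [map_cons, map_map]
      exact congr (congrArg List.cons rfl) ((map_finRange_succ (n := n) _).trans
        (congr (congrArg List.cons rfl) h1))
    have hrootT : ((ℓ₀.map fun i => some (some i)).flatMap
        ((M.split h).rootBlock (M.splitTrees h U V T))).map φ.mapCell =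
          (ℓ₀.map some).flatMap (M.rootBlock A) := by
      rw [map_flatMap, flatMap_map, flatMap_map]
      refine flatMap_congr fun i _ => ?_
      unfold rootBlock
      rw [map_cons, map_map]
      rfl
    have hlegs := graphClass_graft_legs K 0 ((U.edgeList.map (lowerEdge h U V)).flatMap blk ++
      (V.edgeList.map (upperEdge h U V)).flatMap blk) X
      (.vertex ((M.expand A).vertexOf (.inl (M.e ⟨none, 0⟩))) :: c (M.e ⟨none, 0⟩) :: A₁.map c)
      (B₁.map c) (C₁.map c) ((ℓ₀.map some).flatMap (M.rootBlock A))
      (.vertex ((M.expand A).vertexOf (.inr ⟨none, newEdge h U V, false⟩)))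
      (.half (.inr ⟨none, newEdge h U V, true⟩)) (.half (.inr ⟨none, newEdge h U V, false⟩))
    unfold baseBlock
    rw [if_pos rfl, if_pos rfl, flatMap_cons, flatMap_cons, flatMap_cons, hroot, map_append,
      map_append, hrootU, hrootV, hrootT, hnew]
    simp only [append_assoc, cons_append, nil_append, length_map, length_cons, hX, hA₁, hB₁,
      hC₁] at hlegs ⊢
    rw [hlegs, smul_smul, ← msign_add]
    congr 2
    have hp₁ : ((p - 1 : ℕ) : ZMod 2) = p + 1 := by
      have : p - 1 + 1 = p := Nat.sub_add_cancel h.2.2.1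
      rw [← this]; push_cast; linear_combination -zmod2_add_self 1
    have hmp : ((m - p : ℕ) : ZMod 2) = m + p := by
      have : m - p + p = m := Nat.sub_add_cancel h.2.2.2.1
      have h' : ((m - p + p : ℕ) : ZMod 2) = m := by rw [this]
      push_cast at h'
      linear_combination h' - zmod2_add_self (p : ZMod 2)
    push_cast
    rw [hp₁, hmp]
    rw [← sub_eq_zero]
    ring_nf
    reduce_mod_char
  · have hnew : blk (newEdge h U V) =
        [.edge ((M.expand A).edgeOf (.inr ⟨none, newEdge h U V, true⟩))] := if_neg one_ne_zero
    have hbase : ((M.split h).baseBlock (M.splitTrees h U V T) 1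
        (some none :: none :: ℓ₀.map fun i => some (some i)) (.inr false :: o.map .inl)).map
          φ.mapCell = .edge ((M.expand A).edgeOf (.inr ⟨none, newEdge h U V, true⟩)) ::
            M.baseBlock A 1 (none :: ℓ₀.map some) o := by
      unfold baseBlock
      rw [if_neg one_ne_zero, if_neg one_ne_zero, map_cons, map_cons, map_map, map_map]
      have : (M.expand A).edgeOf (.inr ⟨none, newEdge h U V, false⟩) =
          (M.expand A).edgeOf (.inr ⟨none, newEdge h U V, true⟩) := Quot.sound rfl
      exact congr (congrArg List.cons (congrArg _ this)) rfl
    have hlegs := graphClass_swap_word K 1 ((U.edgeList.map (lowerEdge h U V)).flatMap blk ++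
      (V.edgeList.map (upperEdge h U V)).flatMap blk) (M.baseBlock A 1 (none :: ℓ₀.map some) o) X
      [.edge ((M.expand A).edgeOf (.inr ⟨none, newEdge h U V, true⟩))]
    rw [hbase, hnew]
    simp only [append_assoc, cons_append, nil_append, length_singleton, hX] at hlegs ⊢
    rw [hlegs, smul_smul, ← msign_add]
    congr 2
    push_cast
    rw [← sub_eq_zero]
    ring_nf
    reduce_mod_char

end

end Marking

/-- The elements `Φ_Γ (T₁, …, T_k)` of the graph complex. -/
def graphFunctional (K : Type u) [Field K] (ε : ZMod 2) :
    GraphFunctional K ε (GraphComplex K ε) where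
  val M ℓ o T := M.graphElement T K ε ℓ o
  val_reindex M σ ℓ o T _ := M.graphElement_reindex K ε σ ℓ o T
  val_transport M φ ℓ o T _ := M.graphElement_transport K ε φ ℓ o T
  val_swap_vertices M l₁ l₂ x y o T _ := M.graphElement_swap_vertices K ε l₁ l₂ x y o T
  val_swap_edges M ℓ o₁ o₂ x y T _ := M.graphElement_swap_edges K ε ℓ o₁ o₂ x y T
  val_flip_edge M ℓ o₁ o₂ x T _ := M.graphElement_flip_edge K ε ℓ o₁ o₂ x T
  val_rotate M ℓ₀ o t T hf := M.graphElement_rotate K ε (M.two_le hf.1 none) ℓ₀ o t T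
  val_graft M ℓ₀ o _ _ _ h U V T _ := M.graphElement_graft h U V T K ε ℓ₀ o

section

variable {R S : RibbonData} {ι ι' ι₀ : Type}

/-- The orientation given by the orderings of the vertices and of the edges. -/
def Marking.baseWord (M : Marking R ι) (ε : ZMod 2) (ℓ : List ι) (o : List R.H) : List R.Cell :=
  if ε = 0 then ℓ.flatMap M.cellBlock else o.map fun h => .edge (R.edgeOf h)

theorem Marking.cellBlock_transport (M : Marking R ι) (φ : R.Iso S) (i : ι) :
    (M.transport φ).cellBlock i = (M.cellBlock i).map φ.mapCell := by
  unfold Marking.cellBlock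
  rw [map_cons, map_map]
  rfl

theorem Marking.baseWord_reindex (M : Marking R ι) (σ : ι' ≃ ι) (ε : ZMod 2) (ℓ : List ι')
    (o : List R.H) : (M.reindex σ).baseWord ε ℓ o = M.baseWord ε (ℓ.map σ) o := by
  unfold Marking.baseWord
  rw [flatMap_map]
  rfl

theorem Marking.baseWord_transport (M : Marking R ι) (φ : R.Iso S) (ε : ZMod 2) (ℓ : List ι)
    (o : List R.H) :
    (M.transport φ).baseWord ε ℓ (o.map φ.toEquiv) = (M.baseWord ε ℓ o).map φ.mapCell := by
  unfold Marking.baseWord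
  split_ifs
  · rw [map_flatMap]
    exact flatMap_congr fun i _ => M.cellBlock_transport φ i
  · rw [map_map, map_map]
    rfl

theorem Marking.mem_cellBlock (M : Marking R ι) {i : ι} {c : R.Cell} : c ∈ M.cellBlock i ↔
    c = .vertex (R.vertexOf (M.e ⟨i, 0⟩)) ∨ ∃ j, c = .half (M.e ⟨i, j⟩) := by
  unfold Marking.cellBlock
  simp only [mem_cons, mem_map, mem_finRange, true_and, eq_comm]

theorem Marking.vertexOf_e_eq_iff (M : Marking R ι) (i i' : ι) (j : Fin (M.n i + 1))
    (j' : Fin (M.n i' + 1)) : R.vertexOf (M.e ⟨i, j⟩) = R.vertexOf (M.e ⟨i', j'⟩) ↔ i = i' := by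
  constructor
  · intro h
    have := congrArg M.vertexEquiv h
    rwa [M.vertexEquiv_e, M.vertexEquiv_e] at this
  · rintro rfl
    rw [M.vertexOf_e, M.vertexOf_e i j']

theorem Marking.cellBlock_disjoint (M : Marking R ι) {i i' : ι} (h : i ≠ i') :
    (M.cellBlock i).Disjoint (M.cellBlock i') := by
  intro c hc hc'
  rcases M.mem_cellBlock.1 hc with rfl | ⟨j, rfl⟩ <;>
    rcases M.mem_cellBlock.1 hc' with hc' | ⟨j', hc'⟩
  · exact h ((M.vertexOf_e_eq_iff _ _ _ _).1 (Cell.vertex.inj hc'))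
  · cases hc'
  · cases hc'
  · exact h (congrArg Sigma.fst (M.e.injective (Cell.half.inj hc')))

theorem Marking.cellBlock_nodup (M : Marking R ι) (i : ι) : (M.cellBlock i).Nodup := by
  refine List.nodup_cons.2 ⟨?_, ?_⟩
  · rw [mem_map]
    rintro ⟨j, _, hj⟩
    cases hj
  · refine (nodup_finRange _).map fun j j' h => ?_
    exact eq_of_heq (Sigma.mk.inj (M.e.injective (Cell.half.inj h))).2

theorem Marking.length_cellBlock (M : Marking R ι) (i : ι) :
    ((M.cellBlock i).length : ZMod 2) = (M.n i : ZMod 2) := by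
  simp only [Marking.cellBlock, length_cons, length_map, length_finRange]
  push_cast
  linear_combination zmod2_add_self 1

theorem IsFrame.isOrientation {ℓ : List ι} {o : List R.H} (hf : IsFrame R ℓ o) (M : Marking R ι)
    (ε : ZMod 2) : R.IsOrientation ε (M.baseWord ε ℓ o) := by
  unfold Marking.baseWord
  split_ifs with h
  · subst h
    refine ⟨List.nodup_flatMap.2 ⟨fun i _ => M.cellBlock_nodup i, ?_⟩, fun c => ?_⟩
    · exact hf.2.imp fun h => M.cellBlock_disjoint h
    · rw [List.mem_flatMap]
      constructor
      · rintro ⟨i, _, hi⟩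
        rcases M.mem_cellBlock.1 hi with rfl | ⟨j, rfl⟩ <;> exact rfl
      · intro hc
        rcases c with v | x | e
        · obtain ⟨i, rfl⟩ := M.vertexEquiv.symm.surjective v
          exact ⟨i, hf.3 i, M.mem_cellBlock.2 (Or.inl rfl)⟩
        · obtain ⟨⟨i, j⟩, rfl⟩ := M.e.surjective x
          exact ⟨i, hf.3 i, M.mem_cellBlock.2 (Or.inr ⟨j, rfl⟩)⟩
        · exact absurd hc (by change ¬((0 : ZMod 2) = 1); decide)
  · obtain rfl : ε = 1 := (zmod2_cases ε).resolve_left h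
    have e : (o.map fun h => (Cell.edge (R.edgeOf h) : R.Cell)) =
        (o.map R.edgeOf).map .edge := by rw [map_map]; rfl
    rw [e]
    refine ⟨hf.4.1.map fun a b h => Cell.edge.inj h, fun c => ?_⟩
    rw [mem_map]
    constructor
    · rintro ⟨e, _, rfl⟩
      exact rfl
    · intro hc
      rcases c with v | x | e
      · exact absurd hc (by change ¬((1 : ZMod 2) = 0); decide)
      · exact absurd hc (by change ¬((1 : ZMod 2) = 0); decide)
      · exact ⟨e, hf.4.2 e, rfl⟩

theorem wordSign_swap_blocks {α : Type*} (a b : List α) {u v : List α} (h : u.Disjoint v) :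
    wordSign (fun _ => 1) (a ++ u ++ v ++ b) = wordSign (fun _ => 1) (a ++ v ++ u ++ b) +
      (u.length : ZMod 2) * v.length := by
  rw [wordSign_swap_word _ a b h]
  simp

end

namespace GraphFunctional

variable {K : Type u} [Field K] {ε : ZMod 2} {W : Type*} [AddCommGroup W] [Module K W]
  (F : GraphFunctional K ε W) {R S : RibbonData} {ι ι' ι₀ : Type} [Fintype ι] [Fintype ι']
  [Fintype ι₀]

/-- The value of a functional on the graph with orientation `⟨w⟩`. -/
def normal (M : Marking R ι) (ℓ : List ι) (o : List R.H) (w : List R.Cell) : W :=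
  msign K (∑ i, (M.n i : ZMod 2) + wordSign (fun _ => 1) w +
    wordSign (fun _ => 1) (M.baseWord ε ℓ o)) • F.val M ℓ o fun i => PlanarTree.corolla (M.n i)

theorem normal_reindex (M : Marking R ι) (σ : ι' ≃ ι) {ℓ : List ι'} {o : List R.H}
    (hf : IsFrame R ℓ o) (w : List R.Cell) :
    F.normal (M.reindex σ) ℓ o w = F.normal M (ℓ.map σ) o w := by
  unfold normal
  rw [M.baseWord_reindex, ← F.val_reindex M σ ℓ o _ hf]
  congr 3
  congr 1
  exact σ.sum_comp fun i => (M.n i : ZMod 2)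

theorem normal_transport (M : Marking R ι) (φ : R.Iso S) {ℓ : List ι} {o : List R.H}
    (hf : IsFrame R ℓ o) {w : List R.Cell} (hw : R.IsOrientation ε w) :
    F.normal (M.transport φ) ℓ (o.map φ.toEquiv) (w.map φ.mapCell) = F.normal M ℓ o w := by
  have ho := hf.isOrientation M ε
  have hp : w.Perm (M.baseWord ε ℓ o) :=
    (perm_ext_iff_of_nodup hw.1 ho.1).2 fun c => (hw.2 c).trans (ho.2 c).symm
  have h := wordSign_map (fun _ => 1) φ.mapCell_injective hw.1 hp
  unfold normal
  rw [M.baseWord_transport]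
  refine congr (congrArg _ (congrArg _ ?_)) (F.val_transport M φ ℓ o _ hf)
  change ∑ i, (M.n i : ZMod 2) + _ + _ = _
  linear_combination h + zmod2_add_self (wordSign (fun _ => 1) ((M.baseWord ε ℓ o).map φ.mapCell))
    - zmod2_add_self (wordSign (fun _ => 1) w)

theorem degree_corolla (n : ℕ) : (PlanarTree.corolla n).degree 2 = (n : ZMod 2) := by
  rw [PlanarTree.degree_two]
  simp [PlanarTree.corolla]

theorem normal_perm_vertices (M : Marking R ι) {ℓ ℓ' : List ι} {o : List R.H}
    (hf : IsFrame R ℓ o) (w : List R.Cell) (h : ℓ.Perm ℓ') :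
    F.normal M ℓ o w = F.normal M ℓ' o w := by
  refine eq_of_perm_of_swap (fun ℓ => F.normal M ℓ o w) (fun l₁ x y l₂ hp => ?_) h
  have hf' := hf.perm hp
  unfold normal
  rw [F.val_swap_vertices M l₁ l₂ x y o _ hf', smul_smul, ← msign_add, degree_corolla,
    degree_corolla]
  congr 2
  unfold Marking.baseWord
  rcases zmod2_cases ε with rfl | rfl
  · have := wordSign_swap_blocks (l₁.flatMap M.cellBlock) (l₂.flatMap M.cellBlock)
      (M.cellBlock_disjoint (ne_of_nodup_perm hf.2 hp))
    rw [M.length_cellBlock, M.length_cellBlock] at this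
    simp only [if_true, flatMap_append, flatMap_cons, append_assoc] at this ⊢
    rw [this, ← sub_eq_zero]
    ring_nf
    reduce_mod_char
  · rw [if_neg one_ne_zero, if_neg one_ne_zero, ← sub_eq_zero]
    ring_nf
    reduce_mod_char

theorem normal_perm_edges (M : Marking R ι) {ℓ : List ι} {o o' : List R.H}
    (hf : IsFrame R ℓ o) (w : List R.Cell) (h : o.Perm o') :
    F.normal M ℓ o w = F.normal M ℓ o' w := by
  refine eq_of_perm_of_swap (fun o => F.normal M ℓ o w) (fun l₁ x y l₂ hp => ?_) h
  have hf' := hf.permEdges hp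
  unfold normal
  rw [F.val_swap_edges M ℓ l₁ l₂ x y _ hf', smul_smul, ← msign_add]
  congr 2
  unfold Marking.baseWord
  rcases zmod2_cases ε with rfl | rfl
  · simp
  · have hne : (Cell.edge (R.edgeOf x) : R.Cell) ≠ .edge (R.edgeOf y) := by
      intro e
      have h1 := hf'.4.1
      rw [map_append, map_cons, map_cons, Cell.edge.inj e] at h1
      have h2 := (List.nodup_append.1 h1).2.1
      simp at h2
    rw [if_neg one_ne_zero, if_neg one_ne_zero, map_append, map_append]
    simp only [map_cons]
    rw [wordSign_swap _ _ _ hne, ← sub_eq_zero]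
    ring_nf
    reduce_mod_char

theorem normal_flip_edges (M : Marking R ι) {ℓ : List ι} (w : List R.Cell) {o o' : List R.H}
    (h : List.Forall₂ (fun x y => R.edgeOf x = R.edgeOf y) o o') :
    ∀ a : List R.H, IsFrame R ℓ (a ++ o) →
      F.normal M ℓ (a ++ o) w = F.normal M ℓ (a ++ o') w := by
  induction h with
  | nil => exact fun _ _ => rfl
  | @cons x y o o' hxy _ ih =>
    intro a hf
    have hf' : IsFrame R ℓ (a ++ y :: o) := by
      refine ⟨hf.1, hf.2, hf.3, ?_⟩
      have := hf.4
      unfold IsEdgeOrder at this ⊢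
      simpa only [map_append, map_cons, hxy] using this
    have h1 : F.normal M ℓ (a ++ x :: o) w = F.normal M ℓ (a ++ y :: o) w := by
      rcases (IsFrame.edgeOf_eq_iff hf.1).1 hxy with rfl | rfl
      · rfl
      · unfold normal
        rw [F.val_flip_edge M ℓ a o x _ hf]
        unfold Marking.baseWord
        simp only [map_append, map_cons, hxy]
    rw [h1]
    simpa using ih (a ++ [y]) (by simpa using hf')

theorem normal_edges (M : Marking R ι) {ℓ : List ι} (w : List R.Cell) {o o' : List R.H}
    (hf : IsFrame R ℓ o) (ho' : IsEdgeOrder R o') : F.normal M ℓ o w = F.normal M ℓ o' w := by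
  have hp : (o.map R.edgeOf).Perm (o'.map R.edgeOf) :=
    (perm_ext_iff_of_nodup hf.4.1 ho'.1).2 fun c => ⟨fun _ => ho'.2 c, fun _ => hf.4.2 c⟩
  have hr : List.Forall₂ (fun a b => a = R.edgeOf b) (o'.map R.edgeOf) o' := by
    rw [List.forall₂_map_left_iff]
    exact List.forall₂_same.2 fun _ _ => rfl
  obtain ⟨u, hu, hu'⟩ := List.perm_comp_forall₂ hp hr
  rw [List.forall₂_map_left_iff] at hu
  have hf' : IsFrame R ℓ o' := ⟨hf.1, hf.2, hf.3, ho'⟩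
  have h1 := F.normal_flip_edges M w hu [] hf
  have h2 := F.normal_perm_edges M hf' w hu'.symm
  simp only [nil_append] at h1
  rw [h1, h2]

theorem rotate_corolla (n : ℕ) : (PlanarTree.corolla n).rotate = PlanarTree.corolla n :=
  PlanarTree.ext (Finset.image_empty _)

theorem rotationSign_corolla (n : ℕ) : (PlanarTree.corolla n).rotationSign = n := by
  have : (PlanarTree.corolla n).stdOrientation = [] := by
    have h : ((PlanarTree.corolla n).edgeList).length = 0 := Marking.length_edgeList
      (M := (⟨fun _ => n, Equiv.refl _, fun _ _ => rfl⟩ :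
        Marking ⟨Σ _ : Unit, Fin (n + 1), fun x => ⟨x.1, x.2 + 1⟩, id⟩ Unit))
      (fun _ => PlanarTree.corolla n) ()
    unfold PlanarTree.stdOrientation
    rw [List.length_eq_zero_iff.1 h]
    rfl
  unfold PlanarTree.rotationSign
  rw [this]
  simp [inversions]

/-- Rotating the names of the half-edges at a vertex with `n + 1` half-edges changes the word of
cells by a sign. -/
theorem _root_.CyclicTensor.Marking.wordSign_cellBlock_rotate (M : Marking R (Option ι₀))
    (ℓ₀ : List ι₀) :
    wordSign (fun _ => 1)
        ((none :: ℓ₀.map some).flatMap (M.rotate (optCons 1 fun _ => 0)).cellBlock) =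
      wordSign (fun _ => 1) ((none :: ℓ₀.map some).flatMap M.cellBlock) + (M.n none : ZMod 2) := by
  let v : R.Cell := .vertex (R.vertexOf (M.e ⟨none, 0⟩))
  let c : Fin (M.n none + 1) → R.Cell := fun j => .half (M.e ⟨none, j⟩)
  have hc : Function.Injective c := fun j j' h =>
    eq_of_heq (Sigma.mk.inj (M.e.injective (Cell.half.inj h))).2
  let Z := (ℓ₀.map some).flatMap M.cellBlock
  have e₁ : (none :: ℓ₀.map some).flatMap M.cellBlock =
      [v] ++ (finRange (M.n none)).map (fun j => c j.castSucc) ++ [c (Fin.last _)] ++ Z := by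
    rw [flatMap_cons]
    unfold Marking.cellBlock
    rw [Marking.map_finRange_castSucc]
    simp only [append_assoc, cons_append, nil_append]
    rfl
  have e₂ : (none :: ℓ₀.map some).flatMap (M.rotate (optCons 1 fun _ => 0)).cellBlock =
      [v] ++ [c (Fin.last _)] ++ (finRange (M.n none)).map (fun j => c j.castSucc) ++ Z := by
    rw [flatMap_cons]
    have h1 : (M.rotate (optCons 1 fun _ => 0)).cellBlock none =
        v :: (finRange (M.n none + 1)).map (fun j => c (j - 1)) := by
      refine congr (congrArg List.cons ?_) rfl
      exact congrArg Cell.vertex (M.vertexOf_e none (0 - 1))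
    have h2 : (ℓ₀.map some).flatMap (M.rotate (optCons 1 fun _ => 0)).cellBlock = Z := by
      refine flatMap_congr fun i hi => ?_
      obtain ⟨i, _, rfl⟩ := List.mem_map.1 hi
      have : ∀ j, (M.rotate (optCons 1 fun _ => 0)).e ⟨some i, j⟩ = M.e ⟨some i, j⟩ := fun j =>
        congrArg (fun j => M.e ⟨some i, j⟩) (sub_zero j)
      unfold Marking.cellBlock
      refine congr (congrArg List.cons ?_) (map_congr_left fun j _ => ?_)
      · exact congrArg (fun h => Cell.vertex (R.vertexOf h)) (this 0)
      · exact congrArg Cell.half (this j)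
    rw [h1, h2, Marking.map_finRange_sub_one]
    simp
  have hd : ([c (Fin.last _)] : List R.Cell).Disjoint
      ((finRange (M.n none)).map fun j => c j.castSucc) := by
    intro x hx hx'
    obtain ⟨j, _, rfl⟩ := List.mem_map.1 hx'
    exact (Fin.castSucc_lt_last j).ne (hc (List.mem_singleton.1 hx))
  have := wordSign_swap_blocks [v] Z hd
  rw [e₁, e₂, this]
  simp only [length_singleton, length_map, length_finRange, Nat.cast_one, one_mul]

theorem normal_rotate_none (M : Marking R (Option ι₀)) {ℓ₀ : List ι₀} {o : List R.H}
    (hf : IsFrame R (none :: ℓ₀.map some) o) (w : List R.Cell) :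
    F.normal (M.rotate (optCons 1 fun _ => 0)) (none :: ℓ₀.map some) o w =
      F.normal M (none :: ℓ₀.map some) o w := by
  have h := F.val_rotate M ℓ₀ o (PlanarTree.corolla _) (fun _ => PlanarTree.corolla _) hf
  have e : ∀ t : PlanarTree (M.n none), t = PlanarTree.corolla _ →
      optTrees M t (fun _ => PlanarTree.corolla _) =
        fun i => PlanarTree.corolla (M.n i) := by
    rintro t rfl
    funext i
    cases i <;> rfl
  rw [e _ (rotate_corolla _), e _ rfl, rotationSign_corolla] at h
  unfold normal
  refine (congrArg _ h).trans ?_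
  rw [smul_smul, ← msign_add]
  congr 2
  unfold Marking.baseWord
  rcases zmod2_cases ε with rfl | rfl
  · rw [if_pos rfl, if_pos rfl, M.wordSign_cellBlock_rotate, ← sub_eq_zero]
    change ∑ i, (M.n i : ZMod 2) + _ + _ + _ - _ = _
    ring_nf
    reduce_mod_char
  · rw [if_neg one_ne_zero, if_neg one_ne_zero, ← sub_eq_zero]
    change ∑ i, (M.n i : ZMod 2) + _ + _ + _ - _ = _
    ring_nf
    reduce_mod_char

theorem normal_rotate_single [DecidableEq ι] (M : Marking R ι) (x : ι) {ℓ : List ι} {o : List R.H}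
    (hf : IsFrame R ℓ o) (w : List R.Cell) :
    F.normal (M.rotate (Pi.single x 1)) ℓ o w = F.normal M ℓ o w := by
  let σ := Equiv.optionSubtypeNe x
  have hσ : σ none = x := Equiv.optionSubtypeNe_none x
  let ℓ₁ : List (Option {i // i ≠ x}) := ℓ.map σ.symm
  have hℓ₁ : IsFrame R ℓ₁ o := hf.map σ.symm
  obtain ⟨ℓ₂, hℓ₂⟩ := exists_list_of_perm_cons hℓ₁.2 (hℓ₁.3 none)
  have hf₂ := hℓ₁.perm hℓ₂
  obtain ⟨ℓ₀, rfl⟩ := exists_eq_map_some (List.nodup_cons.1 hf₂.2).1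
  have hmap : ℓ = ℓ₁.map σ := by simp [ℓ₁]
  have hrot : (M.rotate (Pi.single x 1)).reindex σ = (M.reindex σ).rotate (optCons 1 fun _ => 0) := by
    refine Marking.ext rfl (heq_of_eq (Equiv.ext ?_))
    rintro ⟨i, j⟩
    have key : (Pi.single x 1 : ∀ i, Fin (M.n i + 1)) (σ i) =
        (optCons (β := fun i => Fin (M.n (σ i) + 1)) 1 (fun _ => 0)) i := by
      rcases i with _ | i
      · have : ∀ y, y = x → (Pi.single x 1 : ∀ i, Fin (M.n i + 1)) y = 1 := by
          rintro y rfl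
          exact Pi.single_eq_same _ _
        exact this _ hσ
      · exact Pi.single_eq_of_ne i.2 _
    have hsub : ∀ (j c c' : Fin (M.n (σ i) + 1)), c = c' → M.e ⟨σ i, j - c⟩ = M.e ⟨σ i, j - c'⟩ := by
      rintro j c _ rfl
      rfl
    exact hsub j _ _ key
  rw [hmap, ← F.normal_reindex _ σ hℓ₁, ← F.normal_reindex _ σ hℓ₁, hrot,
    F.normal_perm_vertices _ hℓ₁ w hℓ₂, F.normal_perm_vertices _ hℓ₁ w hℓ₂,
    F.normal_rotate_none _ hf₂]

theorem normal_rotate (M : Marking R ι) (c : ∀ i, Fin (M.n i + 1)) {ℓ : List ι} {o : List R.H}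
    (hf : IsFrame R ℓ o) (w : List R.Cell) :
    F.normal (M.rotate c) ℓ o w = F.normal M ℓ o w := by
  classical
  obtain ⟨n, e, h⟩ := M
  let P : AddSubmonoid (∀ i, Fin (n i + 1)) :=
    { carrier := {c | ∀ e h, F.normal ((⟨n, e, h⟩ : Marking R ι).rotate c) ℓ o w =
        F.normal ⟨n, e, h⟩ ℓ o w}
      zero_mem' := by
        intro e h
        congr 1
        refine Marking.ext rfl (heq_of_eq (Equiv.ext ?_))
        rintro ⟨i, j⟩
        exact congrArg (fun j => e ⟨i, j⟩) (sub_zero j)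
      add_mem' := by
        intro c c' hc hc' e h
        rw [← hc e h]
        refine Eq.trans ?_ (hc' _ ((⟨n, e, h⟩ : Marking R ι).rotate c).rot_e)
        congr 1
        refine Marking.ext rfl (heq_of_eq (Equiv.ext ?_))
        rintro ⟨i, j⟩
        have hsub : ∀ j : Fin (n i + 1), j - (c i + c' i) = j - c' i - c i := fun j => by abel
        exact congrArg (fun j => e ⟨i, j⟩) (hsub j) }
  have hP : c ∈ P := by
    rw [← Finset.univ_sum_single c]
    refine P.sum_mem fun i _ => ?_
    have hs : ∀ a : ℕ, Pi.single i (a • (1 : Fin (n i + 1))) ∈ P := by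
      intro a
      induction a with
      | zero =>
        rw [zero_nsmul, Pi.single_zero]
        exact P.zero_mem
      | succ a ih =>
        rw [succ_nsmul, Pi.single_add]
        exact P.add_mem ih fun e h => F.normal_rotate_single ⟨n, e, h⟩ i hf w
    have := hs (c i).1
    rwa [Marking.fin_val_nsmul_one] at this
  exact hP e h

theorem exists_eq_rotate (M M' : Marking R ι)
    (h : ∀ i, R.vertexOf (M'.e ⟨i, 0⟩) = R.vertexOf (M.e ⟨i, 0⟩)) : ∃ c, M' = M.rotate c := by
  have hv : ∀ x, M'.vertexEquiv x = M.vertexEquiv x := by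
    intro x
    obtain ⟨i, rfl⟩ := M'.vertexEquiv.symm.surjective x
    rw [Equiv.apply_symm_apply]
    refine Eq.symm (Eq.trans (congrArg _ (h i)) (M.vertexEquiv_e i 0))
  have hfib : ∀ (M : Marking R ι) (i : ι), Nat.card {x : R.H // M.vertexEquiv (R.vertexOf x) = i} =
      M.n i + 1 := by
    intro M i
    rw [← Nat.card_fin (M.n i + 1)]
    refine (Nat.card_congr (Equiv.ofBijective
      (fun j => ⟨M.e ⟨i, j⟩, M.vertexEquiv_e i j⟩) ⟨?_, ?_⟩)).symm
    · intro j j' hj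
      exact eq_of_heq (Sigma.mk.inj (M.e.injective (congrArg Subtype.val hj))).2
    · rintro ⟨x, hx⟩
      obtain ⟨⟨i', j⟩, rfl⟩ := M.e.surjective x
      rw [M.vertexEquiv_e] at hx
      subst hx
      exact ⟨j, rfl⟩
  have hn : M'.n = M.n := by
    funext i
    have h1 := hfib M i
    have h2 := hfib M' i
    simp only [hv] at h2
    omega
  obtain ⟨n, e, he⟩ := M
  obtain ⟨n', e', he'⟩ := M'
  obtain rfl : n' = n := hn
  have h0 : ∀ i, ∃ j, e' ⟨i, 0⟩ = e ⟨i, j⟩ := by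
    intro i
    obtain ⟨⟨i', j⟩, hj⟩ := e.surjective (e' ⟨i, 0⟩)
    have := h i
    change R.vertexOf (e' ⟨i, 0⟩) = R.vertexOf (e ⟨i, 0⟩) at this
    rw [← hj] at this
    obtain rfl : i' = i := ((⟨n', e, he⟩ : Marking R ι).vertexOf_e_eq_iff _ _ _ _).1 this
    exact ⟨j, hj.symm⟩
  choose j hj using h0
  refine ⟨fun i => -j i, Marking.ext rfl (heq_of_eq (Equiv.ext ?_))⟩
  rintro ⟨i, k⟩
  have key : ∀ a : ℕ, e' ⟨i, a • 1⟩ = e ⟨i, a • 1 + j i⟩ := by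
    intro a
    induction a with
    | zero => rw [zero_smul, zero_add]; exact hj i
    | succ a ih =>
      rw [succ_nsmul, ← he', ih, he, add_right_comm]
  have := key k.1
  rw [Marking.fin_val_nsmul_one] at this
  refine this.trans ?_
  change e ⟨i, k + j i⟩ = e ⟨i, k - -j i⟩
  rw [sub_neg_eq_add]

/-- The value of a functional on an oriented graph does not depend on the choices. -/
theorem normal_eq (M : Marking R ι) (M' : Marking R ι') {ℓ : List ι} {ℓ' : List ι'}
    {o o' : List R.H} (hf : IsFrame R ℓ o) (hf' : IsFrame R ℓ' o') (w : List R.Cell) :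
    F.normal M ℓ o w = F.normal M' ℓ' o' w := by
  let σ : ι' ≃ ι := M'.vertexEquiv.symm.trans M.vertexEquiv
  have h1 : ℓ.Perm (ℓ'.map σ) := (perm_ext_iff_of_nodup hf.2 (hf'.map σ).2).2 fun i =>
    ⟨fun _ => (hf'.map σ).3 i, fun _ => hf.3 i⟩
  obtain ⟨c, hc⟩ := exists_eq_rotate M' (M.reindex σ) fun i => by
    have h2 : M.vertexEquiv.symm (σ i) = M'.vertexEquiv.symm i := by simp [σ]
    exact h2
  rw [F.normal_perm_vertices M hf w h1, F.normal_edges M w (hf.perm h1) hf'.4,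
    ← F.normal_reindex M σ hf', hc, F.normal_rotate _ _ hf']

end GraphFunctional

/-! ### Existence of markings and orderings -/

namespace RibbonData

variable {R : RibbonData}

theorem IsRibbonGraph.mem_periodicPts (hR : R.IsRibbonGraph) (x : R.H) :
    x ∈ Function.periodicPts R.rot := by
  obtain ⟨i, j, hij, h⟩ := Finite.exists_ne_map_eq_of_infinite fun a : ℕ => R.rot^[a] x
  wlog hlt : i < j generalizing i j
  · exact this j i hij.symm h.symm (by omega)
  refine Function.mk_mem_periodicPts (n := j - i) (by omega) ?_
  refine (hR.rot_bijective.1.iterate i) ?_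
  rw [← Function.iterate_add_apply, show i + (j - i) = j by omega]
  exact h.symm

theorem IsRibbonGraph.exists_iterate (hR : R.IsRibbonGraph) {x y : R.H}
    (h : R.vertexOf x = R.vertexOf y) : ∃ k, R.rot^[k] x = y := by
  have := Quot.eqvGen_exact h
  clear h
  induction this with
  | rel x y h => exact ⟨1, h⟩
  | refl x => exact ⟨0, rfl⟩
  | symm x y _ ih =>
    obtain ⟨k, rfl⟩ := ih
    have hp := Function.minimalPeriod_pos_of_mem_periodicPts (hR.mem_periodicPts x)
    obtain ⟨c, hc⟩ : ∃ c, k ≤ c * Function.minimalPeriod R.rot x :=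
      ⟨k, Nat.le_mul_of_pos_right k hp⟩
    refine ⟨c * Function.minimalPeriod R.rot x - k, ?_⟩
    rw [← Function.iterate_add_apply, Nat.sub_add_cancel hc]
    exact ((Function.isPeriodicPt_minimalPeriod R.rot x).const_mul c)
  | trans x y z _ _ ih₁ ih₂ =>
    obtain ⟨k, rfl⟩ := ih₁
    obtain ⟨l, rfl⟩ := ih₂
    exact ⟨l + k, Function.iterate_add_apply _ _ _ _⟩

/-- Every ribbon graph has a marking. -/
theorem IsRibbonGraph.exists_labelling (hR : R.IsRibbonGraph) : Nonempty (Labelling R) := by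
  classical
  have hr : ∀ v : R.Vertex, ∃ x, R.vertexOf x = v := fun v => Quot.exists_rep v
  choose r hout using hr
  let s : R.Vertex → ℕ := fun v => Function.minimalPeriod R.rot (r v)
  have hs : ∀ v, s v - 1 + 1 = s v := fun v => Nat.sub_add_cancel
    (Function.minimalPeriod_pos_of_mem_periodicPts (hR.mem_periodicPts _))
  have hit : ∀ (a : ℕ) x, R.vertexOf (R.rot^[a] x) = R.vertexOf x := by
    intro a x
    induction a with
    | zero => rfl
    | succ a ih =>
      have h : ∀ y, R.vertexOf y = R.vertexOf (R.rot y) := fun y => Quot.sound rfl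
      rw [Function.iterate_succ_apply', ← h, ih]
  let g : (Σ v : R.Vertex, Fin (s v - 1 + 1)) → R.H := fun p => R.rot^[p.2.1] (r p.1)
  have hg : Function.Bijective g := by
    constructor
    · rintro ⟨v, j⟩ ⟨v', j'⟩ h
      have hv : v = v' := by
        rw [← hout v, ← hout v', ← hit j.1 (r v), ← hit j'.1 (r v')]
        exact congrArg R.vertexOf h
      subst hv
      have h1 := j.2
      have h2 := j'.2
      have := Function.iterate_injOn_Iio_minimalPeriod (f := R.rot) (x := r v)
        (h1.trans_eq (hs v)) (h2.trans_eq (hs v)) h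
      rw [Fin.ext this]
    · intro x
      obtain ⟨k, hk⟩ := hR.exists_iterate (hout (R.vertexOf x))
      refine ⟨⟨R.vertexOf x, ⟨k % s (R.vertexOf x), ?_⟩⟩, ?_⟩
      · rw [hs]
        exact Nat.mod_lt _ (by have := hs (R.vertexOf x); omega)
      · exact (Function.iterate_mod_minimalPeriod_eq).trans hk
  have : Finite R.Vertex := Quot.finite _
  let τ : Fin (Nat.card R.Vertex) ≃ R.Vertex := (Finite.equivFin R.Vertex).symm
  let M : Marking R R.Vertex :=
    { n := fun v => s v - 1
      e := Equiv.ofBijective g hg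
      rot_e := by
        intro v j
        change R.rot (R.rot^[j.1] (r v)) = R.rot^[(j + 1).1] (r v)
        rw [← Function.iterate_succ_apply' R.rot, Fin.val_add_one]
        split_ifs with h
        · have h1 := congrArg Fin.val h
          rw [Fin.val_last] at h1
          rw [h1, Nat.succ_eq_add_one, hs]
          exact Function.isPeriodicPt_minimalPeriod R.rot (r v)
        · rfl }
  exact ⟨⟨Nat.card R.Vertex, (M.reindex τ).n, (M.reindex τ).e, (M.reindex τ).rot_e⟩⟩

/-- The edges of a graph can be ordered. -/
theorem exists_isEdgeOrder (R : RibbonData) : ∃ o, IsEdgeOrder R o := by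
  classical
  have : Finite R.Edge := Quot.finite _
  let := Fintype.ofFinite R.Edge
  have hr : ∀ e : R.Edge, ∃ x, R.edgeOf x = e := fun e => Quot.exists_rep e
  choose r hr using hr
  have h : ((Finset.univ : Finset R.Edge).toList.map r).map R.edgeOf =
      (Finset.univ : Finset R.Edge).toList := by
    rw [map_map]
    exact (map_congr_left fun c _ => hr c).trans (List.map_id _)
  refine ⟨(Finset.univ : Finset R.Edge).toList.map r, ?_, ?_⟩
  · rw [h]
    exact Finset.nodup_toList _
  · intro c
    rw [h]
    simp

end RibbonData

theorem IsFrame.transport {R S : RibbonData} {ι : Type} {ℓ : List ι} {o : List R.H}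
    (hf : IsFrame R ℓ o) (φ : R.Iso S) : IsFrame S ℓ (o.map φ.toEquiv) := by
  refine ⟨φ.isRibbonGraph hf.1, hf.2, hf.3, ?_⟩
  let g : R.Edge → S.Edge := Quot.map φ.toEquiv fun a b h => by rw [← h, φ.map_inv]
  have hg : Function.Injective g := fun a b h =>
    Cell.edge.inj (φ.mapCell_injective (congrArg Cell.edge h))
  have e : (o.map φ.toEquiv).map S.edgeOf = (o.map R.edgeOf).map g := by
    rw [map_map, map_map]
    rfl
  refine ⟨e ▸ hf.4.1.map hg, fun c => ?_⟩
  rw [e]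
  obtain ⟨x, rfl⟩ := Quot.exists_rep c
  refine List.mem_map.2 ⟨R.edgeOf (φ.toEquiv.symm x), hf.4.2 _, ?_⟩
  exact congrArg S.edgeOf (φ.toEquiv.apply_symm_apply x)

theorem Labelling.isFrame {R : RibbonData} (hR : R.IsRibbonGraph) (L : Labelling R) {o : List R.H}
    (ho : IsEdgeOrder R o) : IsFrame R (finRange L.k) o :=
  ⟨hR, nodup_finRange _, mem_finRange, ho⟩

/-- A marking and orderings of the vertices and edges. -/
theorem RibbonData.IsRibbonGraph.exists_frame {R : RibbonData} (hR : R.IsRibbonGraph) :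
    ∃ (L : Labelling R) (o : List R.H), IsFrame R (finRange L.k) o := by
  obtain ⟨L⟩ := hR.exists_labelling
  obtain ⟨o, ho⟩ := R.exists_isEdgeOrder
  exact ⟨L, o, L.isFrame hR ho⟩

/-! ### Graphs with corollas for vertices -/

theorem TreeHalf.next_corolla {n : ℕ} (hn : 2 ≤ n) (j : Fin (n + 1)) :
    TreeHalf.next (T := PlanarTree.corolla n) (.inl j) = .inl (j + 1) := by
  have hj := j.2
  have hf : TreeHalf.Follows (T := PlanarTree.corolla n) (.inl j) (.inl (j + 1)) := by
    refine ⟨?_, ?_⟩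
    · simp only [TreeHalf.start_inl, TreeHalf.length_inl, Fin.val_add]
      rw [Fin.val_one', Nat.add_mod_mod]
    · simp only [TreeHalf.length_inl]
      omega
  refine TreeHalf.next_eq hf ?_
  rintro (k | ⟨⟨f, hf⟩, _⟩) _
  · exact le_rfl
  · simp [PlanarTree.corolla] at hf

namespace Marking

variable {R : RibbonData} {ι : Type} [Fintype ι]

/-- Replacing all vertices by corollas does not change a graph. -/
def corollaIso (hR : R.IsRibbonGraph) (M : Marking R ι) :
    (M.expand fun i => PlanarTree.corolla (M.n i)).Iso R :=
  haveI : IsEmpty (Σ i, (PlanarTree.corolla (M.n i)).Edge × Bool) :=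
    ⟨fun x => absurd x.2.1.2 (Finset.notMem_empty _)⟩
  expandIso (Equiv.sumEmpty R.H _)
    (by
      rintro i (j | ⟨⟨f, hf⟩, _⟩)
      · rw [TreeHalf.next_corolla (M.two_le hR i)]
        exact (M.rot_e i j).symm
      · exact absurd hf (Finset.notMem_empty _))
    (by
      rintro (h | x)
      · rfl
      · exact isEmptyElim x)

theorem graphElement_corolla (K : Type u) [Field K] (ε : ZMod 2) (hR : R.IsRibbonGraph)
    (M : Marking R ι) (ℓ : List ι) (o : List R.H) :
    M.graphElement (fun i => PlanarTree.corolla (M.n i)) K ε ℓ o =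
      msign K (∑ i, (M.n i : ZMod 2)) • graphClass K ε R (M.baseWord ε ℓ o) := by
  have h0 : ∀ i, (PlanarTree.corolla (M.n i)).edgeList = [] := fun i =>
    List.length_eq_zero_iff.1 (M.length_edgeList (fun i => PlanarTree.corolla (M.n i)) i)
  have h1 : ∀ i, M.treeBlock (fun i => PlanarTree.corolla (M.n i)) ε i = [] := by
    intro i
    unfold treeBlock
    rw [h0]
    split_ifs <;> rfl
  have h2 : pairSum (fun i j => (M.n i : ZMod 2) *
      ((PlanarTree.corolla (M.n j)).edges.card : ZMod 2)) ℓ = 0 := by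
    refine (pairSum_congr (s' := fun _ _ => (0 : ZMod 2) * 0) fun x _ y _ => ?_).trans ?_
    · simp [PlanarTree.corolla]
    · rw [pairSum_mul_left, zero_mul]
  unfold graphElement
  rw [h2, add_zero, graphClass_iso K ε (M.corollaIso hR)]
  congr 2
  have h3 : ℓ.flatMap (M.treeBlock (fun i => PlanarTree.corolla (M.n i)) ε) = [] :=
    List.flatMap_eq_nil_iff.2 fun i _ => h1 i
  rw [h3, nil_append]
  unfold baseBlock baseWord
  split_ifs
  · rw [map_flatMap]
    refine flatMap_congr fun i _ => ?_
    unfold rootBlock cellBlock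
    rw [map_cons, map_map]
    rfl
  · rw [map_map]
    rfl

end Marking

theorem treesToGraph_eq (K : Type u) [Field K] (ε : ZMod 2) {R : RibbonData} (L : Labelling R)
    (o : List R.H) (T : ∀ i, PlanarTree (L.n i)) :
    treesToGraph K ε L o T = L.marking.graphElement T K ε (finRange L.k) o := by
  have key : graphClass K ε (L.expand T) (L.expandedOrientation T ε o) =
      graphClass K ε (L.marking.expand T) ((finRange L.k).flatMap (L.marking.treeBlock T ε) ++
          L.marking.baseBlock T ε (finRange L.k) o) := by
    have hg : ∀ i x, L.glue T i x = L.marking.glue T i x := by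
      rintro i (j | p) <;> rfl
    let φ : (L.expand T).Iso (L.marking.expand T) :=
      { toEquiv := Equiv.refl _
        map_rot := by
          rintro (h | p)
          · exact hg _ _
          · exact hg _ _
        map_inv := by rintro (h | p) <;> rfl }
    rw [graphClass_iso K ε φ]
    congr 1
    unfold Labelling.expandedOrientation Marking.treeBlock Marking.baseBlock
    split_ifs
    · rw [map_append, map_flatMap, map_flatMap]
      refine congr (congrArg _ (flatMap_congr fun i _ => ?_))
        (flatMap_congr fun i _ => ?_)
      · rw [map_flatMap]
        rfl
      · unfold Marking.rootBlock
        rw [map_cons, map_map]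
        rfl
    · rw [map_append, map_flatMap, map_map]
      refine congr (congrArg _ (flatMap_congr fun i _ => ?_)) rfl
      rw [map_map]
      rfl
  unfold treesToGraph Marking.graphElement
  rw [key]
  congr 2
  · congr 1
    · refine sum_congr rfl fun i _ => ?_
      rw [show (2 : ZMod 2) = 0 from rfl, sub_zero]
      rfl
    · exact sum_sum_eq_pairSum fun i j => (L.n i : ZMod 2) * ((T j).edges.card : ZMod 2)

/-! ### Functionals and linear maps -/

namespace GraphFunctional

variable {K : Type u} [Field K] {ε : ZMod 2} {W : Type*} [AddCommGroup W] [Module K W]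
  (F : GraphFunctional K ε W)

/-- The value of a functional on an oriented graph. -/
def onGraph (G : OrientedGraph ε) : W :=
  F.normal G.isRibbonGraph.exists_frame.choose.marking (finRange _)
    G.isRibbonGraph.exists_frame.choose_spec.choose G.orientation

theorem onGraph_eq (G : OrientedGraph ε) {ι : Type} [Fintype ι] (M : Marking G.graph ι)
    {ℓ : List ι} {o : List G.graph.H} (hf : IsFrame G.graph ℓ o) :
    F.onGraph G = F.normal M ℓ o G.orientation :=
  F.normal_eq _ M G.isRibbonGraph.exists_frame.choose_spec.choose_spec hf _

/-- The linear form on the graph complex given by a functional. -/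
def toLinearMap : GraphComplex K ε →ₗ[K] W :=
  Submodule.liftQ _ (linearCombination K F.onGraph) (by
    rw [Submodule.span_le]
    rintro x (⟨R, hR, l₁, l₂, a, b, h, h'⟩ | ⟨G, G', φ, h⟩)
    · obtain ⟨L, o, hf⟩ := hR.exists_frame
      have hab : a ≠ b := by
        rintro rfl
        have := (List.nodup_append.1 h.1).2.1
        simp at this
      change linearCombination K F.onGraph _ = 0
      rw [map_add, linearCombination_single, linearCombination_single, one_smul, one_smul,
        F.onGraph_eq _ L.marking hf, F.onGraph_eq _ L.marking hf]
      unfold normal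
      dsimp only
      rw [wordSign_swap _ _ _ hab, mul_one, show ∀ a b c : ZMod 2, a + (b + 1) + c = a + b + c + 1
        from fun a b c => by ring, msign_add, msign_one, mul_neg_one, neg_smul, neg_add_cancel]
    · obtain ⟨L, o, hf⟩ := G.isRibbonGraph.exists_frame
      change linearCombination K F.onGraph _ = 0
      have hf' := hf.transport φ
      rw [map_sub, linearCombination_single, linearCombination_single, one_smul, one_smul,
        F.onGraph_eq G L.marking hf, F.onGraph_eq G' (L.marking.transport φ) hf', h,
        F.normal_transport _ φ hf G.isOrientation, sub_self])

theorem toLinearMap_graphClass {R : RibbonData} {ι : Type} [Fintype ι] (M : Marking R ι)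
    {ℓ : List ι} {o : List R.H} (hf : IsFrame R ℓ o) {w : List R.Cell}
    (hw : R.IsOrientation ε w) : F.toLinearMap (graphClass K ε R w) = F.normal M ℓ o w := by
  unfold graphClass
  rw [dif_pos ⟨hf.1, hw⟩]
  refine Eq.trans (Submodule.liftQ_apply _ _ _) ?_
  rw [linearCombination_single, one_smul]
  exact F.onGraph_eq ⟨R, w, hf.1, hw⟩ M hf

theorem toLinearMap_graphElement {R : RibbonData} {ι : Type} [Fintype ι] (M : Marking R ι)
    {ℓ : List ι} {o : List R.H} (hf : IsFrame R ℓ o) (T : ∀ i, PlanarTree (M.n i)) :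
    F.toLinearMap (M.graphElement T K ε ℓ o) = F.val M ℓ o T := by
  refine val_eq_of_corolla (F := (graphFunctional K ε).map F.toLinearMap) (F' := F) ?_ M ℓ o T hf
  intro R ι _ M ℓ o hf
  change F.toLinearMap (M.graphElement _ K ε ℓ o) = _
  rw [M.graphElement_corolla K ε hf.1, map_smul, F.toLinearMap_graphClass M hf
    (hf.isOrientation M ε)]
  unfold normal
  rw [smul_smul, ← msign_add, show ∀ a b : ZMod 2, a + (a + b + b) = 0 by decide]
  simp [msign]

/-- A functional of trees on marked ribbon graphs is a linear map on the graph complex. -/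
theorem existsUnique_linearMap : ∃! f : GraphComplex K ε →ₗ[K] W,
    ∀ R : RibbonData, R.IsRibbonGraph → ∀ (L : Labelling R) (o : List R.H), IsEdgeOrder R o →
      ∀ T : ∀ i, PlanarTree (L.n i),
        f (treesToGraph K ε L o T) = F.val L.marking (finRange L.k) o T := by
  refine ⟨F.toLinearMap, fun R hR L o ho T => ?_, fun f hf => ?_⟩
  · rw [treesToGraph_eq]
    exact F.toLinearMap_graphElement L.marking (L.isFrame hR ho) T
  · have key : ∀ G : OrientedGraph ε, f (graphClass K ε G.graph G.orientation) =
        F.toLinearMap (graphClass K ε G.graph G.orientation) := by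
      intro G
      obtain ⟨L, o, hfr⟩ := G.isRibbonGraph.exists_frame
      have h1 := hf G.graph G.isRibbonGraph L o hfr.4 fun i => PlanarTree.corolla (L.n i)
      rw [treesToGraph_eq] at h1
      replace h1 := h1.trans (F.toLinearMap_graphElement L.marking hfr _).symm
      have h2 := L.marking.graphElement_corolla K ε G.isRibbonGraph (finRange L.k) o
      have ho := hfr.isOrientation L.marking ε
      have hp : G.orientation.Perm (L.marking.baseWord ε (finRange L.k) o) :=
        (perm_ext_iff_of_nodup G.isOrientation.1 ho.1).2 fun c =>
          (G.isOrientation.2 c).trans (ho.2 c).symm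
      have h3 : f (graphClass K ε G.graph (L.marking.baseWord ε (finRange L.k) o)) =
          F.toLinearMap (graphClass K ε G.graph (L.marking.baseWord ε (finRange L.k) o)) := by
        have h4 := (congrArg f h2).symm.trans (h1.trans (congrArg F.toLinearMap h2))
        rw [map_smul, map_smul] at h4
        exact smul_right_injective _ (msign_ne_zero K _) h4
      rw [graphClass_perm K ε hp, map_smul, map_smul, h3]
    refine LinearMap.ext fun x => ?_
    obtain ⟨x, rfl⟩ := Submodule.Quotient.mk_surjective _ x
    induction x using Finsupp.induction_linear with
    | zero => simp
    | add x y hx hy => rw [Submodule.Quotient.mk_add, map_add, map_add, hx, hy]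
    | single G a =>
      have h5 := key G
      unfold graphClass at h5
      rw [dif_pos ⟨G.isRibbonGraph, G.isOrientation⟩] at h5
      have h6 : (single G a : OrientedGraph ε →₀ K) = a • single G 1 := by simp
      rw [h6, Submodule.Quotient.mk_smul, map_smul, map_smul]
      exact congrArg (a • ·) h5

end GraphFunctional

/-! ### Words of half-edges -/

section Words

variable {R S : RibbonData} {ι ι' ι₀ : Type}

/-- The word `h1⁺ h1⁻ … h_E⁺ h_E⁻`. -/
def RibbonData.edgeWord (R : RibbonData) (o : List R.H) : List R.H := o.flatMap fun h => [h, R.inv h]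

/-- The word of all half-edges, vertex by vertex. -/
def Marking.halfWord (M : Marking R ι) (ℓ : List ι) : List R.H := ℓ.flatMap M.halfBlock

/-- The cell of a vertex. -/
def Marking.vertexCell (M : Marking R ι) (i : ι) : R.Cell := .vertex (R.vertexOf (M.e ⟨i, 0⟩))

/-- The word `v₁ … v_k h1⁺ h1⁻ … h_E⁺ h_E⁻`. -/
def Marking.edgeCellWord (M : Marking R ι) (ℓ : List ι) (o : List R.H) : List R.Cell :=
  ℓ.map M.vertexCell ++ (R.edgeWord o).map .half

theorem Marking.mem_halfBlock (M : Marking R ι) {i : ι} {x : R.H} :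
    x ∈ M.halfBlock i ↔ ∃ j, x = M.e ⟨i, j⟩ := by
  unfold Marking.halfBlock
  simp only [List.mem_append, mem_map, mem_finRange, true_and, List.mem_singleton]
  constructor
  · rintro (⟨j, rfl⟩ | rfl)
    · exact ⟨_, rfl⟩
    · exact ⟨_, rfl⟩
  · rintro ⟨j, rfl⟩
    induction j using Fin.cases with
    | zero => exact Or.inr rfl
    | succ j => exact Or.inl ⟨j, rfl⟩

theorem Marking.halfBlock_disjoint (M : Marking R ι) {i i' : ι} (h : i ≠ i') :
    (M.halfBlock i).Disjoint (M.halfBlock i') := by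
  intro x hx hx'
  obtain ⟨j, rfl⟩ := M.mem_halfBlock.1 hx
  obtain ⟨j', hj'⟩ := M.mem_halfBlock.1 hx'
  exact h (congrArg Sigma.fst (M.e.injective hj'))

theorem Marking.halfBlock_nodup (M : Marking R ι) (i : ι) : (M.halfBlock i).Nodup := by
  have hinj : Function.Injective fun j => M.e ⟨i, j⟩ := fun j j' h =>
    eq_of_heq (Sigma.mk.inj (M.e.injective h)).2
  refine List.Nodup.append ((nodup_finRange _).map (hinj.comp (Fin.succ_injective _)))
    (List.nodup_singleton _) ?_
  intro x hx hx'
  obtain ⟨j, _, rfl⟩ := List.mem_map.1 hx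
  exact Fin.succ_ne_zero _ (hinj (List.mem_singleton.1 hx'))

/-- A sum over the half-edges at a vertex. -/
theorem Marking.sum_halfBlock {A : Type*} [AddCommMonoid A] (M : Marking R ι) (i : ι) (f : R.H → A) :
    ((M.halfBlock i).map f).sum = ∑ j, f (M.e ⟨i, j⟩) := by
  unfold Marking.halfBlock
  rw [map_append, sum_append, map_map, Fin.sum_univ_succ, add_comm]
  refine congr (congrArg _ (by simp)) ?_
  rw [← List.ofFn_eq_map, List.sum_ofFn]
  rfl

theorem IsFrame.halfWord_nodup {ℓ : List ι} {o : List R.H} (hf : IsFrame R ℓ o)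
    (M : Marking R ι) : (M.halfWord ℓ).Nodup :=
  List.nodup_flatMap.2 ⟨fun i _ => M.halfBlock_nodup i, hf.2.imp fun h => M.halfBlock_disjoint h⟩

theorem IsFrame.mem_halfWord {ℓ : List ι} {o : List R.H} (hf : IsFrame R ℓ o)
    (M : Marking R ι) (x : R.H) : x ∈ M.halfWord ℓ := by
  obtain ⟨⟨i, j⟩, rfl⟩ := M.e.surjective x
  exact List.mem_flatMap.2 ⟨i, hf.3 i, M.mem_halfBlock.2 ⟨j, rfl⟩⟩

theorem RibbonData.edgeWord_pair_disjoint (hR : R.IsRibbonGraph) {x y : R.H}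
    (h : R.edgeOf x ≠ R.edgeOf y) : ([x, R.inv x] : List R.H).Disjoint [y, R.inv y] := by
  have hi' : ∀ z, R.edgeOf z = R.edgeOf (R.inv z) := fun z => Quot.sound rfl
  have hi : ∀ z, R.edgeOf (R.inv z) = R.edgeOf z := fun z => (hi' z).symm
  intro z hz hz'
  have h1 : R.edgeOf z = R.edgeOf x := by
    rcases List.mem_pair.1 hz with rfl | rfl
    · rfl
    · exact hi x
  have h2 : R.edgeOf z = R.edgeOf y := by
    rcases List.mem_pair.1 hz' with rfl | rfl
    · rfl
    · exact hi y
  exact h (h1.symm.trans h2)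

theorem IsFrame.edgeWord_nodup {ℓ : List ι} {o : List R.H} (hf : IsFrame R ℓ o) :
    (R.edgeWord o).Nodup := by
  refine List.nodup_flatMap.2 ⟨fun x _ => ?_, ?_⟩
  · have := hf.1.inv_ne x
    simp [this.symm]
  · have h1 := hf.4.1
    rw [List.Nodup, List.pairwise_map] at h1
    exact h1.imp fun h => RibbonData.edgeWord_pair_disjoint hf.1 h

theorem IsFrame.mem_edgeWord {ℓ : List ι} {o : List R.H} (hf : IsFrame R ℓ o) (x : R.H) :
    x ∈ R.edgeWord o := by
  obtain ⟨y, hy, hyx⟩ := List.mem_map.1 (hf.4.2 (R.edgeOf x))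
  refine List.mem_flatMap.2 ⟨y, hy, List.mem_pair.2 ?_⟩
  rcases (IsFrame.edgeOf_eq_iff hf.1).1 hyx with rfl | rfl
  · exact Or.inl rfl
  · exact Or.inr rfl

theorem IsFrame.edgeWord_perm {ℓ : List ι} {o : List R.H} (hf : IsFrame R ℓ o)
    (M : Marking R ι) : (R.edgeWord o).Perm (M.halfWord ℓ) :=
  (perm_ext_iff_of_nodup hf.edgeWord_nodup (hf.halfWord_nodup M)).2 fun x =>
    ⟨fun _ => hf.mem_halfWord M x, fun _ => hf.mem_edgeWord x⟩

theorem IsFrame.cellWord_perm {ℓ : List ι} {o : List R.H} (hf : IsFrame R ℓ o)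
    (M : Marking R ι) : (ℓ.flatMap M.cellBlock).Perm (M.edgeCellWord ℓ o) := by
  have h1 : ∀ i, (M.cellBlock i).Perm (M.vertexCell i :: (M.halfBlock i).map .half) := by
    intro i
    refine List.Perm.cons _ ?_
    rw [Marking.map_finRange_succ]
    unfold Marking.halfBlock
    rw [map_append, map_map]
    exact (List.perm_append_singleton _ _).symm
  have h2 : ∀ l : List ι, (l.flatMap M.cellBlock).Perm
      (l.map M.vertexCell ++ (M.halfWord l).map .half) := by
    intro l
    induction l with
    | nil => exact List.Perm.refl _
    | cons i l ih =>
      rw [flatMap_cons]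
      refine ((h1 i).append ih).trans ?_
      rw [map_cons, cons_append, cons_append]
      refine List.Perm.cons _ ?_
      unfold Marking.halfWord
      rw [flatMap_cons, map_append, ← append_assoc, ← append_assoc]
      exact List.Perm.append_right _ List.perm_append_comm
  exact (h2 ℓ).trans (((hf.edgeWord_perm M).symm.map _).append_left _)

theorem IsFrame.cellWord_nodup {ℓ : List ι} {o : List R.H} (hf : IsFrame R ℓ o)
    (M : Marking R ι) : (ℓ.flatMap M.cellBlock).Nodup := by
  have := (hf.isOrientation M 0).1
  rwa [Marking.baseWord, if_pos rfl] at this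

theorem RibbonData.sum_edgeWord {A : Type*} [AddCommMonoid A] (o : List R.H) (f : R.H → A) :
    ((R.edgeWord o).map f).sum = (o.map fun h => f h + f (R.inv h)).sum := by
  unfold RibbonData.edgeWord
  induction o with
  | nil => rfl
  | cons h o ih =>
    rw [flatMap_cons, map_append, sum_append, ih]
    simp

theorem IsFrame.sum_halfEdges {ℓ : List ι} {o : List R.H} (hf : IsFrame R ℓ o) (M : Marking R ι)
    (w : R.H → ZMod 2) : (ℓ.map fun i => ∑ j, w (M.e ⟨i, j⟩)).sum =
      (o.map fun h => w h + w (R.inv h)).sum := by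
  rw [← RibbonData.sum_edgeWord, ((hf.edgeWord_perm M).map w).sum_eq]
  unfold Marking.halfWord
  clear hf
  induction ℓ with
  | nil => rfl
  | cons i l ih =>
    rw [map_cons, sum_cons, flatMap_cons, map_append, sum_append, ih, M.sum_halfBlock]

theorem list_prod_ne_zero_imp {K : Type*} [Field K] {α : Type*} {l : List α} {f : α → K}
    (h : (l.map f).prod ≠ 0) : ∀ x ∈ l, f x ≠ 0 := by
  intro x hx h0
  exact h (List.prod_eq_zero (List.mem_map.2 ⟨x, hx, h0⟩))

end Words

/-! ### State sums -/

/-- The data needed for a state sum on ribbon graphs with trees for vertices: the colors `κ` with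
their parities, a number for each coloring of the half-edges of an edge, and a number for each
coloring of the legs of a tree. -/
structure StateData (K : Type u) [Field K] (ε : ZMod 2) where
  κ : Type
  [fintype : Fintype κ]
  deg : κ → ZMod 2
  G : κ → κ → K
  vt : ∀ {n : ℕ}, PlanarTree n → (Fin (n + 1) → κ) → K
  G_deg : ∀ s t, G s t ≠ 0 → deg s + deg t = ε
  G_symm : ∀ s t, G t s = msign K (deg s * deg t + ε) * G s t
  vt_deg : ∀ {n : ℕ} (_ : 2 ≤ n) (T : PlanarTree n) (a : Fin (n + 1) → κ), vt T a ≠ 0 →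
    ∑ j, deg (a j) = T.degree 2 + ε
  vt_rotate : ∀ {n : ℕ} (_ : 2 ≤ n) (T : PlanarTree n) (a : Fin (n + 1) → κ),
    vt T.rotate (fun j => a (j - 1)) =
      msign K (T.rotationSign + deg (a 0) * ∑ l : Fin n, deg (a l.succ)) * vt T a
  vt_graft : ∀ {m n p N : ℕ} (h : Composable m n p N) (U : PlanarTree m) (V : PlanarTree n)
    (a : Fin (N + 1) → κ),
    vt (graft h U V) a = msign K (graftSign (i := p) U V) * ∑ s, ∑ t,
      msign K (V.degree 2 * ∑ l : Fin N with l.1 < p - 1, deg (a l.succ) + ε * deg t) *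
        (vt V (fun j => if h0 : j.1 = 0 then s else a ⟨j.1 + p - 1, by
            obtain ⟨_, _, _, _, _⟩ := h; have := j.2; omega⟩) * G s t *
          vt U (fun j => if h0 : j.1 = p then t else a ⟨if j.1 < p then j.1 else j.1 + n - 1, by
            obtain ⟨_, _, _, _, _⟩ := h; have := j.2; split_ifs <;> omega⟩))

attribute [instance] StateData.fintype

namespace StateData

variable {K : Type u} [Field K] {ε : ZMod 2} (D : StateData K ε) {R S : RibbonData}
  {ι ι' ι₀ : Type} [Fintype ι] [Fintype ι'] [Fintype ι₀]

/-- The sign of a state sum which does not depend on the coloring. -/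
def globalSign (ε : ZMod 2) (M : Marking R ι) (ℓ : List ι) (o : List R.H) (p : ι → ZMod 2) : ZMod 2 :=
  pairSum (fun i j => p i * p j + ε * (p j + 1)) ℓ + ε * ((o.length.choose 2 : ℕ) +
    wordSign (fun _ => 1) (ℓ.flatMap M.cellBlock) + wordSign (fun _ => 1) (M.edgeCellWord ℓ o))

/-- The contribution of a coloring to a state sum. -/
def term (M : Marking R ι) (ℓ : List ι) (o : List R.H) (T : ∀ i, PlanarTree (M.n i))
    (α : R.H → D.κ) : K :=
  msign K (wordSign (fun h => D.deg (α h)) (R.edgeWord o) +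
      wordSign (fun h => D.deg (α h)) (M.halfWord ℓ)) *
    (∏ i, D.vt (T i) fun j => α (M.e ⟨i, j⟩)) * (o.map fun h => D.G (α h) (α (R.inv h))).prod

open Classical in
/-- The state sum. -/
def value (M : Marking R ι) (ℓ : List ι) (o : List R.H) (T : ∀ i, PlanarTree (M.n i)) : K :=
  msign K (globalSign ε M ℓ o fun i => (T i).degree 2) * ∑ α : R.H → D.κ, D.term M ℓ o T α

/-- To compare two state sums it suffices to look at the colorings with the right parities. -/
theorem term_eq_of {M : Marking R ι} {ℓ : List ι} {o : List R.H} {T : ∀ i, PlanarTree (M.n i)}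
    (hf : IsFrame R ℓ o) (α : R.H → D.κ) {C : ZMod 2} {x : K}
    (h : (∀ i, ∑ j, D.deg (α (M.e ⟨i, j⟩)) = (T i).degree 2 + ε) →
      (∀ y ∈ o, D.deg (α y) + D.deg (α (R.inv y)) = ε) → D.term M ℓ o T α = msign K C * x)
    (h' : (∏ i, D.vt (T i) fun j => α (M.e ⟨i, j⟩)) * (o.map fun h => D.G (α h) (α (R.inv h))).prod = 0
      → x = 0) : D.term M ℓ o T α = msign K C * x := by
  by_cases h0 : (∏ i, D.vt (T i) fun j => α (M.e ⟨i, j⟩)) *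
      (o.map fun h => D.G (α h) (α (R.inv h))).prod = 0
  · unfold term
    rw [mul_assoc, h0, h' h0, mul_zero, mul_zero]
  · refine h (fun i => D.vt_deg (M.two_le hf.1 i) _ _ ?_) fun y hy => D.G_deg _ _ ?_
    · exact fun h1 => left_ne_zero_of_mul h0 (prod_eq_zero (mem_univ i) h1)
    · exact list_prod_ne_zero_imp (right_ne_zero_of_mul h0) y hy

theorem value_reindex (M : Marking R ι) (σ : ι' ≃ ι) (ℓ : List ι') (o : List R.H)
    (T : ∀ i, PlanarTree (M.n i)) :
    D.value (M.reindex σ) ℓ o (fun i => T (σ i)) = D.value M (ℓ.map σ) o T := by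
  unfold value
  congr 1
  · unfold globalSign Marking.edgeCellWord
    rw [pairSum_map, flatMap_map, map_map]
    rfl
  · refine sum_congr rfl fun α _ => ?_
    unfold term Marking.halfWord
    rw [flatMap_map, ← σ.prod_comp]
    rfl

theorem value_transport (M : Marking R ι) (φ : R.Iso S) (ℓ : List ι) (o : List R.H)
    (T : ∀ i, PlanarTree (M.n i)) (hf : IsFrame R ℓ o) :
    D.value (M.transport φ) ℓ (o.map φ.toEquiv) T = D.value M ℓ o T := by
  classical
  have he : S.edgeWord (o.map φ.toEquiv) = (R.edgeWord o).map φ.toEquiv := by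
    unfold RibbonData.edgeWord
    rw [map_flatMap, flatMap_map]
    refine flatMap_congr fun h _ => ?_
    simp [φ.map_inv]
  have hh : (M.transport φ).halfWord ℓ = (M.halfWord ℓ).map φ.toEquiv := by
    unfold Marking.halfWord
    rw [map_flatMap]
    refine flatMap_congr fun i _ => ?_
    unfold Marking.halfBlock
    rw [map_append, map_map]
    rfl
  have hc : ℓ.flatMap (M.transport φ).cellBlock = (ℓ.flatMap M.cellBlock).map φ.mapCell := by
    rw [map_flatMap]
    exact flatMap_congr fun i _ => M.cellBlock_transport φ i
  have hc' : (M.transport φ).edgeCellWord ℓ (o.map φ.toEquiv) =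
      (M.edgeCellWord ℓ o).map φ.mapCell := by
    unfold Marking.edgeCellWord
    rw [map_append, map_map, map_map, he, map_map]
    rfl
  have h1 := wordSign_map (fun _ => 1) φ.mapCell_injective (hf.cellWord_nodup M) (hf.cellWord_perm M)
  unfold value
  congr 1
  · unfold globalSign
    rw [hc, hc', length_map]
    refine congrArg _ ?_
    change pairSum (fun i j => (T i).degree 2 * (T j).degree 2 + ε * ((T j).degree 2 + 1)) ℓ + ε * _ =
      pairSum (fun i j => (T i).degree 2 * (T j).degree 2 + ε * ((T j).degree 2 + 1)) ℓ + ε * _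
    linear_combination ε * h1 + ε * zmod2_add_self
      (wordSign (fun _ => 1) ((M.edgeCellWord ℓ o).map φ.mapCell)) - ε * zmod2_add_self
        (wordSign (fun _ => 1) (ℓ.flatMap M.cellBlock))
  · refine (Fintype.sum_equiv (φ.toEquiv.arrowCongr (Equiv.refl D.κ)) _ _ fun α => ?_).symm
    have h2 := wordSign_map (fun h => D.deg (α (φ.toEquiv.symm h))) φ.toEquiv.injective
      hf.edgeWord_nodup (hf.edgeWord_perm M)
    have hα : ∀ h, φ.toEquiv.arrowCongr (Equiv.refl D.κ) α h = α (φ.toEquiv.symm h) := fun _ => rfl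
    unfold term
    simp only [he, hh, map_map, hα, Marking.transport_e, Equiv.symm_apply_apply] at h2 ⊢
    congr 1
    · congr 2
      linear_combination -h2 - zmod2_add_self (wordSign (fun h => D.deg
        (α (φ.toEquiv.symm h))) ((M.halfWord ℓ).map φ.toEquiv)) +
          zmod2_add_self (wordSign (fun h => D.deg (α h)) (R.edgeWord o))
    · congr 1
      refine map_congr_left fun h _ => ?_
      simp only [Function.comp, Equiv.symm_apply_apply, ← φ.map_inv]

theorem value_swap_vertices (M : Marking R ι) (l₁ l₂ : List ι) (x y : ι) (o : List R.H)
    (T : ∀ i, PlanarTree (M.n i)) (hf : IsFrame R (l₁ ++ x :: y :: l₂) o) :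
    D.value M (l₁ ++ x :: y :: l₂) o T =
      msign K ((T x).degree 2 * (T y).degree 2 + ε * ((M.n x : ZMod 2) * (M.n y : ZMod 2))) *
        D.value M (l₁ ++ y :: x :: l₂) o T := by
  have hxy : x ≠ y := by
    rintro rfl
    have := (List.nodup_append.1 hf.2).2.1
    simp at this
  have hc := wordSign_swap_blocks (l₁.flatMap M.cellBlock) (l₂.flatMap M.cellBlock)
    (M.cellBlock_disjoint hxy)
  rw [M.length_cellBlock, M.length_cellBlock] at hc
  have hv : M.vertexCell x ≠ M.vertexCell y := fun h =>
    hxy ((M.vertexOf_e_eq_iff _ _ _ _).1 (Cell.vertex.inj h))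
  have hc' := wordSign_swap (fun _ => 1) (l₁.map M.vertexCell)
    (l₂.map M.vertexCell ++ (R.edgeWord o).map .half) hv
  have key : ∀ α, D.term M (l₁ ++ x :: y :: l₂) o T α =
      msign K (((T x).degree 2 + ε) * ((T y).degree 2 + ε)) * D.term M (l₁ ++ y :: x :: l₂) o T α := by
    intro α
    refine D.term_eq_of hf α (fun h1 _ => ?_) fun h0 => ?_
    · have hh := wordSign_swap_word (fun h => D.deg (α h)) (l₁.flatMap M.halfBlock)
        (l₂.flatMap M.halfBlock) (M.halfBlock_disjoint hxy)
      rw [M.sum_halfBlock, M.sum_halfBlock, h1, h1] at hh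
      unfold term Marking.halfWord
      simp only [flatMap_append, flatMap_cons, append_assoc] at hh ⊢
      rw [hh]
      simp only [msign_add]
      ring
    · unfold term
      rw [mul_assoc, h0, mul_zero]
  unfold value globalSign Marking.edgeCellWord
  rw [sum_congr rfl fun α _ => key α, ← mul_sum, ← mul_assoc, ← mul_assoc, ← msign_add, ← msign_add,
    pairSum_swap]
  congr 2
  simp only [flatMap_append, flatMap_cons, append_assoc, map_append, map_cons,
    cons_append] at hc hc' ⊢
  rw [hc, hc', ← sub_eq_zero]
  generalize (T x).degree 2 = a, (T y).degree 2 = b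
  rcases zmod2_cases ε with rfl | rfl <;> ring_nf <;> reduce_mod_char

theorem value_swap_edges (M : Marking R ι) (ℓ : List ι) (o₁ o₂ : List R.H) (x y : R.H)
    (T : ∀ i, PlanarTree (M.n i)) (hf : IsFrame R ℓ (o₁ ++ x :: y :: o₂)) :
    D.value M ℓ (o₁ ++ x :: y :: o₂) T = msign K ε * D.value M ℓ (o₁ ++ y :: x :: o₂) T := by
  have hxy : R.edgeOf x ≠ R.edgeOf y := by
    intro h
    have := hf.4.1
    rw [map_append] at this
    have := (List.nodup_append.1 this).2.1
    simp [h] at this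
  have hd := RibbonData.edgeWord_pair_disjoint hf.1 hxy
  have hc := wordSign_swap_word (fun _ => (1 : ZMod 2))
    (ℓ.map M.vertexCell ++ (R.edgeWord o₁).map Cell.half)
    ((R.edgeWord o₂).map Cell.half)
    (u := [x, R.inv x].map Cell.half) (v := [y, R.inv y].map Cell.half) (by
      intro c hc hc'
      obtain ⟨z, hz, rfl⟩ := List.mem_map.1 hc
      obtain ⟨z', hz', h⟩ := List.mem_map.1 hc'
      exact hd hz (Cell.half.inj h ▸ hz'))
  have key : ∀ α, D.term M ℓ (o₁ ++ x :: y :: o₂) T α =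
      msign K ε * D.term M ℓ (o₁ ++ y :: x :: o₂) T α := by
    intro α
    refine D.term_eq_of hf α (fun _ h2 => ?_) fun h0 => ?_
    · have hh := wordSign_swap_word (fun h => D.deg (α h)) (R.edgeWord o₁) (R.edgeWord o₂) hd
      simp only [map_cons, map_nil, sum_cons, sum_nil, add_zero] at hh
      rw [h2 x (by simp), h2 y (by simp), zmod2_mul_self] at hh
      unfold term RibbonData.edgeWord
      simp only [RibbonData.edgeWord, flatMap_append, flatMap_cons, append_assoc, map_append,
        map_cons, prod_append, prod_cons] at hh ⊢
      rw [hh]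
      simp only [msign_add]
      ring
    · unfold term
      rw [mul_assoc]
      refine mul_eq_zero_of_right _ ?_
      rw [← h0]
      simp only [map_append, map_cons, prod_append, prod_cons]
      ring
  unfold value globalSign Marking.edgeCellWord
  rw [sum_congr rfl fun α _ => key α, ← mul_sum, mul_left_comm]
  congr 3
  simp only [RibbonData.edgeWord, flatMap_append, flatMap_cons, append_assoc, map_append, map_cons,
    map_nil, sum_cons, sum_nil, length_append, length_cons] at hc ⊢
  rw [hc]
  congr 3
  ring_nf
  reduce_mod_char

theorem value_flip_edge (M : Marking R ι) (ℓ : List ι) (o₁ o₂ : List R.H) (x : R.H)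
    (T : ∀ i, PlanarTree (M.n i)) (hf : IsFrame R ℓ (o₁ ++ x :: o₂)) :
    D.value M ℓ (o₁ ++ x :: o₂) T = D.value M ℓ (o₁ ++ R.inv x :: o₂) T := by
  have hx := hf.1.inv_ne x
  have hc := wordSign_swap (fun _ => (1 : ZMod 2))
    (ℓ.map M.vertexCell ++ (R.edgeWord o₁).map Cell.half)
    ((R.edgeWord o₂).map Cell.half) (x := .half x) (y := .half (R.inv x))
    (fun h => hx (Cell.half.inj h).symm)
  have key : ∀ α, D.term M ℓ (o₁ ++ x :: o₂) T α =
      msign K ε * D.term M ℓ (o₁ ++ R.inv x :: o₂) T α := by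
    intro α
    have hh := wordSign_swap (fun h => D.deg (α h)) (R.edgeWord o₁) (R.edgeWord o₂) hx.symm
    have hG := D.G_symm (α (R.inv x)) (α x)
    unfold term
    simp only [RibbonData.edgeWord, flatMap_append, flatMap_cons, map_append,
      map_cons, prod_append, prod_cons, cons_append, nil_append, hf.1.inv_inv] at hh ⊢
    rw [hh, hG]
    simp only [msign_add]
    rw [mul_comm (D.deg (α (R.inv x)))]
    linear_combination (msign K ε * msign K (wordSign (fun h => D.deg (α h)) (List.flatMap (fun h => [h, R.inv h]) o₁ ++ R.inv x :: x :: List.flatMap (fun h => [h, R.inv h]) o₂)) * msign K (wordSign (fun h => D.deg (α h)) (M.halfWord ℓ)) * (∏ i, D.vt (T i) fun j => α (M.e ⟨i, j⟩)) * ((o₁.map fun h => D.G (α h) (α (R.inv h))).prod * (D.G (α (R.inv x)) (α x) * (o₂.map fun h => D.G (α h) (α (R.inv h))).prod))) * msign_mul_self K (D.deg (α x) * D.deg (α (R.inv x)))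
  unfold value globalSign Marking.edgeCellWord
  rw [sum_congr rfl fun α _ => key α, ← mul_sum, ← mul_assoc, ← msign_add]
  congr 2
  simp only [RibbonData.edgeWord, flatMap_append, flatMap_cons, append_assoc, map_append, map_cons,
    cons_append, nil_append, length_append, length_cons, hf.1.inv_inv] at hc ⊢
  rw [hc, ← sub_eq_zero]
  generalize pairSum (fun i j => (T i).degree 2 * (T j).degree 2 + ε * ((T j).degree 2 + 1)) ℓ = P
  ring_nf
  reduce_mod_char

end StateData

namespace StateData

variable {K : Type u} [Field K] {ε : ZMod 2} (D : StateData K ε) {R S : RibbonData}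
  {ι ι' ι₀ : Type} [Fintype ι] [Fintype ι'] [Fintype ι₀]

theorem value_rotate (M : Marking R (Option ι₀)) (ℓ₀ : List ι₀) (o : List R.H)
    (t : PlanarTree (M.n none)) (T : ∀ i, PlanarTree (M.n (some i)))
    (hf : IsFrame R (none :: ℓ₀.map some) o) :
    D.value (M.rotate (optCons 1 fun _ => 0)) (none :: ℓ₀.map some) o
        (optTrees M t.rotate T) =
      msign K (t.rotationSign + ε * (M.n none : ZMod 2)) *
        D.value M (none :: ℓ₀.map some) o (optTrees M t T) := by
  let M' := M.rotate (optCons 1 fun _ => 0)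
  have hsub : ∀ i j, M'.e ⟨some i, j⟩ = M.e ⟨some i, j⟩ := fun i j =>
    congrArg (fun j => M.e ⟨some i, j⟩) (sub_zero j)
  have hnone : ∀ j : Fin (M.n none + 1), M'.e ⟨none, j⟩ = M.e ⟨none, j - 1⟩ := fun j => rfl
  have hZ : (ℓ₀.map some).flatMap M'.halfBlock = (ℓ₀.map some).flatMap M.halfBlock := by
    refine flatMap_congr fun i hi => ?_
    obtain ⟨i, _, rfl⟩ := List.mem_map.1 hi
    unfold Marking.halfBlock
    exact congr (congrArg _ (map_congr_left fun j _ => hsub i _))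
      (congrArg (fun x => [x]) (hsub i 0))
  have hb : M'.halfBlock none = M.e ⟨none, 0⟩ ::
      (finRange (M.n none)).map (fun j => M.e ⟨none, j.succ⟩) := by
    rw [← Marking.map_finRange_succ (fun j => M.e ⟨none, j⟩), Marking.map_finRange_castSucc]
    unfold Marking.halfBlock
    refine congr (congrArg _ (map_congr_left fun (j : Fin (M.n none)) _ => ?_)) ?_
    · refine (hnone j.succ).trans (congrArg (fun j => M.e ⟨none, j⟩) ?_)
      rw [← Fin.coeSucc_eq_succ, add_sub_cancel_right]
    · refine congrArg (fun x => [x]) ((hnone 0).trans (congrArg (fun j => M.e ⟨none, j⟩) ?_))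
      rw [sub_eq_iff_eq_add, Fin.last_add_one]
  have hv : (none :: ℓ₀.map some).map M'.vertexCell = (none :: ℓ₀.map some).map M.vertexCell := by
    refine map_congr_left fun i _ => ?_
    unfold Marking.vertexCell
    refine congrArg Cell.vertex ?_
    cases i with
    | none => exact M.vertexOf_e none (0 - 1)
    | some i => exact congrArg R.vertexOf (hsub i 0)
  have hdeg : ∀ i, ((optTrees M t.rotate T) i).degree 2 =
      ((optTrees M t T) i).degree 2 := by
    rintro (_ | i)
    · unfold PlanarTree.degree
      rw [optCons_none, optCons_none, card_rotate]
    · rfl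
  have key : ∀ α : R.H → D.κ, D.term M' (none :: ℓ₀.map some) o
        (optTrees M t.rotate T) α =
      msign K t.rotationSign * D.term M (none :: ℓ₀.map some) o
        (optTrees M t T) α := by
    intro α
    let w : R.H → ZMod 2 := fun h => D.deg (α h)
    have hd : ([M.e ⟨none, 0⟩] : List R.H).Disjoint
        ((finRange (M.n none)).map fun j => M.e ⟨none, j.succ⟩) :=
      (List.nodup_append'.1 (M.halfBlock_nodup none)).2.2.symm
    have h1 := wordSign_swap_word w [] ((ℓ₀.map some).flatMap M.halfBlock) hd
    have h2 : ((finRange (M.n none)).map fun j => w (M.e ⟨none, j.succ⟩)).sum =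
        ∑ l : Fin (M.n none), w (M.e ⟨none, l.succ⟩) := by
      rw [← List.ofFn_eq_map, List.sum_ofFn]
    have h3 : wordSign w (M'.halfWord (none :: ℓ₀.map some)) =
        wordSign w (M.halfWord (none :: ℓ₀.map some)) +
          w (M.e ⟨none, 0⟩) * ∑ l : Fin (M.n none), w (M.e ⟨none, l.succ⟩) := by
      unfold Marking.halfWord
      rw [flatMap_cons, flatMap_cons, hZ, hb, ← h2]
      simpa [Function.comp_def, Marking.halfBlock] using h1
    have h4 : D.vt (t.rotate) (fun j => α (M'.e ⟨none, j⟩)) = _ :=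
      D.vt_rotate (M.two_le hf.1 none) t fun j => α (M.e ⟨none, j⟩)
    unfold term
    rw [Fintype.prod_option, Fintype.prod_option]
    have h5 : ∀ i, D.vt (optTrees M t.rotate T (some i))
        (fun j => α (M'.e ⟨some i, j⟩)) = D.vt (T i) fun j => α (M.e ⟨some i, j⟩) := fun i =>
      congrArg (D.vt (T i)) (funext fun j => congrArg α (hsub i j))
    refine (congrArg₂ _ (congrArg₂ _ (congrArg _ (congrArg _ h3)) (congrArg₂ _ h4
      (prod_congr rfl fun i _ => h5 i))) rfl).trans ?_
    simp only [msign_add]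
    have h6 := msign_mul_self K (w (M.e ⟨none, 0⟩) * ∑ l : Fin (M.n none), w (M.e ⟨none, l.succ⟩))
    change _ = _ * (_ * (D.vt t _ * ∏ i, D.vt (T i) _) * _)
    linear_combination (msign K t.rotationSign * (msign K (wordSign w (R.edgeWord o)) *
      msign K (wordSign w (M.halfWord (none :: ℓ₀.map some))) *
      (D.vt t (fun j => α (M.e ⟨none, j⟩)) * ∏ i, D.vt (T i) fun j => α (M.e ⟨some i, j⟩)) *
        (o.map fun h => D.G (α h) (α (R.inv h))).prod)) * h6
  unfold value globalSign Marking.edgeCellWord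
  rw [sum_congr rfl fun α _ => key α, ← mul_sum, M.wordSign_cellBlock_rotate, hv, ← mul_assoc,
    ← mul_assoc, ← msign_add, ← msign_add]
  congr 2
  have hp : pairSum (fun i j =>
        ((optTrees M t.rotate T) i).degree 2 *
          ((optTrees M t.rotate T) j).degree 2 +
        ε * (((optTrees M t.rotate T) j).degree 2 + 1))
      (none :: ℓ₀.map some) = pairSum (fun i j =>
        ((optTrees M t T) i).degree 2 *
          ((optTrees M t T) j).degree 2 +
        ε * (((optTrees M t T) j).degree 2 + 1))
      (none :: ℓ₀.map some) := by
    simp only [hdeg]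
  refine (congrArg (· + _ + _) hp).trans ?_
  ring

end StateData

/-! ### Splitting a vertex -/

section Split

variable {R : RibbonData} {ι₀ : Type}

/-- The Koszul sign of the words of half-edges before and after splitting a vertex. -/
theorem wordSign_split {α : Type*} (w : α ⊕ Bool → ZMod 2) {A B C Z E : List α} {e : α}
    (hn : (A ++ B ++ C ++ e :: Z).Nodup) (hE : E.Perm (A ++ B ++ C ++ e :: Z)) :
    wordSign w (.inr false :: .inr true :: E.map Sum.inl) +
        wordSign w (A.map Sum.inl ++ .inr true :: (C.map Sum.inl ++ .inl e ::
          (B.map Sum.inl ++ .inr false :: Z.map Sum.inl))) =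
      wordSign (fun x => w (.inl x)) E + wordSign (fun x => w (.inl x)) (A ++ B ++ C ++ e :: Z) +
        (w (.inr false) * (w (.inr true) + (A.map fun x => w (.inl x)).sum +
          (C.map fun x => w (.inl x)).sum + w (.inl e) + (B.map fun x => w (.inl x)).sum) +
        w (.inr true) * (A.map fun x => w (.inl x)).sum +
        ((C.map fun x => w (.inl x)).sum + w (.inl e)) * (B.map fun x => w (.inl x)).sum) := by
  have hi : Function.Injective (Sum.inl : α → α ⊕ Bool) := Sum.inl_injective
  have hm := wordSign_map w hi (hE.nodup_iff.2 hn) hE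
  have ha := wordSign_append w [.inr false, .inr true] [] ((hE.nodup_iff.2 hn).map hi) (hE.map Sum.inl)
  have hd : ∀ (L : List α) (b : Bool), (L.map (Sum.inl : α → α ⊕ Bool)).Disjoint [.inr b] := by
    intro L b x hx hx'
    obtain ⟨y, _, rfl⟩ := List.mem_map.1 hx
    exact Sum.inl_ne_inr (List.mem_singleton.1 hx')
  have hABC : (B.map (Sum.inl : α → α ⊕ Bool)).Disjoint ((C ++ [e]).map Sum.inl) := by
    intro x hx hx'
    obtain ⟨y, hy, rfl⟩ := List.mem_map.1 hx
    obtain ⟨z, hz, h⟩ := List.mem_map.1 hx'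
    obtain rfl := hi h
    have h1 : (B ++ (C ++ [e])).Nodup := by
      refine List.Nodup.sublist ?_ hn
      rw [append_assoc, append_assoc, ← append_assoc B, ← append_assoc B]
      refine (List.Sublist.trans ?_ (List.sublist_append_right A _))
      simp
    exact (List.nodup_append'.1 h1).2.2 hy hz
  have h1 := wordSign_swap_word w [] (Z.map Sum.inl) (u := [.inr false])
    (v := .inr true :: (A ++ B ++ C ++ [e]).map Sum.inl) (by
      intro x hx hx'
      rcases List.mem_cons.1 hx' with rfl | hx'
      · simp at hx
      · exact hd _ _ hx' hx)
  have h2 := wordSign_swap_word w [] ((B ++ C ++ [e]).map Sum.inl ++ .inr false :: Z.map Sum.inl)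
    (u := [.inr true]) (v := A.map Sum.inl) (hd A true).symm
  have h3 := wordSign_swap_word w (A.map Sum.inl ++ [.inr true]) (.inr false :: Z.map Sum.inl) hABC
  simp only [map_append, map_cons, map_nil, sum_append, sum_cons, sum_nil, map_map,
    Function.comp_def, append_assoc, cons_append, nil_append, List.append_nil,
    add_zero] at hm ha h1 h2 h3 ⊢
  linear_combination (norm := skip) ha + hm + h1 + h2 + h3
  ring_nf
  reduce_mod_char

namespace Marking

variable (M : Marking R (Option ι₀)) {m n p : ℕ} (h : Composable m n p (M.n none))

theorem halfBlock_split (i : ι₀) :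
    (M.split h).halfBlock (some (some i)) = (M.halfBlock (some i)).map .inl := by
  unfold halfBlock
  rw [map_append, map_map]
  rfl

/-- The numbers of vertices and half-edges of a graph become letters for its cells. -/
def toCell {S : RibbonData} {ι : Type} (M : Marking S ι) : ι ⊕ S.H → S.Cell :=
  Sum.elim M.vertexCell .half

theorem toCell_injective {S : RibbonData} {ι : Type} (M : Marking S ι) :
    Function.Injective M.toCell := by
  rintro (i | x) (j | y) hxy
  · exact congrArg _ ((M.vertexOf_e_eq_iff _ _ _ _).1 (Cell.vertex.inj hxy))
  · cases hxy
  · cases hxy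
  · exact congrArg _ (Cell.half.inj hxy)

/-- Comparison of the words of cells before and after splitting a vertex. -/
theorem wordSign_cell_split {ℓ₀ : List ι₀} {o : List R.H}
    (hf : IsFrame R (none :: ℓ₀.map some) o) :
    wordSign (fun _ => 1) ((some none :: none :: ℓ₀.map fun i => some (some i)).flatMap
        (M.split h).cellBlock) + wordSign (fun _ => 1) ((M.split h).edgeCellWord
          (some none :: none :: ℓ₀.map fun i => some (some i)) (.inr false :: o.map .inl)) =
      wordSign (fun _ => 1) ((none :: ℓ₀.map some).flatMap M.cellBlock) +
        wordSign (fun _ => 1) (M.edgeCellWord (none :: ℓ₀.map some) o) +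
          ((m + p : ZMod 2) * n + p) := by
  obtain ⟨A, B, C, hM, hU, hV, hA, hB, hC⟩ := M.split_legs h
  let c' := (M.split h).toCell
  let g : Option ι₀ ⊕ R.H → Option (Option ι₀) ⊕ (R.H ⊕ Bool) :=
    Sum.map (fun i => i.elim (some none) fun i => some (some i)) .inl
  have hg : Function.Injective g := Sum.map_injective.2 ⟨by
    rintro (_ | i) (_ | j) hij
    · rfl
    · cases hij
    · cases hij
    · cases hij; rfl, Sum.inl_injective⟩
  let f := c' ∘ g
  have hfi : Function.Injective f := (M.split h).toCell_injective.comp hg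
  let Zc : List (Option ι₀ ⊕ R.H) := (ℓ₀.map some).flatMap fun i =>
    .inl i :: (finRange (M.n i + 1)).map fun j => .inr (M.e ⟨i, j⟩)
  let W : List (Option ι₀ ⊕ R.H) :=
    .inl none :: .inr (M.e ⟨none, 0⟩) :: ((A ++ B ++ C).map .inr ++ Zc)
  let V' : List (Option ι₀ ⊕ R.H) :=
    .inl none :: (ℓ₀.map (fun i => .inl (some i)) ++ (R.edgeWord o).map .inr)
  have e₁ : (none :: ℓ₀.map some).flatMap M.cellBlock = W.map M.toCell := by
    have h1 : M.cellBlock none = M.toCell (.inl none) :: M.toCell (.inr (M.e ⟨none, 0⟩)) ::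
        (A ++ B ++ C).map fun x => M.toCell (.inr x) := by
      unfold cellBlock
      rw [map_finRange_succ, ← hM, map_map]
      rfl
    rw [flatMap_cons, h1]
    simp only [W, Zc, map_cons, map_append, map_map, map_flatMap, cons_append, append_assoc]
    rfl
  have e₂ : M.edgeCellWord (none :: ℓ₀.map some) o = V'.map M.toCell := by
    unfold edgeCellWord
    simp only [V', map_cons, map_append, map_map, cons_append]
    rfl
  have hn : W.Nodup := by
    have := hf.cellWord_nodup M
    rw [e₁] at this
    exact List.Nodup.of_map _ this
  have hp : W.Perm V' := by
    have := hf.cellWord_perm M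
    rw [e₁, e₂] at this
    exact (List.map_perm_map_iff M.toCell_injective).1 this
  let v := c' (.inl none)
  let x := c' (.inr (.inr false))
  let y := c' (.inr (.inr true))
  have e₃ : (some none :: none :: ℓ₀.map fun i => some (some i)).flatMap (M.split h).cellBlock =
      f (.inl none) :: f (.inr (M.e ⟨none, 0⟩)) :: (A.map (fun z => f (.inr z)) ++ y ::
        (C.map (fun z => f (.inr z)) ++ v :: x :: (B.map (fun z => f (.inr z)) ++ Zc.map f))) := by
    have h1 : (M.split h).cellBlock (some none) = f (.inl none) :: f (.inr (M.e ⟨none, 0⟩)) ::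
        (A.map (fun z => f (.inr z)) ++ y :: C.map fun z => f (.inr z)) := by
      refine congrArg (List.cons _) ((map_finRange_succ fun j : Fin (m + 1) =>
        Cell.half (R := M.splitGraph h) (M.splitE h ⟨some none, j⟩)).trans ?_)
      refine congr (congrArg _ (congrArg _ (M.splitE_lower_zero h))) ?_
      have h2 := congrArg (List.map (Cell.half (R := M.splitGraph h))) hU
      rw [map_map] at h2
      refine h2.trans ?_
      rw [map_append, map_cons, map_map, map_map]
      rfl
    have h2 : (M.split h).cellBlock none = v :: x :: B.map fun z => f (.inr z) := by
      refine congrArg (List.cons _) ((map_finRange_succ fun j : Fin (n + 1) =>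
        Cell.half (R := M.splitGraph h) (M.splitE h ⟨none, j⟩)).trans ?_)
      refine congr (congrArg _ (congrArg _ (M.splitE_upper_zero h))) ?_
      have h2 := congrArg (List.map (Cell.half (R := M.splitGraph h))) hV
      rw [map_map] at h2
      refine h2.trans ?_
      rw [map_map]
      rfl
    rw [flatMap_cons, flatMap_cons, h1, h2]
    simp only [Zc, map_cons, map_map, map_flatMap, flatMap_map, cons_append, append_assoc]
    rfl
  have e₄ : (M.split h).edgeCellWord (some none :: none :: ℓ₀.map fun i => some (some i))
      (.inr false :: o.map .inl) = f (.inl none) :: v ::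
        (ℓ₀.map (fun i => f (.inl (some i))) ++ x :: y :: (R.edgeWord o).map fun z => f (.inr z)) := by
    unfold edgeCellWord RibbonData.edgeWord
    simp only [map_cons, map_append, map_map, map_flatMap, flatMap_cons, flatMap_map, cons_append]
    rfl
  have h1 := wordSign_map (fun _ => 1) M.toCell_injective hn hp
  have h2 := wordSign_map (fun _ => 1) hfi hn hp
  have h3 := wordSign_append (fun _ => 1) [v, x, y] [] (hn.map hfi) (hp.map f)
  have hd : ∀ (L : List (Option ι₀ ⊕ R.H)), ([v, x, y] : List _).Disjoint (L.map f) := by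
    intro L z hz hz'
    obtain ⟨u, _, rfl⟩ := List.mem_map.1 hz'
    simp only [mem_cons, not_mem_nil, or_false] at hz
    rcases hz with hz | hz | hz <;> rcases u with (_ | u) | u <;>
      cases (M.split h).toCell_injective hz
  have hvy : v ≠ y := fun hz => by cases (M.split h).toCell_injective hz
  have hxy : x ≠ y := fun hz => by cases (M.split h).toCell_injective hz
  have hCB : (C.map fun z => f (.inr z)).Disjoint (B.map fun z => f (.inr z)) := by
    intro z hz hz'
    obtain ⟨c, hc, rfl⟩ := List.mem_map.1 hz
    obtain ⟨b, hb, hbc⟩ := List.mem_map.1 hz'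
    obtain rfl := Sum.inr_injective (hfi hbc)
    have h6 : (A ++ B ++ C).Nodup := by
      rw [← hM]
      exact (List.nodup_append'.1 (M.halfBlock_nodup none)).1
    exact (List.nodup_append'.1 h6).2.2 (List.mem_append_right _ hb) hc
  have s₁ := wordSign_swap_word (fun _ => (1 : ZMod 2)) [] (B.map (fun z => f (.inr z)) ++ Zc.map f)
    (u := f (.inl none) :: f (.inr (M.e ⟨none, 0⟩)) :: (A.map (fun z => f (.inr z)) ++ y ::
      C.map fun z => f (.inr z))) (v := [v, x]) (by
      intro z hz hz'
      have h6 : z ∈ (.inl none :: .inr (M.e ⟨none, 0⟩) :: (A ++ C).map .inr :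
          List (Option ι₀ ⊕ R.H)).map f ∨ z = y := by
        rw [map_cons, map_cons, map_map, map_append]
        simp only [mem_cons, List.mem_append, Function.comp_def] at hz ⊢
        tauto
      rcases h6 with h6 | rfl
      · refine hd _ ?_ h6
        simp only [mem_cons, not_mem_nil, or_false] at hz' ⊢
        tauto
      · simp only [mem_cons, not_mem_nil, or_false] at hz'
        rcases hz' with hz' | hz'
        · exact hvy hz'.symm
        · exact hxy hz'.symm)
  have s₂ := wordSign_swap_word (fun _ => (1 : ZMod 2)) [v, x]
    (C.map (fun z => f (.inr z)) ++ B.map (fun z => f (.inr z)) ++ Zc.map f)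
    (u := f (.inl none) :: f (.inr (M.e ⟨none, 0⟩)) :: A.map (fun z => f (.inr z))) (v := [y]) (by
      intro z hz hz'
      refine hd (.inl none :: .inr (M.e ⟨none, 0⟩) :: A.map .inr) (a := z) ?_ ?_
      · simp only [mem_cons, not_mem_nil, or_false] at hz' ⊢
        tauto
      · rw [map_cons, map_cons, map_map]
        exact hz)
  have s₃ := wordSign_swap_word (fun _ => (1 : ZMod 2)) (v :: x :: y :: f (.inl none) ::
    f (.inr (M.e ⟨none, 0⟩)) :: A.map (fun z => f (.inr z))) (Zc.map f) hCB
  have s₄ := wordSign_swap (fun _ => (1 : ZMod 2)) [] (ℓ₀.map (fun i => f (.inl (some i))) ++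
    x :: y :: (R.edgeWord o).map fun z => f (.inr z)) (x := f (.inl none)) (y := v) (fun hz => by
      cases (M.split h).toCell_injective hz)
  have s₅ := wordSign_swap_word (fun _ => (1 : ZMod 2)) [v]
    ((R.edgeWord o).map fun z => f (.inr z)) (u := f (.inl none) ::
      ℓ₀.map (fun i => f (.inl (some i)))) (v := [x, y]) (by
      intro z hz hz'
      refine hd (.inl none :: ℓ₀.map fun i => .inl (some i)) (a := z) ?_ ?_
      · exact mem_cons_of_mem _ hz'
      · rw [map_cons, map_map]
        exact hz)
  rw [e₁, e₂, e₃, e₄]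
  simp only [W, V', map_append, map_cons, map_nil, sum_append, sum_cons, sum_nil, map_map,
    Function.comp_def, append_assoc, cons_append, nil_append, List.append_nil, add_zero, map_const',
    sum_replicate, nsmul_eq_mul, mul_one, hA, hB, hC] at h1 h2 h3 s₁ s₂ s₃ s₄ s₅ ⊢
  obtain ⟨_, _, hp₁, hp₂, _⟩ := h
  have c₁ : ((p - 1 : ℕ) : ZMod 2) = p + 1 := by
    rw [Nat.cast_sub hp₁, Nat.cast_one, sub_eq_add_neg, zmod2_neg]
  have c₂ : ((m - p : ℕ) : ZMod 2) = m + p := by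
    rw [Nat.cast_sub hp₂, sub_eq_add_neg, zmod2_neg]
  rw [c₁] at s₁ s₂
  rw [c₂] at s₁ s₃
  linear_combination (norm := skip) s₁ + s₂ + s₃ + s₄ + s₅ + h1 + h2 + h3
  ring_nf
  reduce_mod_char

end Marking
end Split

/-- A sum over the colorings of the half-edges after splitting a vertex. -/
theorem sum_splitColoring {α κ A : Type*} [Fintype (α → κ)] [Fintype (α ⊕ Bool → κ)] [Fintype κ]
    [AddCommMonoid A] (F : (α ⊕ Bool → κ) → A) :
    ∑ β, F β = ∑ a : α → κ, ∑ s, ∑ t, F (Sum.elim a fun b => cond b t s) := by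
  rw [← Fintype.sum_equiv ((Equiv.sumArrowEquivProdArrow α Bool κ).trans
    ((Equiv.refl _).prodCongr (Equiv.boolArrowEquivProd κ))).symm _ _ fun _ => rfl,
    Fintype.sum_prod_type]
  refine sum_congr rfl fun a _ => ?_
  rw [Fintype.sum_prod_type]
  refine sum_congr rfl fun s _ => sum_congr rfl fun t _ => congrArg F ?_
  funext x
  rcases x with x | _ | _ <;> rfl

theorem sum_lt_eq_sum_take {N k : ℕ} {α : Type*} (g : Fin N → α) (w : α → ZMod 2) {A B : List α}
    (h : (finRange N).map g = A ++ B) (hA : A.length = k) :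
    ∑ l : Fin N with l.1 < k, w (g l) = (A.map w).sum := by
  rw [← List.sum_take_ofFn, List.ofFn_eq_map, ← Function.comp_def w g, ← map_map, h, map_append,
    List.take_left' (by rw [length_map, hA])]

namespace StateData

variable {K : Type u} [Field K] {ε : ZMod 2} (D : StateData K ε) {R S : RibbonData}
  {ι ι' ι₀ : Type} [Fintype ι] [Fintype ι'] [Fintype ι₀]

theorem graft_sign_identity {ε p m n pU pV E s t a b c r : ZMod 2} (hb : b + s = pV + ε)
    (hc : a + t + c = pU + ε) (hs : s + t = ε) (hr : pU + pV + ε + r = ε * E) :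
    pV * a + ε * t = ε * (p * n + p + m * n + 1) + (pU * pV + ε * (pV + 1) + ε * r) +
      ε * (E + ((m + p) * n + p)) + (s * (t + a + c + b) + t * a + c * b) := by
  have hb' : b = pV + ε - s := by linear_combination hb
  have hs' : t = ε - s := by linear_combination hs
  have hc' : c = pU + ε - a - t := by linear_combination hc
  have hr' : r = ε * E - pU - pV - ε := by linear_combination hr
  subst hb' hc' hs' hr'
  rw [← sub_eq_zero]
  rcases zmod2_cases ε with rfl | rfl <;> rcases zmod2_cases s with rfl | rfl <;>
    rcases zmod2_cases a with rfl | rfl <;> ring_nf <;> reduce_mod_char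

theorem degree_graft {N : ℕ} {m n p : ℕ} (h : Composable m n p N) (U : PlanarTree m)
    (V : PlanarTree n) : (graft h U V).degree 2 = U.degree 2 + V.degree 2 := by
  have hN : ((N : ℕ) : ZMod 2) + 1 = m + n := by exact_mod_cast congrArg Nat.cast h.2.2.2.2
  rw [PlanarTree.degree_two, PlanarTree.degree_two, PlanarTree.degree_two, card_graft h U V]
  push_cast
  linear_combination hN

/-- The change of the global sign when a vertex is split. -/
theorem globalSign_split (M : Marking R (Option ι₀)) (ℓ₀ : List ι₀) (o : List R.H) {m n p : ℕ}
    (h : Composable m n p (M.n none)) (U : PlanarTree m) (V : PlanarTree n)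
    (T : ∀ i, PlanarTree (M.n (some i))) (hf : IsFrame R (none :: ℓ₀.map some) o) :
    globalSign ε M (none :: ℓ₀.map some) o
        (fun i => (optTrees M (graft h U V) T i).degree 2) =
      globalSign ε (M.split h) (some none :: none :: ℓ₀.map fun i => some (some i))
          (.inr false :: o.map .inl) (fun i => (M.splitTrees h U V T i).degree 2) +
        (U.degree 2 * V.degree 2 + ε * (V.degree 2 + 1) +
          ε * (ℓ₀.map fun i => (T i).degree 2 + 1).sum + ε * (o.length + ((m + p) * n + p))) := by
  have hcell := M.wordSign_cell_split h hf
  have g₁ : globalSign ε M (none :: ℓ₀.map some) o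
      (fun i => (optTrees M (graft h U V) T i).degree 2) =
      ((ℓ₀.map fun i => (U.degree 2 + V.degree 2) * (T i).degree 2 + ε * ((T i).degree 2 + 1)).sum +
      pairSum (fun i j => (T i).degree 2 * (T j).degree 2 + ε * ((T j).degree 2 + 1)) ℓ₀) +
      ε * ((o.length.choose 2 : ℕ) + wordSign (fun _ => 1) ((none :: ℓ₀.map some).flatMap M.cellBlock)
        + wordSign (fun _ => 1) (M.edgeCellWord (none :: ℓ₀.map some) o)) := by
    unfold globalSign
    rw [pairSum, map_map, pairSum_map, ← degree_graft h U V]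
    rfl
  have g₂ : globalSign ε (M.split h)
      (some none :: none :: ℓ₀.map fun i => some (some i)) (.inr false :: o.map .inl)
      (fun i => (M.splitTrees h U V T i).degree 2) =
      (U.degree 2 * V.degree 2 + ε * (V.degree 2 + 1) +
        (ℓ₀.map fun i => U.degree 2 * (T i).degree 2 + ε * ((T i).degree 2 + 1)).sum +
        ((ℓ₀.map fun i => V.degree 2 * (T i).degree 2 + ε * ((T i).degree 2 + 1)).sum +
      pairSum (fun i j => (T i).degree 2 * (T j).degree 2 + ε * ((T j).degree 2 + 1)) ℓ₀)) +
      ε * (((o.length + 1).choose 2 : ℕ) + (wordSign (fun _ => 1)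
        ((some none :: none :: ℓ₀.map fun i => some (some i)).flatMap (M.split h).cellBlock)
        + wordSign (fun _ => 1) ((M.split h).edgeCellWord
          (some none :: none :: ℓ₀.map fun i => some (some i)) (.inr false :: o.map .inl)))) := by
    unfold globalSign
    rw [pairSum, pairSum, map_cons, map_map, map_map, pairSum_map, sum_cons, length_cons,
      length_map, add_assoc ((Nat.choose _ _ : ℕ) : ZMod 2)]
    rfl
  rw [hcell] at g₂
  rw [g₁, g₂, Nat.choose_succ_succ' o.length 1, Nat.choose_one_right]
  simp only [list_sum_map_add, list_sum_map_mul_left, add_mul]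
  push_cast
  rw [← sub_eq_zero]
  ring_nf
  reduce_mod_char

theorem value_graft (M : Marking R (Option ι₀)) (ℓ₀ : List ι₀) (o : List R.H) {m n p : ℕ}
    (h : Composable m n p (M.n none)) (U : PlanarTree m) (V : PlanarTree n)
    (T : ∀ i, PlanarTree (M.n (some i))) (hf : IsFrame R (none :: ℓ₀.map some) o) :
    D.value M (none :: ℓ₀.map some) o (optTrees M (graft h U V) T) =
      msign K (graftSign (i := p) U V + ε * ((p : ZMod 2) * n + p + (m : ZMod 2) * n + 1)) *
        D.value (M.split h) (some none :: none :: ℓ₀.map fun i => some (some i))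
          (.inr false :: o.map .inl) (M.splitTrees h U V T) := by
  classical
  obtain ⟨A, B, C, hM, hU, hV, hA, hB, hC⟩ := M.split_legs h
  let vV := fun (α : R.H → D.κ) (s : D.κ) => D.vt V fun j => if h₀ : j.1 = 0 then s else
    α (M.e ⟨none, ⟨j.1 + p - 1, by obtain ⟨_, _, _, _, _⟩ := h; have := j.2; omega⟩⟩)
  let vU := fun (α : R.H → D.κ) (t : D.κ) => D.vt U fun j => if h₀ : j.1 = p then t else
    α (M.e ⟨none, ⟨if j.1 < p then j.1 else j.1 + n - 1, by
      obtain ⟨_, _, _, _, _⟩ := h; have := j.2; split_ifs <;> omega⟩⟩)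
  let Q := fun α : R.H → D.κ => (∏ i, D.vt (T i) fun j => α (M.e ⟨some i, j⟩)) *
    (o.map fun h => D.G (α h) (α (R.inv h))).prod
  let w := fun (α : R.H → D.κ) h => D.deg (α h)
  have e₁ : ∀ α : R.H → D.κ, D.term M (none :: ℓ₀.map some) o
      (optTrees M (graft h U V) T) α = ∑ s, ∑ t,
        msign K (wordSign (w α) (R.edgeWord o) + wordSign (w α) (M.halfWord (none :: ℓ₀.map some)) +
          graftSign (i := p) U V + (V.degree 2 * (A.map (w α)).sum + ε * D.deg t)) *
          (vV α s * D.G s t * vU α t * Q α) := by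
    intro α
    have h2 := sum_lt_eq_sum_take (k := p - 1) (fun j => M.e ⟨none, j.succ⟩) (w α)
      (hM.trans (append_assoc A B C)) hA
    have h1 : D.vt (graft h U V) (fun j => α (M.e ⟨none, j⟩)) = msign K (graftSign (i := p) U V) *
        ∑ s, ∑ t, msign K (V.degree 2 * (A.map (w α)).sum + ε * D.deg t) *
          (vV α s * D.G s t * vU α t) := by
      rw [← h2]
      exact D.vt_graft h U V fun j => α (M.e ⟨none, j⟩)
    unfold term
    rw [Fintype.prod_option]
    refine (congrArg₂ _ (congrArg₂ _ rfl (congrArg₂ _ h1 rfl)) rfl).trans ?_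
    simp only [mul_sum, sum_mul]
    refine sum_congr rfl fun s _ => sum_congr rfl fun t _ => ?_
    simp only [msign_add, Q]
    simp only [optCons]
    ring
  have hv₁ : ∀ α s t, D.vt V (fun j => Sum.elim α (fun b => cond b t s) (M.splitE h ⟨none, j⟩)) = vV α s := by
    intro α s t
    refine congrArg (D.vt V) (funext fun j => ?_)
    rw [M.splitE_upper h j]
    split_ifs <;> rfl
  have hv₂ : ∀ α s t, D.vt U (fun j => Sum.elim α (fun b => cond b t s) (M.splitE h ⟨some none, j⟩)) =
      vU α t := by
    intro α s t
    refine congrArg (D.vt U) (funext fun j => ?_)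
    rw [M.splitE_lower h j]
    split_ifs <;> rfl
  have hfs := hf.split h
  let Z := (ℓ₀.map some).flatMap M.halfBlock
  have hb₁ : (M.split h).halfBlock (some none) =
      A.map .inl ++ .inr true :: C.map .inl ++ [.inl (M.e ⟨none, 0⟩)] :=
    congr (congrArg _ hU) (congrArg (fun x => [x]) (M.splitE_lower_zero h))
  have hb₂ : (M.split h).halfBlock none = B.map .inl ++ [.inr false] :=
    congr (congrArg _ hV) rfl
  have hw : M.halfWord (none :: ℓ₀.map some) = A ++ B ++ C ++ M.e ⟨none, 0⟩ :: Z := by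
    unfold Marking.halfWord
    rw [flatMap_cons, ← hM]
    unfold Marking.halfBlock
    simp only [append_assoc, cons_append, nil_append]
    rfl
  have hw' : (M.split h).halfWord (some none :: none :: ℓ₀.map fun i => some (some i)) =
      A.map Sum.inl ++ .inr true :: (C.map Sum.inl ++ .inl (M.e ⟨none, 0⟩) ::
        (B.map Sum.inl ++ .inr false :: Z.map Sum.inl)) := by
    unfold Marking.halfWord
    rw [flatMap_cons, flatMap_cons, hb₁, hb₂]
    simp only [Z, append_assoc, cons_append, nil_append, map_flatMap, flatMap_map]
    refine congrArg (fun l => List.map Sum.inl A ++ Sum.inr true :: (List.map Sum.inl C ++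
      Sum.inl (M.e ⟨none, 0⟩) :: (List.map Sum.inl B ++ Sum.inr false :: l))) ?_
    exact flatMap_congr fun i _ => M.halfBlock_split h i
  have he' : (M.splitGraph h).edgeWord (.inr false :: o.map .inl) =
      .inr false :: .inr true :: (R.edgeWord o).map Sum.inl := by
    unfold RibbonData.edgeWord
    simp only [map_flatMap, flatMap_cons, flatMap_map, cons_append]
    rfl
  have e₂ : ∀ (α : R.H → D.κ) s t, D.term (M.split h)
      (some none :: none :: ℓ₀.map fun i => some (some i)) (.inr false :: o.map .inl)
      (M.splitTrees h U V T) (Sum.elim α fun b => cond b t s) =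
      msign K (wordSign (w α) (R.edgeWord o) + wordSign (w α) (M.halfWord (none :: ℓ₀.map some)) +
        (D.deg s * (D.deg t + (A.map (w α)).sum + ((C.map (w α)).sum + w α (M.e ⟨none, 0⟩)) +
          (B.map (w α)).sum) + D.deg t * (A.map (w α)).sum +
          ((C.map (w α)).sum + w α (M.e ⟨none, 0⟩)) * (B.map (w α)).sum)) *
        (vV α s * D.G s t * vU α t * Q α) := by
    intro α s t
    let w' : R.H ⊕ Bool → ZMod 2 := fun x => D.deg (Sum.elim α (fun b => cond b t s) x)
    have h1 := wordSign_split w' (hw ▸ hf.halfWord_nodup M) (hw ▸ hf.edgeWord_perm M)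
    rw [← hw, ← hw', ← he'] at h1
    unfold term
    rw [Fintype.prod_option, Fintype.prod_option]
    refine (congrArg₂ (· * ·) (congrArg₂ (· * ·) (congrArg _ h1)
      (congrArg₂ (· * ·) (hv₁ α s t) (congrArg₂ (· * ·) (hv₂ α s t) rfl))) rfl).trans ?_
    rw [map_cons, prod_cons, map_map]
    change msign K (wordSign (w α) (R.edgeWord o) + wordSign (w α) (M.halfWord (none :: ℓ₀.map some)) +
        (D.deg s * (D.deg t + (A.map (w α)).sum + (C.map (w α)).sum + w α (M.e ⟨none, 0⟩) +
          (B.map (w α)).sum) + D.deg t * (A.map (w α)).sum +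
          ((C.map (w α)).sum + w α (M.e ⟨none, 0⟩)) * (B.map (w α)).sum)) *
      (vV α s * (vU α t * ∏ i, D.vt (T i) fun j => α (M.e ⟨some i, j⟩))) *
        (D.G s t * (o.map fun h => D.G (α h) (α (R.inv h))).prod) = _
    rw [add_assoc (D.deg t + _) (List.sum _) (w α (M.e ⟨none, 0⟩))]
    simp only [Q]
    ring
  have e₃ : ∀ (α : R.H → D.κ) s t, vV α s * D.G s t * vU α t * Q α ≠ 0 →
      globalSign ε M (none :: ℓ₀.map some) o
        (fun i => (optTrees M (graft h U V) T i).degree 2) +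
      (V.degree 2 * (A.map (w α)).sum + ε * D.deg t) =
      ε * ((p : ZMod 2) * n + p + (m : ZMod 2) * n + 1) + globalSign ε (M.split h)
        (some none :: none :: ℓ₀.map fun i => some (some i)) (.inr false :: o.map .inl)
        (fun i => (M.splitTrees h U V T i).degree 2) +
        (D.deg s * (D.deg t + (A.map (w α)).sum + ((C.map (w α)).sum + w α (M.e ⟨none, 0⟩)) +
          (B.map (w α)).sum) + D.deg t * (A.map (w α)).sum +
          ((C.map (w α)).sum + w α (M.e ⟨none, 0⟩)) * (B.map (w α)).sum) := by
    intro α s t h0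
    have hG : D.G s t ≠ 0 := right_ne_zero_of_mul (left_ne_zero_of_mul (left_ne_zero_of_mul h0))
    have hs := D.G_deg _ _ hG
    let w' : R.H ⊕ Bool → ZMod 2 := fun x => D.deg (Sum.elim α (fun b => cond b t s) x)
    have hVd : (B.map (w α)).sum + D.deg s = V.degree 2 + ε := by
      have h1 : ∑ j, w' ((M.split h).e ⟨none, j⟩) = V.degree 2 + ε := by
        refine D.vt_deg h.2.1 V (fun j => Sum.elim α (fun b => cond b t s) (M.splitE h ⟨none, j⟩)) ?_
        rw [hv₁ α s t]
        exact left_ne_zero_of_mul (left_ne_zero_of_mul (left_ne_zero_of_mul h0))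
      rw [← Marking.sum_halfBlock, hb₂, map_append, sum_append, map_map, map_singleton,
        sum_singleton] at h1
      exact h1
    have hUd : (A.map (w α)).sum + D.deg t + ((C.map (w α)).sum + w α (M.e ⟨none, 0⟩)) =
        U.degree 2 + ε := by
      have h1 : ∑ j, w' ((M.split h).e ⟨some none, j⟩) = U.degree 2 + ε := by
        refine D.vt_deg h.1 U (fun j => Sum.elim α (fun b => cond b t s) (M.splitE h ⟨some none, j⟩)) ?_
        rw [hv₂ α s t]
        exact right_ne_zero_of_mul (left_ne_zero_of_mul h0)
      rw [← Marking.sum_halfBlock, hb₁, map_append, sum_append, map_append, sum_append, map_cons,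
        sum_cons, map_map, map_map, map_singleton, sum_singleton] at h1
      rw [← h1, add_assoc, add_assoc, add_assoc]
      rfl
    have hTd : ∀ i, ∑ j, w α (M.e ⟨some i, j⟩) = (T i).degree 2 + ε := by
      intro i
      refine D.vt_deg (M.two_le hf.1 _) (T i) _ fun hz => ?_
      exact left_ne_zero_of_mul (right_ne_zero_of_mul h0) (prod_eq_zero (mem_univ i) hz)
    have hod : ∀ y ∈ o, w α y + w α (R.inv y) = ε := fun y hy => D.G_deg _ _
      (list_prod_ne_zero_imp (right_ne_zero_of_mul (right_ne_zero_of_mul h0)) y hy)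
    have hsum := hf.sum_halfEdges M (w α)
    rw [map_cons, sum_cons, ← Marking.sum_halfBlock, map_map, map_congr_left hod, map_const',
      sum_replicate, nsmul_eq_mul] at hsum
    rw [show ((fun i => ∑ j, w α (M.e ⟨i, j⟩)) ∘ some) = fun i => (T i).degree 2 + ε from
      funext hTd] at hsum
    have hnone : ((M.halfBlock none).map (w α)).sum = U.degree 2 + V.degree 2 + ε := by
      unfold Marking.halfBlock
      rw [hM]
      simp only [map_append, map_cons, map_nil, sum_append, sum_cons, sum_nil, add_zero]
      linear_combination hVd + hUd - hs
    rw [hnone] at hsum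
    have key := graft_sign_identity (p := p) (m := m) (n := n) hVd hUd hs
      (hsum.trans (mul_comm _ _))
    have hg := globalSign_split (ε := ε) M ℓ₀ o h U V T hf
    have hlen : ε * (ℓ₀.map fun i => (T i).degree 2 + 1).sum =
        ε * (ℓ₀.map fun i => (T i).degree 2 + ε).sum := by
      rw [← list_sum_map_mul_left, ← list_sum_map_mul_left]
      refine congrArg _ (map_congr_left fun i _ => ?_)
      rw [mul_add, mul_add, zmod2_mul_self, mul_one]
    rw [hg, hlen, add_right_comm, key, ← sub_eq_zero]
    generalize globalSign ε (M.split h) _ _ _ = g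
    ring_nf
    reduce_mod_char
  unfold value
  refine (congrArg _ (sum_congr rfl fun α _ => e₁ α)).trans ?_
  have e₄ : ∀ i : Fintype ((M.splitGraph h).H → D.κ), ∑ β ∈ @Finset.univ _ i, D.term (M.split h)
      (some none :: none :: ℓ₀.map fun i => some (some i)) (.inr false :: o.map .inl)
      (M.splitTrees h U V T) β = _ := fun i => @sum_splitColoring R.H D.κ K _ i _ _ _
  refine Eq.trans ?_ (congrArg (fun z => msign K _ * (msign K _ * z)) (e₄ _).symm)
  rw [← mul_assoc, mul_sum, mul_sum]
  refine sum_congr rfl fun α _ => ?_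
  simp only [mul_sum]
  refine sum_congr rfl fun s _ => sum_congr rfl fun t _ => ?_
  rw [e₂]
  by_cases h0 : vV α s * D.G s t * vU α t * Q α = 0
  · rw [h0, mul_zero, mul_zero, mul_zero, mul_zero]
  · have e₅ : ∀ {a b c d e : ZMod 2} {x : K}, a + b = c + d + e →
        msign K a * (msign K b * x) = msign K c * msign K d * (msign K e * x) := by
      intro a b c d e x hx
      rw [← mul_assoc, ← mul_assoc, ← msign_add, ← msign_add, ← msign_add, hx]
    exact e₅ (by linear_combination e₃ α s t h0)

/-- The state sum as a functional of trees on marked ribbon graphs. -/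
def functional : GraphFunctional K ε K where
  val M ℓ o T := D.value M ℓ o T
  val_reindex M σ ℓ o T _ := D.value_reindex M σ ℓ o T
  val_transport M φ ℓ o T hf := D.value_transport M φ ℓ o T hf
  val_swap_vertices M l₁ l₂ x y o T hf := D.value_swap_vertices M l₁ l₂ x y o T hf
  val_swap_edges M ℓ o₁ o₂ x y T hf := D.value_swap_edges M ℓ o₁ o₂ x y T hf
  val_flip_edge M ℓ o₁ o₂ x T hf := D.value_flip_edge M ℓ o₁ o₂ x T hf
  val_rotate M ℓ₀ o t T hf := D.value_rotate M ℓ₀ o t T hf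
  val_graft M ℓ₀ o _ _ _ h U V T hf := D.value_graft M ℓ₀ o h U V T hf

end StateData

/-! ### The state sum of a cyclic algebra -/

section Algebra

variable {K : Type u} [Field K] {A : Type*} [AddCommGroup A] [Module K A] {N : ℕ}
  {𝒜 : ZMod (2 * N) → Submodule K A} {ε : ZMod 2} {X : CyclicData K A}
  {κ : Type} [Fintype κ] [DecidableEq κ]

theorem parity_add (i j : ZMod (2 * N)) : parity (i + j) = parity i + parity j := map_add _ _ _

theorem parity_sum {ι : Type*} (s : Finset ι) (f : ι → ZMod (2 * N)) :
    parity (∑ l ∈ s, f l) = ∑ l ∈ s, parity (f l) := map_sum _ _ _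

theorem parity_degree {n : ℕ} (T : PlanarTree n) : parity (T.degree (2 * N)) = T.degree 2 :=
  map_intCast (ZMod.castHom (Dvd.intro N rfl) (ZMod 2)) _

theorem insertOp_eq_update {m n i M : ℕ} (h : Composable m n i M) (f : Op K A m) (g : Op K A n)
    (a : Fin M → A) : insertOp h f g a =
      f (Function.update (fun p : Fin m => a ⟨if p.1 + 1 < i then p.1 else p.1 + n - 1, by
          obtain ⟨_, _, _, _, _⟩ := h; have := p.2; split_ifs <;> omega⟩)
        ⟨i - 1, by obtain ⟨_, _, _, _, _⟩ := h; omega⟩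
        (g fun q => a ⟨i - 1 + q.1, by obtain ⟨_, _, _, _, _⟩ := h; have := q.2; omega⟩)) := by
  have hi := h.2.2.1
  unfold insertOp
  refine congrArg f (funext fun p => ?_)
  rw [Function.update_apply]
  by_cases hp : p = ⟨i - 1, by obtain ⟨_, _, _, _, _⟩ := h; omega⟩
  · have hp' : p.1 = i - 1 := congrArg Fin.val hp
    rw [if_pos hp, dif_neg (by omega), dif_pos (by omega)]
    refine congrArg g (funext fun q => congrArg a (Fin.ext ?_))
    dsimp only
    omega
  · have hp' : p.1 ≠ i - 1 := fun hh => hp (Fin.ext hh)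
    rw [if_neg hp]
    split_ifs <;> first | omega | rfl

/-- The Gram matrix of a bilinear form. -/
def gram (B : A →ₗ[K] A →ₗ[K] K) (b : Module.Basis κ K A) : Matrix κ κ K :=
  Matrix.of fun s t => B (b s) (b t)

theorem gram_mul_inv {B : A →ₗ[K] A →ₗ[K] K} (h : B.Nondegenerate) (b : Module.Basis κ K A) :
    gram B b * (gram B b)⁻¹ = 1 := by
  refine Matrix.mul_nonsing_inv _ (isUnit_iff_ne_zero.2 ?_)
  have := (LinearMap.nondegenerate_toMatrix₂_iff b b).2 h
  rw [show gram B b = LinearMap.toMatrix₂ b b B from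
    Matrix.ext fun s t => (LinearMap.toMatrix₂_apply b b B s t).symm]
  exact Matrix.nondegenerate_iff_det_ne_zero.1 this

/-- A vector is determined by its products with a basis. -/
theorem eq_sum_gram_inv {B : A →ₗ[K] A →ₗ[K] K} (h : B.Nondegenerate) (b : Module.Basis κ K A)
    (a : A) : a = ∑ s, ∑ t, (B a (b s) * (gram B b)⁻¹ s t) • b t := by
  have h1 : ∀ t, ∑ s, B a (b s) * (gram B b)⁻¹ s t = b.repr a t := by
    intro t
    have h2 : ∀ s, B a (b s) = ∑ u, b.repr a u * gram B b u s := by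
      intro s
      conv_lhs => rw [← b.sum_repr a]
      rw [map_sum, LinearMap.sum_apply]
      simp [gram]
    simp only [h2, sum_mul]
    rw [sum_comm]
    simp only [mul_assoc, ← mul_sum]
    simp only [← Matrix.mul_apply, gram_mul_inv h b]
    simp [Matrix.one_apply]
  rw [sum_comm]
  simp only [← Finset.sum_smul, h1]
  exact (b.sum_repr a).symm

section

variable (hX : IsCyclicAInfinity 𝒜 ε X) (b : Module.Basis κ K A) (deg : κ → ZMod (2 * N))
  (hb : ∀ s, b s ∈ 𝒜 (deg s))

include hX hb

theorem gram_parity (s t : κ) (h : gram X.pairing b s t ≠ 0) :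
    parity (deg s) = parity (deg t) + ε := hX.pairing_parity _ _ _ (hb s) _ (hb t) h

theorem gram_symm (s t : κ) : gram X.pairing b s t =
    msign K (parity (deg s) * parity (deg t)) * gram X.pairing b t s :=
  hX.pairing_symm _ _ _ (hb s) _ (hb t)

theorem gram_inv_parity (s t : κ) (h : (gram X.pairing b)⁻¹ s t ≠ 0) :
    parity (deg s) + parity (deg t) = ε := by
  have h1 : gram X.pairing b * Matrix.of (fun s t => if parity (deg s) + parity (deg t) = ε then
      (gram X.pairing b)⁻¹ s t else 0) = 1 := by
    ext r t
    rw [Matrix.mul_apply]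
    by_cases hrt : parity (deg r) = parity (deg t)
    · rw [← gram_mul_inv hX.pairing_nondegenerate b, Matrix.mul_apply]
      refine sum_congr rfl fun s _ => ?_
      by_cases h0 : gram X.pairing b r s = 0
      · rw [h0, zero_mul, zero_mul]
      · rw [Matrix.of_apply, if_pos]
        rw [← hrt, gram_parity hX b deg hb r s h0, ← add_assoc, zmod2_add_self, zero_add]
    · rw [Matrix.one_apply_ne fun hh => hrt (by rw [hh])]
      refine Finset.sum_eq_zero fun s _ => ?_
      by_cases h0 : gram X.pairing b r s = 0
      · rw [h0, zero_mul]
      · rw [Matrix.of_apply, if_neg, mul_zero]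
        intro hh
        refine hrt ?_
        rw [gram_parity hX b deg hb r s h0, ← hh, ← add_assoc, zmod2_add_self, zero_add]
  by_contra h0
  rw [Matrix.inv_eq_right_inv h1, Matrix.of_apply, if_neg h0] at h
  exact h rfl

theorem gram_inv_symm (s t : κ) : (gram X.pairing b)⁻¹ t s =
    msign K (parity (deg s) * parity (deg t) + ε + ε * parity (deg s) + ε * parity (deg t)) *
      (gram X.pairing b)⁻¹ s t := by
  have h1 : Matrix.of (fun t s => msign K (parity (deg s) * parity (deg t) + ε +
      ε * parity (deg s) + ε * parity (deg t)) * (gram X.pairing b)⁻¹ s t) * gram X.pairing b = 1 := by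
    ext t r
    have h2 : (gram X.pairing b * (gram X.pairing b)⁻¹) r t = (1 : Matrix κ κ K) t r := by
      rw [gram_mul_inv hX.pairing_nondegenerate b, Matrix.one_apply, Matrix.one_apply]
      simp only [eq_comm]
    rw [← h2, Matrix.mul_apply, Matrix.mul_apply]
    refine sum_congr rfl fun s _ => ?_
    rw [Matrix.of_apply, gram_symm hX b deg hb s r]
    by_cases h0 : (gram X.pairing b)⁻¹ s t = 0
    · rw [h0]; ring
    by_cases h0' : gram X.pairing b r s = 0
    · rw [h0']; ring
    have h3 := gram_inv_parity hX b deg hb s t h0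
    have h4 := gram_parity hX b deg hb r s h0'
    have h5 : msign K (parity (deg s) * parity (deg t) + ε + ε * parity (deg s) +
        ε * parity (deg t)) * msign K (parity (deg s) * parity (deg r)) = 1 := by
      rw [← msign_add, h4, ← h3]
      generalize parity (deg s) = x
      generalize parity (deg t) = y
      rw [show x * y + (x + y) + (x + y) * x + (x + y) * y + x * (x + (x + y)) = 0 by
        revert x y; decide, msign_zero]
    linear_combination ((gram X.pairing b)⁻¹ s t * gram X.pairing b r s) * h5
  exact congrFun (congrFun (Matrix.inv_eq_left_inv h1) t) s

/-- The state data of a cyclic `A∞`-algebra with a homogeneous basis. -/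
def algebraStateData : StateData K ε where
  κ := κ
  deg s := parity (deg s)
  G s t := (gram X.pairing b)⁻¹ s t * msign K (ε * parity (deg t))
  vt T a := X.pairing (X.ρ _ (single T 1) fun j => b (a j.succ)) (b (a 0))
  G_deg s t h := gram_inv_parity hX b deg hb s t (left_ne_zero_of_mul h)
  G_symm s t := by
    rw [gram_inv_symm hX b deg hb s t]
    simp only [msign_add]
    linear_combination (msign K (parity (deg s) * parity (deg t)) * msign K ε *
      msign K (ε * parity (deg t)) * (gram X.pairing b)⁻¹ s t) * msign_mul_self K (ε * parity (deg s))
  vt_deg hn T a h := by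
    have h1 := hX.pairing_parity _ _ _ (hX.ρ_mem _ hn T _ _ fun l => hb (a l.succ)) _ (hb (a 0)) h
    rw [parity_add, parity_sum, parity_degree] at h1
    rw [Fin.sum_univ_succ]
    linear_combination h1 + zmod2_add_self (parity (deg (a 0))) - zmod2_add_self (T.degree 2)
  vt_rotate {n} hn T a := by
    have h1 := hX.cyclic n hn T (fun l => deg (a l)) (fun l => b (a l)) fun l => hb _
    rw [treeRotation_single, ← mul_one (msign K T.rotationSign), ← smul_eq_mul, ← smul_single,
      map_smul, smul_apply, map_smul, LinearMap.smul_apply, smul_eq_mul] at h1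
    have h2 : ∀ j : Fin n, a (j.succ - 1) = a j.castSucc := fun j => by
      rw [← Fin.coeSucc_eq_succ, add_sub_cancel_right]
    have h3 : a (0 - 1) = a (Fin.last n) := by
      rw [sub_eq_iff_eq_add.2 (Fin.last_add_one n).symm]
    simp only [h2, h3]
    rw [msign_add, mul_assoc, ← h1, ← mul_assoc, msign_mul_self, one_mul]
  vt_graft {m n p N} h U V a := by
    have h1 := hX.ρ_comp m n p N h U V (fun l => deg (a l.succ)) (fun l => b (a l.succ)) fun l => hb _
    rw [treeComp_eq, ← mul_one (msign K (graftSign _ _)), ← smul_eq_mul, ← smul_single, map_smul,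
      smul_apply, msign_smul_eq_iff] at h1
    rw [h1, map_smul, LinearMap.smul_apply, smul_eq_mul, map_smul, LinearMap.smul_apply, smul_eq_mul]
    refine congrArg _ ?_
    rw [insertOp_eq_update]
    let v := X.ρ n (single V 1) fun q => b (a (Fin.succ ⟨p - 1 + q.1, by
      obtain ⟨_, _, _, _, _⟩ := id h; have := q.2; omega⟩))
    have hp := h.2.2.1
    rw [show (X.ρ n (single V 1) fun q => _) = _ from
      eq_sum_gram_inv hX.pairing_nondegenerate b v]
    simp only [MultilinearMap.map_update_sum, MultilinearMap.map_update_smul, map_sum, map_smul,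
      LinearMap.sum_apply, LinearMap.smul_apply, mul_sum, smul_eq_mul, msign_add]
    refine sum_congr rfl fun s _ => sum_congr rfl fun t _ => ?_
    have hv : v = X.ρ n (single V 1) fun j : Fin n => b (if h0 : (j.succ).1 = 0 then s else
        a ⟨(j.succ).1 + p - 1, by obtain ⟨_, _, _, _, _⟩ := id h; have := j.succ.2; omega⟩) := by
      refine congrArg _ (funext fun j => congrArg b ?_)
      rw [dif_neg (by simp)]
      refine congrArg a (Fin.ext ?_)
      simp only [Fin.val_succ]
      omega
    have hu : (Function.update (fun q : Fin m => b (a (Fin.succ ⟨if q.1 + 1 < p then q.1 else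
          q.1 + n - 1, by obtain ⟨_, _, _, _, _⟩ := id h; have := q.2; split_ifs <;> omega⟩)))
        ⟨p - 1, by obtain ⟨_, _, _, _, _⟩ := id h; omega⟩ (b t)) = fun j : Fin m =>
          b (if h0 : (j.succ).1 = p then t else a ⟨if (j.succ).1 < p then (j.succ).1 else
            (j.succ).1 + n - 1, by
              obtain ⟨_, _, _, _, _⟩ := id h; have := j.succ.2; split_ifs <;> omega⟩) := by
      funext j
      have hn := h.2.1
      rw [Function.update_apply]
      by_cases hj : j = ⟨p - 1, by have h' := id h; obtain ⟨_, _, _, _, _⟩ := h'; omega⟩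
      · have hj' : j.1 = p - 1 := congrArg Fin.val hj
        rw [if_pos hj, dif_pos (by simp only [Fin.val_succ]; omega)]
      · have hj' : j.1 ≠ p - 1 := fun hh => hj (Fin.ext hh)
        rw [if_neg hj, dif_neg (by simp only [Fin.val_succ]; omega)]
        refine congrArg b (congrArg a (Fin.ext ?_))
        simp only [Fin.val_succ]
        split_ifs <;> omega
    have hz : ∀ (hk : _), (⟨if ((0 : Fin (m + 1)).1) < p then (0 : Fin (m + 1)).1 else
        (0 : Fin (m + 1)).1 + n - 1, hk⟩ : Fin (N + 1)) = 0 := fun hk => Fin.ext (if_pos hp)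
    have hl : ∀ f : Fin N → ZMod 2, ∑ l with l.1 + 1 < p, f l = ∑ l with l.1 < p - 1, f l := fun f =>
      sum_congr (Finset.filter_congr fun l _ => by omega) fun _ _ => rfl
    rw [hu, hl, ← hv, dif_pos (show ((0 : Fin (n + 1)) : ℕ) = 0 from rfl),
      dif_neg (show ¬((0 : Fin (m + 1)) : ℕ) = p from Nat.ne_of_lt hp), hz]
    have e : ∀ x y z q r : K, r * r = 1 → x * (y * z * q) = x * r * (y * (z * r) * q) := by
      intro x y z q r hr
      linear_combination (-(x * y * z * q)) * hr
    exact e _ _ _ _ _ (msign_mul_self K _)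

end

/-- In a homogeneous basis, the contraction along a graph is a state sum. -/
theorem contraction_eq_value (hX : IsCyclicAInfinity 𝒜 ε X) {m : ℕ} (b : Module.Basis (Fin m) K A) (deg : Fin m → ZMod (2 * N))
    (hb : ∀ s, b s ∈ 𝒜 (deg s)) {R : RibbonData} (hR : R.IsRibbonGraph) (L : Labelling R)
    (o : List R.H) (ho : IsEdgeOrder R o) (T : ∀ i, PlanarTree (L.n i)) :
    contraction X.pairing ε b (fun s => parity (deg s)) L o
      (fun i => X.ρ _ (single (T i) 1)) (fun i => (T i).degree 2) =
      (algebraStateData hX b deg hb).value L.marking (finRange L.k) o T := by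
  classical
  have hf : IsFrame R (finRange L.k) o :=
    ⟨hR, nodup_finRange _, mem_finRange, ho⟩
  have h1 := fun w : R.H → ZMod 2 =>
    inversions_idxOf w hf.edgeWord_nodup (hf.edgeWord_perm L.marking)
  have h2 := inversions_idxOf (fun _ => 1) (hf.cellWord_nodup L.marking)
    (hf.cellWord_perm L.marking)
  unfold contraction StateData.value StateData.term
  refine congr (congrArg _ (congrArg _ ?_)) (sum_congr rfl fun α _ => ?_)
  · unfold StateData.globalSign
    have h3 : ∀ (k : ℕ) (p : Fin k → ZMod 2), ∑ i : Fin k, ((k : ZMod 2) - 1 - (i.1 : ZMod 2)) * p i =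
        pairSum (fun i _ => p i) (finRange k) := by
      intro k p
      rw [← sum_sum_eq_pairSum]
      refine sum_congr rfl fun i _ => ?_
      rw [Finset.sum_const, nsmul_eq_mul, Finset.filter_lt_eq_Ioi, Fin.card_Ioi, Nat.sub_sub,
        Nat.cast_sub (by omega)]
      push_cast
      ring
    have h4 : ∀ i : Fin L.k → ZMod 2, pairSum (fun i' j => (i i' + ε) * (i j + ε)) (finRange L.k) +
        ε * pairSum (fun i' _ => i i') (finRange L.k) =
        pairSum (fun i' j => i i' * i j + ε * (i j + 1)) (finRange L.k) := by
      intro i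
      rw [← pairSum_mul_left, ← pairSum_add]
      refine pairSum_congr fun x _ y _ => ?_
      rw [← sub_eq_zero]
      rcases zmod2_cases ε with rfl | rfl <;> ring_nf <;> reduce_mod_char
    rw [h3, sum_sum_eq_pairSum, add_comm (ε * _), h4]
    refine Eq.trans ?_ (congrArg (fun z => _ + ε * z) (add_assoc _ _ _).symm)
    rw [← h2, mul_add, ← add_assoc]
    rfl
  · exact congrArg₂ _ (congrArg₂ _ (congrArg _ (h1 _)) rfl) rfl

end Algebra

/-! ### Independence of the basis -/

section Expand

/-- A product of sums over the colorings of the blocks of a set is a sum over the colorings of this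
set. -/
theorem prod_sum_blocks {K H κ ι : Type*} [CommSemiring K] [Fintype ι] [Fintype κ] [DecidableEq ι]
    [Fintype (H → κ)] {n : ι → ℕ} (e : (Σ i, Fin (n i)) ≃ H) (f : ∀ i, (Fin (n i) → κ) → K) :
    ∏ i, ∑ a, f i a = ∑ α : H → κ, ∏ i, f i fun j => α (e ⟨i, j⟩) := by
  classical
  rw [Finset.prod_univ_sum, Fintype.piFinset_univ]
  exact (Fintype.sum_equiv ((e.symm.arrowCongr (Equiv.refl κ)).trans (Equiv.piCurry fun _ _ => κ)) _ _
    fun α => rfl).symm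

variable {R : RibbonData} {ι : Type}

/-- The half-edges of a graph from an ordering of its edges. -/
theorem IsFrame.exists_edgeEquiv {ℓ : List ι} {o : List R.H} (hf : IsFrame R ℓ o) :
    ∃ e : (Σ _ : Fin o.length, Fin 2) ≃ R.H,
      ∀ i, e ⟨i, 0⟩ = o[i] ∧ e ⟨i, 1⟩ = R.inv o[i] := by
  refine ⟨Equiv.ofBijective (fun p => if p.2 = 0 then o[p.1] else R.inv o[p.1]) ⟨?_, ?_⟩,
    fun i => ⟨by simp, by simp⟩⟩
  · rintro ⟨i, s⟩ ⟨j, t⟩ h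
    have hi : ∀ z, R.edgeOf z = R.edgeOf (R.inv z) := fun z => Quot.sound rfl
    have h1 : R.edgeOf o[i] = R.edgeOf o[j] := by
      have := congrArg R.edgeOf h
      dsimp only at this
      split_ifs at this <;> simpa only [← hi] using this
    have h2 : i = j := by
      have := (List.Nodup.getElem_inj_iff hf.4.1 (i := i.1) (j := j.1) (hi := by simp) (hj := by simp)).1
        (by simpa using h1)
      exact Fin.ext this
    subst h2
    have h3 := hf.1.inv_ne o[i]
    have h4 : (if s = 0 then o[i] else R.inv o[i]) = if t = 0 then o[i] else R.inv o[i] := h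
    refine congrArg (Sigma.mk i) ?_
    by_cases hs : s = 0 <;> by_cases ht : t = 0
    · rw [hs, ht]
    · rw [if_pos hs, if_neg ht] at h4
      exact absurd h4.symm h3
    · rw [if_neg hs, if_pos ht] at h4
      exact absurd h4 h3
    · omega
  · intro x
    obtain ⟨y, hy, hxy⟩ := List.mem_flatMap.1 (hf.mem_edgeWord x)
    obtain ⟨i, hi, rfl⟩ := List.getElem_of_mem hy
    rcases List.mem_pair.1 hxy with rfl | rfl
    · exact ⟨⟨⟨i, hi⟩, 0⟩, by simp⟩
    · exact ⟨⟨⟨i, hi⟩, 1⟩, by simp⟩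

theorem RibbonData.prod_edgeWord {K : Type*} [CommMonoid K] (o : List R.H) (f : R.H → K) :
    ((R.edgeWord o).map f).prod = (o.map fun h => f h * f (R.inv h)).prod := by
  unfold RibbonData.edgeWord
  induction o with
  | nil => rfl
  | cons h o ih =>
    rw [flatMap_cons, map_append, prod_append, ih]
    simp

theorem IsFrame.sum_prod_edges {ℓ : List ι} {o : List R.H} (hf : IsFrame R ℓ o) {K κ : Type*} [Field K]
    [Fintype κ] [Fintype (R.H → κ)] (g : R.H → κ → κ → K) :
    ∑ α : R.H → κ, (o.map fun h => g h (α h) (α (R.inv h))).prod =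
      (o.map fun h => ∑ x, ∑ y, g h x y).prod := by
  obtain ⟨e, he⟩ := hf.exists_edgeEquiv
  have h1 : ∀ h : R.H, ∑ x, ∑ y, g h x y = ∑ a : Fin 2 → κ, g h (a 0) (a 1) := fun h => by
    rw [← Fintype.sum_prod_type']
    exact (Fintype.sum_equiv (finTwoArrowEquiv κ) _ _ fun a => rfl).symm
  simp only [h1, ← Fin.prod_univ_fun_getElem]
  refine Eq.trans ?_ (prod_sum_blocks e fun i a => g o[i] (a 0) (a 1)).symm
  refine sum_congr rfl fun α _ => prod_congr rfl fun i _ => ?_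
  change _ = g o[i] (α (e ⟨i, 0⟩)) (α (e ⟨i, 1⟩))
  rw [(he i).1, (he i).2]
  rfl

end Expand

namespace StateData

variable {K : Type u} [Field K] {ε : ZMod 2} {R : RibbonData} {ι : Type} [Fintype ι]

/-- State sums do not change under a homogeneous change of colors. -/
theorem value_eq_of_matrix {D D' : StateData K ε} (P : D'.κ → D.κ → K)
    (hdeg : ∀ x y, P x y ≠ 0 → D'.deg x = D.deg y)
    (hvt : ∀ {n : ℕ} (T : PlanarTree n) (a : Fin (n + 1) → D'.κ),
      D'.vt T a = ∑ c : Fin (n + 1) → D.κ, (∏ j, P (a j) (c j)) * D.vt T c)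
    (hG : ∀ s t, ∑ x, ∑ y, P x s * P y t * D'.G x y = D.G s t)
    (M : Marking R ι) (ℓ : List ι) (o : List R.H) (T : ∀ i, PlanarTree (M.n i))
    (hf : IsFrame R ℓ o) : D'.value M ℓ o T = D.value M ℓ o T := by
  classical
  unfold value
  refine congrArg _ ?_
  have h1 : ∀ α' : R.H → D'.κ, D'.term M ℓ o T α' = ∑ α : R.H → D.κ,
      msign K (wordSign (fun h => D.deg (α h)) (R.edgeWord o) +
        wordSign (fun h => D.deg (α h)) (M.halfWord ℓ)) *
      (∏ i, D.vt (T i) fun j => α (M.e ⟨i, j⟩)) *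
      (o.map fun h => P (α' h) (α h) * P (α' (R.inv h)) (α (R.inv h)) *
        D'.G (α' h) (α' (R.inv h))).prod := by
    intro α'
    unfold term
    simp only [hvt]
    rw [prod_sum_blocks M.e fun i c => (∏ j, P (α' (M.e ⟨i, j⟩)) (c j)) * D.vt (T i) c, mul_sum,
      sum_mul]
    refine sum_congr rfl fun α _ => ?_
    have h2 : ∏ i, ∏ j, P (α' (M.e ⟨i, j⟩)) (α (M.e ⟨i, j⟩)) =
        (o.map fun h => P (α' h) (α h) * P (α' (R.inv h)) (α (R.inv h))).prod := by
      rw [← Fintype.prod_sigma' (fun i j => P (α' (M.e ⟨i, j⟩)) (α (M.e ⟨i, j⟩))),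
        M.e.prod_comp fun h => P (α' h) (α h),
        ← list_prod_eq_fintype_prod hf.edgeWord_nodup hf.mem_edgeWord]
      exact RibbonData.prod_edgeWord o _
    have h3 : (o.map fun h => P (α' h) (α h) * P (α' (R.inv h)) (α (R.inv h)) *
        D'.G (α' h) (α' (R.inv h))).prod =
        (o.map fun h => P (α' h) (α h) * P (α' (R.inv h)) (α (R.inv h))).prod *
        (o.map fun h => D'.G (α' h) (α' (R.inv h))).prod := List.prod_map_mul
    rw [prod_mul_distrib, h2, h3]
    by_cases h0 : (o.map fun h => P (α' h) (α h) * P (α' (R.inv h)) (α (R.inv h))).prod = 0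
    · rw [h0]; ring
    · have h4 : (fun h => D'.deg (α' h)) = fun h => D.deg (α h) := by
        funext h
        refine hdeg _ _ fun hz => h0 ?_
        rw [← h2]
        obtain ⟨⟨i, j⟩, rfl⟩ := M.e.surjective h
        exact prod_eq_zero (mem_univ i) (prod_eq_zero (mem_univ j) hz)
      rw [h4]
      ring
  rw [sum_congr rfl fun α' _ => h1 α', sum_comm]
  refine sum_congr rfl fun α _ => ?_
  rw [← mul_sum, hf.sum_prod_edges fun h x y =>
    P x (α h) * P y (α (R.inv h)) * D'.G x y]
  simp only [hG]
  rfl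

end StateData

section Algebra

variable {K : Type u} [Field K] {A : Type*} [AddCommGroup A] [Module K A] {N : ℕ}
  {𝒜 : ZMod (2 * N) → Submodule K A} {ε : ZMod 2} {X : CyclicData K A}
  {κ κ' : Type} [Fintype κ] [DecidableEq κ] [Fintype κ'] [DecidableEq κ']

theorem multilinear_expand {ι A' : Type*} [Fintype ι] [DecidableEq ι] [AddCommGroup A'] [Module K A']
    (f : MultilinearMap K (fun _ : ι => A) A') (b : Module.Basis κ K A) (v : ι → A) :
    f v = ∑ c : ι → κ, (∏ j, b.repr (v j) (c j)) • f fun j => b (c j) := by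
  conv_lhs => rw [show v = fun j => ∑ y, b.repr (v j) y • b y from funext fun j => (b.sum_repr _).symm]
  rw [MultilinearMap.map_sum]
  exact sum_congr rfl fun c _ => f.map_smul_univ _ _

/-- A graded vector space has a parity involution. -/
def HasParityInvolution (𝒜 : ZMod (2 * N) → Submodule K A) : Prop :=
  ∃ γ : A →ₗ[K] A, ∀ i, ∀ a ∈ 𝒜 i, γ a = msign K (parity i) • a

theorem parity_eq_of_repr [CharZero K] (h𝒜 : HasParityInvolution 𝒜) {b : Module.Basis κ K A}
    {deg : κ → ZMod (2 * N)} (hb : ∀ s, b s ∈ 𝒜 (deg s)) {i : ZMod (2 * N)} {a : A} (ha : a ∈ 𝒜 i)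
    {y : κ} (h : b.repr a y ≠ 0) : parity i = parity (deg y) := by
  obtain ⟨γ, hγ⟩ := h𝒜
  have h1 : b.repr (γ a) y = msign K (parity (deg y)) * b.repr a y := by
    conv_lhs => rw [← b.sum_repr a]
    simp only [map_sum, map_smul, hγ _ _ (hb _), Finsupp.coe_finsetSum, Finset.sum_apply,
      Finsupp.smul_apply, b.repr_self, smul_eq_mul]
    rw [sum_eq_single y]
    · rw [Finsupp.single_eq_same]; ring
    · intro x _ hx
      rw [Finsupp.single_eq_of_ne hx.symm]; ring
    · exact fun hy => absurd (mem_univ y) hy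
  rw [hγ i a ha, map_smul, Finsupp.smul_apply, smul_eq_mul] at h1
  have h2 := mul_right_cancel₀ h h1
  have h3 : (1 : K) ≠ -1 := by
    intro h; have : (2 : K) = 0 := by linear_combination h
    exact two_ne_zero this
  rcases zmod2_cases (parity i) with h4 | h4 <;> rcases zmod2_cases (parity (deg y)) with h5 | h5 <;>
    rw [h4, h5] at h2 ⊢ <;> simp at h2
  · exact absurd h2 h3
  · exact absurd h2.symm h3

/-- State sums of a cyclic algebra do not depend on the homogeneous basis. -/
theorem algebraStateData_value_eq [CharZero K] (h𝒜 : HasParityInvolution 𝒜)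
    (hX : IsCyclicAInfinity 𝒜 ε X) {b : Module.Basis κ K A} {deg : κ → ZMod (2 * N)}
    (hb : ∀ s, b s ∈ 𝒜 (deg s)) {b' : Module.Basis κ' K A} {deg' : κ' → ZMod (2 * N)}
    (hb' : ∀ s, b' s ∈ 𝒜 (deg' s)) {R : RibbonData} {ι : Type} [Fintype ι] (M : Marking R ι)
    (ℓ : List ι) (o : List R.H) (T : ∀ i, PlanarTree (M.n i)) (hf : IsFrame R ℓ o) :
    (algebraStateData hX b' deg' hb').value M ℓ o T = (algebraStateData hX b deg hb).value M ℓ o T := by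
  have hdeg : ∀ x y, b.repr (b' x) y ≠ 0 → parity (deg' x) = parity (deg y) := fun x y h =>
    parity_eq_of_repr h𝒜 hb (hb' x) h
  refine StateData.value_eq_of_matrix (D := algebraStateData hX b deg hb)
    (D' := algebraStateData hX b' deg' hb') (fun (x : κ') (y : κ) => b.repr (b' x) y) hdeg
    (fun {n} T (a : Fin (n + 1) → κ') => ?_) (fun (s t : κ) => ?_) M ℓ o T hf
  · change X.pairing (X.ρ _ (single T 1) fun j => b' (a j.succ)) (b' (a 0)) =
      ∑ c : Fin (n + 1) → κ, (∏ j, b.repr (b' (a j)) (c j)) *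
        X.pairing (X.ρ _ (single T 1) fun j => b (c j.succ)) (b (c 0))
    rw [← (Fin.consEquiv fun _ => κ).sum_comp, Fintype.sum_prod_type, multilinear_expand _ b,
      map_sum, LinearMap.sum_apply, sum_comm]
    refine sum_congr rfl fun c _ => ?_
    conv_lhs => rw [← b.sum_repr (b' (a 0))]
    rw [map_sum]
    refine sum_congr rfl fun y _ => ?_
    simp only [map_smul, LinearMap.smul_apply, smul_eq_mul, Fin.prod_univ_succ, Fin.consEquiv_apply,
      Fin.cons_zero, Fin.cons_succ]
    ring
  · change ∑ x, ∑ y, b.repr (b' x) s * b.repr (b' y) t *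
      ((gram X.pairing b')⁻¹ x y * msign K (ε * parity (deg' y))) =
        (gram X.pairing b)⁻¹ s t * msign K (ε * parity (deg t))
    have h1 : gram X.pairing b' = (b.toMatrix b').transpose * gram X.pairing b * b.toMatrix b' := by
      ext x y
      simp only [Matrix.mul_apply, Matrix.transpose_apply, Module.Basis.toMatrix_apply]
      change X.pairing (b' x) (b' y) = _
      conv_lhs => rw [← b.sum_repr (b' y), map_sum]
      refine sum_congr rfl fun t _ => ?_
      conv_lhs => rw [← b.sum_repr (b' x), map_smul, map_sum, LinearMap.sum_apply]
      rw [smul_eq_mul, mul_comm]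
      refine congrArg (· * _) (sum_congr rfl fun s _ => ?_)
      rw [map_smul, LinearMap.smul_apply]
      rfl
    have h2 : b.toMatrix b' * (gram X.pairing b')⁻¹ * (b.toMatrix b').transpose =
        (gram X.pairing b)⁻¹ := by
      refine (Matrix.inv_eq_left_inv ?_).symm
      have h3 : b.toMatrix b' * b'.toMatrix b = 1 := b.toMatrix_mul_toMatrix_flip b'
      have h4 : (b.toMatrix b').transpose * gram X.pairing b =
          gram X.pairing b' * b'.toMatrix b := by
        rw [h1, Matrix.mul_assoc _ _ (b'.toMatrix b), h3, Matrix.mul_one]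
      have h5 : (gram X.pairing b')⁻¹ * gram X.pairing b' = 1 :=
        mul_eq_one_comm.1 (gram_mul_inv hX.pairing_nondegenerate b')
      rw [Matrix.mul_assoc, h4, Matrix.mul_assoc, ← Matrix.mul_assoc _ _ (b'.toMatrix b), h5,
        Matrix.one_mul, h3]
    have h3 := congrFun (congrFun h2 s) t
    rw [← h3]
    simp only [Matrix.mul_apply, Matrix.transpose_apply, Module.Basis.toMatrix_apply, sum_mul]
    rw [sum_comm]
    refine sum_congr rfl fun y _ => sum_congr rfl fun x _ => ?_
    by_cases h0 : b.repr (b' y) t = 0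
    · rw [h0]; ring
    · rw [hdeg y t h0]; ring

/-- A graded vector space has a homogeneous basis. -/
def HasHomogeneousBasis (𝒜 : ZMod (2 * N) → Submodule K A) : Prop :=
  ∃ (m : ℕ) (b : Module.Basis (Fin m) K A) (deg : Fin m → ZMod (2 * N)), ∀ s, b s ∈ 𝒜 (deg s)

/-- The cocycle of a cyclic algebra is the linear map which belongs to the state sum. -/
theorem isKontsevichCocycle_iff [CharZero K] (h𝒜 : HasParityInvolution 𝒜)
    (hX : IsCyclicAInfinity 𝒜 ε X) (hB : HasHomogeneousBasis 𝒜) {b : Module.Basis κ K A}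
    {deg : κ → ZMod (2 * N)} (hb : ∀ s, b s ∈ 𝒜 (deg s)) (c : GraphComplex K ε →ₗ[K] K) :
    IsKontsevichCocycle 𝒜 ε X c ↔ ∀ (R : RibbonData), R.IsRibbonGraph → ∀ (L : Labelling R)
      (o : List R.H), IsEdgeOrder R o → ∀ T : ∀ i, PlanarTree (L.n i),
      c (treesToGraph K ε L o T) =
        (algebraStateData hX b deg hb).functional.val L.marking (finRange L.k) o T := by
  have key : ∀ (R : RibbonData) (hR : R.IsRibbonGraph) (L : Labelling R) (o : List R.H)
      (ho : IsEdgeOrder R o) (T : ∀ i, PlanarTree (L.n i)) (m : ℕ) (b' : Module.Basis (Fin m) K A)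
      (deg' : Fin m → ZMod (2 * N)), (∀ s, b' s ∈ 𝒜 (deg' s)) →
      contraction X.pairing ε b' (fun s => parity (deg' s)) L o
        (fun i => X.ρ _ (single (T i) 1)) (fun i => (T i).degree 2) =
      (algebraStateData hX b deg hb).functional.val L.marking (finRange L.k) o T := by
    intro R hR L o ho T m b' deg' hb'
    rw [contraction_eq_value hX b' deg' hb' hR L o ho T]
    exact algebraStateData_value_eq h𝒜 hX hb hb' L.marking _ o T
      ⟨hR, nodup_finRange _, mem_finRange, ho⟩
  constructor
  · intro hc R hR L o ho T
    obtain ⟨m, b', deg', hb'⟩ := hB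
    rw [hc R hR L o ho T m b' deg' hb', key R hR L o ho T m b' deg' hb']
  · intro hc R hR L o ho T m b' deg' hb'
    rw [hc R hR L o ho T, key R hR L o ho T m b' deg' hb']

theorem existsUnique_cocycle [CharZero K] (h𝒜 : HasParityInvolution 𝒜)
    (hX : IsCyclicAInfinity 𝒜 ε X) (hB : HasHomogeneousBasis 𝒜) :
    ∃! c, IsKontsevichCocycle 𝒜 ε X c := by
  obtain ⟨m, b, deg, hb⟩ := id hB
  simp only [isKontsevichCocycle_iff h𝒜 hX hB hb]
  exact (algebraStateData hX b deg hb).functional.existsUnique_linearMap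

end Algebra

/-! ### The product of two functionals along a diagonal -/

instance PlanarTree.instFinite (n : ℕ) : Finite (PlanarTree n) := by
  let S : Finset Interval := (Finset.Icc 1 n ×ˢ Finset.Icc 1 n).image fun p => Interval.mk p.1 p.2
  have hS : ∀ T : PlanarTree n, T.edges ∈ S.powerset := fun T => by
    refine Finset.mem_powerset.2 fun e he => Finset.mem_image.2 ⟨(e.lo, e.hi), ?_, rfl⟩
    have := T.proper e he
    simp only [Interval.Proper] at this
    simp only [Finset.mem_product, Finset.mem_Icc]
    omega
  exact Finite.of_injective (fun T => (⟨T.edges, hS T⟩ : {s // s ∈ S.powerset})) fun T T' h =>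
    PlanarTree.ext (congrArg Subtype.val h)

instance PlanarTree.instFintype (n : ℕ) : Fintype (PlanarTree n) := Fintype.ofFinite _

theorem sum_optCons {ι : Type} [Fintype ι] {β : Option ι → Type*} {M : Type*} [AddCommMonoid M]
    [Fintype (β none)] [Fintype (∀ i, β (some i))] {_ : Fintype (∀ i, β i)} (f : (∀ i, β i) → M) :
    ∑ P, f P = ∑ p : β none, ∑ P : ∀ i, β (some i), f (optCons p P) := by
  rw [← Fintype.sum_prod_type']
  refine Fintype.sum_equiv ⟨fun P => (P none, fun i => P (some i)), fun q => optCons q.1 q.2,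
    fun P => ?_, fun q => rfl⟩ _ _ fun P => congrArg f ?_ <;>
  · funext i
    cases i <;> rfl

namespace IsCyclicDiagonal

variable {K : Type u} [Field K] {Δ : ∀ n, TreeChain K n →ₗ[K] TreeChain₂ K n}

theorem degree_eq (hΔ : IsCyclicDiagonal Δ) (q : ℕ) {n : ℕ} (hn : 2 ≤ n) {T : PlanarTree n}
    {P : PlanarTree n × PlanarTree n} (h : Δ n (single T 1) P ≠ 0) :
    P.1.degree q + P.2.degree q = T.degree q := by
  have h1 := hΔ.degree_zero n hn T P (Finsupp.mem_support_iff.2 h)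
  unfold PlanarTree.degree at h1 ⊢
  rw [← Int.cast_add, ZMod.intCast_eq_intCast_iff] at h1 ⊢
  exact h1.of_dvd (dvd_zero _)

variable {W : Type*} [AddCommGroup W] [Module K W]

theorem sum_rotate (hΔ : IsCyclicDiagonal Δ) {n : ℕ} (hn : 2 ≤ n) (T : PlanarTree n)
    (F : PlanarTree n × PlanarTree n → W) :
    ∑ P, Δ n (single T.rotate 1) P • F P = msign K T.rotationSign •
      ∑ P, Δ n (single T 1) P •
        msign K (P.1.rotationSign + P.2.rotationSign) • F (P.1.rotate, P.2.rotate) := by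
  have h1 := hΔ.rotation n hn (single T 1)
  rw [treeRotation_single, ← mul_one (msign K _), ← smul_eq_mul, ← smul_single, map_smul,
    msign_smul_eq_iff] at h1
  have h2 : ∀ (x : TreeChain₂ K n) (F : PlanarTree n × PlanarTree n → W),
      ∑ P, x P • F P = linearCombination K F x := fun x F => by
    rw [linearCombination_apply, sum_fintype _ _ (by simp)]
  rw [h2, h2, h1, map_smul]
  refine congrArg _ ?_
  rw [← LinearMap.comp_apply]
  refine congrArg (fun f : TreeChain₂ K n →ₗ[K] W => f (Δ n (single T 1)))
    (Finsupp.lhom_ext' fun P => LinearMap.ext_ring ?_)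
  simp only [LinearMap.comp_apply, Finsupp.lsingle_apply, treeRotation₂, treeRotation_single, treeTmul,
    zero_mul, mul_zero, Finsupp.single_zero, Finsupp.sum_single_index, msign_add, one_smul,
    linearCombination_single]

theorem sum_graft (hΔ : IsCyclicDiagonal Δ) {m n p N : ℕ} (h : Composable m n p N)
    (U : PlanarTree m) (V : PlanarTree n) (F : PlanarTree N × PlanarTree N → W) :
    ∑ P, Δ N (single (graft h U V) 1) P • F P = msign K (graftSign (i := p) U V) •
      ∑ Q, ∑ P, (Δ n (single V 1) Q * Δ m (single U 1) P) •
        msign K (P.2.degree 2 * Q.1.degree 2 + graftSign (i := p) P.1 Q.1 +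
          graftSign (i := p) P.2 Q.2) • F (graft h P.1 Q.1, graft h P.2 Q.2) := by
  have h1 := hΔ.comp m n p N h U V
  rw [treeComp_eq, ← mul_one (msign K _), ← smul_eq_mul, ← smul_single, map_smul,
    msign_smul_eq_iff] at h1
  have h2 : ∀ (x : TreeChain₂ K N) (F : PlanarTree N × PlanarTree N → W),
      ∑ P, x P • F P = linearCombination K F x := fun x F => by
    rw [linearCombination_apply, sum_fintype _ _ (by simp)]
  rw [h2, h1, map_smul]
  refine congrArg _ ?_
  rw [sum_comm, treeComp₂, sum_fintype _ _ (by simp), map_sum]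
  refine sum_congr rfl fun P _ => ?_
  rw [sum_fintype _ _ (by simp), map_sum]
  refine sum_congr rfl fun Q _ => ?_
  simp only [treeComp_eq, treeTmul, map_smul, zero_mul, mul_zero, Finsupp.single_zero,
    Finsupp.sum_single_index, linearCombination_single, smul_smul, msign_add]
  congr 1
  ring

end IsCyclicDiagonal

namespace GraphFunctional

variable {K : Type u} [Field K] {εA εB : ZMod 2} {WA WB : Type*} [AddCommGroup WA] [Module K WA]
  [AddCommGroup WB] [Module K WB] (FA : GraphFunctional K εA WA) (FB : GraphFunctional K εB WB)
  (Δ : ∀ n, TreeChain K n →ₗ[K] TreeChain₂ K n)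

/-- The sign in the diagonal of the graph complex. -/
def prodSign (εA εB : ZMod 2) {R : RibbonData} {ι : Type} {n : ι → ℕ} (ℓ : List ι)
    (P : ∀ i, PlanarTree (n i) × PlanarTree (n i)) : ZMod 2 :=
  pairSum (fun i j => (P i).2.degree 2 * (P j).1.degree 2) ℓ +
    εA * εB * ((Fintype.card R.H / 2 + 1 - ℓ.length).choose 2 : ℕ)

open Classical in
/-- The value of the product of two functionals along a diagonal. -/
def prodVal {R : RibbonData} {ι : Type} [Fintype ι] (M : Marking R ι) (ℓ : List ι) (o : List R.H)
    (T : ∀ i, PlanarTree (M.n i)) : WA ⊗[K] WB :=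
  ∑ P : ∀ i, PlanarTree (M.n i) × PlanarTree (M.n i),
    (∏ i, Δ (M.n i) (single (T i) 1) (P i)) • msign K (prodSign (R := R) εA εB ℓ P) •
      (FA.val M ℓ o (fun i => (P i).1) ⊗ₜ[K] FB.val M ℓ o (fun i => (P i).2))

variable {Δ} {R S : RibbonData} {ι ι' ι₀ : Type} [Fintype ι] [Fintype ι'] [Fintype ι₀]

theorem msign_smul_tmul (a b c : ZMod 2) (x : WA) (y : WB) :
    msign K a • ((msign K b • x) ⊗ₜ[K] (msign K c • y)) = msign K (a + b + c) • (x ⊗ₜ[K] y) := by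
  rw [TensorProduct.smul_tmul_smul, smul_smul, msign_add, msign_add, mul_assoc]

theorem prodVal_reindex (M : Marking R ι) (σ : ι' ≃ ι) (ℓ : List ι') (o : List R.H)
    (T : ∀ i, PlanarTree (M.n i)) (hf : IsFrame R ℓ o) :
    prodVal FA FB Δ (M.reindex σ) ℓ o (fun i => T (σ i)) = prodVal FA FB Δ M (ℓ.map σ) o T := by
  classical
  refine (Fintype.sum_equiv (Equiv.piCongrLeft
    (fun i => PlanarTree (M.n i) × PlanarTree (M.n i)) σ).symm _ _ fun P => ?_).symm
  refine congrArg₂ _ ?_ (congrArg₂ _ (congrArg _ ?_) (congrArg₂ _ ?_ ?_))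
  · exact (σ.prod_comp fun i => Δ (M.n i) (single (T i) 1) (P i)).symm
  · unfold prodSign
    rw [pairSum_map, length_map]
    rfl
  · exact (FA.val_reindex M σ ℓ o (fun i => (P i).1) hf).symm
  · exact (FB.val_reindex M σ ℓ o (fun i => (P i).2) hf).symm

theorem prodVal_transport (M : Marking R ι) (φ : R.Iso S) (ℓ : List ι) (o : List R.H)
    (T : ∀ i, PlanarTree (M.n i)) (hf : IsFrame R ℓ o) :
    prodVal FA FB Δ (M.transport φ) ℓ (o.map φ.toEquiv) T = prodVal FA FB Δ M ℓ o T := by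
  refine sum_congr rfl fun P _ => ?_
  refine congrArg₂ _ rfl (congrArg₂ _ (congrArg _ ?_) (congrArg₂ _ ?_ ?_))
  · unfold prodSign
    rw [Fintype.card_congr φ.toEquiv]
    rfl
  · exact FA.val_transport M φ ℓ o (fun i => (P i).1) hf
  · exact FB.val_transport M φ ℓ o (fun i => (P i).2) hf

theorem prodVal_swap_vertices (hΔ : IsCyclicDiagonal Δ) (M : Marking R ι) (l₁ l₂ : List ι) (x y : ι)
    (o : List R.H) (T : ∀ i, PlanarTree (M.n i)) (hf : IsFrame R (l₁ ++ x :: y :: l₂) o) :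
    prodVal FA FB Δ M (l₁ ++ x :: y :: l₂) o T =
      msign K ((T x).degree 2 * (T y).degree 2 + (εA + εB) * ((M.n x : ZMod 2) * (M.n y : ZMod 2))) •
        prodVal FA FB Δ M (l₁ ++ y :: x :: l₂) o T := by
  classical
  unfold prodVal
  rw [smul_sum]
  refine sum_congr rfl fun P _ => ?_
  by_cases h0 : ∏ i, Δ (M.n i) (single (T i) 1) (P i) = 0
  · rw [h0, zero_smul, zero_smul, smul_zero]
  have hd : ∀ i, (T i).degree 2 = (P i).1.degree 2 + (P i).2.degree 2 := fun i =>
    (hΔ.degree_eq 2 (M.two_le hf.1 i) (Finset.prod_ne_zero_iff.1 h0 i (mem_univ i))).symm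
  rw [FA.val_swap_vertices M l₁ l₂ x y o _ hf, FB.val_swap_vertices M l₁ l₂ x y o _ hf,
    msign_smul_tmul, smul_comm (msign K _) (∏ i, _), smul_smul (msign K _), ← msign_add, hd x, hd y]
  refine congrArg₂ _ rfl (congrArg₂ _ (congrArg _ ?_) rfl)
  unfold prodSign
  rw [pairSum_swap]
  simp only [length_append, length_cons]
  ring

theorem prodVal_swap_edges (M : Marking R ι) (ℓ : List ι) (o₁ o₂ : List R.H) (x y : R.H)
    (T : ∀ i, PlanarTree (M.n i)) (hf : IsFrame R ℓ (o₁ ++ x :: y :: o₂)) :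
    prodVal FA FB Δ M ℓ (o₁ ++ x :: y :: o₂) T =
      msign K (εA + εB) • prodVal FA FB Δ M ℓ (o₁ ++ y :: x :: o₂) T := by
  unfold prodVal
  rw [smul_sum]
  refine sum_congr rfl fun P _ => ?_
  rw [FA.val_swap_edges M ℓ o₁ o₂ x y _ hf, FB.val_swap_edges M ℓ o₁ o₂ x y _ hf, msign_smul_tmul,
    smul_comm (msign K _) (∏ i, _), smul_smul (msign K _), ← msign_add]
  refine congrArg₂ _ rfl (congrArg₂ _ (congrArg _ ?_) rfl)
  ring

theorem prodVal_flip_edge (M : Marking R ι) (ℓ : List ι) (o₁ o₂ : List R.H) (x : R.H)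
    (T : ∀ i, PlanarTree (M.n i)) (hf : IsFrame R ℓ (o₁ ++ x :: o₂)) :
    prodVal FA FB Δ M ℓ (o₁ ++ x :: o₂) T = prodVal FA FB Δ M ℓ (o₁ ++ R.inv x :: o₂) T := by
  unfold prodVal
  refine sum_congr rfl fun P _ => ?_
  rw [FA.val_flip_edge M ℓ o₁ o₂ x _ hf, FB.val_flip_edge M ℓ o₁ o₂ x _ hf]

/-- The contribution of all but one of the vertices. -/
theorem prodVal_optCons (M : Marking R (Option ι₀)) (ℓ : List (Option ι₀)) (o : List R.H)
    (t : PlanarTree (M.n none)) (T : ∀ i, PlanarTree (M.n (some i))) :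
    letI := Classical.decEq ι₀
    prodVal FA FB Δ M ℓ o (optTrees M t T) =
      ∑ P : ∀ i, PlanarTree (M.n (some i)) × PlanarTree (M.n (some i)),
        (∏ i, Δ _ (single (T i) 1) (P i)) • ∑ p, Δ _ (single t 1) p •
          msign K (prodSign (R := R) εA εB ℓ
            (optCons (β := fun i => PlanarTree (M.n i) × PlanarTree (M.n i)) p P)) •
          (FA.val M ℓ o (optTrees M p.1 fun i => (P i).1) ⊗ₜ[K]
            FB.val M ℓ o (optTrees M p.2 fun i => (P i).2)) := by
  classical
  unfold prodVal
  rw [sum_optCons, sum_comm]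
  refine sum_congr (by congr!) fun P _ => ?_
  rw [smul_sum]
  refine sum_congr rfl fun p _ => ?_
  rw [Fintype.prod_option, mul_comm, mul_smul]
  have h : ∀ f : ∀ i, PlanarTree (M.n i) × PlanarTree (M.n i) → PlanarTree (M.n i),
      (fun i => f i (optCons (β := fun i => PlanarTree (M.n i) × PlanarTree (M.n i)) p P i)) =
        optTrees M (f none p) fun i => f (some i) (P i) := fun f => by
    funext i
    cases i <;> rfl
  rw [h fun _ q => q.1, h fun _ q => q.2]
  rfl

theorem prodVal_rotate (hΔ : IsCyclicDiagonal Δ) (M : Marking R (Option ι₀)) (ℓ₀ : List ι₀)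
    (o : List R.H) (t : PlanarTree (M.n none)) (T : ∀ i, PlanarTree (M.n (some i)))
    (hf : IsFrame R (none :: ℓ₀.map some) o) :
    prodVal FA FB Δ (M.rotate (optCons 1 fun _ => 0)) (none :: ℓ₀.map some) o
        (optTrees M t.rotate T) =
      msign K (t.rotationSign + (εA + εB) * (M.n none : ZMod 2)) •
        prodVal FA FB Δ M (none :: ℓ₀.map some) o
          (optTrees M t T) := by
  refine (prodVal_optCons FA FB (M.rotate (optCons 1 fun _ => 0)) _ o t.rotate T).trans ?_
  rw [prodVal_optCons, smul_sum]
  refine sum_congr rfl fun P _ => ?_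
  rw [smul_comm (msign K _)]
  refine congrArg₂ _ rfl ?_
  refine (hΔ.sum_rotate (M.two_le hf.1 none) t _).trans ?_
  rw [msign_add, mul_smul, smul_sum (r := msign K ((εA + εB) * _))]
  refine congrArg _ (sum_congr rfl fun p _ => ?_)
  rw [smul_comm (msign K ((εA + εB) * _))]
  refine congrArg₂ _ rfl ?_
  rw [smul_smul, smul_smul, ← msign_add, ← msign_add]
  refine (congrArg₂ _ rfl (congrArg₂ _ (FA.val_rotate M ℓ₀ o p.1 (fun i => (P i).1) hf)
    (FB.val_rotate M ℓ₀ o p.2 (fun i => (P i).2) hf))).trans ?_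
  rw [msign_smul_tmul]
  refine congrArg₂ _ (congrArg _ ?_) rfl
  have h : prodSign (R := R) εA εB (none :: ℓ₀.map some)
      (optCons (β := fun i => PlanarTree (M.n i) × PlanarTree (M.n i)) (p.1.rotate, p.2.rotate) P) =
      prodSign (R := R) εA εB (none :: ℓ₀.map some)
        (optCons (β := fun i => PlanarTree (M.n i) × PlanarTree (M.n i)) p P) := by
    unfold prodSign
    refine congrArg (· + _) (pairSum_congr fun i _ j _ => ?_)
    have h1 : ∀ T : PlanarTree (M.n none), T.rotate.degree 2 = T.degree 2 := fun T => by
      rw [PlanarTree.degree, PlanarTree.degree, card_rotate]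
    have h2 := h1 p.1
    have h3 := h1 p.2
    cases i <;> cases j
    · exact congrArg₂ _ h3 h2
    · exact congrArg (· * _) h3
    · exact congrArg (_ * ·) h2
    · rfl
  refine (congrArg (fun z => _ + z + _ + _) h).trans ?_
  rw [← sub_eq_zero]
  ring_nf
  reduce_mod_char

/-- The product for a graph one vertex of which has been split. -/
theorem prodVal_splitTrees (M : Marking R (Option ι₀)) {m n p : ℕ} (h : Composable m n p (M.n none))
    (U : PlanarTree m) (V : PlanarTree n) (T : ∀ i, PlanarTree (M.n (some i)))
    (ℓ : List (Option (Option ι₀))) (o : List (M.splitGraph h).H) :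
    letI := Classical.decEq ι₀
    prodVal FA FB Δ (M.split h) ℓ o (M.splitTrees h U V T) =
      ∑ P : ∀ i, PlanarTree (M.n (some i)) × PlanarTree (M.n (some i)),
        (∏ i, Δ _ (single (T i) 1) (P i)) • ∑ q, ∑ p,
          (Δ n (single V 1) q * Δ m (single U 1) p) •
          msign K (prodSign (R := M.splitGraph h) (n := (M.split h).n) εA εB ℓ fun i =>
            (M.splitTrees h p.1 q.1 (fun i => (P i).1) i,
              M.splitTrees h p.2 q.2 (fun i => (P i).2) i)) •
          (FA.val (M.split h) ℓ o (M.splitTrees h p.1 q.1 fun i => (P i).1) ⊗ₜ[K]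
            FB.val (M.split h) ℓ o (M.splitTrees h p.2 q.2 fun i => (P i).2)) := by
  classical
  let β : Option (Option ι₀) → Type := fun i =>
    PlanarTree ((M.split h).n i) × PlanarTree ((M.split h).n i)
  unfold prodVal
  refine (sum_optCons (β := β) _).trans ?_
  refine (sum_congr rfl fun q _ => sum_optCons (β := fun i => β (some i)) _).trans ?_
  refine (sum_congr rfl fun q _ => sum_comm).trans (Finset.sum_comm.trans ?_)
  refine sum_congr (by congr!) fun P _ => ?_
  rw [smul_sum]
  refine sum_congr rfl fun q _ => ?_
  rw [smul_sum]
  refine sum_congr rfl fun p _ => ?_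
  rw [Fintype.prod_option, Fintype.prod_option, ← mul_assoc, mul_comm, mul_smul]
  have e : optCons (β := β) q (optCons (β := fun i => β (some i)) p P) = fun i =>
      (M.splitTrees h p.1 q.1 (fun i => (P i).1) i, M.splitTrees h p.2 q.2 (fun i => (P i).2) i) := by
    funext i
    rcases i with _ | _ | i <;> rfl
  rw [e]
  rfl

theorem prodVal_graft (hΔ : IsCyclicDiagonal Δ) (M : Marking R (Option ι₀)) (ℓ₀ : List ι₀)
    (o : List R.H) {m n p : ℕ} (h : Composable m n p (M.n none)) (U : PlanarTree m)
    (V : PlanarTree n) (T : ∀ i, PlanarTree (M.n (some i))) (hf : IsFrame R (none :: ℓ₀.map some) o) :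
    prodVal FA FB Δ M (none :: ℓ₀.map some) o
        (optTrees M (graft h U V) T) =
      msign K (graftSign (i := p) U V +
          (εA + εB) * ((p : ZMod 2) * n + p + (m : ZMod 2) * n + 1)) •
        prodVal FA FB Δ (M.split h) (some none :: none :: ℓ₀.map fun i => some (some i))
          (.inr false :: o.map .inl) (M.splitTrees h U V T) := by
  rw [prodVal_optCons, prodVal_splitTrees, smul_sum]
  refine sum_congr rfl fun P _ => ?_
  rw [smul_comm (msign K _), hΔ.sum_graft h U V, msign_add, mul_smul,
    smul_sum (r := msign K ((εA + εB) * _))]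
  refine congrArg _ (congrArg _ (sum_congr rfl fun q _ => ?_))
  rw [smul_sum]
  refine sum_congr rfl fun r _ => ?_
  rw [smul_comm (msign K ((εA + εB) * _))]
  refine congrArg _ ?_
  rw [FA.val_graft M ℓ₀ o h r.1 q.1 (fun i => (P i).1) hf,
    FB.val_graft M ℓ₀ o h r.2 q.2 (fun i => (P i).2) hf, msign_smul_tmul, smul_smul, smul_smul,
    ← msign_add, ← msign_add]
  refine congrArg₂ _ (congrArg _ ?_) rfl
  have hs : prodSign (R := M.splitGraph h) (n := (M.split h).n) εA εB
      (some none :: none :: ℓ₀.map fun i => some (some i)) (fun i =>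
        (M.splitTrees h r.1 q.1 (fun i => (P i).1) i, M.splitTrees h r.2 q.2 (fun i => (P i).2) i)) =
      r.2.degree 2 * q.1.degree 2 + prodSign (R := R) εA εB (none :: ℓ₀.map some)
        (optCons (β := fun i => PlanarTree (M.n i) × PlanarTree (M.n i))
          (graft h r.1 q.1, graft h r.2 q.2) P) := by
    have hc : Fintype.card (M.splitGraph h).H = Fintype.card R.H + 2 := Fintype.card_sum
    have hb : Fintype.card (M.splitGraph h).H / 2 + 1 -
        (some none :: none :: ℓ₀.map fun i => some (some i)).length =
        Fintype.card R.H / 2 + 1 - (none :: ℓ₀.map some).length := by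
      rw [hc]
      simp only [length_cons, length_map]
      omega
    unfold prodSign
    rw [hb, ← add_assoc]
    refine congrArg (· + _) ?_
    simp only [pairSum, pairSum_map, map_cons, sum_cons, map_map]
    have h1 := StateData.degree_graft h r.2 q.2
    have h2 : ((ℓ₀.map fun i => (r.2.degree 2 + q.2.degree 2) * (P i).1.degree 2).sum) =
        (ℓ₀.map fun i => r.2.degree 2 * (P i).1.degree 2).sum +
          (ℓ₀.map fun i => q.2.degree 2 * (P i).1.degree 2).sum := by
      rw [← list_sum_map_add]
      simp only [add_mul]
    rw [← h1] at h2
    refine Eq.trans ?_ (congrArg (fun z => _ + (z + _)) h2.symm)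
    change r.2.degree 2 * q.1.degree 2 + (ℓ₀.map fun i => r.2.degree 2 * (P i).1.degree 2).sum +
      ((ℓ₀.map fun i => q.2.degree 2 * (P i).1.degree 2).sum + _) = _
    rw [add_assoc, add_assoc]
    rfl
  rw [hs, ← sub_eq_zero]
  ring_nf
  reduce_mod_char

/-- The product of two functionals along a cyclic diagonal. -/
def prod (hΔ : IsCyclicDiagonal Δ) : GraphFunctional K (εA + εB) (WA ⊗[K] WB) where
  val M ℓ o T := prodVal FA FB Δ M ℓ o T
  val_reindex M σ ℓ o T hf := prodVal_reindex FA FB M σ ℓ o T hf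
  val_transport M φ ℓ o T hf := prodVal_transport FA FB M φ ℓ o T hf
  val_swap_vertices M l₁ l₂ x y o T hf := prodVal_swap_vertices FA FB hΔ M l₁ l₂ x y o T hf
  val_swap_edges M ℓ o₁ o₂ x y T hf := prodVal_swap_edges FA FB M ℓ o₁ o₂ x y T hf
  val_flip_edge M ℓ o₁ o₂ x T hf := prodVal_flip_edge FA FB M ℓ o₁ o₂ x T hf
  val_rotate M ℓ₀ o t T hf := prodVal_rotate FA FB hΔ M ℓ₀ o t T hf
  val_graft M ℓ₀ o _ _ _ h U V T hf := prodVal_graft FA FB hΔ M ℓ₀ o h U V T hf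

end GraphFunctional

theorem isGraphDiagonal_iff {K : Type u} [Field K] {Δ : ∀ n, TreeChain K n →ₗ[K] TreeChain₂ K n}
    (hΔ : IsCyclicDiagonal Δ) (εA εB : ZMod 2)
    (δ : GraphComplex K (εA + εB) →ₗ[K] GraphComplex K εA ⊗[K] GraphComplex K εB) :
    IsGraphDiagonal Δ εA εB δ ↔ ∀ R : RibbonData, R.IsRibbonGraph → ∀ (L : Labelling R)
      (o : List R.H), IsEdgeOrder R o → ∀ T : ∀ i, PlanarTree (L.n i),
      δ (treesToGraph K (εA + εB) L o T) =
        ((graphFunctional K εA).prod (graphFunctional K εB) hΔ).val L.marking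
          (finRange L.k) o T := by
  unfold IsGraphDiagonal
  refine forall_congr' fun R => forall_congr' fun hR => forall_congr' fun L => forall_congr' fun o =>
    forall_congr' fun ho => forall_congr' fun T => Eq.congr_right ?_
  have h : ∀ i : Fintype (∀ i, PlanarTree (L.n i) × PlanarTree (L.n i)), ∀ f :
      (∀ i, PlanarTree (L.n i) × PlanarTree (L.n i)) → GraphComplex K εA ⊗[K] GraphComplex K εB,
      ∑ P ∈ Fintype.piFinset fun i => (Δ (L.n i) (single (T i) 1)).support,
        (∏ i, Δ (L.n i) (single (T i) 1) (P i)) • f P =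
      ∑ P ∈ @Finset.univ _ i, (∏ i, Δ (L.n i) (single (T i) 1) (P i)) • f P := by
    intro i f
    refine Finset.sum_subset (Finset.subset_univ _) fun P _ hP => ?_
    rw [Fintype.mem_piFinset, not_forall] at hP
    obtain ⟨j, hj⟩ := hP
    have h0 : ∏ i, Δ (L.n i) (single (T i) 1) (P i) = 0 :=
      prod_eq_zero (mem_univ j) (Finsupp.notMem_support_iff.1 hj)
    rw [h0, zero_smul]
  simp only [mul_smul, sum_sum_eq_pairSum, treesToGraph_eq]
  refine (h _ _).trans (sum_congr rfl fun P _ => ?_)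
  refine congrArg₂ _ rfl (congrArg₂ _ (congrArg _ ?_) rfl)
  unfold GraphFunctional.prodSign
  rw [length_finRange]
  rfl

theorem existsUnique_graphDiagonal {K : Type u} [Field K]
    {Δ : ∀ n, TreeChain K n →ₗ[K] TreeChain₂ K n} (hΔ : IsCyclicDiagonal Δ) (εA εB : ZMod 2) :
    ∃! δ, IsGraphDiagonal Δ εA εB δ := by
  simp only [isGraphDiagonal_iff hΔ]
  exact GraphFunctional.existsUnique_linearMap _

/-! ### State sums of products -/

theorem pairSum_flatMap_mul {α β : Type*} (u v : α → ZMod 2) (f : β → List α) (l : List β) :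
    pairSum (fun x y => u x * v y) (l.flatMap f) =
      (l.map fun i => pairSum (fun x y => u x * v y) (f i)).sum +
        pairSum (fun i j => ((f i).map u).sum * ((f j).map v).sum) l := by
  induction l with
  | nil => simp [pairSum]
  | cons a l ih =>
    have h : ((f a).map fun x => ((l.flatMap f).map fun y => u x * v y).sum).sum =
        (l.map fun j => ((f a).map u).sum * ((f j).map v).sum).sum := by
      simp only [list_sum_map_mul_left]
      have h1 : ((l.flatMap f).map v).sum = (l.map fun j => ((f j).map v).sum).sum := by
        rw [map_flatMap, List.flatMap_def, List.sum_flatten, map_map]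
        rfl
      rw [h1]
      rw [List.sum_map_mul_right]
    rw [flatMap_cons, pairSum_append, ih, h, map_cons, sum_cons, pairSum]
    ring

theorem pairSum_mul_symm {α : Type*} (p q : α → ZMod 2) (l : List α) :
    pairSum (fun i j => p i * q j + q i * p j) l + (l.map fun i => q i * p i).sum =
      (l.map p).sum * (l.map q).sum := by
  induction l with
  | nil => simp [pairSum]
  | cons a l ih =>
    simp only [pairSum, map_cons, sum_cons, list_sum_map_add, list_sum_map_mul_left]
    linear_combination ih

theorem pairSum_add_symm {α : Type*} (q : α → ZMod 2) (l : List α) :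
    pairSum (fun i j => q i + q j) l = ((l.length : ZMod 2) + 1) * (l.map q).sum := by
  induction l with
  | nil => simp [pairSum]
  | cons a l ih =>
    simp only [pairSum, map_cons, sum_cons, list_sum_map_add, map_const', sum_replicate,
      nsmul_eq_mul, length_cons, Nat.cast_add, Nat.cast_one, ih]
    generalize (l.length : ZMod 2) = k
    generalize (l.map q).sum = s
    rw [← sub_eq_zero]
    ring_nf
    reduce_mod_char

theorem pairSum_const {α : Type*} (c : ZMod 2) (l : List α) :
    pairSum (fun _ _ => c) l = c * (l.length.choose 2 : ℕ) := by
  induction l with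
  | nil => simp [pairSum]
  | cons a l ih =>
    simp only [pairSum, map_const', sum_replicate, nsmul_eq_mul, length_cons, ih,
      Nat.choose_succ_succ' _ 1, Nat.choose_one_right, Nat.cast_add]
    ring

theorem wordSign_add {α : Type*} (a b : α → ZMod 2) {l l' : List α} (hn : l.Nodup) (h : l.Perm l') :
    wordSign (fun x => a x + b x) l + wordSign a l + wordSign b l + pairSum (fun x y => b x * a y) l =
      wordSign (fun x => a x + b x) l' + wordSign a l' + wordSign b l' +
        pairSum (fun x y => b x * a y) l' := by
  refine eq_of_perm_of_swap (fun l => wordSign (fun x => a x + b x) l + wordSign a l +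
    wordSign b l + pairSum (fun x y => b x * a y) l) ?_ h
  intro l₁ x y l₂ hp
  have hxy := ne_of_nodup_perm hn hp
  simp only [wordSign_swap _ l₁ l₂ hxy, pairSum_swap _ l₁ l₂ x y]
  rw [← sub_eq_zero]
  ring_nf
  reduce_mod_char

theorem choose_two_cast {E k : ℕ} (h : k ≤ E) :
    ((E + 1 - k).choose 2 : ZMod 2) = (E + k) * (1 + k) + E.choose 2 + k.choose 2 := by
  obtain ⟨c, rfl⟩ := Nat.exists_eq_add_of_le h
  have h1 : ((k + c).choose 2 : ℕ) = k.choose 2 + c.choose 2 + k * c := by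
    induction c with
    | zero => simp
    | succ c ih =>
      rw [← add_assoc, Nat.choose_succ_succ' (k + c) 1, Nat.choose_succ_succ' c 1, Nat.choose_one_right,
        Nat.choose_one_right, ih (Nat.le_add_right _ _)]
      ring
  rw [show k + c + 1 - k = c + 1 by omega, Nat.choose_succ_succ' c 1, Nat.choose_one_right, h1]
  push_cast
  generalize (c.choose 2 : ZMod 2) = x
  generalize (k.choose 2 : ZMod 2) = y
  rw [← sub_eq_zero]
  ring_nf
  reduce_mod_char

namespace StateData

variable {K : Type u} [Field K] {εA εB : ZMod 2} {R : RibbonData} {ι : Type} [Fintype ι]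

theorem prod_sign_identity {M : Marking R ι} {ℓ : List ι} {o : List R.H} (hf : IsFrame R ℓ o)
    (a b : R.H → ZMod 2) (p q T : ι → ZMod 2) (hT : ∀ i, T i = p i + q i)
    (ha : ∀ h ∈ o, a h + a (R.inv h) = εA) (hb : ∀ h ∈ o, b h + b (R.inv h) = εB)
    (hp : ∀ i, ∑ j, a (M.e ⟨i, j⟩) = p i + εA) (hq : ∀ i, ∑ j, b (M.e ⟨i, j⟩) = q i + εB) :
    globalSign (εA + εB) M ℓ o T +
      (wordSign (fun h => a h + b h) (R.edgeWord o) + wordSign (fun h => a h + b h) (M.halfWord ℓ)) +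
      (ℓ.map fun i => pairSum (fun x y => b x * a y) (M.halfBlock i) + q i * ∑ j, a (M.e ⟨i, j⟩)).sum +
      (o.map fun h => b h * a (R.inv h)).sum =
    pairSum (fun i j => q i * p j) ℓ +
        εA * εB * ((Fintype.card R.H / 2 + 1 - ℓ.length).choose 2 : ℕ) +
      (globalSign εA M ℓ o p + (wordSign a (R.edgeWord o) + wordSign a (M.halfWord ℓ))) +
      (globalSign εB M ℓ o q + (wordSign b (R.edgeWord o) + wordSign b (M.halfWord ℓ))) := by
  classical
  have hcard : Fintype.card R.H = 2 * o.length := by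
    have h1 := hf.exists_edgeEquiv
    obtain ⟨e, _⟩ := h1
    rw [← Fintype.card_congr e, Fintype.card_sigma]
    simp [mul_comm]
  have hlen : ℓ.length = Fintype.card ι := by
    rw [← List.toFinset_card_of_nodup hf.2, show ℓ.toFinset = Finset.univ from
      Finset.eq_univ_of_forall fun i => List.mem_toFinset.2 (hf.3 i), Finset.card_univ]
  have hk : ℓ.length ≤ o.length := by
    have h1 := Fintype.card_congr M.e
    rw [Fintype.card_sigma, hcard] at h1
    have h₂ : ∑ _i : ι, 3 ≤ ∑ i, Fintype.card (Fin (M.n i + 1)) := Finset.sum_le_sum fun i _ => by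
      have := M.two_le hf.1 i
      rw [Fintype.card_fin]
      omega
    rw [Finset.sum_const, Finset.card_univ, smul_eq_mul] at h₂
    omega
  have hws := wordSign_add a b hf.edgeWord_nodup (hf.edgeWord_perm M)
  have hE : pairSum (fun x y => b x * a y) (R.edgeWord o) =
      (o.map fun h => b h * a (R.inv h)).sum + εB * εA * (o.length.choose 2 : ℕ) := by
    unfold RibbonData.edgeWord
    rw [pairSum_flatMap_mul, ← pairSum_const]
    refine congrArg₂ _ (congrArg _ (map_congr_left fun h _ => by simp [pairSum]))
      (pairSum_congr fun x hx y hy => ?_)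
    simp [ha y hy, hb x hx]
  have hH : pairSum (fun x y => b x * a y) (M.halfWord ℓ) =
      (ℓ.map fun i => pairSum (fun x y => b x * a y) (M.halfBlock i)).sum +
        (pairSum (fun i j => q i * p j) ℓ + pairSum (fun i j => εA * q i + εB * p j) ℓ +
          εA * εB * (ℓ.length.choose 2 : ℕ)) := by
    unfold Marking.halfWord
    rw [pairSum_flatMap_mul, ← pairSum_const, ← pairSum_add, ← pairSum_add]
    refine congrArg _ (pairSum_congr fun x _ y _ => ?_)
    rw [M.sum_halfBlock, M.sum_halfBlock, hq, hp]
    ring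
  have hg : globalSign (εA + εB) M ℓ o T = globalSign εA M ℓ o p + globalSign εB M ℓ o q +
      pairSum (fun i j => p i * q j + q i * p j) ℓ + pairSum (fun i j => εA * q j + εB * p j) ℓ := by
    have h1 : pairSum (fun i j => T i * T j + (εA + εB) * (T j + 1)) ℓ =
        pairSum (fun i j => p i * p j + εA * (p j + 1)) ℓ +
          pairSum (fun i j => q i * q j + εB * (q j + 1)) ℓ +
          pairSum (fun i j => p i * q j + q i * p j) ℓ + pairSum (fun i j => εA * q j + εB * p j) ℓ := by
      rw [← pairSum_add, ← pairSum_add, ← pairSum_add]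
      refine pairSum_congr fun x _ y _ => ?_
      rw [hT, hT]
      ring
    unfold globalSign
    rw [h1]
    ring
  have hpq : pairSum (fun i j => εA * q j + εB * p j) ℓ + pairSum (fun i j => εA * q i + εB * p j) ℓ =
      εA * (((ℓ.length : ZMod 2) + 1) * (ℓ.map q).sum) := by
    rw [← pairSum_add_symm, ← pairSum_mul_left, ← pairSum_add]
    refine pairSum_congr fun x _ y _ => ?_
    rw [← sub_eq_zero]
    ring_nf
    reduce_mod_char
  have hsum : ∀ (w : R.H → ZMod 2) (r : ι → ZMod 2) (ε : ZMod 2), (∀ h ∈ o, w h + w (R.inv h) = ε) →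
      (∀ i, ∑ j, w (M.e ⟨i, j⟩) = r i + ε) →
      (ℓ.map r).sum = ((o.length : ZMod 2) + ℓ.length) * ε := by
    intro w r ε h1 h₂
    have h3 := hf.sum_halfEdges M w
    rw [map_congr_left h1, map_congr_left fun i _ => h₂ i, list_sum_map_add] at h3
    simp only [map_const', sum_replicate, nsmul_eq_mul] at h3
    linear_combination h3 - zmod2_add_self ((ℓ.length : ZMod 2) * ε)
  have hsp := hsum a p εA ha hp
  have hsq := hsum b q εB hb hq
  have hsym := pairSum_mul_symm p q ℓ
  have hqp : (ℓ.map fun i => pairSum (fun x y => b x * a y) (M.halfBlock i) +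
      q i * ∑ j, a (M.e ⟨i, j⟩)).sum = (ℓ.map fun i => pairSum (fun x y => b x * a y)
        (M.halfBlock i)).sum + ((ℓ.map fun i => q i * p i).sum + εA * (ℓ.map q).sum) := by
    rw [← list_sum_map_mul_left, ← list_sum_map_add, ← list_sum_map_add]
    refine congrArg _ (map_congr_left fun i _ => ?_)
    rw [hp]
    ring
  rw [hcard, Nat.mul_div_cancel_left _ two_pos, choose_two_cast hk, hg, hqp]
  rw [hE, hH] at hws
  rw [hsq] at hqp hpq hsym ⊢
  rw [hsp] at hsym
  generalize pairSum (fun i j => εA * q j + εB * p j) ℓ = x₁ at *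
  generalize pairSum (fun i j => εA * q i + εB * p j) ℓ = x₂ at *
  generalize pairSum (fun i j => p i * q j + q i * p j) ℓ = x₃ at *
  generalize pairSum (fun i j => q i * p j) ℓ = x₄ at *
  generalize (ℓ.map fun i => q i * p i).sum = x₅ at *
  generalize (ℓ.map fun i => pairSum (fun x y => b x * a y) (M.halfBlock i)).sum = x₆ at *
  generalize (o.map fun h => b h * a (R.inv h)).sum = x₇ at *
  generalize (ℓ.length : ZMod 2) = k at *
  generalize (o.length : ZMod 2) = E at *
  generalize wordSign (fun h => a h + b h) _ = y₁ at *
  generalize wordSign (fun h => a h + b h) _ = y₂ at *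
  have h2 : (2 : ZMod 2) = 0 := rfl
  linear_combination hws + hpq + hsym + εA * εB * (zmod2_mul_self E + zmod2_mul_self k) +
    h2 * (y₂ + x₆ + εA * E * k * εB + εA * E * εB + εA * k * εB -
      εA * εB * (o.length.choose 2 : ℕ) - wordSign a (R.edgeWord o) - wordSign b (R.edgeWord o))
theorem value_eq_sum {D : StateData K (εA + εB)} {DA : StateData K εA} {DB : StateData K εB}
    {Δ : ∀ n, TreeChain K n →ₗ[K] TreeChain₂ K n} (hΔ : IsCyclicDiagonal Δ)
    (e : DA.κ × DB.κ ≃ D.κ) (hdeg : ∀ s t, D.deg (e (s, t)) = DA.deg s + DB.deg t)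
    (hG : ∀ s t s' t', D.G (e (s, t)) (e (s', t')) =
      msign K (DB.deg t * DA.deg s') * (DA.G s s' * DB.G t t'))
    (hvt : ∀ {n : ℕ} (T : PlanarTree n) (a : Fin (n + 1) → DA.κ) (b : Fin (n + 1) → DB.κ), 2 ≤ n →
      D.vt T (fun j => e (a j, b j)) = ∑ P, Δ n (single T 1) P *
        (msign K (pairSum (fun x y => DB.deg (b x) * DA.deg (a y))
          ((finRange n).map Fin.succ ++ [0]) + P.2.degree 2 * ∑ j, DA.deg (a j)) *
          (DA.vt P.1 a * DB.vt P.2 b)))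
    (M : Marking R ι) (ℓ : List ι) (o : List R.H) (T : ∀ i, PlanarTree (M.n i))
    (hf : IsFrame R ℓ o) :
    D.value M ℓ o T = LinearMap.mul' K K
      (GraphFunctional.prodVal DA.functional DB.functional Δ M ℓ o T) := by
  classical
  let Φ : (R.H → DA.κ) × (R.H → DB.κ) ≃ (R.H → D.κ) :=
    (Equiv.arrowProdEquivProdArrow R.H (fun _ => DA.κ) (fun _ => DB.κ)).symm.trans
      (Equiv.arrowCongr (Equiv.refl _) e)
  have h1 : D.value M ℓ o T = ∑ P : ∀ i, PlanarTree (M.n i) × PlanarTree (M.n i),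
      ∑ a : R.H → DA.κ, ∑ b : R.H → DB.κ, msign K (globalSign (εA + εB) M ℓ o fun i => (T i).degree 2) *
        (msign K (wordSign (fun h => DA.deg (a h) + DB.deg (b h)) (R.edgeWord o) +
          wordSign (fun h => DA.deg (a h) + DB.deg (b h)) (M.halfWord ℓ)) *
        (∏ i, (Δ (M.n i) (single (T i) 1) (P i) *
          (msign K (pairSum (fun x y => DB.deg (b x) * DA.deg (a y)) (M.halfBlock i) +
            (P i).2.degree 2 * ∑ j, DA.deg (a (M.e ⟨i, j⟩))) *
            (DA.vt (P i).1 (fun j => a (M.e ⟨i, j⟩)) * DB.vt (P i).2 fun j => b (M.e ⟨i, j⟩))))) *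
        (o.map fun h => msign K (DB.deg (b h) * DA.deg (a (R.inv h))) *
          (DA.G (a h) (a (R.inv h)) * DB.G (b h) (b (R.inv h)))).prod) := by
    rw [sum_comm]
    unfold value
    rw [mul_sum, ← Φ.sum_comp, Fintype.sum_prod_type]
    refine sum_congr rfl fun a _ => ?_
    rw [sum_comm]
    refine sum_congr rfl fun b _ => ?_
    rw [← mul_sum]
    refine congrArg _ ?_
    rw [← sum_mul, ← mul_sum]
    have h₂ : (fun h => D.deg (Φ (a, b) h)) = fun h => DA.deg (a h) + DB.deg (b h) :=
      funext fun h => hdeg _ _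
    have h3 : ∀ i, D.vt (T i) (fun j => Φ (a, b) (M.e ⟨i, j⟩)) = _ := fun i =>
      hvt (T i) (fun j => a (M.e ⟨i, j⟩)) (fun j => b (M.e ⟨i, j⟩)) (M.two_le hf.1 i)
    have h4 : (fun h => D.G (Φ (a, b) h) (Φ (a, b) (R.inv h))) = _ := funext fun h => hG _ _ _ _
    unfold term
    rw [h₂, h4, prod_congr rfl fun i _ => h3 i, Finset.prod_univ_sum, Fintype.piFinset_univ]
    refine congrArg (_ * · * _) (sum_congr rfl fun P _ => prod_congr rfl fun i _ => ?_)
    unfold Marking.halfBlock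
    rw [← pairSum_map (fun x y => DB.deg (b x) * DA.deg (a y)) (fun j => M.e ⟨i, j⟩), map_append,
      map_map]
    rfl
  rw [h1]
  unfold GraphFunctional.prodVal
  rw [map_sum]
  refine sum_congr rfl fun P _ => ?_
  rw [map_smul, map_smul, LinearMap.mul'_apply, smul_eq_mul, smul_eq_mul]
  change _ = _ * (_ * ((msign K _ * _) * (msign K _ * _)))
  rw [mul_mul_mul_comm (msign K (globalSign εA _ _ _ _)), Finset.sum_mul_sum, mul_sum, mul_sum,
    mul_sum]
  refine sum_congr rfl fun a _ => ?_
  rw [mul_sum, mul_sum, mul_sum]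
  refine sum_congr rfl fun b _ => ?_
  have e₁ : (o.map fun h => msign K (DB.deg (b h) * DA.deg (a (R.inv h))) *
      (DA.G (a h) (a (R.inv h)) * DB.G (b h) (b (R.inv h)))).prod =
      msign K (o.map fun h => DB.deg (b h) * DA.deg (a (R.inv h))).sum *
        ((o.map fun h => DA.G (a h) (a (R.inv h))).prod *
          (o.map fun h => DB.G (b h) (b (R.inv h))).prod) := by
    rw [msign_list_sum, ← List.prod_map_mul, ← List.prod_map_mul]
  rw [e₁]
  unfold term
  rw [prod_mul_distrib, prod_mul_distrib, prod_mul_distrib, ← msign_sum,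
    ← list_sum_eq_fintype_sum hf.2 hf.3]
  by_cases h0 : (∏ i, Δ (M.n i) (single (T i) 1) (P i)) *
      ((∏ i, DA.vt (P i).1 fun j => a (M.e ⟨i, j⟩)) * (∏ i, DB.vt (P i).2 fun j => b (M.e ⟨i, j⟩))) *
      ((o.map fun h => DA.G (a h) (a (R.inv h))).prod *
        (o.map fun h => DB.G (b h) (b (R.inv h))).prod) = 0
  · refine Eq.trans (b := 0) ?_ (Eq.symm ?_)
    · have e₂ : ∀ {c₁ c₂ c₃ c₄ x y z u v : K}, x * (y * z) * (u * v) = 0 →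
          c₁ * (c₂ * (x * (c₃ * (y * z))) * (c₄ * (u * v))) = 0 := by
        intro c₁ c₂ c₃ c₄ x y z u v h
        linear_combination (c₁ * c₂ * c₃ * c₄) * h
      exact e₂ h0
    · have e₂ : ∀ {c₁ c₂ c₃ c₄ c₅ x y z u v : K}, x * (y * z) * (u * v) = 0 →
          x * (c₁ * (c₂ * c₃ * ((c₄ * y * u) * (c₅ * z * v)))) = 0 := by
        intro c₁ c₂ c₃ c₄ c₅ x y z u v h
        linear_combination (c₁ * c₂ * c₃ * c₄ * c₅) * h
      exact e₂ h0
  · have n₁ := Finset.prod_ne_zero_iff.1 (left_ne_zero_of_mul (left_ne_zero_of_mul h0))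
    have n₂ := Finset.prod_ne_zero_iff.1
      (left_ne_zero_of_mul (right_ne_zero_of_mul (left_ne_zero_of_mul h0)))
    have n₃ := Finset.prod_ne_zero_iff.1
      (right_ne_zero_of_mul (right_ne_zero_of_mul (left_ne_zero_of_mul h0)))
    have n₄ := list_prod_ne_zero_imp (left_ne_zero_of_mul (right_ne_zero_of_mul h0))
    have n₅ := list_prod_ne_zero_imp (right_ne_zero_of_mul (right_ne_zero_of_mul h0))
    have key := congrArg (msign K) (prod_sign_identity hf (fun h => DA.deg (a h))
      (fun h => DB.deg (b h)) (fun i => (P i).1.degree 2) (fun i => (P i).2.degree 2)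
      (fun i => (T i).degree 2)
      (fun i => (hΔ.degree_eq 2 (M.two_le hf.1 i) (n₁ i (mem_univ i))).symm)
      (fun h hh => DA.G_deg _ _ (n₄ h hh)) (fun h hh => DB.G_deg _ _ (n₅ h hh))
      (fun i => DA.vt_deg (M.two_le hf.1 i) _ _ (n₂ i (mem_univ i)))
      (fun i => DB.vt_deg (M.two_le hf.1 i) _ _ (n₃ i (mem_univ i))))
    unfold GraphFunctional.prodSign
    simp only [msign_add _ (_ + _), msign_add] at key ⊢
    linear_combination ((∏ i, Δ (M.n i) (single (T i) 1) (P i)) *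
      ((∏ i, DA.vt (P i).1 fun j => a (M.e ⟨i, j⟩)) * (∏ i, DB.vt (P i).2 fun j => b (M.e ⟨i, j⟩))) *
      ((o.map fun h => DA.G (a h) (a (R.inv h))).prod *
        (o.map fun h => DB.G (b h) (b (R.inv h))).prod)) * key

end StateData

/-! ### Homogeneous elements -/

section Homogeneous

variable {K : Type u} [Field K] {A : Type*} [AddCommGroup A] [Module K A]
  {B : Type*} [AddCommGroup B] [Module K B] {N : ℕ}

theorem parityProj_of_mem (𝒜 : ZMod (2 * N) → Submodule K A) [DirectSum.Decomposition 𝒜] (p : ZMod 2)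
    {i : ZMod (2 * N)} {a : A} (ha : a ∈ 𝒜 i) :
    parityProj 𝒜 p a = if parity i = p then a else 0 := by
  unfold parityProj
  rw [LinearMap.comp_apply]
  change DirectSum.toModule K (ZMod (2 * N)) A _ (DirectSum.decompose 𝒜 a) = _
  rw [DirectSum.decompose_of_mem 𝒜 ha]
  change DirectSum.toModule K (ZMod (2 * N)) A _ (DirectSum.lof K _ (fun i => 𝒜 i) i ⟨a, ha⟩) = _
  rw [DirectSum.toModule_lof]
  split_ifs <;> rfl

theorem hasParityInvolution (𝒜 : ZMod (2 * N) → Submodule K A) [DirectSum.Decomposition 𝒜] :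
    HasParityInvolution 𝒜 := by
  refine ⟨∑ s : ZMod 2, msign K s • parityProj 𝒜 s, fun i a ha => ?_⟩
  simp only [LinearMap.sum_apply, LinearMap.smul_apply, parityProj_of_mem 𝒜 _ ha, smul_ite, smul_zero]
  rw [Finset.sum_ite_eq, if_pos (mem_univ _)]

theorem hasHomogeneousBasis (𝒜 : ZMod (2 * N) → Submodule K A) [DirectSum.Decomposition 𝒜]
    [FiniteDimensional K A] : HasHomogeneousBasis 𝒜 := by
  let h := DirectSum.Decomposition.isInternal 𝒜
  let b := h.collectedBasis fun i => Module.finBasis K (𝒜 i)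
  have := Module.Finite.finite_basis b
  obtain ⟨m, ⟨e⟩⟩ := Finite.exists_equiv_fin (Σ i, Fin (Module.finrank K (𝒜 i)))
  refine ⟨m, b.reindex e, fun s => (e.symm s).1, fun s => ?_⟩
  rw [Module.Basis.reindex_apply]
  exact h.collectedBasis_mem _ _

theorem tmul_mem {𝒜 : ZMod (2 * N) → Submodule K A} {ℬ : ZMod (2 * N) → Submodule K B}
    {i j k : ZMod (2 * N)} {a : A} {b : B} (ha : a ∈ 𝒜 i) (hb : b ∈ ℬ j) (hk : i + j = k) :
    a ⊗ₜ[K] b ∈ tensorGrading 𝒜 ℬ k :=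
  Submodule.mem_iSup_of_mem i (Submodule.apply_mem_map₂ (TensorProduct.mk K A B) ha
    (by rwa [← hk, add_sub_cancel_left]))

theorem HasHomogeneousBasis.tensor {𝒜 : ZMod (2 * N) → Submodule K A}
    {ℬ : ZMod (2 * N) → Submodule K B} (hA : HasHomogeneousBasis 𝒜) (hB : HasHomogeneousBasis ℬ) :
    HasHomogeneousBasis (tensorGrading 𝒜 ℬ) := by
  obtain ⟨m, b, i, hb⟩ := hA
  obtain ⟨n, c, j, hc⟩ := hB
  refine ⟨m * n, (b.tensorProduct c).reindex finProdFinEquiv,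
    fun s => i (finProdFinEquiv.symm s).1 + j (finProdFinEquiv.symm s).2, fun s => ?_⟩
  rw [Module.Basis.reindex_apply, Module.Basis.tensorProduct_apply']
  exact tmul_mem (hb _) (hc _) rfl

/-- The homogeneous pure tensors of a degree. -/
def pureTensors (𝒜 : ZMod (2 * N) → Submodule K A) (ℬ : ZMod (2 * N) → Submodule K B)
    (k : ZMod (2 * N)) : Set (A ⊗[K] B) :=
  {x | ∃ i j a b, a ∈ 𝒜 i ∧ b ∈ ℬ j ∧ i + j = k ∧ x = a ⊗ₜ[K] b}

theorem tensorGrading_le_span (𝒜 : ZMod (2 * N) → Submodule K A) (ℬ : ZMod (2 * N) → Submodule K B)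
    (k : ZMod (2 * N)) : tensorGrading 𝒜 ℬ k ≤ Submodule.span K (pureTensors 𝒜 ℬ k) :=
  iSup_le fun i => Submodule.map₂_le.2 fun a ha b hb =>
    Submodule.subset_span ⟨i, k - i, a, b, ha, hb, add_sub_cancel _ _, rfl⟩

theorem HasParityInvolution.tensor {𝒜 : ZMod (2 * N) → Submodule K A}
    {ℬ : ZMod (2 * N) → Submodule K B} (hA : HasParityInvolution 𝒜) (hB : HasParityInvolution ℬ) :
    HasParityInvolution (tensorGrading 𝒜 ℬ) := by
  obtain ⟨γ, hγ⟩ := hA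
  obtain ⟨γ', hγ'⟩ := hB
  refine ⟨TensorProduct.map γ γ', fun k x hx => ?_⟩
  have hx' := tensorGrading_le_span 𝒜 ℬ k hx
  clear hx
  induction hx' using Submodule.span_induction with
  | mem x hx =>
    obtain ⟨i, j, a, b, ha, hb, rfl, rfl⟩ := hx
    rw [TensorProduct.map_tmul, hγ i a ha, hγ' j b hb, TensorProduct.smul_tmul_smul, parity_add,
      msign_add]
  | zero => rw [map_zero, smul_zero]
  | add x y _ _ hx hy => rw [map_add, hx, hy, smul_add]
  | smul c x _ hx => rw [map_smul, hx, smul_comm]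

/-- Multilinear maps which agree on generators of subspaces agree on these subspaces. -/
theorem multilinear_eq_of_span {ι V W : Type*} [Fintype ι] [DecidableEq ι] [AddCommGroup V]
    [Module K V] [AddCommGroup W] [Module K W] {f g : MultilinearMap K (fun _ : ι => V) W}
    {S : ι → Set V} (h : ∀ v, (∀ l, v l ∈ S l) → f v = g v) {v : ι → V}
    (hv : ∀ l, v l ∈ Submodule.span K (S l)) : f v = g v := by
  suffices H : ∀ s : Finset ι, ∀ v : ι → V, (∀ l ∈ s, v l ∈ Submodule.span K (S l)) →
      (∀ l ∉ s, v l ∈ S l) → f v = g v from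
    H Finset.univ v (fun l _ => hv l) fun l hl => absurd (mem_univ l) hl
  intro s
  induction s using Finset.induction_on with
  | empty => exact fun v _ hv => h v fun l => hv l (Finset.notMem_empty l)
  | insert i s hi ih =>
    intro v hv hv'
    have key : ∀ x ∈ Submodule.span K (S i), f (Function.update v i x) = g (Function.update v i x) := by
      intro x hx
      induction hx using Submodule.span_induction with
      | mem x hx =>
        refine ih _ (fun l hl => ?_) fun l hl => ?_
        · rw [Function.update_of_ne (ne_of_mem_of_not_mem hl hi)]
          exact hv l (Finset.mem_insert_of_mem hl)
        · by_cases hli : l = i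
          · subst hli
            rwa [Function.update_self]
          · rw [Function.update_of_ne hli]
            exact hv' l fun h => (Finset.mem_insert.1 h).elim hli hl
      | zero => rw [f.map_update_zero, g.map_update_zero]
      | add x y _ _ hx hy => rw [f.map_update_add, g.map_update_add, hx, hy]
      | smul c x _ hx => rw [f.map_update_smul, g.map_update_smul, hx]
    rw [← Function.update_eq_self i v]
    exact key _ (hv i (Finset.mem_insert_self i s))

theorem bilinear_eq_of_span {V W : Type*} [AddCommGroup V] [Module K V] [AddCommGroup W] [Module K W]
    {f g : V →ₗ[K] V →ₗ[K] W} {S T : Set V} (h : ∀ x ∈ S, ∀ y ∈ T, f x y = g x y) {x y : V}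
    (hx : x ∈ Submodule.span K S) (hy : y ∈ Submodule.span K T) : f x y = g x y := by
  have h1 : ∀ x ∈ S, f x y = g x y := fun x hx => LinearMap.eqOn_span (fun y hy => h x hx y hy) hy
  exact LinearMap.eqOn_span (f := f.flip y) (g := g.flip y) (fun x hx => h1 x hx) hx

theorem mem_span_pureTensors {𝒜 : ZMod (2 * N) → Submodule K A} {ℬ : ZMod (2 * N) → Submodule K B}
    (hA : HasHomogeneousBasis 𝒜) (hB : HasHomogeneousBasis ℬ) (x : A ⊗[K] B) :
    x ∈ Submodule.span K {x | ∃ i j a b, a ∈ 𝒜 i ∧ b ∈ ℬ j ∧ x = a ⊗ₜ[K] b} := by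
  obtain ⟨m, b, i, hb⟩ := hA
  obtain ⟨n, c, j, hc⟩ := hB
  have h := (b.tensorProduct c).span_eq.ge (Submodule.mem_top (x := x))
  refine Submodule.span_mono ?_ h
  rintro _ ⟨s, rfl⟩
  exact ⟨_, _, _, _, hb s.1, hc s.2, Module.Basis.tensorProduct_apply' _ _ _⟩

end Homogeneous

/-! ### The tensor product on homogeneous elements -/

section Tensor

variable {K : Type u} [Field K] {A : Type*} [AddCommGroup A] [Module K A]
  {B : Type*} [AddCommGroup B] [Module K B] {N : ℕ}
  [FiniteDimensional K A] [FiniteDimensional K B]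

theorem plainTensorOp_tmul {n : ℕ} (f : Op K A n) (g : Op K B n) (a : Fin n → A) (b : Fin n → B) :
    plainTensorOp f g (fun l => a l ⊗ₜ[K] b l) = f a ⊗ₜ[K] g b := by
  rw [multilinear_expand f (Module.finBasis K A) a, multilinear_expand g (Module.finBasis K B) b,
    TensorProduct.sum_tmul]
  unfold plainTensorOp
  simp only [sum_apply]
  refine sum_congr rfl fun α _ => ?_
  rw [TensorProduct.tmul_sum]
  refine sum_congr rfl fun β _ => ?_
  rw [TensorProduct.smul_tmul_smul, ← prod_mul_distrib]
  rw [MultilinearMap.smulRight_apply, MultilinearMap.compLinearMap_apply,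
    MultilinearMap.mkPiAlgebra_apply]
  refine congrArg (· • _) (prod_congr rfl fun l _ => ?_)
  rw [Module.Basis.coord_apply, Module.Basis.tensorProduct_repr_tmul_apply, smul_eq_mul, mul_comm]

variable (𝒜 : ZMod (2 * N) → Submodule K A) [DirectSum.Decomposition 𝒜]
    (ℬ : ZMod (2 * N) → Submodule K B) [DirectSum.Decomposition ℬ]

/-- The exponent of the sign in the rearrangement of `a₁ ⊗ b₁ ⊗ … ⊗ a_n ⊗ b_n`. -/
def shuffleSign (l : List (ZMod 2 × ZMod 2)) : ZMod 2 := pairSum (fun x y => x.2 * y.1) l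

theorem tensorOp_tmul {n : ℕ} (f : Op K A n) (g : Op K B n) (q : ZMod 2) {i j : Fin n → ZMod (2 * N)}
    {a : Fin n → A} {b : Fin n → B} (ha : ∀ l, a l ∈ 𝒜 (i l)) (hb : ∀ l, b l ∈ ℬ (j l)) :
    tensorOp 𝒜 ℬ f g q (fun l => a l ⊗ₜ[K] b l) =
      msign K (shuffleSign ((finRange n).map fun l => (parity (i l), parity (j l))) +
        (∑ l, parity (i l)) * q) • (f a ⊗ₜ[K] g b) := by
  have h0 : ∀ s t : Fin n → ZMod 2, s ≠ (fun l => parity (i l)) ∨ t ≠ (fun l => parity (j l)) →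
      plainTensorOp (f.compLinearMap fun l => parityProj 𝒜 (s l))
        (g.compLinearMap fun l => parityProj ℬ (t l)) (fun l => a l ⊗ₜ[K] b l) = 0 := by
    intro s t h
    rw [plainTensorOp_tmul, MultilinearMap.compLinearMap_apply, MultilinearMap.compLinearMap_apply]
    simp only [parityProj_of_mem _ _ (ha _), parityProj_of_mem _ _ (hb _)]
    rcases h with h | h
    · obtain ⟨l, hl⟩ := Function.ne_iff.1 h
      rw [f.map_coord_zero l (if_neg hl.symm), TensorProduct.zero_tmul]
    · obtain ⟨l, hl⟩ := Function.ne_iff.1 h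
      rw [g.map_coord_zero l (if_neg hl.symm), TensorProduct.tmul_zero]
  unfold tensorOp
  simp only [sum_apply, smul_apply]
  rw [sum_eq_single fun l => parity (i l), sum_eq_single fun l => parity (j l)]
  · rw [plainTensorOp_tmul, MultilinearMap.compLinearMap_apply, MultilinearMap.compLinearMap_apply]
    simp only [parityProj_of_mem _ _ (ha _), parityProj_of_mem _ _ (hb _), if_true]
    rw [sum_sum_eq_pairSum (fun l l' => parity (j l) * parity (i l')), ← sum_mul, shuffleSign,
      pairSum_map]
  · intro t _ ht
    rw [h0 _ _ (Or.inr ht), smul_zero]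
  · exact fun h => absurd (mem_univ _) h
  · intro s _ hs
    exact Finset.sum_eq_zero fun t _ => by rw [h0 _ _ (Or.inl hs), smul_zero]
  · exact fun h => absurd (mem_univ _) h

variable (X : CyclicData K A) (Y : CyclicData K B) (Δ : ∀ n, TreeChain K n →ₗ[K] TreeChain₂ K n)

theorem tensor_d_tmul {i : ZMod (2 * N)} {a : A} (ha : a ∈ 𝒜 i) (b : B) :
    (X.tensor 𝒜 ℬ Y Δ).d (a ⊗ₜ[K] b) = X.d a ⊗ₜ[K] b + msign K (parity i) • (a ⊗ₜ[K] Y.d b) := by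
  unfold CyclicData.tensor
  simp only [LinearMap.add_apply, TensorProduct.map_tmul, LinearMap.id_apply, LinearMap.sum_apply,
    LinearMap.smul_apply, parityProj_of_mem 𝒜 _ ha]
  rw [sum_eq_single (parity i), if_pos rfl]
  · intro s _ hs
    rw [if_neg hs.symm, TensorProduct.zero_tmul, smul_zero]
  · exact fun h => absurd (mem_univ _) h

theorem tensor_pairing_tmul {i j : ZMod (2 * N)} (a : A) {b : B} (hb : b ∈ ℬ j) {a' : A}
    (ha' : a' ∈ 𝒜 i) (b' : B) :
    (X.tensor 𝒜 ℬ Y Δ).pairing (a ⊗ₜ[K] b) (a' ⊗ₜ[K] b') =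
      msign K (parity j * parity i) * (X.pairing a a' * Y.pairing b b') := by
  have h : ∀ s t, LinearMap.BilinForm.tmul (X.pairing.compl₁₂ LinearMap.id (parityProj 𝒜 s))
      (Y.pairing.compl₁₂ (parityProj ℬ t) LinearMap.id) (a ⊗ₜ[K] b) (a' ⊗ₜ[K] b') =
      X.pairing a (parityProj 𝒜 s a') * Y.pairing (parityProj ℬ t b) b' := fun s t => by
    rw [LinearMap.BilinForm.tmul, LinearMap.BilinForm.tensorDistrib_tmul]
    simp [mul_comm]
  unfold CyclicData.tensor
  simp only [LinearMap.sum_apply, LinearMap.smul_apply, smul_eq_mul]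
  rw [sum_eq_single (parity i), sum_eq_single (parity j)]
  · refine congrArg _ ((h _ _).trans ?_)
    rw [parityProj_of_mem 𝒜 _ ha', if_pos rfl, parityProj_of_mem ℬ _ hb, if_pos rfl]
  · intro t _ ht
    refine (congrArg _ ((h _ _).trans ?_)).trans (mul_zero _)
    rw [parityProj_of_mem ℬ _ hb, if_neg ht.symm, map_zero, LinearMap.zero_apply, mul_zero]
  · exact fun h => absurd (mem_univ _) h
  · intro s _ hs
    refine Finset.sum_eq_zero fun t _ => (congrArg _ ((h _ _).trans ?_)).trans (mul_zero _)
    rw [parityProj_of_mem 𝒜 _ ha', if_neg hs.symm, map_zero, zero_mul]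
  · exact fun h => absurd (mem_univ _) h

theorem tensor_ρ_apply {n : ℕ} (x : TreeChain K n) (v : Fin n → A ⊗[K] B) :
    (X.tensor 𝒜 ℬ Y Δ).ρ n x v = ∑ P, Δ n x P •
      tensorOp 𝒜 ℬ (X.ρ n (single P.1 1)) (Y.ρ n (single P.2 1)) (P.2.degree 2) v := by
  unfold CyclicData.tensor
  rw [LinearMap.comp_apply, linearCombination_apply, sum_fintype _ _ (by simp),
    sum_apply]
  rfl

theorem tensor_ρ_tmul {n : ℕ} (x : TreeChain K n) {i j : Fin n → ZMod (2 * N)} {a : Fin n → A}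
    {b : Fin n → B} (ha : ∀ l, a l ∈ 𝒜 (i l)) (hb : ∀ l, b l ∈ ℬ (j l)) :
    (X.tensor 𝒜 ℬ Y Δ).ρ n x (fun l => a l ⊗ₜ[K] b l) = ∑ P, Δ n x P •
      msign K (shuffleSign ((finRange n).map fun l => (parity (i l), parity (j l))) +
        (∑ l, parity (i l)) * P.2.degree 2) •
      (X.ρ n (single P.1 1) a ⊗ₜ[K] Y.ρ n (single P.2 1) b) := by
  rw [tensor_ρ_apply]
  exact sum_congr rfl fun P _ => congrArg _ (tensorOp_tmul 𝒜 ℬ _ _ _ ha hb)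

end Tensor

/-! ### Insertion of operations -/

namespace Composable

variable {m n p M : ℕ}

/-- The argument of the lower operation to which the upper operation is inserted. -/
def slot (h : Composable m n p M) : Fin m := ⟨p - 1, by obtain ⟨_, _, _, _, _⟩ := h; omega⟩

/-- The position of the other arguments of the lower operation. -/
def outer (h : Composable m n p M) (q : Fin m) : Fin M :=
  ⟨if q.1 + 1 < p then q.1 else q.1 + n - 1, by
    obtain ⟨_, _, _, _, _⟩ := h; have := q.2; split_ifs <;> omega⟩

/-- The position of the arguments of the upper operation. -/
def inner (h : Composable m n p M) (q : Fin n) : Fin M :=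
  ⟨p - 1 + q.1, by obtain ⟨_, _, _, _, _⟩ := h; have := q.2; omega⟩

theorem inner_injective (h : Composable m n p M) : Function.Injective h.inner := fun q r hqr => by
  have := congrArg Fin.val hqr
  simp only [inner] at this
  exact Fin.ext (by omega)

theorem outer_injective (h : Composable m n p M) : Function.Injective h.outer := fun q r hqr => by
  have h1 := congrArg Fin.val hqr
  obtain ⟨_, _, _, _, _⟩ := id h
  simp only [outer] at h1
  exact Fin.ext (by split_ifs at h1 <;> omega)

theorem outer_ne_inner (h : Composable m n p M) {q : Fin m} (hq : q ≠ h.slot) (r : Fin n) :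
    h.outer q ≠ h.inner r := fun hqr => hq (by
  have h1 := congrArg Fin.val hqr
  obtain ⟨_, _, _, _, _⟩ := id h
  have := r.2
  simp only [outer, inner] at h1
  exact Fin.ext (by simp only [slot]; split_ifs at h1 <;> omega))

theorem exists_eq (h : Composable m n p M) (l : Fin M) :
    (∃ q, l = h.inner q) ∨ ∃ q, q ≠ h.slot ∧ l = h.outer q := by
  obtain ⟨_, _, _, _, _⟩ := id h
  have := l.2
  by_cases h1 : l.1 + 1 < p
  · refine Or.inr ⟨⟨l.1, by omega⟩, fun hh => ?_, Fin.ext (by simp [outer, h1])⟩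
    have := congrArg Fin.val hh
    simp only [slot] at this
    omega
  · by_cases h2 : l.1 + 1 < p + n
    · exact Or.inl ⟨⟨l.1 + 1 - p, by omega⟩, Fin.ext (by simp only [inner]; omega)⟩
    · refine Or.inr ⟨⟨l.1 + 1 - n, by omega⟩, fun hh => ?_, Fin.ext ?_⟩
      · have := congrArg Fin.val hh
        simp only [slot] at this
        omega
      · simp only [outer]
        split_ifs <;> omega

theorem exists_finRange_eq (h : Composable m n p M) : ∃ I J L : List (Fin M),
    finRange M = I ++ (J ++ L) ∧ (finRange n).map h.inner = J ∧ I.length = p - 1 ∧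
    ∀ {α : Type} (f : Fin M → α) (c : α),
      (finRange m).map (Function.update (f ∘ h.outer) h.slot c) = I.map f ++ c :: L.map f := by
  obtain ⟨_, _, _, _, _⟩ := id h
  refine ⟨(finRange M).take (p - 1), (finRange n).map h.inner,
    (finRange M).drop (p - 1 + n), ?_, rfl, ?_, fun f c => ?_⟩
  · refine ext_getElem (by simp; omega) fun k h1 h2 => ?_
    simp only [length_finRange] at h1
    simp only [getElem_append, getElem_map, getElem_finRange, List.getElem_take, List.getElem_drop,
      List.length_take, length_map, length_finRange]
    split_ifs <;> refine Fin.ext ?_ <;> simp [inner] <;> omega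
  · simp only [List.length_take, length_finRange]
    omega
  · refine ext_getElem (by simp; omega) fun k h1 h2 => ?_
    simp only [length_map, length_finRange] at h1
    simp only [getElem_append, List.getElem_cons, getElem_map, getElem_finRange, List.getElem_take,
      List.getElem_drop, List.length_take, length_map, length_finRange, Function.update_apply,
      Fin.ext_iff, slot, Function.comp_apply, outer, Fin.cast_mk]
    rcases lt_trichotomy k (p - 1) with hk | hk | hk
    · rw [if_neg hk.ne, dif_pos (by omega)]
      exact congrArg f (Fin.ext (if_pos (by omega)))
    · rw [if_pos hk, dif_neg (by omega), dif_pos (by omega)]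
    · rw [if_neg hk.ne', dif_neg (by omega), dif_neg (by omega)]
      refine congrArg f (Fin.ext ((if_neg (by omega)).trans ?_))
      simp only
      omega

end Composable

section Insert

variable {K : Type u} [Field K] {A : Type*} [AddCommGroup A] [Module K A] {m n p M : ℕ}

theorem insertOp_eq (h : Composable m n p M) (f : Op K A m) (g : Op K A n) (a : Fin M → A) :
    insertOp h f g a = f (Function.update (a ∘ h.outer) h.slot (g (a ∘ h.inner))) :=
  insertOp_eq_update h f g a

theorem insertOp_update (h : Composable m n p M) (f : Op K A m) (g : Op K A n) (l : Fin M) :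
    (∃ q, ∀ a x, insertOp h f g (Function.update a l x) = f (Function.update (a ∘ h.outer) h.slot
      (g (Function.update (a ∘ h.inner) q x)))) ∨
    ∃ q, ∀ a x, insertOp h f g (Function.update a l x) =
      f (Function.update (Function.update (a ∘ h.outer) h.slot (g (a ∘ h.inner))) q x) := by
  rcases h.exists_eq l with ⟨q, rfl⟩ | ⟨q, hq, rfl⟩
  · refine Or.inl ⟨q, fun a x => ?_⟩
    rw [insertOp_eq, Function.update_comp_eq_of_injective _ h.inner_injective]
    refine congrArg f (funext fun r => ?_)
    by_cases hr : r = h.slot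
    · rw [hr, Function.update_self, Function.update_self]
    · rw [Function.update_of_ne hr, Function.update_of_ne hr, Function.comp_apply,
        Function.update_of_ne (h.outer_ne_inner hr q), Function.comp_apply]
  · refine Or.inr ⟨q, fun a x => ?_⟩
    rw [insertOp_eq, Function.update_comp_eq_of_injective _ h.outer_injective,
      Function.update_comp_eq_of_forall_ne _ _ fun r => (h.outer_ne_inner hq r).symm,
      Function.update_comm hq]

/-- Insertion of operations as a multilinear map. -/
def insertMultilinear (h : Composable m n p M) (f : Op K A m) (g : Op K A n) : Op K A M :=
  MultilinearMap.mk' (insertOp h f g)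
    (fun a l x y => by
      rcases insertOp_update h f g l with ⟨q, hq⟩ | ⟨q, hq⟩ <;>
        simp only [hq, MultilinearMap.map_update_add])
    (fun a l c x => by
      rcases insertOp_update h f g l with ⟨q, hq⟩ | ⟨q, hq⟩ <;>
        simp only [hq, MultilinearMap.map_update_smul])

end Insert

/-! ### The tensor product is a cyclic algebra -/

section Tensor

variable {K : Type u} [Field K] {A : Type*} [AddCommGroup A] [Module K A]
  {B : Type*} [AddCommGroup B] [Module K B] {N : ℕ}
  [FiniteDimensional K A] [FiniteDimensional K B]
  {𝒜 : ZMod (2 * N) → Submodule K A} [DirectSum.Decomposition 𝒜]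
  {ℬ : ZMod (2 * N) → Submodule K B} [DirectSum.Decomposition ℬ] {εA εB : ZMod 2}
  {X : CyclicData K A} {Y : CyclicData K B} {Δ : ∀ n, TreeChain K n →ₗ[K] TreeChain₂ K n}

theorem exists_of_pureTensors {ι : Type*} {k : ι → ZMod (2 * N)} {v : ι → A ⊗[K] B}
    (hv : ∀ l, v l ∈ pureTensors 𝒜 ℬ (k l)) : ∃ (i j : ι → ZMod (2 * N)) (a : ι → A) (b : ι → B),
      (∀ l, a l ∈ 𝒜 (i l)) ∧ (∀ l, b l ∈ ℬ (j l)) ∧ k = (fun l => i l + j l) ∧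
      v = fun l => a l ⊗ₜ[K] b l := by
  choose i j a b ha hb hk hv using hv
  exact ⟨i, j, a, b, ha, hb, funext fun l => (hk l).symm, funext hv⟩

theorem tensor_d_mem (hX : IsCyclicAInfinity 𝒜 εA X) (hY : IsCyclicAInfinity ℬ εB Y)
    (k : ZMod (2 * N)) (x : A ⊗[K] B) (hx : x ∈ tensorGrading 𝒜 ℬ k) :
    (X.tensor 𝒜 ℬ Y Δ).d x ∈ tensorGrading 𝒜 ℬ (k - 1) := by
  have h : Submodule.span K (pureTensors 𝒜 ℬ k) ≤
      (tensorGrading 𝒜 ℬ (k - 1)).comap (X.tensor 𝒜 ℬ Y Δ).d := by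
    refine Submodule.span_le.2 ?_
    rintro _ ⟨i, j, a, b, ha, hb, rfl, rfl⟩
    change (X.tensor 𝒜 ℬ Y Δ).d _ ∈ tensorGrading 𝒜 ℬ _
    rw [tensor_d_tmul 𝒜 ℬ X Y Δ ha]
    exact add_mem (tmul_mem (hX.d_mem i a ha) hb (by ring))
      (Submodule.smul_mem _ _ (tmul_mem ha (hY.d_mem j b hb) (by ring)))
  exact h (tensorGrading_le_span 𝒜 ℬ k hx)

theorem parity_neg_one : parity (-1 : ZMod (2 * N)) = 1 := by
  rw [parity, map_neg, map_one]
  rfl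

theorem tensor_d_d (hX : IsCyclicAInfinity 𝒜 εA X) (hY : IsCyclicAInfinity ℬ εB Y) (x : A ⊗[K] B) :
    (X.tensor 𝒜 ℬ Y Δ).d ((X.tensor 𝒜 ℬ Y Δ).d x) = 0 := by
  have h := mem_span_pureTensors (hasHomogeneousBasis 𝒜) (hasHomogeneousBasis ℬ) x
  refine LinearMap.eqOn_span (f := (X.tensor 𝒜 ℬ Y Δ).d ∘ₗ (X.tensor 𝒜 ℬ Y Δ).d) (g := 0) ?_ h
  rintro _ ⟨i, j, a, b, ha, hb, rfl⟩
  rw [LinearMap.comp_apply, tensor_d_tmul 𝒜 ℬ X Y Δ ha, map_add, map_smul,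
    tensor_d_tmul 𝒜 ℬ X Y Δ (hX.d_mem i a ha), tensor_d_tmul 𝒜 ℬ X Y Δ ha, hX.d_d, hY.d_d,
    TensorProduct.zero_tmul, TensorProduct.tmul_zero, smul_zero, add_zero, zero_add, sub_eq_add_neg,
    parity_add, parity_neg_one, ← add_smul, msign_add, msign_one]
  simp

theorem tensor_pairing_symm (hX : IsCyclicAInfinity 𝒜 εA X) (hY : IsCyclicAInfinity ℬ εB Y)
    (k l : ZMod (2 * N)) (x : A ⊗[K] B) (hx : x ∈ tensorGrading 𝒜 ℬ k) (y : A ⊗[K] B)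
    (hy : y ∈ tensorGrading 𝒜 ℬ l) : (X.tensor 𝒜 ℬ Y Δ).pairing x y =
      msign K (parity k * parity l) * (X.tensor 𝒜 ℬ Y Δ).pairing y x := by
  refine bilinear_eq_of_span (g := msign K (parity k * parity l) • (X.tensor 𝒜 ℬ Y Δ).pairing.flip)
    ?_ (tensorGrading_le_span 𝒜 ℬ k hx) (tensorGrading_le_span 𝒜 ℬ l hy)
  rintro _ ⟨i, j, a, b, ha, hb, rfl, rfl⟩ _ ⟨i', j', a', b', ha', hb', rfl, rfl⟩
  rw [LinearMap.smul_apply, LinearMap.smul_apply, LinearMap.flip_apply, smul_eq_mul,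
    tensor_pairing_tmul 𝒜 ℬ X Y Δ a hb ha' b', tensor_pairing_tmul 𝒜 ℬ X Y Δ a' hb' ha b,
    hX.pairing_symm i i' a ha a' ha', hY.pairing_symm j j' b hb b' hb', parity_add, parity_add]
  have e : msign K (parity j * parity i') * (msign K (parity i * parity i') *
      msign K (parity j * parity j')) =
      msign K ((parity i + parity j) * (parity i' + parity j')) * msign K (parity j' * parity i) := by
    rw [← msign_add, ← msign_add, ← msign_add]
    refine congrArg _ ?_
    rw [← sub_eq_zero]
    ring_nf
    reduce_mod_char
  linear_combination (X.pairing a' a * Y.pairing b' b) * e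

theorem tensor_pairing_parity (hX : IsCyclicAInfinity 𝒜 εA X) (hY : IsCyclicAInfinity ℬ εB Y)
    (k l : ZMod (2 * N)) (x : A ⊗[K] B) (hx : x ∈ tensorGrading 𝒜 ℬ k) (y : A ⊗[K] B)
    (hy : y ∈ tensorGrading 𝒜 ℬ l) (h : (X.tensor 𝒜 ℬ Y Δ).pairing x y ≠ 0) :
    parity k = parity l + (εA + εB) := by
  by_contra hne
  refine h (bilinear_eq_of_span (g := 0) ?_ (tensorGrading_le_span 𝒜 ℬ k hx)
    (tensorGrading_le_span 𝒜 ℬ l hy))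
  rintro _ ⟨i, j, a, b, ha, hb, rfl, rfl⟩ _ ⟨i', j', a', b', ha', hb', rfl, rfl⟩
  rw [tensor_pairing_tmul 𝒜 ℬ X Y Δ a hb ha' b', LinearMap.zero_apply, LinearMap.zero_apply]
  by_contra h0
  refine hne ?_
  rw [parity_add, parity_add,
    hX.pairing_parity i i' a ha a' ha' (left_ne_zero_of_mul (right_ne_zero_of_mul h0)),
    hY.pairing_parity j j' b hb b' hb' (right_ne_zero_of_mul (right_ne_zero_of_mul h0))]
  ring

theorem tensor_pairing_d (hX : IsCyclicAInfinity 𝒜 εA X) (hY : IsCyclicAInfinity ℬ εB Y)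
    (k : ZMod (2 * N)) (x : A ⊗[K] B) (hx : x ∈ tensorGrading 𝒜 ℬ k) (y : A ⊗[K] B) :
    (X.tensor 𝒜 ℬ Y Δ).pairing ((X.tensor 𝒜 ℬ Y Δ).d x) y =
      msign K (parity k + 1) * (X.tensor 𝒜 ℬ Y Δ).pairing x ((X.tensor 𝒜 ℬ Y Δ).d y) := by
  let Z := X.tensor 𝒜 ℬ Y Δ
  refine bilinear_eq_of_span (f := Z.pairing.comp Z.d)
    (g := msign K (parity k + 1) • Z.pairing.compl₁₂ LinearMap.id Z.d) ?_
    (tensorGrading_le_span 𝒜 ℬ k hx)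
    (mem_span_pureTensors (hasHomogeneousBasis 𝒜) (hasHomogeneousBasis ℬ) y)
  rintro _ ⟨i, j, a, b, ha, hb, rfl, rfl⟩ _ ⟨i', j', a', b', ha', hb', rfl⟩
  rw [LinearMap.comp_apply, LinearMap.smul_apply, LinearMap.smul_apply, LinearMap.compl₁₂_apply,
    LinearMap.id_apply, tensor_d_tmul 𝒜 ℬ X Y Δ ha, tensor_d_tmul 𝒜 ℬ X Y Δ ha', map_add, map_smul,
    map_add, map_smul, LinearMap.add_apply, LinearMap.smul_apply, smul_eq_mul, smul_eq_mul, smul_eq_mul,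
    tensor_pairing_tmul 𝒜 ℬ X Y Δ _ hb ha', tensor_pairing_tmul 𝒜 ℬ X Y Δ _ (hY.d_mem j b hb) ha',
    tensor_pairing_tmul 𝒜 ℬ X Y Δ _ hb (hX.d_mem i' a' ha'), tensor_pairing_tmul 𝒜 ℬ X Y Δ _ hb ha',
    hX.pairing_d i a ha, hY.pairing_d j b hb, sub_eq_add_neg, sub_eq_add_neg, parity_add, parity_add,
    parity_add, parity_neg_one]
  have e₁ : msign K (parity j * parity i') * msign K (parity i + 1) =
      msign K (parity i + parity j + 1) * msign K (parity j * (parity i' + 1)) := by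
    rw [← msign_add, ← msign_add]
    refine congrArg _ ?_
    rw [← sub_eq_zero]
    ring_nf
    reduce_mod_char
  have e₂ : msign K (parity i) * (msign K ((parity j + 1) * parity i') * msign K (parity j + 1)) =
      msign K (parity i + parity j + 1) * (msign K (parity i') * msign K (parity j * parity i')) := by
    rw [← msign_add, ← msign_add, ← msign_add, ← msign_add]
    refine congrArg _ ?_
    rw [← sub_eq_zero]
    ring_nf
    try reduce_mod_char
  linear_combination (X.pairing a (X.d a') * Y.pairing b b') * e₁ +
    (X.pairing a a' * Y.pairing b (Y.d b')) * e₂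

end Tensor

/-! ### The structure maps of the tensor product -/

section Tensor

variable {K : Type u} [Field K] {A : Type*} [AddCommGroup A] [Module K A]
  {B : Type*} [AddCommGroup B] [Module K B] {N : ℕ}
  [FiniteDimensional K A] [FiniteDimensional K B]
  {𝒜 : ZMod (2 * N) → Submodule K A} [DirectSum.Decomposition 𝒜]
  {ℬ : ZMod (2 * N) → Submodule K B} [DirectSum.Decomposition ℬ] {εA εB : ZMod 2}
  {X : CyclicData K A} {Y : CyclicData K B} {Δ : ∀ n, TreeChain K n →ₗ[K] TreeChain₂ K n}

theorem shuffleSign_append (l l' : List (ZMod 2 × ZMod 2)) : shuffleSign (l ++ l') =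
    shuffleSign l + shuffleSign l' + (l.map Prod.snd).sum * (l'.map Prod.fst).sum := by
  unfold shuffleSign
  rw [pairSum_append]
  simp only [list_sum_map_mul_left]
  rw [List.sum_map_mul_right]

theorem tensor_pairing_ρ (hY : IsCyclicAInfinity ℬ εB Y) {n : ℕ} (hn : 2 ≤ n) (x : TreeChain K n)
    {i j : Fin (n + 1) → ZMod (2 * N)} {a : Fin (n + 1) → A} {b : Fin (n + 1) → B}
    (ha : ∀ l, a l ∈ 𝒜 (i l)) (hb : ∀ l, b l ∈ ℬ (j l)) :
    (X.tensor 𝒜 ℬ Y Δ).pairing ((X.tensor 𝒜 ℬ Y Δ).ρ n x fun l => a l.succ ⊗ₜ[K] b l.succ)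
        (a 0 ⊗ₜ[K] b 0) = ∑ P, Δ n x P *
      (msign K (shuffleSign (((finRange n).map Fin.succ ++ [0]).map
        fun l => (parity (i l), parity (j l))) + P.2.degree 2 * ∑ l, parity (i l)) *
      (X.pairing (X.ρ n (single P.1 1) fun l => a l.succ) (a 0) *
        Y.pairing (Y.ρ n (single P.2 1) fun l => b l.succ) (b 0))) := by
  rw [tensor_ρ_tmul 𝒜 ℬ X Y Δ x (fun l => ha l.succ) (fun l => hb l.succ), map_sum,
    LinearMap.sum_apply]
  refine sum_congr rfl fun P _ => ?_
  rw [map_smul, map_smul, LinearMap.smul_apply, LinearMap.smul_apply, smul_eq_mul, smul_eq_mul,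
    tensor_pairing_tmul 𝒜 ℬ X Y Δ _ (hY.ρ_mem n hn P.2 _ _ fun l => hb l.succ) (ha 0),
    ← mul_assoc (msign K _), ← msign_add]
  refine congrArg _ (congrArg (msign K · * _) ?_)
  rw [map_append, map_map, map_singleton, shuffleSign_append, parity_add, parity_sum, parity_degree,
    Fin.sum_univ_succ, map_map, map_singleton, sum_singleton,
    Fin.sum_univ_def fun l : Fin n => parity (j l.succ)]
  simp only [shuffleSign, pairSum, Function.comp_def, map_nil, sum_nil]
  ring

theorem tensor_ρ_mem (hX : IsCyclicAInfinity 𝒜 εA X) (hY : IsCyclicAInfinity ℬ εB Y)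
    (hΔ : IsCyclicDiagonal Δ) (n : ℕ) (hn : 2 ≤ n) (T : PlanarTree n) (k : Fin n → ZMod (2 * N))
    (v : Fin n → A ⊗[K] B) (hv : ∀ l, v l ∈ tensorGrading 𝒜 ℬ (k l)) :
    (X.tensor 𝒜 ℬ Y Δ).ρ n (single T 1) v ∈
      tensorGrading 𝒜 ℬ (T.degree (2 * N) + ∑ l, k l) := by
  let Q := tensorGrading 𝒜 ℬ (T.degree (2 * N) + ∑ l, k l)
  let F := (X.tensor 𝒜 ℬ Y Δ).ρ n (single T 1)
  suffices h : Q.mkQ.compMultilinearMap F v = (0 : MultilinearMap K _ _) v from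
    (Submodule.Quotient.mk_eq_zero Q).1 h
  refine multilinear_eq_of_span (fun v hv => ?_) fun l => tensorGrading_le_span 𝒜 ℬ (k l) (hv l)
  obtain ⟨i, j, a, b, ha, hb, hk, rfl⟩ := exists_of_pureTensors hv
  refine (Submodule.Quotient.mk_eq_zero Q).2 ?_
  change (X.tensor 𝒜 ℬ Y Δ).ρ n (single T 1) _ ∈ tensorGrading 𝒜 ℬ _
  rw [tensor_ρ_tmul 𝒜 ℬ X Y Δ _ ha hb]
  refine Submodule.sum_mem _ fun P _ => ?_
  by_cases h0 : Δ n (single T 1) P = 0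
  · rw [h0, zero_smul]
    exact zero_mem _
  · refine Submodule.smul_mem _ _ (Submodule.smul_mem _ _ (tmul_mem (hX.ρ_mem n hn P.1 i a ha)
      (hY.ρ_mem n hn P.2 j b hb) ?_))
    rw [← hΔ.degree_eq (2 * N) hn h0, hk, sum_add_distrib]
    ring

theorem tensor_cyclic (hX : IsCyclicAInfinity 𝒜 εA X) (hY : IsCyclicAInfinity ℬ εB Y)
    (hΔ : IsCyclicDiagonal Δ) (n : ℕ) (hn : 2 ≤ n) (T : PlanarTree n)
    (k : Fin (n + 1) → ZMod (2 * N)) (v : Fin (n + 1) → A ⊗[K] B)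
    (hv : ∀ l, v l ∈ tensorGrading 𝒜 ℬ (k l)) :
    (X.tensor 𝒜 ℬ Y Δ).pairing ((X.tensor 𝒜 ℬ Y Δ).ρ n (treeRotation K n (single T 1))
        fun l => v l.castSucc) (v (Fin.last n)) =
      msign K (parity (k 0) * ∑ l : Fin n, parity (k l.succ)) *
        (X.tensor 𝒜 ℬ Y Δ).pairing ((X.tensor 𝒜 ℬ Y Δ).ρ n (single T 1)
          fun l => v l.succ) (v 0) := by
  let Z := X.tensor 𝒜 ℬ Y Δ
  let F : TreeChain K n → MultilinearMap K (fun _ : Fin (n + 1) => A ⊗[K] B) K := fun x =>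
    (Z.pairing.compMultilinearMap (Z.ρ n x)).uncurryRight
  have hF : ∀ x w, ((F x).domDomCongr (finRotate (n + 1))) w =
      Z.pairing (Z.ρ n x fun l => w l.succ) (w 0) := by
    intro x w
    change Z.pairing (Z.ρ n x fun l => w (finRotate (n + 1) l.castSucc))
      (w (finRotate (n + 1) (Fin.last n))) = _
    simp only [finRotate_apply, Fin.coeSucc_eq_succ, Fin.last_add_one]
  suffices h : F (treeRotation K n (single T 1)) v =
      (msign K (parity (k 0) * ∑ l : Fin n, parity (k l.succ)) •
        (F (single T 1)).domDomCongr (finRotate (n + 1))) v by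
    rw [smul_apply, hF] at h
    exact h
  refine multilinear_eq_of_span (fun v hv => ?_) fun l => tensorGrading_le_span 𝒜 ℬ (k l) (hv l)
  obtain ⟨i, j, a, b, ha, hb, rfl, rfl⟩ := exists_of_pureTensors hv
  rw [smul_apply, hF, smul_eq_mul]
  change Z.pairing (Z.ρ n _ fun l => a l.castSucc ⊗ₜ[K] b l.castSucc)
    (a (Fin.last n) ⊗ₜ[K] b (Fin.last n)) = _
  have h1 := tensor_pairing_ρ (X := X) (Δ := Δ) hY hn (treeRotation K n (single T 1))
    (a := fun l => a (l - 1)) (b := fun l => b (l - 1)) (fun l => ha (l - 1)) fun l => hb (l - 1)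
  have h2 : ∀ l : Fin n, l.succ - 1 = l.castSucc := fun l => by
    rw [← Fin.coeSucc_eq_succ, add_sub_cancel_right]
  have h3 : (0 - 1 : Fin (n + 1)) = Fin.last n := sub_eq_iff_eq_add.2 (Fin.last_add_one n).symm
  simp only [h2, h3] at h1
  rw [h1, tensor_pairing_ρ hY hn _ ha hb]
  have h4 : ∀ G : PlanarTree n × PlanarTree n → K,
      ∑ P, Δ n (treeRotation K n (single T 1)) P * G P = ∑ P, Δ n (single T 1) P *
        (msign K (P.1.rotationSign + P.2.rotationSign) * G (P.1.rotate, P.2.rotate)) := by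
    intro G
    have := hΔ.sum_rotate hn T G
    rw [← msign_smul_eq_iff, smul_sum] at this
    rw [treeRotation_single, ← mul_one (msign K T.rotationSign), ← smul_eq_mul, ← smul_single,
      map_smul]
    simp only [Finsupp.smul_apply, smul_eq_mul, mul_assoc] at this ⊢
    exact this
  rw [h4, mul_sum]
  refine sum_congr rfl fun P _ => ?_
  have hA := hX.cyclic n hn P.1 i a ha
  have hB := hY.cyclic n hn P.2 j b hb
  rw [treeRotation_single, ← mul_one (msign K (PlanarTree.rotationSign _)), ← smul_eq_mul,
    ← smul_single, map_smul, smul_apply, map_smul, LinearMap.smul_apply,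
    msign_smul_eq_iff, smul_eq_mul] at hA hB
  rw [hA, hB]
  have h5 : ((finRange n).map Fin.succ ++ [0]).map (fun l : Fin (n + 1) =>
      (parity (i (l - 1)), parity (j (l - 1)))) =
      [(parity (i 0), parity (j 0))] ++ (finRange n).map
        fun l => (parity (i l.succ), parity (j l.succ)) := by
    rw [map_append, map_map, map_singleton, h3]
    have h := Marking.map_finRange_castSucc fun l => (parity (i l), parity (j l))
    rw [finRange_succ, map_cons, map_map] at h
    refine Eq.trans ?_ h.symm
    exact congrArg (· ++ _) (map_congr_left fun l _ => by rw [Function.comp_apply, h2])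
  have h6 : ∑ l : Fin (n + 1), parity (i (l - 1)) = ∑ l, parity (i l) :=
    (Equiv.subRight (1 : Fin (n + 1))).sum_comp fun l => parity (i l)
  have h7 : P.2.rotate.degree 2 = P.2.degree 2 := by
    rw [PlanarTree.degree, PlanarTree.degree, card_rotate]
  have e : msign K (P.1.rotationSign + P.2.rotationSign) *
      (msign K (shuffleSign (((finRange n).map Fin.succ ++ [0]).map (fun l : Fin (n + 1) =>
        (parity (i (l - 1)), parity (j (l - 1))))) +
          P.2.rotate.degree 2 * ∑ l : Fin (n + 1), parity (i (l - 1))) *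
      ((msign K P.1.rotationSign * msign K (parity (i 0) * ∑ l : Fin n, parity (i l.succ))) *
      (msign K P.2.rotationSign * msign K (parity (j 0) * ∑ l : Fin n, parity (j l.succ))))) =
      msign K (parity (i 0 + j 0) * ∑ l : Fin n, parity (i l.succ + j l.succ)) *
      msign K (shuffleSign (((finRange n).map Fin.succ ++ [0]).map
        fun l => (parity (i l), parity (j l))) + P.2.degree 2 * ∑ l, parity (i l)) := by
    simp only [h5, h6, h7, ← msign_add, parity_add, sum_add_distrib]
    rw [map_append, map_map, map_singleton, shuffleSign_append, shuffleSign_append]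
    simp only [Fin.sum_univ_def fun l : Fin n => parity (i l.succ),
      Fin.sum_univ_def fun l : Fin n => parity (j l.succ), map_map, map_singleton, sum_singleton,
      Function.comp_def]
    refine congrArg _ ?_
    generalize shuffleSign _ = x
    generalize shuffleSign _ = y
    rw [← sub_eq_zero]
    ring_nf
    reduce_mod_char
  linear_combination (Δ n (single T 1) P *
    (X.pairing (X.ρ n (single P.1 1) fun l => a l.succ) (a 0) *
      Y.pairing (Y.ρ n (single P.2 1) fun l => b l.succ) (b 0))) * e

theorem tensor_ρ_treeComp_tmul (hX : IsCyclicAInfinity 𝒜 εA X) (hY : IsCyclicAInfinity ℬ εB Y)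
    (hΔ : IsCyclicDiagonal Δ) {m n p M : ℕ} (h : Composable m n p M) (U : PlanarTree m)
    (V : PlanarTree n) {i j : Fin M → ZMod (2 * N)} {a : Fin M → A} {b : Fin M → B}
    (ha : ∀ l, a l ∈ 𝒜 (i l)) (hb : ∀ l, b l ∈ ℬ (j l)) :
    (X.tensor 𝒜 ℬ Y Δ).ρ M (treeComp K h U V) (fun l => a l ⊗ₜ[K] b l) =
      ∑ Q, ∑ P, (Δ n (single V 1) Q * Δ m (single U 1) P) •
        msign K (P.2.degree 2 * Q.1.degree 2 +
          (shuffleSign ((finRange M).map fun l => (parity (i l), parity (j l))) +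
          (∑ l, parity (i l)) * (P.2.degree 2 + Q.2.degree 2)) +
          Q.1.degree 2 * (∑ l : Fin M with l.1 + 1 < p, parity (i l)) +
          Q.2.degree 2 * (∑ l : Fin M with l.1 + 1 < p, parity (j l))) •
        (insertOp h (X.ρ m (single P.1 1)) (X.ρ n (single Q.1 1)) a ⊗ₜ[K]
          insertOp h (Y.ρ m (single P.2 1)) (Y.ρ n (single Q.2 1)) b) := by
  rw [treeComp_eq, ← mul_one (msign K _), ← smul_eq_mul, ← smul_single, map_smul,
    smul_apply, tensor_ρ_tmul 𝒜 ℬ X Y Δ _ ha hb, msign_smul_eq_iff,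
    hΔ.sum_graft h U V]
  refine congrArg _ (sum_congr rfl fun Q _ => sum_congr rfl fun P _ => ?_)
  refine congrArg _ ?_
  have hA := hX.ρ_comp m n p M h P.1 Q.1 i a ha
  have hB := hY.ρ_comp m n p M h P.2 Q.2 j b hb
  rw [treeComp_eq, ← mul_one (msign K (graftSign _ _)), ← smul_eq_mul, ← smul_single, map_smul,
    smul_apply, msign_smul_eq_iff, smul_smul, ← msign_add] at hA hB
  rw [hA, hB, TensorProduct.smul_tmul_smul, smul_smul, smul_smul, ← msign_add, ← msign_add,
    ← msign_add]
  refine congrArg₂ _ (congrArg _ ?_) rfl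
  rw [StateData.degree_graft h P.2 Q.2, ← sub_eq_zero]
  ring_nf
  reduce_mod_char

theorem tensor_insertOp_tmul (hX : IsCyclicAInfinity 𝒜 εA X) (hY : IsCyclicAInfinity ℬ εB Y)
    {m n p M : ℕ} (h : Composable m n p M) (x : TreeChain K m) (y : TreeChain K n)
    {i j : Fin M → ZMod (2 * N)} {a : Fin M → A} {b : Fin M → B}
    (ha : ∀ l, a l ∈ 𝒜 (i l)) (hb : ∀ l, b l ∈ ℬ (j l)) (w : Fin M → ZMod 2 × ZMod 2)
    (hw : w = fun l => (parity (i l), parity (j l)))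
    (c : PlanarTree n × PlanarTree n → ZMod 2 × ZMod 2)
    (hc : c = fun Q => (Q.1.degree 2 + ∑ l, (w (h.inner l)).1, Q.2.degree 2 + ∑ l, (w (h.inner l)).2)) :
    insertOp h ((X.tensor 𝒜 ℬ Y Δ).ρ m x) ((X.tensor 𝒜 ℬ Y Δ).ρ n y) (fun l => a l ⊗ₜ[K] b l) =
      ∑ Q, ∑ P, (Δ n y Q * Δ m x P) •
        msign K (shuffleSign ((finRange n).map fun l => w (h.inner l)) +
          (∑ l, (w (h.inner l)).1) * Q.2.degree 2 +
          (shuffleSign ((finRange m).map (Function.update (w ∘ h.outer) h.slot (c Q))) +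
          (∑ l, (Function.update (w ∘ h.outer) h.slot (c Q) l).1) * P.2.degree 2)) •
        (insertOp h (X.ρ m (single P.1 1)) (X.ρ n (single Q.1 1)) a ⊗ₜ[K]
          insertOp h (Y.ρ m (single P.2 1)) (Y.ρ n (single Q.2 1)) b) := by
  rw [insertOp_eq, show ((fun l => a l ⊗ₜ[K] b l) ∘ h.inner) =
    fun q => a (h.inner q) ⊗ₜ[K] b (h.inner q) from rfl,
    tensor_ρ_tmul 𝒜 ℬ X Y Δ _ (fun q => ha (h.inner q)) (fun q => hb (h.inner q)),
    MultilinearMap.map_update_sum]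
  refine sum_congr rfl fun Q _ => ?_
  rw [MultilinearMap.map_update_smul, MultilinearMap.map_update_smul]
  let a' := Function.update (a ∘ h.outer) h.slot (X.ρ n (single Q.1 1) (a ∘ h.inner))
  let b' := Function.update (b ∘ h.outer) h.slot (Y.ρ n (single Q.2 1) (b ∘ h.inner))
  let i' := Function.update (i ∘ h.outer) h.slot (Q.1.degree (2 * N) + ∑ q, i (h.inner q))
  let j' := Function.update (j ∘ h.outer) h.slot (Q.2.degree (2 * N) + ∑ q, j (h.inner q))
  have ha' : ∀ q, a' q ∈ 𝒜 (i' q) := fun q => by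
    by_cases hq : q = h.slot
    · simp only [a', i', hq, Function.update_self]
      exact hX.ρ_mem n h.2.1 Q.1 _ _ fun l => ha _
    · simp only [a', i', Function.update_of_ne hq]
      exact ha _
  have hb' : ∀ q, b' q ∈ ℬ (j' q) := fun q => by
    by_cases hq : q = h.slot
    · simp only [b', j', hq, Function.update_self]
      exact hY.ρ_mem n h.2.1 Q.2 _ _ fun l => hb _
    · simp only [b', j', Function.update_of_ne hq]
      exact hb _
  have h3 : Function.update ((fun l => a l ⊗ₜ[K] b l) ∘ h.outer) h.slot
      ((X.ρ n (single Q.1 1) fun q => a (h.inner q)) ⊗ₜ[K]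
        (Y.ρ n (single Q.2 1) fun q => b (h.inner q))) = fun q => a' q ⊗ₜ[K] b' q := by
    funext q
    by_cases hq : q = h.slot
    · simp only [a', b', hq, Function.update_self]
      rfl
    · simp only [a', b', Function.update_of_ne hq]
      rfl
  have h4 : (fun q => (parity (i' q), parity (j' q))) =
      Function.update (w ∘ h.outer) h.slot (c Q) := by
    funext q
    by_cases hq : q = h.slot
    · simp only [i', j', hq, Function.update_self, parity_add, parity_sum, parity_degree, hc, hw]
    · simp only [i', j', Function.update_of_ne hq, hw]
      rfl
  have h5 : ∑ l, parity (i' l) = ∑ l, (Function.update (w ∘ h.outer) h.slot (c Q) l).1 :=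
    sum_congr rfl fun l _ => congrArg Prod.fst (congrFun h4 l)
  rw [h3, tensor_ρ_tmul 𝒜 ℬ X Y Δ _ ha' hb', smul_sum, smul_sum, h4, h5]
  refine sum_congr rfl fun P _ => ?_
  rw [insertOp_eq, insertOp_eq, smul_comm (msign K _) (Δ m _ P), smul_smul (msign K _), ← msign_add,
    smul_smul]
  simp only [hw]
  rfl

theorem tensor_comp_sign {m n p M : ℕ} (h : Composable m n p M) (w : Fin M → ZMod 2 × ZMod 2)
    (x₁ y₁ y₂ : ZMod 2) :
    x₁ * y₁ + (shuffleSign ((finRange M).map w) + (∑ l, (w l).1) * (x₁ + y₂)) +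
        y₁ * (∑ l : Fin M with l.1 + 1 < p, (w l).1) + y₂ * (∑ l : Fin M with l.1 + 1 < p, (w l).2) =
      (y₁ + y₂) * ∑ l : Fin M with l.1 + 1 < p, ((w l).1 + (w l).2) +
        (shuffleSign ((finRange n).map fun l => w (h.inner l)) +
          (∑ l, (w (h.inner l)).1) * y₂ +
          (shuffleSign ((finRange m).map (Function.update (w ∘ h.outer) h.slot
            (y₁ + ∑ l, (w (h.inner l)).1, y₂ + ∑ l, (w (h.inner l)).2))) +
          (∑ l, (Function.update (w ∘ h.outer) h.slot
            (y₁ + ∑ l, (w (h.inner l)).1, y₂ + ∑ l, (w (h.inner l)).2) l).1) * x₁)) := by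
  obtain ⟨I, J, L, hM, hn, hI, hm⟩ := h.exists_finRange_eq
  have hsum : ∀ f : Fin M → ZMod 2, ∑ l with l.1 + 1 < p, f l = (I.map f).sum := fun f => by
    rw [← sum_lt_eq_sum_take (k := p - 1) (fun l => l) f (by rw [List.map_id', hM]) hI]
    refine sum_congr (Finset.filter_congr fun l _ => ?_) fun _ _ => rfl
    have := h.2.2.1
    omega
  have hin : ∀ f : Fin M → ZMod 2, ∑ l, f (h.inner l) = (J.map f).sum := fun f => by
    rw [← hn, map_map, Fin.sum_univ_def]
    rfl
  have hall : ∑ l, (w l).1 = (I.map fun l => (w l).1).sum + ((J.map fun l => (w l).1).sum +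
      (L.map fun l => (w l).1).sum) := by
    rw [Fin.sum_univ_def, hM, map_append, map_append, sum_append, sum_append]
  have hJ : (finRange n).map (fun l => w (h.inner l)) = J.map w := by
    rw [← hn, map_map]
    rfl
  have hout : ∀ c, ∑ l, (Function.update (w ∘ h.outer) h.slot c l).1 =
      (I.map fun l => (w l).1).sum + (c.1 + (L.map fun l => (w l).1).sum) := fun c => by
    rw [Fin.sum_univ_def]
    refine (congrArg List.sum (map_map (f := Function.update (w ∘ h.outer) h.slot c)
      (g := Prod.fst) (l := finRange m)).symm).trans ?_
    rw [hm, map_append, map_cons, map_map, map_map, sum_append, sum_cons]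
    rfl
  have hcons : ∀ (c : ZMod 2 × ZMod 2) l, shuffleSign (c :: l) =
      c.2 * (l.map Prod.fst).sum + shuffleSign l := fun c l => by
    rw [shuffleSign, pairSum, list_sum_map_mul_left]
    rfl
  rw [hsum, hsum, hsum, hin fun l => (w l).1, hin fun l => (w l).2, hall, hJ, hout, hm, hM, map_append, map_append,
    shuffleSign_append, shuffleSign_append, shuffleSign_append, hcons, list_sum_map_add]
  simp only [map_append, map_cons, map_map, sum_append, sum_cons]
  change x₁ * y₁ + (shuffleSign (I.map w) + (shuffleSign (J.map w) + shuffleSign (L.map w) +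
    (J.map fun l => (w l).2).sum * (L.map fun l => (w l).1).sum) + (I.map fun l => (w l).2).sum *
      ((J.map fun l => (w l).1).sum + (L.map fun l => (w l).1).sum) + _) + _ + _ =
    _ + (_ + (shuffleSign (I.map w) + ((y₂ + _) * (L.map fun l => (w l).1).sum +
      shuffleSign (L.map w)) + (I.map fun l => (w l).2).sum * (_ + (L.map fun l => (w l).1).sum) + _))
  generalize (I.map fun l => (w l).1).sum = i₁
  generalize (I.map fun l => (w l).2).sum = i₂
  generalize (J.map fun l => (w l).1).sum = j₁
  generalize (J.map fun l => (w l).2).sum = j₂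
  generalize (L.map fun l => (w l).1).sum = l₁
  rw [← sub_eq_zero]
  ring_nf
  reduce_mod_char

theorem tensor_ρ_comp (hX : IsCyclicAInfinity 𝒜 εA X) (hY : IsCyclicAInfinity ℬ εB Y)
    (hΔ : IsCyclicDiagonal Δ) (m n p M : ℕ) (h : Composable m n p M) (U : PlanarTree m)
    (V : PlanarTree n) (k : Fin M → ZMod (2 * N)) (v : Fin M → A ⊗[K] B)
    (hv : ∀ l, v l ∈ tensorGrading 𝒜 ℬ (k l)) :
    (X.tensor 𝒜 ℬ Y Δ).ρ M (treeComp K h U V) v =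
      msign K (V.degree 2 * ∑ l : Fin M with l.1 + 1 < p, parity (k l)) •
        insertOp h ((X.tensor 𝒜 ℬ Y Δ).ρ m (single U 1))
          ((X.tensor 𝒜 ℬ Y Δ).ρ n (single V 1)) v := by
  let Z := X.tensor 𝒜 ℬ Y Δ
  refine multilinear_eq_of_span (g := msign K (V.degree 2 *
    ∑ l : Fin M with l.1 + 1 < p, parity (k l)) • insertMultilinear h (Z.ρ m (single U 1))
      (Z.ρ n (single V 1))) (fun v hv => ?_)
    fun l => tensorGrading_le_span 𝒜 ℬ (k l) (hv l)
  obtain ⟨i, j, a, b, ha, hb, rfl, rfl⟩ := exists_of_pureTensors hv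
  rw [smul_apply]
  refine Eq.trans ?_ (congrArg _ (tensor_insertOp_tmul hX hY h _ _ ha hb _ rfl _ rfl).symm)
  rw [tensor_ρ_treeComp_tmul hX hY hΔ h U V ha hb, smul_sum]
  refine sum_congr rfl fun Q _ => ?_
  rw [smul_sum]
  refine sum_congr rfl fun P _ => ?_
  by_cases h0 : Δ n (single V 1) Q = 0
  · rw [h0, zero_mul, zero_smul, zero_smul, smul_zero]
  rw [smul_comm (msign K _)]
  refine congrArg _ ?_
  rw [smul_smul, ← msign_add, ← hΔ.degree_eq 2 h.2.1 h0]
  refine congrArg₂ _ (congrArg _ ?_) rfl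
  simp only [parity_add]
  exact tensor_comp_sign h (fun l => (parity (i l), parity (j l))) _ _ _

end Tensor

/-! ### The differential and the structure maps of the tensor product -/

section Boundary

variable {K : Type u} [Field K]

theorem degree_of_treeBoundary {n : ℕ} {T S : PlanarTree n}
    (h : treeBoundary K n (single T 1) S ≠ 0) : S.degree 2 = T.degree 2 + 1 := by
  unfold treeBoundary at h
  rw [linearCombination_single, one_smul, Finsupp.finsetSum_apply] at h
  obtain ⟨p, _, hp⟩ := Finset.exists_ne_zero_of_sum_ne_zero h
  split_ifs at hp with hc
  · have hS : T.addEdge _ hc = S := by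
      by_contra hne
      exact hp (Finsupp.single_eq_of_ne (Ne.symm hne))
    have hcard : S.edges.card = T.edges.card + 1 := by
      rw [← hS]
      exact Finset.card_insert_of_notMem hc.1
    rw [PlanarTree.degree_two, PlanarTree.degree_two, hcard]
    push_cast
    ring
  · exact absurd rfl hp

theorem IsCyclicDiagonal.sum_boundary {Δ : ∀ n, TreeChain K n →ₗ[K] TreeChain₂ K n}
    {W : Type*} [AddCommGroup W] [Module K W] (hΔ : IsCyclicDiagonal Δ) {n : ℕ} (hn : 2 ≤ n)
    (T : PlanarTree n) (F : PlanarTree n × PlanarTree n → W) :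
    ∑ P, Δ n (treeBoundary K n (single T 1)) P • F P = ∑ P, Δ n (single T 1) P •
      (∑ S, treeBoundary K n (single P.1 1) S • F (S, P.2) + msign K (P.1.degree 2) •
        ∑ S, treeBoundary K n (single P.2 1) S • F (P.1, S)) := by
  have h2 : ∀ (x : TreeChain₂ K n) (F : PlanarTree n × PlanarTree n → W),
      ∑ P, x P • F P = linearCombination K F x := fun x F => by
    rw [linearCombination_apply, sum_fintype _ _ (by simp)]
  rw [h2, h2, hΔ.boundary n hn, ← LinearMap.comp_apply]
  refine congrArg (fun f : TreeChain₂ K n →ₗ[K] W => f (Δ n (single T 1)))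
    (Finsupp.lhom_ext' fun P => LinearMap.ext_ring ?_)
  have h3 : ∀ x y : TreeChain K n, linearCombination K F (treeTmul x y) =
      ∑ S, ∑ S', (x S * y S') • F (S, S') := fun x y => by
    unfold treeTmul
    rw [sum_fintype _ _ (by simp), map_sum]
    refine sum_congr rfl fun S _ => ?_
    rw [sum_fintype _ _ (by simp), map_sum]
    refine sum_congr rfl fun S' _ => ?_
    rw [linearCombination_single]
  have h4 : ∀ (S : PlanarTree n) (f : PlanarTree n → W),
      ∑ S', (single S (1 : K) S') • f S' = f S := fun S f => by
    rw [sum_eq_single S, Finsupp.single_eq_same, one_smul]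
    · intro S' _ hS
      rw [Finsupp.single_eq_of_ne hS, zero_smul]
    · exact fun hS => absurd (mem_univ _) hS
  simp only [LinearMap.comp_apply, Finsupp.lsingle_apply, treeBoundary₂, linearCombination_single,
    one_smul, map_add, map_smul, h3, mul_smul, h4, ← smul_sum]

theorem shuffleSign_add_left {n : ℕ} (f g : Fin n → ZMod 2) (l : Fin n) :
    shuffleSign ((finRange n).map fun q => (f q + (if q = l then 1 else 0), g q)) =
      shuffleSign ((finRange n).map fun q => (f q, g q)) + ∑ q with q < l, g q := by
  unfold shuffleSign
  rw [pairSum_map, pairSum_map, ← sum_sum_eq_pairSum, ← sum_sum_eq_pairSum, Finset.sum_filter,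
    ← sum_add_distrib]
  refine sum_congr rfl fun x _ => ?_
  simp only [mul_add, sum_add_distrib, mul_ite, mul_one, mul_zero]
  rw [Finset.sum_ite_eq']
  simp

theorem shuffleSign_add_right {n : ℕ} (f g : Fin n → ZMod 2) (l : Fin n) :
    shuffleSign ((finRange n).map fun q => (f q, g q + (if q = l then 1 else 0))) =
      shuffleSign ((finRange n).map fun q => (f q, g q)) + ∑ q with l < q, f q := by
  unfold shuffleSign
  rw [pairSum_map, pairSum_map, ← sum_sum_eq_pairSum, ← sum_sum_eq_pairSum]
  simp only [add_mul, sum_add_distrib, ite_mul, one_mul, zero_mul]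
  refine congrArg _ ?_
  rw [sum_eq_single l]
  · simp
  · intro x _ hx
    simp [hx]
  · exact fun h => absurd (mem_univ _) h

theorem sum_lt_add_gt {n : ℕ} (f : Fin n → ZMod 2) (l : Fin n) :
    ∑ q, f q = ∑ q with q < l, f q + f l + ∑ q with l < q, f q := by
  rw [Finset.sum_filter, Finset.sum_filter, add_right_comm, ← sum_add_distrib,
    ← Finset.sum_ite_eq' Finset.univ l f |>.trans (if_pos (mem_univ l)), ← sum_add_distrib]
  refine sum_congr rfl fun q _ => ?_
  rcases lt_trichotomy q l with h | h | h
  · simp [h, h.ne, h.not_gt]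
  · simp [h]
  · simp [h, h.ne', h.not_gt]

end Boundary

section Tensor

variable {K : Type u} [Field K] {A : Type*} [AddCommGroup A] [Module K A]
  {B : Type*} [AddCommGroup B] [Module K B] {N : ℕ}
  [FiniteDimensional K A] [FiniteDimensional K B]
  {𝒜 : ZMod (2 * N) → Submodule K A} [DirectSum.Decomposition 𝒜]
  {ℬ : ZMod (2 * N) → Submodule K B} [DirectSum.Decomposition ℬ] {εA εB : ZMod 2}
  {X : CyclicData K A} {Y : CyclicData K B} {Δ : ∀ n, TreeChain K n →ₗ[K] TreeChain₂ K n}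

theorem parity_update {n : ℕ} (i : Fin n → ZMod (2 * N)) (l q : Fin n) :
    parity (Function.update i l (i l - 1) q) = parity (i q) + if q = l then 1 else 0 := by
  by_cases hq : q = l
  · rw [hq, Function.update_self, if_pos rfl, sub_eq_add_neg, parity_add, parity_neg_one]
  · rw [Function.update_of_ne hq, if_neg hq, add_zero]

theorem update_mem_grading {C : Type*} [AddCommGroup C] [Module K C]
    {𝒞 : ZMod (2 * N) → Submodule K C} {n : ℕ} {r : Fin n → ZMod (2 * N)} {c : Fin n → C}
    (hc : ∀ l, c l ∈ 𝒞 (r l)) {l : Fin n} {y : C} (hy : y ∈ 𝒞 (r l - 1)) (q : Fin n) :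
    Function.update c l y q ∈ 𝒞 (Function.update r l (r l - 1) q) := by
  by_cases hq : q = l
  · subst hq
    rwa [Function.update_self, Function.update_self]
  · rw [Function.update_of_ne hq, Function.update_of_ne hq]
    exact hc q

theorem CyclicData.ρ_eq_sum {C : Type*} [AddCommGroup C] [Module K C] (Z : CyclicData K C) {n : ℕ}
    (x : TreeChain K n) (c : Fin n → C) :
    Z.ρ n x c = ∑ S, x S • Z.ρ n (single S 1) c := by
  conv_lhs => rw [← Finsupp.sum_single x, sum_fintype _ _ (by simp), map_sum,
    sum_apply]
  refine sum_congr rfl fun S _ => ?_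
  rw [← smul_apply, ← map_smul, smul_single, smul_eq_mul, mul_one]

theorem tensor_ρ_update_d (hX : IsCyclicAInfinity 𝒜 εA X) (hY : IsCyclicAInfinity ℬ εB Y) {n : ℕ}
    (x : TreeChain K n) {i j : Fin n → ZMod (2 * N)} {a : Fin n → A} {b : Fin n → B}
    (ha : ∀ l, a l ∈ 𝒜 (i l)) (hb : ∀ l, b l ∈ ℬ (j l)) (l : Fin n) :
    (X.tensor 𝒜 ℬ Y Δ).ρ n x (Function.update (fun l => a l ⊗ₜ[K] b l) l
        ((X.tensor 𝒜 ℬ Y Δ).d (a l ⊗ₜ[K] b l))) = ∑ P, Δ n x P •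
      (msign K (shuffleSign ((finRange n).map fun l => (parity (i l), parity (j l))) +
          ∑ q with q < l, parity (j q) + ((∑ l, parity (i l)) + 1) * P.2.degree 2) •
        (X.ρ n (single P.1 1) (Function.update a l (X.d (a l))) ⊗ₜ[K]
          Y.ρ n (single P.2 1) b) +
      msign K (parity (i l) +
        (shuffleSign ((finRange n).map fun l => (parity (i l), parity (j l))) +
          ∑ q with l < q, parity (i q) + (∑ l, parity (i l)) * P.2.degree 2)) •
        (X.ρ n (single P.1 1) a ⊗ₜ[K]
          Y.ρ n (single P.2 1) (Function.update b l (Y.d (b l))))) := by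
  have h1 : Function.update (fun l => a l ⊗ₜ[K] b l) l (X.d (a l) ⊗ₜ[K] b l) =
      fun q => Function.update a l (X.d (a l)) q ⊗ₜ[K] b q := by
    funext q
    by_cases hq : q = l
    · rw [hq, Function.update_self, Function.update_self]
    · rw [Function.update_of_ne hq, Function.update_of_ne hq]
  have h2 : Function.update (fun l => a l ⊗ₜ[K] b l) l (a l ⊗ₜ[K] Y.d (b l)) =
      fun q => a q ⊗ₜ[K] Function.update b l (Y.d (b l)) q := by
    funext q
    by_cases hq : q = l
    · rw [hq, Function.update_self, Function.update_self]
    · rw [Function.update_of_ne hq, Function.update_of_ne hq]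
  rw [tensor_d_tmul 𝒜 ℬ X Y Δ (ha l), MultilinearMap.map_update_add, MultilinearMap.map_update_smul,
    h1, h2, tensor_ρ_tmul 𝒜 ℬ X Y Δ x (update_mem_grading ha (hX.d_mem _ _ (ha l))) hb,
    tensor_ρ_tmul 𝒜 ℬ X Y Δ x ha (update_mem_grading hb (hY.d_mem _ _ (hb l))), smul_sum,
    ← sum_add_distrib]
  refine sum_congr rfl fun P _ => ?_
  rw [smul_comm (msign K _) (Δ n x P), ← smul_add, smul_smul (msign K _), ← msign_add]
  simp only [parity_update, shuffleSign_add_left, shuffleSign_add_right, sum_add_distrib,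
    Finset.sum_ite_eq', mem_univ, if_true]

theorem tensor_boundary_identity {V W : Type*} [AddCommGroup V] [Module K V] [AddCommGroup W]
    [Module K W] {n : ℕ} (f g : Fin n → ZMod 2) (p q r : ZMod 2) (x x' : V) (y y' : W)
    (u : Fin n → V) (v : Fin n → W) :
    msign K (r + (∑ l, f l) * q) • ((x' - ∑ l, msign K (p + ∑ l' with l' < l, f l') • u l) ⊗ₜ[K] y) +
      msign K p • msign K (r + (∑ l, f l) * (q + 1)) •
        (x ⊗ₜ[K] (y' - ∑ l, msign K (q + ∑ l' with l' < l, g l') • v l)) =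
    msign K (r + (∑ l, f l) * q) • (x' ⊗ₜ[K] y + msign K (p + ∑ l, f l) • (x ⊗ₜ[K] y')) -
      ∑ l, msign K (p + q + ∑ l' with l' < l, (f l' + g l')) •
        (msign K (r + ∑ q with q < l, g q + ((∑ l, f l) + 1) * q) • (u l ⊗ₜ[K] y) +
          msign K (f l + (r + ∑ q with l < q, f q + (∑ l, f l) * q)) • (x ⊗ₜ[K] v l)) := by
  have h1 : ∀ l, msign K (p + q + ∑ l' with l' < l, (f l' + g l')) •
      (msign K (r + ∑ q with q < l, g q + ((∑ l, f l) + 1) * q) • (u l ⊗ₜ[K] y) +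
        msign K (f l + (r + ∑ q with l < q, f q + (∑ l, f l) * q)) • (x ⊗ₜ[K] v l)) =
      msign K (r + (∑ l, f l) * q) • msign K (p + ∑ l' with l' < l, f l') • (u l ⊗ₜ[K] y) +
        msign K p • msign K (r + (∑ l, f l) * (q + 1)) •
          msign K (q + ∑ l' with l' < l, g l') • (x ⊗ₜ[K] v l) := by
    intro l
    have h := sum_lt_add_gt f l
    rw [smul_add]
    simp only [smul_smul, ← msign_add, sum_add_distrib]
    generalize ∑ l, f l = s at *
    generalize ∑ q with q < l, f q = s₁ at *
    generalize ∑ q with l < q, f q = s₂ at *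
    generalize ∑ q with q < l, g q = s₃ at *
    refine congrArg₂ _ (congrArg (msign K · • _) ?_) (congrArg (msign K · • _) ?_)
    · rw [← sub_eq_zero]
      ring_nf
      try reduce_mod_char
    · rw [← sub_eq_zero, h]
      ring_nf
      try reduce_mod_char
  have h2 : msign K (r + (∑ l, f l) * q) • msign K (p + ∑ l, f l) • (x ⊗ₜ[K] y') =
      msign K p • msign K (r + (∑ l, f l) * (q + 1)) • (x ⊗ₜ[K] y') := by
    rw [smul_smul, smul_smul, ← msign_add, ← msign_add]
    refine congrArg (msign K · • _) ?_
    ring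
  rw [sum_congr rfl fun l _ => h1 l]
  simp only [sum_add_distrib, smul_add, h2, TensorProduct.sub_tmul, TensorProduct.tmul_sub,
    TensorProduct.sum_tmul, TensorProduct.tmul_sum, ← TensorProduct.smul_tmul',
    TensorProduct.tmul_smul, smul_sub, smul_sum]
  abel

theorem tensor_ρ_boundary (hX : IsCyclicAInfinity 𝒜 εA X) (hY : IsCyclicAInfinity ℬ εB Y)
    (hΔ : IsCyclicDiagonal Δ) (n : ℕ) (hn : 2 ≤ n) (T : PlanarTree n) (k : Fin n → ZMod (2 * N))
    (v : Fin n → A ⊗[K] B) (hv : ∀ l, v l ∈ tensorGrading 𝒜 ℬ (k l)) :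
    (X.tensor 𝒜 ℬ Y Δ).ρ n (treeBoundary K n (single T 1)) v =
      (X.tensor 𝒜 ℬ Y Δ).d ((X.tensor 𝒜 ℬ Y Δ).ρ n (single T 1) v) -
        ∑ l, msign K (T.degree 2 + ∑ l' with l' < l, parity (k l')) •
          (X.tensor 𝒜 ℬ Y Δ).ρ n (single T 1)
            (Function.update v l ((X.tensor 𝒜 ℬ Y Δ).d (v l))) := by
  let Z := X.tensor 𝒜 ℬ Y Δ
  let G : Op K (A ⊗[K] B) n := Z.d.compMultilinearMap (Z.ρ n (single T 1)) -
    ∑ l, msign K (T.degree 2 + ∑ l' with l' < l, parity (k l')) •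
      (Z.ρ n (single T 1)).compLinearMap (Function.update (fun _ => LinearMap.id) l Z.d)
  have hG : ∀ v, G v = Z.d (Z.ρ n (single T 1) v) -
      ∑ l, msign K (T.degree 2 + ∑ l' with l' < l, parity (k l')) •
        Z.ρ n (single T 1) (Function.update v l (Z.d (v l))) := by
    intro v
    simp only [G, sub_apply, sum_apply, smul_apply,
      MultilinearMap.compLinearMap_apply, LinearMap.compMultilinearMap_apply]
    refine congrArg _ (sum_congr rfl fun l _ => congrArg _ (congrArg _ (funext fun q => ?_)))
    by_cases hq : q = l
    · subst hq
      rw [Function.update_self, Function.update_self]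
    · rw [Function.update_of_ne hq, Function.update_of_ne hq, LinearMap.id_apply]
  refine Eq.trans ?_ (hG v)
  refine multilinear_eq_of_span (fun v hv => ?_) fun l => tensorGrading_le_span 𝒜 ℬ (k l) (hv l)
  obtain ⟨i, j, a, b, ha, hb, rfl, rfl⟩ := exists_of_pureTensors hv
  rw [hG, tensor_ρ_tmul 𝒜 ℬ X Y Δ _ ha hb, hΔ.sum_boundary hn, tensor_ρ_tmul 𝒜 ℬ X Y Δ _ ha hb,
    map_sum, sum_congr rfl fun l _ => congrArg _ (tensor_ρ_update_d hX hY _ ha hb l)]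
  simp only [smul_sum]
  rw [sum_comm, ← Finset.sum_sub_distrib]
  refine sum_congr rfl fun P _ => ?_
  by_cases h0 : Δ n (single T 1) P = 0
  · simp only [h0, zero_smul, smul_zero, map_zero, Finset.sum_const_zero, sub_zero]
  simp only [smul_comm (msign K _) (Δ n (single T 1) P), ← smul_sum]
  rw [map_smul, ← smul_sub, map_smul, tensor_d_tmul 𝒜 ℬ X Y Δ (hX.ρ_mem n hn P.1 i a ha),
    parity_add, parity_sum, parity_degree, ← hΔ.degree_eq 2 hn h0]
  refine congrArg _ ?_
  have h1 : ∑ S, treeBoundary K n (single P.1 1) S • msign K (shuffleSign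
      ((finRange n).map fun l => (parity (i l), parity (j l))) +
        (∑ l, parity (i l)) * P.2.degree 2) •
      (X.ρ n (single S 1) a ⊗ₜ[K] Y.ρ n (single P.2 1) b) =
      msign K (shuffleSign ((finRange n).map fun l => (parity (i l), parity (j l))) +
        (∑ l, parity (i l)) * P.2.degree 2) • (X.ρ n (treeBoundary K n (single P.1 1)) a ⊗ₜ[K]
          Y.ρ n (single P.2 1) b) := by
    rw [X.ρ_eq_sum (treeBoundary K n (single P.1 1)) a, TensorProduct.sum_tmul, smul_sum]
    refine sum_congr rfl fun S _ => ?_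
    rw [smul_comm, TensorProduct.smul_tmul']
  have h2 : ∑ S, treeBoundary K n (single P.2 1) S • msign K (shuffleSign
      ((finRange n).map fun l => (parity (i l), parity (j l))) +
        (∑ l, parity (i l)) * S.degree 2) •
      (X.ρ n (single P.1 1) a ⊗ₜ[K] Y.ρ n (single S 1) b) =
      msign K (shuffleSign ((finRange n).map fun l => (parity (i l), parity (j l))) +
        (∑ l, parity (i l)) * (P.2.degree 2 + 1)) • (X.ρ n (single P.1 1) a ⊗ₜ[K]
          Y.ρ n (treeBoundary K n (single P.2 1)) b) := by
    rw [Y.ρ_eq_sum (treeBoundary K n (single P.2 1)) b, TensorProduct.tmul_sum, smul_sum]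
    refine sum_congr rfl fun S _ => ?_
    by_cases hS : treeBoundary K n (single P.2 1) S = 0
    · rw [hS, zero_smul, zero_smul, TensorProduct.tmul_zero, smul_zero]
    · rw [degree_of_treeBoundary hS, smul_comm, TensorProduct.tmul_smul]
  refine (congrArg₂ (fun z z' => z + msign K _ • z') h1 h2).trans ?_
  rw [hX.ρ_boundary n hn P.1 i a ha, hY.ρ_boundary n hn P.2 j b hb]
  simp only [parity_add]
  exact tensor_boundary_identity (fun l => parity (i l)) (fun l => parity (j l)) _ _ _ _ _ _ _ _ _

end Tensor

/-! ### The cocycle of the tensor product -/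

/-- The inverse of a tensor product of matrices with Koszul signs. -/
theorem signed_kronecker_mul {K : Type u} [Field K] {κ κ' : Type} [Fintype κ] [Fintype κ']
    [DecidableEq κ] [DecidableEq κ'] {G H : Matrix κ κ K} {G' H' : Matrix κ' κ' K} (h : G * H = 1)
    (h' : G' * H' = 1) (d : κ → ZMod 2) (e : κ' → ZMod 2) :
    Matrix.of (fun x y : κ × κ' => msign K (e x.2 * d y.1) * (G x.1 y.1 * G' x.2 y.2)) *
      Matrix.of (fun x y : κ × κ' => msign K (e y.2 * d x.1) * (H x.1 y.1 * H' x.2 y.2)) = 1 := by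
  ext ⟨s, t⟩ ⟨s', t'⟩
  have h1 : ∀ x y, ∑ z, G x z * H z y = (1 : Matrix κ κ K) x y := fun x y => by
    rw [← h, Matrix.mul_apply]
  have h2 : ∀ x y, ∑ z, G' x z * H' z y = (1 : Matrix κ' κ' K) x y := fun x y => by
    rw [← h', Matrix.mul_apply]
  rw [Matrix.mul_apply, Fintype.sum_prod_type]
  have h3 : ∀ x y, msign K (e t * d x) * (G s x * G' t y) * (msign K (e t' * d x) * (H x s' * H' y t')) =
      msign K ((e t + e t') * d x) * (G s x * H x s') * (G' t y * H' y t') := fun x y => by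
    rw [add_mul, msign_add]
    ring
  simp only [Matrix.of_apply, h3, ← mul_sum, h2]
  by_cases ht : t = t'
  · subst ht
    simp only [zmod2_add_self, zero_mul, msign_zero, one_mul, ← sum_mul, h1]
    simp [Matrix.one_apply]
  · simp [ht]

section Tensor

variable {K : Type u} [Field K] {A : Type*} [AddCommGroup A] [Module K A]
  {B : Type*} [AddCommGroup B] [Module K B] {N : ℕ}
  [FiniteDimensional K A] [FiniteDimensional K B]
  {𝒜 : ZMod (2 * N) → Submodule K A} [DirectSum.Decomposition 𝒜]
  {ℬ : ZMod (2 * N) → Submodule K B} [DirectSum.Decomposition ℬ] {εA εB : ZMod 2}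
  {X : CyclicData K A} {Y : CyclicData K B} {Δ : ∀ n, TreeChain K n →ₗ[K] TreeChain₂ K n}
  {κ κ' : Type} [Fintype κ] [Fintype κ'] [DecidableEq κ] [DecidableEq κ']
  {b : Module.Basis κ K A} {i : κ → ZMod (2 * N)} {c : Module.Basis κ' K B} {j : κ' → ZMod (2 * N)}

theorem gram_tensor (hb : ∀ s, b s ∈ 𝒜 (i s)) (hc : ∀ t, c t ∈ ℬ (j t)) :
    gram (X.tensor 𝒜 ℬ Y Δ).pairing (b.tensorProduct c) = Matrix.of fun x y =>
      msign K (parity (j x.2) * parity (i y.1)) * (gram X.pairing b x.1 y.1 * gram Y.pairing c x.2 y.2) := by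
  ext x y
  rw [gram, Matrix.of_apply, Module.Basis.tensorProduct_apply', Module.Basis.tensorProduct_apply',
    tensor_pairing_tmul 𝒜 ℬ X Y Δ _ (hc _) (hb _)]
  rfl

theorem gram_tensor_mul (hX : IsCyclicAInfinity 𝒜 εA X) (hY : IsCyclicAInfinity ℬ εB Y)
    (hb : ∀ s, b s ∈ 𝒜 (i s)) (hc : ∀ t, c t ∈ ℬ (j t)) :
    gram (X.tensor 𝒜 ℬ Y Δ).pairing (b.tensorProduct c) * Matrix.of (fun x y =>
      msign K (parity (j y.2) * parity (i x.1)) *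
        ((gram X.pairing b)⁻¹ x.1 y.1 * (gram Y.pairing c)⁻¹ x.2 y.2)) = 1 := by
  rw [gram_tensor hb hc]
  exact signed_kronecker_mul (gram_mul_inv hX.pairing_nondegenerate b)
    (gram_mul_inv hY.pairing_nondegenerate c) (fun s => parity (i s)) fun t => parity (j t)

theorem tensor_pairing_nondegenerate (hX : IsCyclicAInfinity 𝒜 εA X) (hY : IsCyclicAInfinity ℬ εB Y) :
    (X.tensor 𝒜 ℬ Y Δ).pairing.Nondegenerate := by
  obtain ⟨m, b, i, hb⟩ := id (hasHomogeneousBasis 𝒜)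
  obtain ⟨n, c, j, hc⟩ := id (hasHomogeneousBasis ℬ)
  refine (LinearMap.nondegenerate_toMatrix₂_iff (b.tensorProduct c) (b.tensorProduct c)).1
    (Matrix.nondegenerate_iff_det_ne_zero.2 ?_)
  have h := congrArg Matrix.det (gram_tensor_mul (Δ := Δ) hX hY hb hc)
  rw [Matrix.det_mul, Matrix.det_one] at h
  rw [show LinearMap.toMatrix₂ (b.tensorProduct c) (b.tensorProduct c) (X.tensor 𝒜 ℬ Y Δ).pairing =
    gram (X.tensor 𝒜 ℬ Y Δ).pairing (b.tensorProduct c) from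
      Matrix.ext fun s t => LinearMap.toMatrix₂_apply _ _ _ s t]
  exact left_ne_zero_of_mul_eq_one h

/-- The tensor product of two cyclic `A∞`-algebras is a cyclic `A∞`-algebra. -/
theorem isCyclicAInfinity_tensor (hX : IsCyclicAInfinity 𝒜 εA X) (hY : IsCyclicAInfinity ℬ εB Y)
    (hΔ : IsCyclicDiagonal Δ) :
    IsCyclicAInfinity (tensorGrading 𝒜 ℬ) (εA + εB) (X.tensor 𝒜 ℬ Y Δ) where
  d_mem := tensor_d_mem hX hY
  d_d := tensor_d_d hX hY
  pairing_symm := tensor_pairing_symm hX hY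
  pairing_parity := tensor_pairing_parity hX hY
  pairing_nondegenerate := tensor_pairing_nondegenerate hX hY
  pairing_d := tensor_pairing_d hX hY
  ρ_mem := tensor_ρ_mem hX hY hΔ
  ρ_comp := tensor_ρ_comp hX hY hΔ
  ρ_boundary := tensor_ρ_boundary hX hY hΔ
  cyclic := tensor_cyclic hX hY hΔ

/-- The state sum of the tensor product, in the tensor product of two homogeneous bases. -/
theorem value_tensor (hX : IsCyclicAInfinity 𝒜 εA X) (hY : IsCyclicAInfinity ℬ εB Y)
    (hΔ : IsCyclicDiagonal Δ) (hZ : IsCyclicAInfinity (tensorGrading 𝒜 ℬ) (εA + εB) (X.tensor 𝒜 ℬ Y Δ))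
    (hb : ∀ s, b s ∈ 𝒜 (i s)) (hc : ∀ t, c t ∈ ℬ (j t))
    {k : κ × κ' → ZMod (2 * N)} (hk : ∀ s t, k (s, t) = i s + j t)
    (hbc : ∀ s, b.tensorProduct c s ∈ tensorGrading 𝒜 ℬ (k s))
    {R : RibbonData} {ι : Type} [Fintype ι] (M : Marking R ι) (ℓ : List ι) (o : List R.H)
    (T : ∀ i, PlanarTree (M.n i)) (hf : IsFrame R ℓ o) :
    (algebraStateData hZ (b.tensorProduct c) k hbc).value M ℓ o T =
      LinearMap.mul' K K (GraphFunctional.prodVal (algebraStateData hX b i hb).functional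
        (algebraStateData hY c j hc).functional Δ M ℓ o T) := by
  refine StateData.value_eq_sum (D := algebraStateData hZ (b.tensorProduct c) k hbc)
    (DA := algebraStateData hX b i hb) (DB := algebraStateData hY c j hc) hΔ (Equiv.refl (κ × κ'))
    ?_ ?_ ?_ M ℓ o T hf
  · exact fun (s : κ) (t : κ') => (congrArg parity (hk s t)).trans (parity_add (i s) (j t))
  · intro (s : κ) (t : κ') (s' : κ) (t' : κ')
    change (gram (X.tensor 𝒜 ℬ Y Δ).pairing (b.tensorProduct c))⁻¹ (s, t) (s', t') *
      msign K ((εA + εB) * parity (k (s', t'))) = msign K (parity (j t) * parity (i s')) *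
        ((gram X.pairing b)⁻¹ s s' * msign K (εA * parity (i s')) *
          ((gram Y.pairing c)⁻¹ t t' * msign K (εB * parity (j t'))))
    rw [Matrix.inv_eq_right_inv (gram_tensor_mul hX hY hb hc), Matrix.of_apply, hk, parity_add]
    by_cases h1 : (gram X.pairing b)⁻¹ s s' = 0
    · simp only [h1, zero_mul, mul_zero]
    by_cases h2 : (gram Y.pairing c)⁻¹ t t' = 0
    · simp only [h2, zero_mul, mul_zero]
    have h3 : parity (j t') * parity (i s) + (εA + εB) * (parity (i s') + parity (j t')) =
        parity (j t) * parity (i s') + εA * parity (i s') + εB * parity (j t') := by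
      rw [← gram_inv_parity hX b i hb s s' h1, ← gram_inv_parity hY c j hc t t' h2]
      generalize parity (i s) = x
      generalize parity (i s') = x'
      generalize parity (j t) = y
      generalize parity (j t') = y'
      revert x x' y y'
      decide
    have h4 := congrArg (msign K) h3
    rw [msign_add, msign_add, msign_add] at h4
    linear_combination ((gram X.pairing b)⁻¹ s s' * (gram Y.pairing c)⁻¹ t t') * h4
  · intro n T (x : Fin (n + 1) → κ) (y : Fin (n + 1) → κ') hn
    refine Eq.trans ?_ ((tensor_pairing_ρ (X := X) (Δ := Δ) hY hn (single T 1)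
      (fun l => hb (x l)) (fun l => hc (y l))).trans ?_)
    · change (X.tensor 𝒜 ℬ Y Δ).pairing ((X.tensor 𝒜 ℬ Y Δ).ρ n (single T 1) fun l =>
        b.tensorProduct c (x l.succ, y l.succ)) (b.tensorProduct c (x 0, y 0)) = _
      simp only [Module.Basis.tensorProduct_apply]
    · unfold shuffleSign
      simp only [pairSum_map]
      rfl

theorem cocycle_tensor [CharZero K] (hX : IsCyclicAInfinity 𝒜 εA X) (hY : IsCyclicAInfinity ℬ εB Y)
    (hΔ : IsCyclicDiagonal Δ) {cA : GraphComplex K εA →ₗ[K] K} {cB : GraphComplex K εB →ₗ[K] K}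
    {cAB : GraphComplex K (εA + εB) →ₗ[K] K}
    {δ : GraphComplex K (εA + εB) →ₗ[K] GraphComplex K εA ⊗[K] GraphComplex K εB}
    (hA : IsKontsevichCocycle 𝒜 εA X cA) (hB : IsKontsevichCocycle ℬ εB Y cB)
    (hAB : IsKontsevichCocycle (tensorGrading 𝒜 ℬ) (εA + εB) (X.tensor 𝒜 ℬ Y Δ) cAB)
    (hδ : IsGraphDiagonal Δ εA εB δ) :
    cAB = LinearMap.mul' K K ∘ₗ TensorProduct.map cA cB ∘ₗ δ := by
  have h𝒜 := hasParityInvolution 𝒜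
  have hℬ := hasParityInvolution ℬ
  obtain ⟨m, b, i, hb⟩ := id (hasHomogeneousBasis 𝒜)
  obtain ⟨n, c, j, hc⟩ := id (hasHomogeneousBasis ℬ)
  have hbc : ∀ s, b.tensorProduct c s ∈ tensorGrading 𝒜 ℬ (i s.1 + j s.2) := fun s => by
    rw [Module.Basis.tensorProduct_apply']
    exact tmul_mem (hb _) (hc _) rfl
  have hZ := isCyclicAInfinity_tensor hX hY hΔ
  rw [isKontsevichCocycle_iff h𝒜 hX (hasHomogeneousBasis 𝒜) hb] at hA
  rw [isKontsevichCocycle_iff hℬ hY (hasHomogeneousBasis ℬ) hc] at hB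
  rw [isKontsevichCocycle_iff (h𝒜.tensor hℬ) hZ
    ((hasHomogeneousBasis 𝒜).tensor (hasHomogeneousBasis ℬ)) hbc] at hAB
  rw [isGraphDiagonal_iff hΔ] at hδ
  refine (algebraStateData hZ (b.tensorProduct c)
    (fun s => i s.1 + j s.2) hbc).functional.existsUnique_linearMap.unique hAB
      fun R hR L o ho T => Eq.trans ?_
        (value_tensor hX hY hΔ hZ hb hc (fun _ _ => rfl) hbc L.marking (finRange L.k) o T (L.isFrame hR ho)).symm
  rw [LinearMap.comp_apply, LinearMap.comp_apply, hδ R hR L o ho T]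
  refine congrArg (LinearMap.mul' K K) ?_
  change TensorProduct.map cA cB (GraphFunctional.prodVal _ _ Δ L.marking _ o T) = _
  unfold GraphFunctional.prodVal
  rw [map_sum]
  refine sum_congr rfl fun P _ => ?_
  rw [map_smul, map_smul, TensorProduct.map_tmul]
  refine congrArg _ (congrArg _ (congrArg₂ _ ?_ ?_))
  · exact (congrArg cA (treesToGraph_eq K εA L o fun i => (P i).1).symm).trans
      (hA R hR L o ho fun i => (P i).1)
  · exact (congrArg cB (treesToGraph_eq K εB L o fun i => (P i).2).symm).trans
      (hB R hR L o ho fun i => (P i).2)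

end Tensor

end CyclicTensor

end

theorem mainTheorem6 {K : Type*} [Field K] [CharZero K] (N : ℕ)
    {A : Type*} [AddCommGroup A] [Module K A] [FiniteDimensional K A]
    {B : Type*} [AddCommGroup B] [Module K B] [FiniteDimensional K B]
    (𝒜 : ZMod (2 * N) → Submodule K A) [DirectSum.Decomposition 𝒜]
    (ℬ : ZMod (2 * N) → Submodule K B) [DirectSum.Decomposition ℬ]
    (εA εB : ZMod 2)
    (X : CyclicTensor.CyclicData K A) (hX : CyclicTensor.IsCyclicAInfinity 𝒜 εA X)
    (Y : CyclicTensor.CyclicData K B) (hY : CyclicTensor.IsCyclicAInfinity ℬ εB Y)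
    (Δ : ∀ n, CyclicTensor.TreeChain K n →ₗ[K] CyclicTensor.TreeChain₂ K n)
    (hΔ : CyclicTensor.IsCyclicDiagonal Δ) :
    (∃! cA, CyclicTensor.IsKontsevichCocycle 𝒜 εA X cA) ∧
    (∃! cB, CyclicTensor.IsKontsevichCocycle ℬ εB Y cB) ∧
    CyclicTensor.IsCyclicAInfinity (CyclicTensor.tensorGrading 𝒜 ℬ) (εA + εB)
      (X.tensor 𝒜 ℬ Y Δ) ∧
    (∃! cAB, CyclicTensor.IsKontsevichCocycle (CyclicTensor.tensorGrading 𝒜 ℬ) (εA + εB)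
      (X.tensor 𝒜 ℬ Y Δ) cAB) ∧
    (∃! δ, CyclicTensor.IsGraphDiagonal Δ εA εB δ) ∧
    ∀ cA cB cAB δ, CyclicTensor.IsKontsevichCocycle 𝒜 εA X cA →
      CyclicTensor.IsKontsevichCocycle ℬ εB Y cB →
      CyclicTensor.IsKontsevichCocycle (CyclicTensor.tensorGrading 𝒜 ℬ) (εA + εB)
        (X.tensor 𝒜 ℬ Y Δ) cAB →
      CyclicTensor.IsGraphDiagonal Δ εA εB δ →
      cAB = LinearMap.mul' K K ∘ₗ TensorProduct.map cA cB ∘ₗ δ := by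
  have hZ := CyclicTensor.isCyclicAInfinity_tensor hX hY hΔ
  have h𝒜 := CyclicTensor.hasParityInvolution 𝒜
  have hℬ := CyclicTensor.hasParityInvolution ℬ
  have hb𝒜 := CyclicTensor.hasHomogeneousBasis 𝒜
  have hbℬ := CyclicTensor.hasHomogeneousBasis ℬ
  exact ⟨CyclicTensor.existsUnique_cocycle h𝒜 hX hb𝒜, CyclicTensor.existsUnique_cocycle hℬ hY hbℬ,
    hZ, CyclicTensor.existsUnique_cocycle (h𝒜.tensor hℬ) hZ (hb𝒜.tensor hbℬ),
    CyclicTensor.existsUnique_graphDiagonal hΔ εA εB,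
    fun _ _ _ _ hA hB hAB hδ => CyclicTensor.cocycle_tensor hX hY hΔ hA hB hAB hδ⟩
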